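/- All simplicial complexes are finite, geometric, and embedded in some Euclidean space $\mathbb{R}^n$; different embeddings count as different complexes. A *simplicial surface* is a $2$-dimensional simplicial complex whose underlying space is a compact surface without boundary. Regard $\mathbb{R}^2$ as a plane in $\mathbb{R}^3$. A *pyramid* is the boundary of the cone on a simplicial disk in $\mathbb{R}^2$ from a point of $\mathbb{R}^3 \setminus \mathbb{R}^2$. A *bipyramid* is the boundary of the suspension of a polygonal disk in $\mathbb{R}^2$ from two points of $\mathbb{R}^3\setminus\mathbb{R}^2$ (necessarily on opposite sides of $\mathbb{R}^2$), triangulated as the union of the two cones over the boundary polygon. Let $\mathcal{S}$ be a set of simplicial surfaces. A *simplicial-complex-supported function* on $\mathcal{S}$ is a function $\Lambda \colon \mathcal{S} \to \mathbb{R}$. A *vertex-supported function* $\phi$ on $\mathcal{S}$ assigns a real number $\phi(v, K)$ to each $K \in \mathcal{S}$ and each vertex $v$ of $K$. The function $\Lambda$ is *geometrically locally determined* if there is a vertex-supported function $\phi$ on $\mathcal{S}$ such that: 1. (invariance under simplicial isometries of stars) if $K, L \in \mathcal{S}$ have vertices $v$ and $w$ respectively, and there is a simplicial isomorphism from the star of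 $v$ in $K$ to the star of $w$ in $L$ that preserves the lengths of edges and takes $v$ to $w$, then $\phi(v,K) = \phi(w,L)$; 2. (invariance under subdivision) if $K, J \in \mathcal{S}$ and $J$ is a subdivision of $K$, then $\phi(v,K) = \phi(v,J)$ for every vertex $v$ of $K$; 3. (continuity) if $K$ and $K_1, K_2, \ldots$ in $\mathcal{S}$ are combinatorially equivalent and lie in the same Euclidean space, and for each vertex $v$ of $K$ the corresponding vertices $v_k$ of $K_k$ converge to $v$, then $\lim_{k\to\infty} \phi(v_k, K_k) = \phi(v, K)$ for every vertex $v$ of $K$; 4. (Descartes-Gauss-Bonnet) $\sum_{v} \phi(v,K) = \Lambda(K)$ for every $K \in \mathcal{S}$, where the sum is over all vertices $v$ of $K$. **Corollary 2.7.** Let $\mathcal{S}$ be a set of simplicial surfaces that contains all pyramids and bipyramids and that contains every subdivision of each of its members. Then the Euler characteristic is the unique simplicial-complex-supported function on $\mathcal{S}$ that is geometrically locally determined and has value $2$ on all pyramids and bipyramids. -/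

import Mathlib

open Geometry Filter Topology

/-- Simplicial complexes in Euclidean `n`-space. A face is recorded by its finite vertex set;
the simplex itself is the convex hull of that set. -/
abbrev EuclideanComplex (n : ℕ) : Type :=
  SimplicialComplex ℝ (EuclideanSpace ℝ (Fin n))

/-- A simplicial complex embedded in some Euclidean space. Different embeddings of
combinatorially equivalent complexes are different objects. -/
abbrev EmbeddedComplex : Type :=
  Σ n : ℕ, EuclideanComplex n

/-- The number `f_i(K)` of `i`-simplices of `K`. -/
noncomputable def simplexCount {n : ℕ} (K : EuclideanComplex n) (i : ℕ) : ℕ :=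
  {s : Finset (EuclideanSpace ℝ (Fin n)) | s ∈ K.faces ∧ s.card = i + 1}.ncard

/-- The Euler characteristic `f_0 - f_1 + f_2` of a finite `2`-dimensional complex. -/
noncomputable def eulerCharacteristic {n : ℕ} (K : EuclideanComplex n) : ℤ :=
  (simplexCount K 0 : ℤ) - (simplexCount K 1 : ℤ) + (simplexCount K 2 : ℤ)

/-- A simplicial surface: a finite `2`-dimensional simplicial complex whose underlying space
is a (necessarily compact) topological surface without boundary. -/
structure IsSimplicialSurface {n : ℕ} (K : EuclideanComplex n) : Prop where
  finite_faces : K.faces.Finite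
  card_le_three : ∀ s ∈ K.faces, s.card ≤ 3
  exists_triangle : ∃ s ∈ K.faces, s.card = 3
  locally_euclidean : Nonempty (ChartedSpace (EuclideanSpace ℝ (Fin 2)) K.space)

/-- `J` is a subdivision of `K`: a finite complex with the same underlying space, each of
whose simplices is contained in a simplex of `K`. -/
structure IsSubdivision {n : ℕ} (J K : EuclideanComplex n) : Prop where
  finite_faces : J.faces.Finite
  space_eq : J.space = K.space
  refines : ∀ s ∈ J.faces, ∃ t ∈ K.faces,
    convexHull ℝ (s : Set (EuclideanSpace ℝ (Fin n))) ⊆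
      convexHull ℝ (t : Set (EuclideanSpace ℝ (Fin n)))

/-- The faces of the (closed) star of `v` in `K`: all faces of simplices that contain `v`. -/
def starFaces {n : ℕ} (K : EuclideanComplex n) (v : EuclideanSpace ℝ (Fin n)) :
    Set (Finset (EuclideanSpace ℝ (Fin n))) :=
  {s | s ∈ K.faces ∧ ∃ t ∈ K.faces, v ∈ t ∧ s ⊆ t}

open Classical in
/-- The vertex map `f` is a simplicial isomorphism from the complex with faces `A` onto the
complex with faces `B`: it is injective on the vertices of `A`, and the faces of `B` are
exactly the images of the faces of `A`. Only the values of `f` at vertices matter. -/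
def IsSimplicialIso {E F : Type*} (A : Set (Finset E)) (B : Set (Finset F)) (f : E → F) : Prop :=
  Set.InjOn f {x | ∃ s ∈ A, x ∈ s} ∧ (fun s : Finset E => s.image f) '' A = B

open Classical in
/-- The stars of `v` in `K` and of `w` in `L` are simplicially isometric: there is a simplicial
isomorphism between them that preserves the lengths of edges and takes `v` to `w`. -/
def StarsIsometric {m n : ℕ} (K : EuclideanComplex m) (v : EuclideanSpace ℝ (Fin m))
    (L : EuclideanComplex n) (w : EuclideanSpace ℝ (Fin n)) : Prop :=
  ∃ f : EuclideanSpace ℝ (Fin m) → EuclideanSpace ℝ (Fin n),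
    IsSimplicialIso (starFaces K v) (starFaces L w) f ∧ f v = w ∧
      ∀ x y, ({x, y} : Finset (EuclideanSpace ℝ (Fin m))) ∈ starFaces K v →
        dist (f x) (f y) = dist x y

/-- Vertex-supported functions. Such a function on a set `S` of complexes assigns a real number
to each complex of `S` and each of its vertices; all conditions below only involve these
values, so that values elsewhere play no role. -/
abbrev VertexFunction : Type :=
  (n : ℕ) → EuclideanComplex n → EuclideanSpace ℝ (Fin n) → ℝ

/-- Invariance of a vertex-supported function on `S` under subdivision. -/
def InvariantUnderSubdivision (S : Set EmbeddedComplex) (φ : VertexFunction) : Prop :=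
  ∀ (n : ℕ) (K J : EuclideanComplex n), (⟨n, K⟩ : EmbeddedComplex) ∈ S →
    (⟨n, J⟩ : EmbeddedComplex) ∈ S → IsSubdivision J K →
      ∀ v ∈ K.vertices, φ n K v = φ n J v

/-- Invariance of a vertex-supported function on `S` under simplicial isometries of stars. -/
def InvariantUnderStarIsometry (S : Set EmbeddedComplex) (φ : VertexFunction) : Prop :=
  ∀ (m n : ℕ) (K : EuclideanComplex m) (L : EuclideanComplex n),
    (⟨m, K⟩ : EmbeddedComplex) ∈ S → (⟨n, L⟩ : EmbeddedComplex) ∈ S →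
      ∀ v ∈ K.vertices, ∀ w ∈ L.vertices, StarsIsometric K v L w → φ m K v = φ n L w

/-- Continuity of a vertex-supported function on `S`: if complexes `K_k` in `S` are
combinatorially equivalent to `K` in `S` through vertex bijections `f_k`, in the same Euclidean
space, and converge to `K` at each vertex, then the values of the function at corresponding
vertices converge. -/
def ContinuousVertexFunction (S : Set EmbeddedComplex) (φ : VertexFunction) : Prop :=
  ∀ (n : ℕ) (K : EuclideanComplex n) (Kseq : ℕ → EuclideanComplex n)
    (f : ℕ → EuclideanSpace ℝ (Fin n) → EuclideanSpace ℝ (Fin n)),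
    (⟨n, K⟩ : EmbeddedComplex) ∈ S → (∀ k, (⟨n, Kseq k⟩ : EmbeddedComplex) ∈ S) →
      (∀ k, IsSimplicialIso K.faces (Kseq k).faces (f k)) →
      (∀ v ∈ K.vertices, Tendsto (fun k => f k v) atTop (𝓝 v)) →
        ∀ v ∈ K.vertices, Tendsto (fun k => φ n (Kseq k) (f k v)) atTop (𝓝 (φ n K v))

/-- The Descartes-Gauss-Bonnet property of `φ` with respect to `Λ` on `S`. -/
def SatisfiesDescartesGaussBonnet (S : Set EmbeddedComplex) (φ : VertexFunction)
    (Λ : S → ℝ) : Prop :=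
  ∀ K : S, ∑ᶠ v ∈ K.1.2.vertices, φ K.1.1 K.1.2 v = Λ K

/-- The complex-supported function `Λ` on `S` is geometrically locally determined. -/
def GeometricallyLocallyDetermined (S : Set EmbeddedComplex) (Λ : S → ℝ) : Prop :=
  ∃ φ : VertexFunction, InvariantUnderStarIsometry S φ ∧ InvariantUnderSubdivision S φ ∧
    ContinuousVertexFunction S φ ∧ SatisfiesDescartesGaussBonnet S φ Λ

/-- The set `S` contains every subdivision of each of its members. -/
def ClosedUnderSubdivision (S : Set EmbeddedComplex) : Prop :=
  ∀ (n : ℕ) (K J : EuclideanComplex n), (⟨n, K⟩ : EmbeddedComplex) ∈ S →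
    IsSubdivision J K → (⟨n, J⟩ : EmbeddedComplex) ∈ S

/-- The plane as the coordinate plane `x₂ = 0` in space. -/
noncomputable def planeInSpace (x : EuclideanSpace ℝ (Fin 2)) : EuclideanSpace ℝ (Fin 3) :=
  !₂[x 0, x 1, 0]

/-- A simplicial disk in the plane: a finite complex whose underlying space is homeomorphic to
the closed unit disk. -/
structure IsPlanarSimplicialDisk (D : EuclideanComplex 2) : Prop where
  finite_faces : D.faces.Finite
  disk : Nonempty (D.space ≃ₜ Metric.closedBall (0 : EuclideanSpace ℝ (Fin 2)) 1)

/-- The faces of the boundary of a simplicial disk: the edges that lie in exactly one triangle,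
and their endpoints. -/
def diskBoundaryFaces (D : EuclideanComplex 2) : Set (Finset (EuclideanSpace ℝ (Fin 2))) :=
  {s | s.Nonempty ∧ ∃ e ∈ D.faces, e.card = 2 ∧
    (∃! t : Finset (EuclideanSpace ℝ (Fin 2)), t ∈ D.faces ∧ t.card = 3 ∧ e ⊆ t) ∧ s ⊆ e}

open Classical in
/-- `K` is a pyramid: the boundary of the cone with apex `p` off the plane over a simplicial
disk `D` in the plane. This boundary consists of `D` and of the cone with apex `p` over the
boundary of `D`. -/
def IsPyramid (K : EuclideanComplex 3) : Prop :=
  ∃ (D : EuclideanComplex 2) (p : EuclideanSpace ℝ (Fin 3)),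
    IsPlanarSimplicialDisk D ∧ p 2 ≠ 0 ∧
      K.faces = (fun s => s.image planeInSpace) '' D.faces ∪ {{p}} ∪
        (fun s => insert p (s.image planeInSpace)) '' diskBoundaryFaces D

/-- A simple closed polygon in the plane: at least three distinct vertices, listed in cyclic
order, and edges that meet only in common endpoints. -/
structure IsSimpleClosedPolygon {n : ℕ} [NeZero n]
    (P : Polygon (EuclideanSpace ℝ (Fin 2)) n) : Prop where
  three_le : 3 ≤ n
  injective : Function.Injective P.vertices
  inter_edges : ∀ i j : Fin n, i ≠ j →
    P.edgeSet ℝ i ∩ P.edgeSet ℝ j ⊆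
      {P.vertices i, P.vertices (i + 1)} ∩ {P.vertices j, P.vertices (j + 1)}

open Classical in
/-- `K` is a bipyramid on the polygonal disk enclosed by a simple closed polygon `P` in the
plane, with apices `p` and `q`: the boundary of the suspension of that disk from `p` and `q`,
that is, the union of the cones over `P` with apices `p` and `q`. The apices lie on opposite
sides of the plane, because otherwise the two cones over the disk overlap. -/
def IsBipyramid (K : EuclideanComplex 3) : Prop :=
  ∃ (n : ℕ) (_ : NeZero n) (P : Polygon (EuclideanSpace ℝ (Fin 2)) n)
    (p q : EuclideanSpace ℝ (Fin 3)),
    IsSimpleClosedPolygon P ∧ 0 < p 2 ∧ q 2 < 0 ∧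
      K.faces = {s | s.Nonempty ∧ ∃ i : Fin n, ∃ a ∈ ({p, q} : Set (EuclideanSpace ℝ (Fin 3))),
        s ⊆ {a, planeInSpace (P.vertices i), planeInSpace (P.vertices (i + 1))}}

/-! The only candidate for `φ` is the normalised angle defect `1 - (angle sum) / 2π`; both
directions of the equivalence go through it.

Uniqueness. In a surface every edge lies in exactly two triangles and links are connected, so each
star is a wheel (`IsSimplicialSurface.exists_wheel`). Subdividing the spokes of two wheels with the
same cyclic list of angles makes all spokes equally long, hence the stars isometric, so `φ` depends
only on that list (`HasWheelValue.unique`). Subdividing the rim cuts one angle into two, and two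
lists with equal sums have a common refinement, so `φ` is a function `f` of the angle sum alone
(`eq_of_angleSum_eq`). Deforming bipyramids over squares shows that `f` is continuous on `(0, 2π)`.

Put `F x = f x - (1 - x / 2π)`. A bipyramid over a `2m`-gon with alternating radii has congruent
lateral triangles with angles `α` at the apices and `β`, `γ` at the equator. Since the total of `φ`
is `2`, this gives `2 F(2mα) + m F(4β) + m F(4γ) = 0`. Regular bipyramids make `F` homogeneous under
integer multiples on `(0, 2π)`, hence linear there by continuity, and then zero. Bipyramids with a
reflex equatorial angle carry this over to angle sums of at least `2π`, where no continuity is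
available (`eq_zero_of_bipyramid_equation`). Only bipyramids are needed for this direction.

Existence. The angle defect is visibly invariant under isometries of stars and continuous. It is
invariant under subdivision because the angle sum can be read off from the area of the underlying
space in small balls around the vertex (`measure_space_inter_closedBall`). Summing the angles
triangle by triangle gives the total `V - F/2`, and `3F = 2E` turns this into the Euler
characteristic. Its value is `2` on bipyramids by counting. On a pyramid the faces at the apex
contribute `1`, because its link is a cycle, and the base contributes `1`: the rational simplicial
cochain complex of a planar disk has cohomology only in degree zero
(`eulerCharacteristic_of_isPlanarSimplicialDisk`).

The topology rests on one tool, continuous logarithms of nonvanishing complex functions, which play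
the part of first cohomology: a punctured disc has rank one, a contractible space has rank zero. -/

set_option linter.unusedSectionVars false

/-! ### Convex weights and barycentric coordinates. -/

section Weights

variable {E : Type*} [AddCommGroup E] [Module ℝ E]

/-- The barycenter of a finitely supported weight function. -/
noncomputable def weightBarycenter : (E →₀ ℝ) →ₗ[ℝ] E := Finsupp.linearCombination ℝ (id : E → E)

/-- The total mass of a finitely supported weight function. -/
noncomputable def weightTotal : (E →₀ ℝ) →ₗ[ℝ] ℝ :=
  Finsupp.linearCombination ℝ (fun _ : E => (1 : ℝ))

lemma weightBarycenter_single (x : E) (c : ℝ) :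
    weightBarycenter (Finsupp.single x c) = c • x := by
  simp [weightBarycenter]

lemma weightTotal_single (x : E) (c : ℝ) : weightTotal (Finsupp.single x c) = c := by
  simp [weightTotal]

lemma weightTotal_eq_sum {s : Finset E} {w : E →₀ ℝ} (h : w.support ⊆ s) :
    weightTotal w = ∑ x ∈ s, w x := by
  rw [weightTotal, Finsupp.linearCombination_apply, Finsupp.sum_of_support_subset _ h] <;> simp

lemma weightBarycenter_eq_sum {s : Finset E} {w : E →₀ ℝ} (h : w.support ⊆ s) :
    weightBarycenter w = ∑ x ∈ s, w x • x := by
  rw [weightBarycenter, Finsupp.linearCombination_apply, Finsupp.sum_of_support_subset _ h] <;> simp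

/-- Convex weights supported on a member of `A`. -/
structure IsFaceWeight (A : Set (Finset E)) (w : E →₀ ℝ) : Prop where
  nonneg : ∀ x, 0 ≤ w x
  support_mem : w.support ∈ A
  total : weightTotal w = 1

/-- Points have at most one representation by convex weights supported on a member of `A`. -/
def UniqueFaceWeights (A : Set (Finset E)) : Prop :=
  ∀ w w', IsFaceWeight A w → IsFaceWeight A w' → weightBarycenter w = weightBarycenter w' → w = w'

lemma mem_convexHull_iff_weight {s : Finset E} {y : E} :
    y ∈ convexHull ℝ (s : Set E) ↔
      ∃ w : E →₀ ℝ, (∀ x, 0 ≤ w x) ∧ w.support ⊆ s ∧ weightTotal w = 1 ∧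
        weightBarycenter w = y := by
  classical
  rw [Finset.mem_convexHull']
  constructor
  · rintro ⟨w, h0, h1, h2⟩
    refine ⟨Finsupp.onFinset s (fun x => if x ∈ s then w x else 0) (by intro a; simp; tauto),
      ?_, Finsupp.support_onFinset_subset, ?_, ?_⟩
    · intro x
      simp only [Finsupp.onFinset_apply]
      split_ifs with h
      · exact h0 x h
      · exact le_rfl
    · rw [weightTotal_eq_sum Finsupp.support_onFinset_subset, ← h1]
      exact Finset.sum_congr rfl fun x hx => by simp [hx]
    · rw [weightBarycenter_eq_sum Finsupp.support_onFinset_subset, ← h2]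
      exact Finset.sum_congr rfl fun x hx => by simp [hx]
  · rintro ⟨w, h0, hs, h1, h2⟩
    refine ⟨w, fun x _ => h0 x, ?_, ?_⟩
    · rw [← weightTotal_eq_sum hs, h1]
    · rw [← weightBarycenter_eq_sum hs, h2]

lemma weight_support_nonempty {w : E →₀ ℝ} (h : weightTotal w = 1) : w.support.Nonempty := by
  rw [Finsupp.support_nonempty_iff]
  rintro rfl
  simp at h

lemma weight_eq_of_affineIndependent {s : Finset E}
    (hs : AffineIndependent ℝ ((↑) : s → E)) {w w' : E →₀ ℝ}
    (h : w.support ⊆ s) (h' : w'.support ⊆ s) (ht : weightTotal w = weightTotal w')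
    (hb : weightBarycenter w = weightBarycenter w') : w = w' := by
  classical
  rw [affineIndependent_iff] at hs
  ext x
  by_cases hx : x ∈ s
  · have := hs Finset.univ (fun i : s => w i - w' i) ?_ ?_ ⟨x, hx⟩ (Finset.mem_univ _)
    · simpa [sub_eq_zero] using this
    · rw [Finset.sum_coe_sort s (fun i => w i - w' i), Finset.sum_sub_distrib,
        ← weightTotal_eq_sum h, ← weightTotal_eq_sum h', ht, sub_self]
    · rw [Finset.sum_coe_sort s (fun i => (w i - w' i) • i)]
      simp only [sub_smul]
      rw [Finset.sum_sub_distrib, ← weightBarycenter_eq_sum h, ← weightBarycenter_eq_sum h', hb,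
        sub_self]
  · rw [Finsupp.notMem_support_iff.1 fun h1 => hx (h h1),
      Finsupp.notMem_support_iff.1 fun h1 => hx (h' h1)]

/-- The common barycenter lies in the hulls of both supports, hence in the hull of their
intersection. Weights there agree with `w` and with `w'` by affine independence of each support. -/
lemma Geometry.SimplicialComplex.uniqueFaceWeights (K : SimplicialComplex ℝ E) :
    UniqueFaceWeights K.faces := by
  classical
  intro w w' hw hw' hb
  have h1 : weightBarycenter w ∈ convexHull ℝ (w.support : Set E) :=
    mem_convexHull_iff_weight.2 ⟨w, hw.nonneg, subset_rfl, hw.total, rfl⟩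
  have h2 : weightBarycenter w ∈ convexHull ℝ (w'.support : Set E) :=
    mem_convexHull_iff_weight.2 ⟨w', hw'.nonneg, subset_rfl, hw'.total, hb.symm⟩
  have h3 := K.inter_subset_convexHull hw.support_mem hw'.support_mem ⟨h1, h2⟩
  rw [← Finset.coe_inter, mem_convexHull_iff_weight] at h3
  obtain ⟨z, hz0, hzs, hz1, hzb⟩ := h3
  have e1 : w = z := weight_eq_of_affineIndependent (K.indep hw.support_mem) subset_rfl
    (hzs.trans Finset.inter_subset_left) (hw.total.trans hz1.symm) hzb.symm
  have e2 : w' = z := weight_eq_of_affineIndependent (K.indep hw'.support_mem) subset_rfl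
    (hzs.trans Finset.inter_subset_right) (hw'.total.trans hz1.symm) (hb.symm.trans hzb.symm)
  rw [e1, e2]

/-- A down-closed family of finite sets with unique convex weights is a simplicial complex. -/
def complexOfUniqueFaceWeights (A : Set (Finset E)) (hne : ∀ s ∈ A, s.Nonempty)
    (hdown : ∀ s ∈ A, ∀ t ⊆ s, t.Nonempty → t ∈ A) (h : UniqueFaceWeights A) :
    SimplicialComplex ℝ E where
  faces := A
  isRelLowerSet_faces := fun s hs => ⟨hne s hs, fun t hts ht => hdown s hs t hts ht⟩
  indep := by
    classical
    intro s hs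
    rw [affineIndependent_iff]
    intro t c hc0 hcb i hi
    by_contra hne0
    -- Split the affine dependence `c` into positive part `p` and negative part `n`. They have equal
    -- mass and barycenter, so after division by the mass they are two face weights of one point.
    -- Uniqueness makes them equal, although at each vertex one of them vanishes.
    set p : E →₀ ℝ := ∑ j ∈ t, Finsupp.single (j : E) (max (c j) 0) with hp
    set n : E →₀ ℝ := ∑ j ∈ t, Finsupp.single (j : E) (max (-c j) 0) with hn
    have pn : p - n = ∑ j ∈ t, Finsupp.single (j : E) (c j) := by
      rw [hp, hn, ← Finset.sum_sub_distrib]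
      refine Finset.sum_congr rfl fun j _ => ?_
      rw [← Finsupp.single_sub]
      congr 1
      rcases le_total (c j) 0 with h | h
      · rw [max_eq_right h, max_eq_left (by linarith)]; ring
      · rw [max_eq_left h, max_eq_right (by linarith)]; ring
    have happ : ∀ (g : s → ℝ) (j : s), (∑ j ∈ t, Finsupp.single (j : E) (g j)) (j : E) =
        if j ∈ t then g j else 0 := by
      intro g j
      rw [Finsupp.finsetSum_apply]
      simp only [Finsupp.single_apply, Subtype.coe_inj]
      rw [Finset.sum_ite_eq' t j]
    have hnn : ∀ (g : s → ℝ), (∀ j, 0 ≤ g j) → ∀ x,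
        0 ≤ (∑ j ∈ t, Finsupp.single (j : E) (g j)) x := by
      intro g hg x
      rw [Finsupp.finsetSum_apply]
      refine Finset.sum_nonneg fun j _ => ?_
      rw [Finsupp.single_apply]
      split_ifs
      · exact hg j
      · exact le_rfl
    have hsupp : ∀ (g : s → ℝ), (∑ j ∈ t, Finsupp.single (j : E) (g j)).support ⊆ s := by
      intro g x hx
      by_contra hxs
      rw [Finsupp.mem_support_iff, Finsupp.finsetSum_apply] at hx
      refine hx (Finset.sum_eq_zero fun j _ => ?_)
      rw [Finsupp.single_apply, if_neg]
      rintro rfl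
      exact hxs j.2
    have htot : weightTotal p = weightTotal n := by
      rw [← sub_eq_zero, ← map_sub, pn, map_sum]
      simpa [weightTotal_single] using hc0
    have hbar : weightBarycenter p = weightBarycenter n := by
      rw [← sub_eq_zero, ← map_sub, pn, map_sum]
      simpa [weightBarycenter_single] using hcb
    have hpos : 0 < weightTotal p := by
      have hle : ∀ (g : s → ℝ), (∀ j, 0 ≤ g j) → 0 < g i →
          0 < weightTotal (∑ j ∈ t, Finsupp.single (j : E) (g j)) := by
        intro g hg hgi
        rw [map_sum]
        simp only [weightTotal_single]
        exact Finset.sum_pos' (fun j _ => hg j) ⟨i, hi, hgi⟩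
      rcases lt_or_gt_of_ne hne0 with h | h
      · rw [htot]
        exact hle _ (fun j => le_max_right _ _) (lt_max_of_lt_left (by linarith))
      · exact hle _ (fun j => le_max_right _ _) (lt_max_of_lt_left h)
    have key : ∀ g : s → ℝ, (∀ j, 0 ≤ g j) →
        weightTotal (∑ j ∈ t, Finsupp.single (j : E) (g j)) = weightTotal p →
        IsFaceWeight A ((weightTotal p)⁻¹ • (∑ j ∈ t, Finsupp.single (j : E) (g j))) := by
      intro g hg htg
      have ht1 : weightTotal ((weightTotal p)⁻¹ • (∑ j ∈ t, Finsupp.single (j : E) (g j))) = 1 := by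
        rw [map_smul, htg, smul_eq_mul, inv_mul_cancel₀ hpos.ne']
      refine ⟨fun x => ?_, ?_, ht1⟩
      · rw [Finsupp.smul_apply, smul_eq_mul]
        exact mul_nonneg (inv_nonneg.2 hpos.le) (hnn g hg x)
      · exact hdown s hs _ (Finsupp.support_smul.trans (hsupp g)) (weight_support_nonempty ht1)
    have := h _ _ (key _ (fun j => le_max_right (c j) 0) rfl)
      (key _ (fun j => le_max_right (-c j) 0) htot.symm) (by rw [map_smul, map_smul, hbar])
    have h2 : p i = n i := by
      have := DFunLike.congr_fun this (i : E)
      simp only [Finsupp.smul_apply, smul_eq_mul] at this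
      exact mul_left_cancel₀ (inv_ne_zero hpos.ne') this
    rw [hp, hn, happ (fun j => max (c j) 0), happ (fun j => max (-c j) 0), if_pos hi,
      if_pos hi] at h2
    rcases lt_or_gt_of_ne hne0 with h | h
    · rw [max_eq_right h.le, max_eq_left (by linarith)] at h2; linarith
    · rw [max_eq_left h.le, max_eq_right (by linarith)] at h2; linarith
  inter_subset_convexHull := by
    classical
    rintro s t hs ht y ⟨hys, hyt⟩
    obtain ⟨w, hw0, hws, hw1, hwb⟩ := mem_convexHull_iff_weight.1 hys
    obtain ⟨w', hw0', hws', hw1', hwb'⟩ := mem_convexHull_iff_weight.1 hyt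
    have := h w w' ⟨hw0, hdown s hs _ hws (weight_support_nonempty hw1), hw1⟩
      ⟨hw0', hdown t ht _ hws' (weight_support_nonempty hw1'), hw1'⟩ (hwb.trans hwb'.symm)
    rw [← Finset.coe_inter, mem_convexHull_iff_weight]
    exact ⟨w, hw0, Finset.subset_inter hws (this ▸ hws'), hw1, hwb⟩

open Classical in
/-- The barycentric coordinates of a point of a simplicial complex (zero off the complex). -/
noncomputable def Geometry.SimplicialComplex.coord (K : SimplicialComplex ℝ E) (y : E) : E →₀ ℝ :=
  if h : ∃ w, IsFaceWeight K.faces w ∧ weightBarycenter w = y then h.choose else 0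

namespace Geometry.SimplicialComplex

variable (K : SimplicialComplex ℝ E)

variable {K} in
lemma exists_weight_of_mem_convexHull {s : Finset E} (hs : s ∈ K.faces) {y : E}
    (hy : y ∈ convexHull ℝ (s : Set E)) :
    ∃ w, IsFaceWeight K.faces w ∧ weightBarycenter w = y ∧ w.support ⊆ s := by
  obtain ⟨w, h0, h1, h2, h3⟩ := mem_convexHull_iff_weight.1 hy
  exact ⟨w, ⟨h0, K.down_closed hs h1 (weight_support_nonempty h2), h2⟩, h3, h1⟩

variable {K} in
lemma coord_eq {w : E →₀ ℝ} (hw : IsFaceWeight K.faces w) :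
    K.coord (weightBarycenter w) = w := by
  have h : ∃ w', IsFaceWeight K.faces w' ∧ weightBarycenter w' = weightBarycenter w := ⟨w, hw, rfl⟩
  rw [coord, dif_pos h]
  exact K.uniqueFaceWeights _ _ h.choose_spec.1 hw h.choose_spec.2

variable {K}

lemma coord_spec {y : E} (hy : y ∈ K.space) :
    IsFaceWeight K.faces (K.coord y) ∧ weightBarycenter (K.coord y) = y := by
  obtain ⟨s, hs, hys⟩ := mem_space_iff.1 hy
  obtain ⟨w, hw, hb, -⟩ := exists_weight_of_mem_convexHull hs hys
  rw [← hb, coord_eq hw]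
  exact ⟨hw, rfl⟩

lemma mem_convexHull_iff_coord {s : Finset E} (hs : s ∈ K.faces) {y : E} (hy : y ∈ K.space) :
    y ∈ convexHull ℝ (s : Set E) ↔ (K.coord y).support ⊆ s := by
  constructor
  · intro h
    obtain ⟨w, hw, hb, hsub⟩ := exists_weight_of_mem_convexHull hs h
    rw [← hb, coord_eq hw]
    exact hsub
  · intro h
    obtain ⟨h1, h2⟩ := coord_spec hy
    exact mem_convexHull_iff_weight.2 ⟨_, h1.nonneg, h, h1.total, h2⟩

lemma mem_vertices_of_mem_face {s : Finset E} (hs : s ∈ K.faces) {v : E} (hv : v ∈ s) :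
    v ∈ K.vertices :=
  K.down_closed hs (Finset.singleton_subset_iff.2 hv) (Finset.singleton_nonempty v)

lemma weightBarycenter_mem_space {w : E →₀ ℝ} (hw : IsFaceWeight K.faces w) :
    weightBarycenter w ∈ K.space :=
  mem_space_iff.2 ⟨w.support, hw.support_mem,
    mem_convexHull_iff_weight.2 ⟨w, hw.nonneg, subset_rfl, hw.total, rfl⟩⟩

lemma coord_vertex {v : E} (hv : v ∈ K.vertices) : K.coord v = Finsupp.single v 1 := by
  have : IsFaceWeight K.faces (Finsupp.single v (1 : ℝ)) := by
    refine ⟨fun x => ?_, ?_, weightTotal_single _ _⟩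
    · classical
      rw [Finsupp.single_apply]; split_ifs <;> norm_num
    · rw [Finsupp.support_single _ one_ne_zero]; exact hv
  have h := coord_eq this
  rwa [weightBarycenter_single, one_smul] at h

lemma coord_nonneg (y v : E) : 0 ≤ K.coord y v := by
  by_cases h : ∃ w, IsFaceWeight K.faces w ∧ weightBarycenter w = y
  · obtain ⟨w, hw, rfl⟩ := h
    rw [coord_eq hw]; exact hw.nonneg v
  · rw [coord, dif_neg h]; simp

/-- A point of the hull of `s` that is a vertex of the complex belongs to `s`. -/
lemma vertex_mem_of_mem_convexHull {s : Finset E} (hs : s ∈ K.faces) {v : E} (hv : v ∈ K.vertices)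
    (h : v ∈ convexHull ℝ (s : Set E)) : v ∈ s := by
  have h1 := (mem_convexHull_iff_coord hs (convexHull_subset_space hs h)).1 h
  rw [coord_vertex hv, Finsupp.support_single _ one_ne_zero] at h1
  exact h1 (Finset.mem_singleton_self v)

end Geometry.SimplicialComplex

end Weights

/-! ### Continuity of barycentric coordinates. -/

section WeightTopology

variable {E : Type*} [NormedAddCommGroup E] [NormedSpace ℝ E] {K : SimplicialComplex ℝ E}

/-- The preimage of a closed set is a finite union, over the faces, of continuous images of compact
sets of weights, hence closed. -/
lemma Geometry.SimplicialComplex.continuousOn_coord (hK : K.faces.Finite) (v : E) :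
    ContinuousOn (fun y => K.coord y v) K.space := by
  classical
  rw [continuousOn_iff_isClosed]
  intro C hC
  -- `g s` is the part of the hull of `s` where the coordinate at `v` lies in `C`. Weights off `s`
  -- are pinned to `0`, so the parameters fill a product of compact sets although they are indexed
  -- by all of `E`.
  let g : Finset E → Set E := fun s =>
    (fun w : E → ℝ => ∑ x ∈ s, w x • x) ''
      ({w | (∀ x ∈ s, 0 ≤ w x) ∧ (∑ x ∈ s, w x = 1) ∧ (if v ∈ s then w v else 0) ∈ C} ∩
        Set.univ.pi fun x => if x ∈ s then Set.Icc (0 : ℝ) 1 else {0})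
  refine ⟨⋃ s ∈ K.faces, g s, ?_, ?_⟩
  · refine hK.isClosed_biUnion fun s hs => IsCompact.isClosed ?_
    refine IsCompact.image ?_ (by fun_prop)
    refine IsCompact.inter_left ?_ ?_
    · refine isCompact_univ_pi fun x => ?_
      split_ifs
      · exact isCompact_Icc
      · exact isCompact_singleton
    · have h1 : IsClosed {w : E → ℝ | ∀ x ∈ s, 0 ≤ w x} := by
        simp only [Set.ofPred_forall]
        exact isClosed_biInter fun x _ => isClosed_le continuous_const (continuous_apply x)
      have h2 : IsClosed {w : E → ℝ | ∑ x ∈ s, w x = 1} :=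
        isClosed_eq (by fun_prop) continuous_const
      have h3 : IsClosed {w : E → ℝ | (if v ∈ s then w v else 0) ∈ C} := by
        refine hC.preimage ?_
        split_ifs <;> fun_prop
      exact h1.inter (h2.inter h3)
  · have key : ∀ s ∈ K.faces, ∀ y, y ∈ g s ↔
        y ∈ convexHull ℝ (s : Set E) ∧ K.coord y v ∈ C := by
      intro s hs y
      constructor
      · rintro ⟨w, ⟨⟨h0, h1, h2⟩, h3⟩, rfl⟩
        let w' : E →₀ ℝ := Finsupp.onFinset s w (by
          intro a ha
          by_contra hs
          have := h3 a trivial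
          simp [hs] at this
          exact ha this)
        have hs' : w'.support ⊆ s := Finsupp.support_onFinset_subset
        have hb : weightBarycenter w' = ∑ x ∈ s, w x • x := by
          rw [weightBarycenter_eq_sum hs']; rfl
        have ht : weightTotal w' = 1 := by
          rw [weightTotal_eq_sum hs', ← h1]; rfl
        have hw' : IsFaceWeight K.faces w' := by
          refine ⟨fun x => ?_, K.down_closed hs hs' (weight_support_nonempty ht), ht⟩
          have := h3 x trivial
          simp only at this
          split_ifs at this with hx
          · exact this.1
          · exact le_of_eq (by simpa [w'] using (Set.mem_singleton_iff.1 this).symm)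
        have hv : K.coord (∑ x ∈ s, w x • x) v = if v ∈ s then w v else 0 := by
          rw [← hb, SimplicialComplex.coord_eq hw']
          split_ifs with h
          · rfl
          · have := h3 v trivial
            simp only [h, if_false, Set.mem_singleton_iff] at this
            exact this
        simp only
        refine ⟨?_, by rw [hv]; exact h2⟩
        rw [← hb]
        exact mem_convexHull_iff_weight.2 ⟨w', hw'.nonneg, hs', ht, rfl⟩
      · rintro ⟨h1, h2⟩
        obtain ⟨w, hw, hb, hsub⟩ := SimplicialComplex.exists_weight_of_mem_convexHull hs h1
        have hcw : K.coord y = w := by rw [← hb, SimplicialComplex.coord_eq hw]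
        rw [hcw] at h2
        have hz : ∀ x, x ∉ s → w x = 0 := fun x hx =>
          Finsupp.notMem_support_iff.1 fun h => hx (hsub h)
        have ht : ∑ x ∈ s, w x = 1 := by rw [← weightTotal_eq_sum hsub, hw.total]
        refine ⟨w, ⟨⟨fun x _ => hw.nonneg x, ht, ?_⟩, ?_⟩, ?_⟩
        · split_ifs with h
          · exact h2
          · rw [← hz v h]; exact h2
        · intro x _
          simp only
          split_ifs with h
          · refine ⟨hw.nonneg x, ?_⟩
            rw [← ht]
            exact Finset.single_le_sum (fun x _ => hw.nonneg x) h
          · exact hz x h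
        · simp only
          rw [← weightBarycenter_eq_sum hsub, hb]
    ext y
    simp only [Set.mem_inter_iff, Set.mem_preimage, Set.mem_iUnion, SimplicialComplex.mem_space_iff]
    constructor
    · rintro ⟨h1, s, hs, hy⟩
      exact ⟨⟨s, hs, (key s hs y).2 ⟨hy, h1⟩⟩, s, hs, hy⟩
    · rintro ⟨⟨s, hs, hy⟩, h⟩
      exact ⟨((key s hs y).1 hy).2, h⟩

end WeightTopology

/-! ### Stellar subdivision at a point of an edge. -/

section EdgeSplit

variable {E : Type*} [AddCommGroup E] [Module ℝ E] [DecidableEq E]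

/-- The faces of the stellar subdivision of `K` at a point `x` of the open edge `{a, b}`. -/
def edgeSplitFaces (K : SimplicialComplex ℝ E) (a b x : E) : Set (Finset E) :=
  {s | s ∈ K.faces ∧ ¬ ({a, b} : Finset E) ⊆ s} ∪
    {s | ∃ s', ¬ ({a, b} : Finset E) ⊆ s' ∧ s' ∪ {a, b} ∈ K.faces ∧ s = insert x s'}

/-- The point `x` lies in the open edge `{a, b}` of `K`. -/
structure IsInOpenEdge (K : SimplicialComplex ℝ E) (a b x : E) : Prop where
  ne : a ≠ b
  -- The edge is described by its members rather than as `{a, b}`, so the condition does not depend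
  -- on a choice of decidable equality.
  mem : ∀ s : Finset E, (∀ y, y ∈ s ↔ y = a ∨ y = b) → s ∈ K.faces
  mem_openSegment : x ∈ openSegment ℝ a b

variable {K : SimplicialComplex ℝ E} {a b x : E}

lemma IsInOpenEdge.edge_mem (h : IsInOpenEdge K a b x) : ({a, b} : Finset E) ∈ K.faces :=
  h.mem _ (by simp)

lemma IsInOpenEdge.notMem_vertices (h : IsInOpenEdge K a b x) : x ∉ K.vertices := by
  intro hx
  have h1 : x ∈ convexHull ℝ ((({a, b} : Finset E) : Set E)) := by
    rw [Finset.coe_pair, convexHull_pair]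
    exact openSegment_subset_segment _ _ _ h.mem_openSegment
  have h2 := SimplicialComplex.vertex_mem_of_mem_convexHull h.edge_mem hx h1
  obtain ⟨s, t, hs, ht, hst, hxe⟩ := h.mem_openSegment
  simp only [Finset.mem_insert, Finset.mem_singleton] at h2
  obtain rfl : s = 1 - t := by linarith
  rcases h2 with rfl | rfl
  · have h4 : x = x + t • (b - x) := by nth_rewrite 1 [← hxe]; module
    have h5 : t • (b - x) = 0 := by simpa using h4.symm
    rcases smul_eq_zero.1 h5 with h4 | h4
    · linarith
    · exact h.ne (sub_eq_zero.1 h4).symm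
  · have h4 : x = x + (1 - t) • (a - x) := by nth_rewrite 1 [← hxe]; module
    have h5 : (1 - t) • (a - x) = 0 := by simpa using h4.symm
    rcases smul_eq_zero.1 h5 with h4 | h4
    · linarith
    · exact h.ne (sub_eq_zero.1 h4)

lemma IsInOpenEdge.ne_of_mem_face (h : IsInOpenEdge K a b x) {s : Finset E} (hs : s ∈ K.faces) :
    x ∉ s := fun hx => h.notMem_vertices (SimplicialComplex.mem_vertices_of_mem_face hs hx)

lemma IsInOpenEdge.exists_coeff (h : IsInOpenEdge K a b x) :
    ∃ t : ℝ, 0 < t ∧ t < 1 ∧ x = (1 - t) • a + t • b := by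
  obtain ⟨s, t, hs, ht, hst, hxe⟩ := h.mem_openSegment
  exact ⟨t, ht, by linarith, by rw [← hxe, ← hst]; simp⟩

lemma edgeSplitFaces_nonempty {s : Finset E} (hs : s ∈ edgeSplitFaces K a b x) : s.Nonempty := by
  rcases hs with hs | ⟨s', -, -, rfl⟩
  · exact SimplicialComplex.nonempty_of_mem_faces hs.1
  · exact Finset.insert_nonempty _ _

lemma edgeSplitFaces_down {s : Finset E} (hs : s ∈ edgeSplitFaces K a b x) {t : Finset E}
    (hts : t ⊆ s) (ht : t.Nonempty) : t ∈ edgeSplitFaces K a b x := by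
  rcases hs with hs | ⟨s', hs1, hs2, rfl⟩
  · exact Or.inl ⟨K.down_closed hs.1 hts ht, fun h => hs.2 (h.trans hts)⟩
  · by_cases hx : x ∈ t
    · refine Or.inr ⟨t.erase x, fun h => hs1 (h.trans ?_), ?_, (Finset.insert_erase hx).symm⟩
      · rwa [← Finset.subset_insert_iff]
      · refine K.down_closed hs2 (Finset.union_subset_union ?_ subset_rfl) ⟨a, by simp⟩
        rwa [← Finset.subset_insert_iff]
    · have h1 : t ⊆ s' := (Finset.subset_insert_iff_of_notMem hx).1 hts
      exact Or.inl ⟨K.down_closed hs2 (h1.trans Finset.subset_union_left) ht,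
        fun h => hs1 (h.trans h1)⟩

/-- Redistribution of the weight of `x = (1 - t) a + t b` to `a` and `b`. -/
noncomputable def redistribute (a b x : E) (t c : ℝ) : E →₀ ℝ :=
  Finsupp.single a (c * (1 - t)) + Finsupp.single b (c * t) - Finsupp.single x c

lemma weightTotal_redistribute (t c : ℝ) : weightTotal (redistribute a b x t c) = 0 := by
  simp only [redistribute, map_add, map_sub, weightTotal_single]; ring

lemma weightBarycenter_redistribute {t : ℝ} (hx : x = (1 - t) • a + t • b) (c : ℝ) :
    weightBarycenter (redistribute a b x t c) = 0 := by
  simp only [redistribute, map_add, map_sub, weightBarycenter_single]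
  rw [hx]; module

lemma redistribute_apply_left (hab : a ≠ b) (hxa : x ≠ a) (t c : ℝ) :
    redistribute a b x t c a = c * (1 - t) := by
  simp [redistribute, hab.symm, hxa]

lemma redistribute_apply_right (hab : a ≠ b) (hxb : x ≠ b) (t c : ℝ) :
    redistribute a b x t c b = c * t := by
  simp [redistribute, hab, hxb]

lemma redistribute_apply_self (hxa : x ≠ a) (hxb : x ≠ b) (t c : ℝ) :
    redistribute a b x t c x = -c := by
  simp [redistribute, hxa.symm, hxb.symm]

lemma redistribute_apply_of_ne {y : E} (ha : y ≠ a) (hb : y ≠ b) (hx : y ≠ x) (t c : ℝ) :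
    redistribute a b x t c y = 0 := by
  simp [redistribute, ha.symm, hb.symm, hx.symm]

lemma IsInOpenEdge.ne_left (h : IsInOpenEdge K a b x) : x ≠ a := by
  rintro rfl
  exact h.ne_of_mem_face h.edge_mem (by simp)

lemma IsInOpenEdge.ne_right (h : IsInOpenEdge K a b x) : x ≠ b := by
  rintro rfl
  exact h.ne_of_mem_face h.edge_mem (by simp)

/-- Handing the weight of `x` back to `a` and `b` turns a representation of a point in the
subdivision into its representation in `K`. -/
lemma IsInOpenEdge.push_weight (h : IsInOpenEdge K a b x) {t : ℝ} (ht0 : 0 < t) (ht1 : t < 1)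
    (hx : x = (1 - t) • a + t • b) {w : E →₀ ℝ} (hw : IsFaceWeight (edgeSplitFaces K a b x) w) :
    IsFaceWeight K.faces (w + redistribute a b x t (w x)) ∧
      weightBarycenter (w + redistribute a b x t (w x)) = weightBarycenter w := by
  have hxa := h.ne_left
  have hxb := h.ne_right
  have htot : weightTotal (w + redistribute a b x t (w x)) = 1 := by
    rw [map_add, weightTotal_redistribute, hw.total, add_zero]
  refine ⟨⟨fun y => ?_, ?_, htot⟩, ?_⟩
  · rw [Finsupp.add_apply]
    have h0 := hw.nonneg y
    have h0x := hw.nonneg x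
    by_cases ha : y = a
    · rw [ha, redistribute_apply_left h.ne hxa]
      have := hw.nonneg a
      have : 0 ≤ w x * (1 - t) := mul_nonneg h0x (by linarith)
      linarith
    by_cases hb : y = b
    · rw [hb, redistribute_apply_right h.ne hxb]
      have := hw.nonneg b
      have : 0 ≤ w x * t := mul_nonneg h0x (by linarith)
      linarith
    by_cases hyx : y = x
    · rw [hyx, redistribute_apply_self hxa hxb]; linarith
    · rw [redistribute_apply_of_ne ha hb hyx, add_zero]; exact h0
  · have hne := weight_support_nonempty htot
    rcases hw.support_mem with hs | ⟨s', hs1, hs2, hs3⟩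
    · have hwx : w x = 0 := Finsupp.notMem_support_iff.1 (h.ne_of_mem_face hs.1)
      have : w + redistribute a b x t (w x) = w := by
        rw [hwx]; simp [redistribute]
      rw [this]; exact hs.1
    · refine K.down_closed hs2 (fun y hy => ?_) hne
      rw [Finsupp.mem_support_iff, Finsupp.add_apply] at hy
      by_cases ha : y = a
      · simp [ha]
      by_cases hb : y = b
      · simp [hb]
      by_cases hyx : y = x
      · rw [hyx, redistribute_apply_self hxa hxb] at hy
        simp at hy
      · rw [redistribute_apply_of_ne ha hb hyx, add_zero, ← Finsupp.mem_support_iff, hs3] at hy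
        simp only [Finset.mem_insert, hyx, false_or] at hy
        simp [hy]
  · rw [map_add, weightBarycenter_redistribute hx, add_zero]

lemma IsInOpenEdge.uniqueFaceWeights (h : IsInOpenEdge K a b x) :
    UniqueFaceWeights (edgeSplitFaces K a b x) := by
  obtain ⟨t, ht0, ht1, hx⟩ := h.exists_coeff
  have hxa := h.ne_left
  have hxb := h.ne_right
  have hzero : ∀ w, IsFaceWeight (edgeSplitFaces K a b x) w → w a = 0 ∨ w b = 0 := by
    intro w hw
    by_contra hcon
    push Not at hcon
    have hsub : ({a, b} : Finset E) ⊆ w.support := by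
      intro y hy
      simp only [Finset.mem_insert, Finset.mem_singleton] at hy
      rcases hy with rfl | rfl
      · exact Finsupp.mem_support_iff.2 hcon.1
      · exact Finsupp.mem_support_iff.2 hcon.2
    rcases hw.support_mem with hs | ⟨s', hs1, -, hs3⟩
    · exact hs.2 hsub
    · rw [hs3] at hsub
      refine hs1 fun y hy => ?_
      have h1 := hsub hy
      simp only [Finset.mem_insert, Finset.mem_singleton] at hy h1
      rcases h1 with rfl | h1
      · rcases hy with rfl | rfl
        · exact absurd rfl hxa
        · exact absurd rfl hxb
      · exact h1
  -- If the pushed weights agree and `w x < w' x`, then `w` must exceed `w'` at both `a` and `b`, so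
  -- it is positive at both; but no face of the subdivision contains both.
  have hle : ∀ w w', IsFaceWeight (edgeSplitFaces K a b x) w →
      IsFaceWeight (edgeSplitFaces K a b x) w' → w + redistribute a b x t (w x) =
        w' + redistribute a b x t (w' x) → w' x ≤ w x := by
    intro w w' hw hw' he
    by_contra! hlt
    have ea := DFunLike.congr_fun he a
    have eb := DFunLike.congr_fun he b
    rw [Finsupp.add_apply, Finsupp.add_apply, redistribute_apply_left h.ne hxa,
      redistribute_apply_left h.ne hxa] at ea
    rw [Finsupp.add_apply, Finsupp.add_apply, redistribute_apply_right h.ne hxb,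
      redistribute_apply_right h.ne hxb] at eb
    have h1 := hw'.nonneg a
    have h2 := hw'.nonneg b
    have h3 : w x * (1 - t) < w' x * (1 - t) := mul_lt_mul_of_pos_right hlt (by linarith)
    have h4 : w x * t < w' x * t := mul_lt_mul_of_pos_right hlt ht0
    rcases hzero w hw with h5 | h5 <;> linarith
  intro w w' hw hw' hb
  obtain ⟨p1, p2⟩ := h.push_weight ht0 ht1 hx hw
  obtain ⟨p1', p2'⟩ := h.push_weight ht0 ht1 hx hw'
  have he := K.uniqueFaceWeights _ _ p1 p1' (by rw [p2, p2', hb])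
  have hxx : w x = w' x := le_antisymm (hle _ _ hw' hw he.symm) (hle _ _ hw hw' he)
  rw [hxx] at he
  exact add_right_cancel he

/-- The stellar subdivision of `K` at a point `x` of the open edge `{a, b}`. -/
def edgeSplit (h : IsInOpenEdge K a b x) : SimplicialComplex ℝ E :=
  complexOfUniqueFaceWeights (edgeSplitFaces K a b x) (fun _ hs => edgeSplitFaces_nonempty hs)
    (fun _ hs _ hts ht => edgeSplitFaces_down hs hts ht) h.uniqueFaceWeights

lemma edgeSplit_faces (h : IsInOpenEdge K a b x) :
    (edgeSplit h).faces = edgeSplitFaces K a b x := rfl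

lemma mem_edgeSplit_of_notMem (h : IsInOpenEdge K a b x) {s : Finset E} (hx : x ∉ s) :
    s ∈ (edgeSplit h).faces ↔ s ∈ K.faces ∧ ¬ ({a, b} : Finset E) ⊆ s := by
  rw [edgeSplit_faces]
  constructor
  · rintro (hs | ⟨s', -, -, rfl⟩)
    · exact hs
    · simp at hx
  · exact Or.inl

lemma mem_edgeSplit_of_mem (h : IsInOpenEdge K a b x) {s : Finset E} (hx : x ∈ s) :
    s ∈ (edgeSplit h).faces ↔ ¬ ({a, b} : Finset E) ⊆ s ∧ s.erase x ∪ {a, b} ∈ K.faces := by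
  have hiff : ({a, b} : Finset E) ⊆ s ↔ ({a, b} : Finset E) ⊆ s.erase x := by
    rw [Finset.subset_erase]
    have := h.ne_left
    have := h.ne_right
    simp_all
  rw [edgeSplit_faces, hiff]
  constructor
  · rintro (hs | ⟨s', h1, h2, rfl⟩)
    · exact absurd hx (h.ne_of_mem_face hs.1)
    · have : x ∉ s' := fun hx' => h.ne_of_mem_face h2 (Finset.mem_union_left _ hx')
      rw [Finset.erase_insert this]
      exact ⟨h1, h2⟩
  · rintro ⟨h1, h2⟩
    exact Or.inr ⟨s.erase x, h1, h2, (Finset.insert_erase hx).symm⟩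

lemma edgeSplit_space (h : IsInOpenEdge K a b x) : (edgeSplit h).space = K.space := by
  obtain ⟨t, ht0, ht1, hx⟩ := h.exists_coeff
  have hxa := h.ne_left
  have hxb := h.ne_right
  apply Set.Subset.antisymm
  · intro y hy
    obtain ⟨h1, h2⟩ := SimplicialComplex.coord_spec hy
    obtain ⟨p1, p2⟩ := h.push_weight ht0 ht1 hx h1
    rw [← h2, ← p2]
    exact SimplicialComplex.weightBarycenter_mem_space p1
  · intro y hy
    obtain ⟨hW, hWy⟩ := SimplicialComplex.coord_spec hy
    set W := K.coord y with hWdef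
    -- The largest mass that can be moved to `x`: it takes `c * (1 - t)` from `a` and `c * t` from
    -- `b`, and exhausts at least one of them.
    set c := min (W a / (1 - t)) (W b / t) with hc
    have ht1' : 0 < 1 - t := by linarith
    have hc0 : 0 ≤ c := le_min (div_nonneg (hW.nonneg a) ht1'.le) (div_nonneg (hW.nonneg b) ht0.le)
    have hca : c * (1 - t) ≤ W a := by
      rw [← le_div_iff₀ ht1']; exact min_le_left _ _
    have hcb : c * t ≤ W b := by
      rw [← le_div_iff₀ ht0]; exact min_le_right _ _
    have hWx : W x = 0 := Finsupp.notMem_support_iff.1 (h.ne_of_mem_face hW.support_mem)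
    set w := W - redistribute a b x t c with hw
    have hwa : w a = W a - c * (1 - t) := by
      rw [hw, Finsupp.sub_apply, redistribute_apply_left h.ne hxa]
    have hwb : w b = W b - c * t := by
      rw [hw, Finsupp.sub_apply, redistribute_apply_right h.ne hxb]
    have hwx : w x = c := by
      rw [hw, Finsupp.sub_apply, redistribute_apply_self hxa hxb, hWx]; ring
    have hwy : ∀ z, z ≠ a → z ≠ b → z ≠ x → w z = W z := by
      intro z h1 h2 h3
      rw [hw, Finsupp.sub_apply, redistribute_apply_of_ne h1 h2 h3, sub_zero]
    have hwab : w a = 0 ∨ w b = 0 := by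
      rcases min_choice (W a / (1 - t)) (W b / t) with h1 | h1
      · left; rw [hwa, hc, h1, div_mul_cancel₀ _ ht1'.ne', sub_self]
      · right; rw [hwb, hc, h1, div_mul_cancel₀ _ ht0.ne', sub_self]
    have htot : weightTotal w = 1 := by
      rw [hw, map_sub, weightTotal_redistribute, hW.total, sub_zero]
    have hnab : ¬ ({a, b} : Finset E) ⊆ w.support := by
      intro hsub
      have h1 := Finsupp.mem_support_iff.1 (hsub (Finset.mem_insert_self a _))
      have h2 := Finsupp.mem_support_iff.1 (hsub (show b ∈ ({a, b} : Finset E) by simp))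
      tauto
    have hface : IsFaceWeight (edgeSplit h).faces w := by
      refine ⟨fun z => ?_, ?_, htot⟩
      · by_cases h1 : z = a
        · rw [h1, hwa]; linarith
        by_cases h2 : z = b
        · rw [h2, hwb]; linarith
        by_cases h3 : z = x
        · rw [h3, hwx]; exact hc0
        · rw [hwy z h1 h2 h3]; exact hW.nonneg z
      · rcases hc0.eq_or_lt with h0 | h0
        · have hxs : x ∉ w.support := by rw [Finsupp.notMem_support_iff, hwx, ← h0]
          rw [mem_edgeSplit_of_notMem h hxs]
          refine ⟨?_, hnab⟩
          have : w = W := by rw [hw, ← h0]; simp [redistribute]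
          rw [this]; exact hW.support_mem
        · have hxs : x ∈ w.support := by rw [Finsupp.mem_support_iff, hwx]; exact h0.ne'
          rw [mem_edgeSplit_of_mem h hxs]
          refine ⟨hnab, K.down_closed hW.support_mem ?_ ⟨a, by simp⟩⟩
          have hWa : a ∈ W.support := by
            rw [Finsupp.mem_support_iff]
            have := mul_pos h0 ht1'
            intro h; linarith
          have hWb : b ∈ W.support := by
            rw [Finsupp.mem_support_iff]
            have := mul_pos h0 ht0
            intro h; linarith
          intro z hz
          by_cases h1 : z = a
          · rw [h1]; exact hWa
          by_cases h2 : z = b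
          · rw [h2]; exact hWb
          simp only [Finset.mem_union, Finset.mem_erase, Finset.mem_insert, Finset.mem_singleton,
            h1, h2, or_false] at hz
          have := hz.2
          rw [Finsupp.mem_support_iff, hwy z h1 h2 hz.1] at this
          exact Finsupp.mem_support_iff.2 this
    have : weightBarycenter w = y := by
      rw [hw, map_sub, weightBarycenter_redistribute hx, sub_zero, hWy]
    rw [← this]
    exact SimplicialComplex.weightBarycenter_mem_space hface

lemma edgeSplit_refines (h : IsInOpenEdge K a b x) :
    ∀ s ∈ (edgeSplit h).faces, ∃ t ∈ K.faces, convexHull ℝ (s : Set E) ⊆ convexHull ℝ (t : Set E) := by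
  rintro s (hs | ⟨s', -, h2, rfl⟩)
  · exact ⟨s, hs.1, subset_rfl⟩
  · refine ⟨_, h2, convexHull_min ?_ (convex_convexHull ℝ _)⟩
    intro y hy
    simp only [Finset.coe_insert, Set.mem_insert_iff, Finset.mem_coe] at hy
    rcases hy with rfl | hy
    · have : segment ℝ a b ⊆ convexHull ℝ ((s' ∪ {a, b} : Finset E) : Set E) :=
        segment_subset_convexHull (by simp) (by simp)
      exact this (openSegment_subset_segment _ _ _ h.mem_openSegment)
    · exact subset_convexHull ℝ _ (by simp [hy])

lemma edgeSplit_finite (h : IsInOpenEdge K a b x) (hK : K.faces.Finite) :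
    (edgeSplit h).faces.Finite := by
  -- The empty set is adjoined because the vertex `x` alone comes from `s' = ∅`, which is not a
  -- face.
  refine ((hK.subset fun s hs => hs.1).union
    (((hK.union (Set.finite_singleton ∅)).image (insert x)).subset ?_))
  rintro s ⟨s', -, h2, rfl⟩
  refine ⟨s', ?_, rfl⟩
  rcases s'.eq_empty_or_nonempty with h0 | h0
  · exact Or.inr h0
  · exact Or.inl (K.down_closed h2 Finset.subset_union_left h0)

lemma edgeSplit_isSubdivision {n : ℕ} {K : EuclideanComplex n} {a b x : EuclideanSpace ℝ (Fin n)}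
    (h : IsInOpenEdge K a b x) (hK : K.faces.Finite) : IsSubdivision (edgeSplit h) K :=
  ⟨edgeSplit_finite h hK, edgeSplit_space h, edgeSplit_refines h⟩

end EdgeSplit

/-! ### Continuous logarithms and winding numbers. -/

section Logarithms

variable {X Y : Type*} [TopologicalSpace X] [TopologicalSpace Y]

/-- The function `g` has a continuous logarithm on `s`. -/
def HasLogOn (g : X → ℂ) (s : Set X) : Prop :=
  ∃ f : X → ℂ, ContinuousOn f s ∧ ∀ x ∈ s, Complex.exp (f x) = g x

lemma HasLogOn.comp {g : X → ℂ} {s : Set X} (h : HasLogOn g s) {k : Y → X} {t : Set Y}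
    (hk : ContinuousOn k t) (hm : Set.MapsTo k t s) : HasLogOn (fun y => g (k y)) t :=
  let ⟨f, hf, he⟩ := h
  ⟨f ∘ k, hf.comp hk hm, fun _ hy => he _ (hm hy)⟩

lemma HasLogOn.congr {g g' : X → ℂ} {s : Set X} (h : HasLogOn g s) (hg : ∀ x ∈ s, g' x = g x) :
    HasLogOn g' s :=
  let ⟨f, hf, he⟩ := h
  ⟨f, hf, fun x hx => (he x hx).trans (hg x hx).symm⟩

lemma HasLogOn.mul {g g' : X → ℂ} {s : Set X} (h : HasLogOn g s) (h' : HasLogOn g' s) :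
    HasLogOn (fun x => g x * g' x) s :=
  let ⟨f, hf, he⟩ := h
  let ⟨f', hf', he'⟩ := h'
  ⟨fun x => f x + f' x, hf.add hf', fun x hx => by rw [Complex.exp_add, he x hx, he' x hx]⟩

lemma HasLogOn.zpow {g : X → ℂ} {s : Set X} (h : HasLogOn g s) (n : ℤ) :
    HasLogOn (fun x => g x ^ n) s :=
  let ⟨f, hf, he⟩ := h
  ⟨fun x => n * f x, continuousOn_const.mul hf, fun x hx => by
    rw [Complex.exp_int_mul, he x hx]⟩

/-- Two continuous logarithms on a preconnected space that agree at a point are equal. -/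
lemma eq_of_exp_eq [PreconnectedSpace X] {f f' : X → ℂ} (hf : Continuous f) (hf' : Continuous f')
    (he : ∀ x, Complex.exp (f x) = Complex.exp (f' x)) (x₀ : X) (h : f x₀ = f' x₀) : f = f' :=
  Complex.isCoveringMap_exp.eq_of_comp_eq hf hf' (funext fun x => Subtype.ext (he x)) x₀ h

/-- Composed with a contraction, `g` becomes homotopic to a constant, which has a logarithm; the
homotopy lifts through the covering map `exp`, and its end is a logarithm of `g`. -/
lemma hasLog_of_contractible [ContractibleSpace X] {g : X → ℂ} (hg : Continuous g)
    (h0 : ∀ x, g x ≠ 0) : ∃ f : X → ℂ, Continuous f ∧ ∀ x, Complex.exp (f x) = g x := by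
  obtain ⟨x₀, ⟨H⟩⟩ := (contractible_iff_id_nullhomotopic X).1 ‹_›
  let G : C(X, {z : ℂ // z ≠ 0}) := ⟨fun x => ⟨g x, h0 x⟩, by fun_prop⟩
  let F := G.comp H.symm.toContinuousMap
  let c : C(X, ℂ) := ContinuousMap.const X (Complex.log (g x₀))
  have hF0 : ∀ a, F (0, a) = (⟨Complex.exp (c a), (c a).exp_ne_zero⟩ : {z : ℂ // z ≠ 0}) := by
    intro a
    apply Subtype.ext
    simp [F, G, c, Complex.exp_log (h0 x₀)]
  refine ⟨fun x => Complex.isCoveringMap_exp.liftHomotopy F c hF0 (1, x), by fun_prop, fun x => ?_⟩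
  have h1 := congrArg Subtype.val
    (congrFun (Complex.isCoveringMap_exp.liftHomotopy_lifts F c hF0) (1, x))
  simp only [Function.comp_apply] at h1
  rw [h1]
  simp [F, G]

lemma hasLogOn_of_starConvex {E : Type*} [AddCommGroup E] [Module ℝ E] [TopologicalSpace E]
    [ContinuousAdd E] [ContinuousSMul ℝ E] {s : Set E} {x : E} (hs : StarConvex ℝ x s)
    {g : E → ℂ} (hg : ContinuousOn g s) (h0 : ∀ x ∈ s, g x ≠ 0) : HasLogOn g s := by
  classical
  rcases s.eq_empty_or_nonempty with rfl | hne
  · exact ⟨fun _ => 0, continuousOn_const, by simp⟩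
  have := hs.contractibleSpace hne
  obtain ⟨f, hf, he⟩ := hasLog_of_contractible (X := s) (g := fun x => g x)
    (continuousOn_iff_continuous_domRestrict.1 hg) (fun x => h0 x x.2)
  refine ⟨fun y => if h : y ∈ s then f ⟨y, h⟩ else 0, ?_, fun y hy => ?_⟩
  · rw [continuousOn_iff_continuous_domRestrict]
    convert hf using 1
    ext y
    simp [Set.domRestrict]
  · simp [hy, he]

/-- Along the circle a logarithm of `z ^ n` is forced to be `f r + n t i`, which changes by `2π n i`
after one turn. -/
lemma not_hasLogOn_zpow_sphere {r : ℝ} (hr : 0 < r) {n : ℤ} (hn : n ≠ 0) :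
    ¬ HasLogOn (fun z : ℂ => z ^ n) (Metric.sphere 0 r) := by
  rintro ⟨f, hf, he'⟩
  have he : ∀ z ∈ Metric.sphere (0 : ℂ) r, Complex.exp (f z) = z ^ n := he'
  have hm : ∀ t : ℝ, (r : ℂ) * Complex.exp (t * Complex.I) ∈ Metric.sphere (0 : ℂ) r := by
    intro t
    simp [Complex.norm_exp_ofReal_mul_I, abs_of_pos hr]
  have h1 : Continuous fun t : ℝ => f (r * Complex.exp (t * Complex.I)) :=
    hf.comp_continuous (by fun_prop) hm
  have h2 : Continuous fun t : ℝ => f r + n * (t * Complex.I) := by fun_prop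
  have hr' : (r : ℂ) ∈ Metric.sphere (0 : ℂ) r := by simpa using hm 0
  have h3 := eq_of_exp_eq h1 h2 (fun t => by
    rw [he _ (hm t), Complex.exp_add, he _ hr', mul_zpow, Complex.exp_int_mul]) 0 (by simp)
  have h4 := congrFun h3 (2 * Real.pi)
  simp only [Complex.ofReal_mul, Complex.ofReal_ofNat, Complex.exp_two_pi_mul_I, mul_one] at h4
  have h5 : (n : ℂ) * (2 * Real.pi * Complex.I) = 0 := by
    linear_combination -h4
  rcases mul_eq_zero.1 h5 with h6 | h6
  · exact hn (by exact_mod_cast h6)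
  · exact Complex.two_pi_I_ne_zero h6

/-- A nonvanishing function on a punctured disc is a power of `z` times an exponential. -/
lemma exists_hasLogOn_mul_zpow {r : ℝ} (hr : 0 < r) {g : ℂ → ℂ}
    (hg : ContinuousOn g (Metric.ball 0 r \ {0})) (h0 : ∀ z ∈ Metric.ball (0 : ℂ) r \ {0}, g z ≠ 0) :
    ∃ n : ℤ, HasLogOn (fun z => g z * z ^ n) (Metric.ball 0 r \ {0}) := by
  -- `exp` maps this half-plane onto the punctured disc, and convexity of `H` provides a logarithm
  -- `F` of the pulled back function.
  set H : Set ℂ := {w | w.re < Real.log r} with hH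
  have hmem : ∀ w, w ∈ H ↔ Complex.exp w ∈ Metric.ball (0 : ℂ) r \ {0} := by
    intro w
    simp only [hH, Set.mem_ofPred_eq, Set.mem_sdiff, mem_ball_zero_iff, Complex.norm_exp,
      Set.mem_singleton_iff, Complex.exp_ne_zero, not_false_eq_true, and_true]
    exact (Real.lt_log_iff_exp_lt hr)
  have hconv : Convex ℝ H := convex_halfSpace_re_lt _
  obtain ⟨w₀, hw₀⟩ : H.Nonempty := ⟨((Real.log r - 1 : ℝ) : ℂ), by simp [hH]⟩
  obtain ⟨F, hF, hFe'⟩ := hasLogOn_of_starConvex (hconv.starConvex hw₀) (g := fun w => g (Complex.exp w))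
    (hg.comp (by fun_prop) fun w hw => (hmem w).1 hw) (fun w hw => h0 _ ((hmem w).1 hw))
  have hFe : ∀ w ∈ H, Complex.exp (F w) = g (Complex.exp w) := hFe'
  have hper : ∀ w, w ∈ H → w + 2 * Real.pi * Complex.I ∈ H := by
    intro w hw
    rw [hmem] at hw ⊢
    rwa [Complex.exp_periodic w]
  have hpc : PreconnectedSpace H := Subtype.preconnectedSpace hconv.isPreconnected
  have hFc : Continuous fun w : H => F w := continuousOn_iff_continuous_domRestrict.1 hF
  have hFc' : Continuous fun w : H => F (w + 2 * Real.pi * Complex.I) :=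
    hF.comp_continuous (by fun_prop) fun w => hper w w.2
  -- Translation by `2πi` changes `F` by a constant multiple of `2πi`; the integer `n` is the
  -- winding number of `g`.
  obtain ⟨n, hn⟩ : ∃ n : ℤ, ∀ w ∈ H, F (w + 2 * Real.pi * Complex.I) = F w + n * (2 * Real.pi * Complex.I) := by
    have h1 : Complex.exp (F (w₀ + 2 * Real.pi * Complex.I) - F w₀) = 1 := by
      rw [Complex.exp_sub, hFe _ (hper _ hw₀), hFe _ hw₀, Complex.exp_periodic w₀]
      exact div_self (h0 _ ((hmem _).1 hw₀))
    obtain ⟨n, hn⟩ := Complex.exp_eq_one_iff.1 h1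
    refine ⟨n, fun w hw => ?_⟩
    have h2 := eq_of_exp_eq (f := fun w : H => F (w + 2 * Real.pi * Complex.I))
      (f' := fun w : H => F w + n * (2 * Real.pi * Complex.I)) hFc' (hFc.add continuous_const) (fun w => by
        rw [Complex.exp_add, Complex.exp_int_mul_two_pi_mul_I, mul_one, hFe _ (hper _ w.2),
          hFe _ w.2, Complex.exp_periodic w.1]) ⟨w₀, hw₀⟩ (by
        simp only
        linear_combination hn)
    exact congrFun h2 ⟨w, hw⟩
  -- The correction `n * w` makes `P` periodic, so it descends to the punctured disc as a logarithm
  -- of `g z * z ^ (-n)`.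
  set P : ℂ → ℂ := fun w => F w - n * w with hP
  have hPper : ∀ (k : ℕ) (w : ℂ), w ∈ H → P (w + k * (2 * Real.pi * Complex.I)) = P w ∧
      w + k * (2 * Real.pi * Complex.I) ∈ H := by
    intro k w hw
    induction k with
    | zero => simpa using hw
    | succ k ih =>
      have h1 := hn _ ih.2
      have e1 : w + ((k + 1 : ℕ) : ℂ) * (2 * Real.pi * Complex.I) =
          w + k * (2 * Real.pi * Complex.I) + 2 * Real.pi * Complex.I := by push_cast; ring
      rw [e1]
      refine ⟨?_, hper _ ih.2⟩
      rw [← ih.1]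
      simp only [hP]
      rw [h1]; ring
  have hPeq : ∀ w w', w ∈ H → w' ∈ H → Complex.exp w = Complex.exp w' → P w = P w' := by
    intro w w' hw hw' h
    obtain ⟨k, hk⟩ := Complex.exp_eq_exp_iff_exists_int.1 h
    rcases Int.eq_nat_or_neg k with ⟨m, rfl | rfl⟩
    · rw [hk]
      exact_mod_cast (hPper m w' hw').1
    · have : w' = w + m * (2 * Real.pi * Complex.I) := by rw [hk]; push_cast; ring
      rw [this, (hPper m w hw).1]
  have hlog : ∀ z ∈ Metric.ball (0 : ℂ) r \ {0}, Complex.log z ∈ H := fun z hz => by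
    rw [hmem, Complex.exp_log hz.2]; exact hz
  refine ⟨-n, fun z => P (Complex.log z), ?_, ?_⟩
  · intro z₀ hz₀
    -- The principal logarithm jumps across its cut. Near `z₀` it is replaced by the continuous
    -- branch `log (z / z₀) + log z₀`, which `P` does not distinguish from it.
    apply ContinuousWithinAt.congr (f := fun z => P (Complex.log (z / z₀) + Complex.log z₀))
    · have hH' : H ∈ 𝓝 (Complex.log z₀) :=
        (isOpen_lt Complex.continuous_re continuous_const).mem_nhds (hlog z₀ hz₀)
      have hPc : ContinuousAt P (Complex.log (z₀ / z₀) + Complex.log z₀) := by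
        rw [div_self hz₀.2, Complex.log_one, zero_add]
        exact (hF.continuousAt hH').sub (by fun_prop)
      have hl : ContinuousAt (fun z => Complex.log (z / z₀) + Complex.log z₀) z₀ := by
        refine ContinuousAt.add (ContinuousAt.clog (by fun_prop) ?_) continuousAt_const
        rw [div_self hz₀.2]
        exact Complex.one_mem_slitPlane
      exact (ContinuousAt.comp (f := fun z => Complex.log (z / z₀) + Complex.log z₀) hPc hl).continuousWithinAt
    · intro z hz
      have he : Complex.exp (Complex.log (z / z₀) + Complex.log z₀) = z := by
        rw [Complex.exp_add, Complex.exp_log hz₀.2, Complex.exp_log (div_ne_zero hz.2 hz₀.2),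
          div_mul_cancel₀ _ hz₀.2]
      refine hPeq _ _ (hlog z hz) ?_ ?_
      · rw [hmem, he]; exact hz
      · rw [he, Complex.exp_log hz.2]
    · refine hPeq _ _ (hlog z₀ hz₀) ?_ ?_
      · rw [div_self hz₀.2, Complex.log_one, zero_add]; exact hlog z₀ hz₀
      · rw [div_self hz₀.2, Complex.log_one, zero_add]
  · intro z hz
    simp only [hP]
    rw [Complex.exp_sub, hFe _ (hlog z hz), Complex.exp_int_mul, Complex.exp_log hz.2, zpow_neg,
      div_eq_mul_inv]

end Logarithms

/-! ### Punctured neighbourhoods in a surface. -/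

section LocalTopology

variable {X : Type*} [TopologicalSpace X]

lemma exists_planar_chart [ChartedSpace (EuclideanSpace ℝ (Fin 2)) X] (x : X) :
    ∃ e : OpenPartialHomeomorph X ℂ, x ∈ e.source ∧ e x = 0 := by
  let c := chartAt (EuclideanSpace ℝ (Fin 2)) x
  let φ : EuclideanSpace ℝ (Fin 2) ≃ₜ ℂ :=
    Complex.orthonormalBasisOneI.repr.symm.toHomeomorph
  let e := (c.trans φ.toOpenPartialHomeomorph).trans
    (Homeomorph.addRight (-(φ (c x)))).toOpenPartialHomeomorph
  refine ⟨e, ?_, ?_⟩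
  · simp [e, c]
  · simp [e]

/-- Small discs around a point in a planar chart. -/
lemma exists_chart_ball {e : OpenPartialHomeomorph X ℂ} {x : X} (hx : x ∈ e.source) (he : e x = 0)
    {N : Set X} (hN : N ∈ 𝓝 x) :
    ∃ r > 0, Metric.ball (0 : ℂ) r ⊆ e.target ∧ e.symm '' Metric.ball 0 r ⊆ N ∧
      e.symm '' Metric.ball 0 r ∈ 𝓝 x ∧
      e.symm '' (Metric.ball 0 r \ {0}) = e.symm '' Metric.ball 0 r \ {x} := by
  have hs : e.symm 0 = x := by rw [← he, e.left_inv hx]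
  have h0 : (0 : ℂ) ∈ e.target := he ▸ e.map_source hx
  have h1 : e.target ∩ e.symm ⁻¹' N ∈ 𝓝 (0 : ℂ) :=
    inter_mem (e.open_target.mem_nhds h0)
      ((e.continuousAt_symm h0).preimage_mem_nhds (by rwa [hs]))
  obtain ⟨r, hr, hsub⟩ := Metric.mem_nhds_iff.1 h1
  have hbt : Metric.ball (0 : ℂ) r ⊆ e.target := fun z hz => (hsub hz).1
  refine ⟨r, hr, hbt, ?_, ?_, ?_⟩
  · rintro _ ⟨z, hz, rfl⟩; exact (hsub hz).2
  · rw [← hs]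
    exact (e.symm.isOpen_image_of_subset_source Metric.isOpen_ball hbt).mem_nhds
      ⟨0, Metric.mem_ball_self hr, rfl⟩
  · rw [← hs]
    ext y
    constructor
    · rintro ⟨z, ⟨hz, hz0⟩, rfl⟩
      exact ⟨⟨z, hz, rfl⟩, fun h => hz0 (e.symm.injOn (hbt hz) h0 h)⟩
    · rintro ⟨⟨z, hz, rfl⟩, hy⟩
      exact ⟨z, ⟨hz, fun h => hy (by rw [Set.mem_singleton_iff.1 h]; rfl)⟩, rfl⟩

variable [ChartedSpace (EuclideanSpace ℝ (Fin 2)) X] (x : X)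

lemma exists_connected_punctured_nhd {N : Set X} (hN : N ∈ 𝓝 x) :
    ∃ W ∈ 𝓝 x, W ⊆ N ∧ IsConnected (W \ {x}) := by
  obtain ⟨e, hx, he⟩ := exists_planar_chart x
  obtain ⟨r, hr, hbt, hsub, hmem, himg⟩ := exists_chart_ball hx he hN
  refine ⟨_, hmem, hsub, ?_⟩
  rw [← himg]
  refine IsConnected.image ?_ _ (e.continuousOn_symm.mono (Set.sdiff_subset.trans hbt))
  refine ⟨⟨((r / 2 : ℝ) : ℂ), ?_, ?_⟩, ?_⟩
  · simp [abs_of_pos hr, hr]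
  · simp [hr.ne']
  · have h1 : Metric.ball (0 : ℂ) r \ {0} = Complex.exp '' {w | w.re < Real.log r} := by
      ext z
      simp only [Set.mem_sdiff, mem_ball_zero_iff, Set.mem_singleton_iff, Set.mem_image,
        Set.mem_ofPred_eq]
      constructor
      · rintro ⟨h1, h2⟩
        refine ⟨Complex.log z, ?_, Complex.exp_log h2⟩
        rw [Complex.log_re]
        exact Real.log_lt_log (norm_pos_iff.2 h2) h1
      · rintro ⟨w, hw, rfl⟩
        rw [Complex.norm_exp]
        exact ⟨(Real.lt_log_iff_exp_lt hr).1 hw, Complex.exp_ne_zero _⟩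
    rw [h1]
    exact (convex_halfSpace_re_lt _).isPreconnected.image _ (by fun_prop)

/-- Each function on the punctured disc has an integer winding number, and two integers satisfy a
nontrivial linear relation. This rank bound will exclude three triangles at an edge. -/
lemma exists_hasLogOn_punctured_nhd {N : Set X} (hN : N ∈ 𝓝 x) {g₁ g₂ : X → ℂ}
    (h₁ : ContinuousOn g₁ (N \ {x})) (h₂ : ContinuousOn g₂ (N \ {x}))
    (h₁' : ∀ y ∈ N \ {x}, g₁ y ≠ 0) (h₂' : ∀ y ∈ N \ {x}, g₂ y ≠ 0) :
    ∃ W ∈ 𝓝 x, W ⊆ N ∧ ∃ n₁ n₂ : ℤ, (n₁ ≠ 0 ∨ n₂ ≠ 0) ∧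
      HasLogOn (fun y => g₁ y ^ n₁ * g₂ y ^ n₂) (W \ {x}) := by
  obtain ⟨e, hx, he⟩ := exists_planar_chart x
  obtain ⟨r, hr, hbt, hsub, hmem, himg⟩ := exists_chart_ball hx he hN
  have hmaps : Set.MapsTo e.symm (Metric.ball 0 r \ {0}) (N \ {x}) := fun z hz =>
    Set.sdiff_subset_sdiff_left hsub (himg ▸ ⟨z, hz, rfl⟩)
  have hes : ContinuousOn e.symm (Metric.ball 0 r \ {0}) :=
    e.continuousOn_symm.mono (Set.sdiff_subset.trans hbt)
  obtain ⟨a₁, l₁⟩ := exists_hasLogOn_mul_zpow hr (h₁.comp hes hmaps) (fun z hz => h₁' _ (hmaps hz))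
  obtain ⟨a₂, l₂⟩ := exists_hasLogOn_mul_zpow hr (h₂.comp hes hmaps) (fun z hz => h₂' _ (hmaps hz))
  have hback : ∀ n₁ n₂ : ℤ, a₁ * n₁ + a₂ * n₂ = 0 →
      HasLogOn (fun y => g₁ y ^ n₁ * g₂ y ^ n₂) (e.symm '' Metric.ball 0 r \ {x}) := by
    intro n₁ n₂ hn
    have l := (l₁.zpow n₁).mul (l₂.zpow n₂)
    have hle : Set.MapsTo e (e.symm '' Metric.ball 0 r \ {x}) (Metric.ball 0 r \ {0}) := by
      rw [← himg]
      rintro _ ⟨z, hz, rfl⟩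
      rw [e.right_inv (hbt hz.1)]
      exact hz
    refine (l.comp (e.continuousOn.mono ?_) hle).congr ?_
    · rintro _ ⟨⟨z, hz, rfl⟩, -⟩
      exact e.map_target (hbt hz)
    · rw [← himg]
      rintro _ ⟨z, hz, rfl⟩
      simp only [Function.comp_apply]
      rw [e.right_inv (hbt hz.1), mul_zpow, mul_zpow, ← zpow_mul, ← zpow_mul]
      have : z ^ (a₁ * n₁) * z ^ (a₂ * n₂) = 1 := by
        rw [← zpow_add₀ hz.2, hn, zpow_zero]
      linear_combination (-(g₁ (e.symm z) ^ n₁ * g₂ (e.symm z) ^ n₂)) * this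
  refine ⟨_, hmem, hsub, ?_⟩
  by_cases ha : a₁ = 0
  · exact ⟨1, 0, Or.inl one_ne_zero, hback 1 0 (by simp [ha])⟩
  · exact ⟨a₂, -a₁, Or.inr (neg_ne_zero.2 ha), hback a₂ (-a₁) (by ring)⟩

/-- The chart itself serves as `g`: it winds once around `0` on small circles inside every smaller
punctured neighbourhood. This will exclude boundary points. -/
lemma exists_not_hasLogOn_punctured_nhd {N : Set X} (hN : N ∈ 𝓝 x) :
    ∃ W ∈ 𝓝 x, W ⊆ N ∧ ∃ g : X → ℂ, ContinuousOn g (W \ {x}) ∧ (∀ y ∈ W \ {x}, g y ≠ 0) ∧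
      ∀ V ∈ 𝓝 x, V ⊆ W → ¬ HasLogOn g (V \ {x}) := by
  obtain ⟨e, hx, he⟩ := exists_planar_chart x
  obtain ⟨r, hr, hbt, hsub, hmem, himg⟩ := exists_chart_ball hx he hN
  have hsrc : e.symm '' Metric.ball 0 r \ {x} ⊆ e.source := by
    rintro _ ⟨⟨z, hz, rfl⟩, -⟩
    exact e.map_target (hbt hz)
  refine ⟨_, hmem, hsub, e, e.continuousOn.mono hsrc, ?_, ?_⟩
  · intro y hy h
    exact hy.2 (e.injOn (hsrc hy) hx (h.trans he.symm))
  · intro V hV hVW hlog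
    obtain ⟨ρ, hρ, hbt', hsub', -, himg'⟩ := exists_chart_ball hx he hV
    have hsph : Metric.sphere (0 : ℂ) (ρ / 2) ⊆ Metric.ball 0 ρ \ {0} := by
      intro z hz
      rw [mem_sphere_zero_iff_norm] at hz
      refine ⟨?_, ?_⟩
      · rw [mem_ball_zero_iff, hz]; linarith
      · rintro rfl; simp at hz; linarith
    have hl := hlog.comp (k := e.symm) (t := Metric.sphere 0 (ρ / 2))
      (e.continuousOn_symm.mono (hsph.trans (Set.sdiff_subset.trans hbt')))
      (fun z hz => Set.sdiff_subset_sdiff_left hsub' (himg' ▸ ⟨z, hsph hz, rfl⟩))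
    refine not_hasLogOn_zpow_sphere (half_pos hρ) one_ne_zero (hl.congr fun z hz => ?_)
    rw [e.right_inv (hbt' (hsph hz).1), zpow_one]

end LocalTopology

/-! ### The same facts for a surface inside an ambient space. -/

section SubspaceLocalTopology

variable {E : Type*} [TopologicalSpace E] {A : Set E}

lemma hasLogOn_image_val {g : A → ℂ} {s : Set A} (h : HasLogOn g s) {G : E → ℂ}
    (hG : ∀ x : A, G x = g x) : HasLogOn G (Subtype.val '' s) := by
  classical
  obtain ⟨f, hf, he⟩ := h
  refine ⟨fun y => if hy : y ∈ A then f ⟨y, hy⟩ else 0, ?_, ?_⟩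
  · rw [Topology.IsEmbedding.subtypeVal.continuousOn_image_iff]
    convert hf using 1
    ext y
    simp
  · rintro _ ⟨x, hx, rfl⟩
    simp [he x hx, hG]

lemma preimage_val_sdiff {N : Set E} (x : A) :
    (Subtype.val ⁻¹' N : Set A) \ {x} = Subtype.val ⁻¹' (N \ {(x : E)}) := by
  ext y
  simp [Subtype.ext_iff]

lemma image_val_sdiff {W : Set A} (x : A) :
    Subtype.val '' (W \ {x}) = Subtype.val '' W \ {(x : E)} := by
  rw [Set.image_sdiff Subtype.val_injective, Set.image_singleton]

lemma image_val_mem_nhdsWithin {W : Set A} {x : A} (hW : W ∈ 𝓝 x) :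
    Subtype.val '' W ∈ 𝓝[A] (x : E) := by
  rwa [← mem_nhds_subtype_iff_nhdsWithin]

lemma exists_connected_punctured_nhdsWithin
    (hA : Nonempty (ChartedSpace (EuclideanSpace ℝ (Fin 2)) A)) {x : E} (hx : x ∈ A) {N : Set E}
    (hN : N ∈ 𝓝[A] x) :
    ∃ W ∈ 𝓝[A] x, W ⊆ N ∧ W ⊆ A ∧ IsConnected (W \ {x}) := by
  obtain ⟨hA⟩ := hA
  obtain ⟨W, hW, hWN, hc⟩ :=
    exists_connected_punctured_nhd (⟨x, hx⟩ : A) (preimage_coe_mem_nhds_subtype.2 hN)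
  refine ⟨Subtype.val '' W, image_val_mem_nhdsWithin hW, by simpa using hWN, by simp, ?_⟩
  rw [← image_val_sdiff ⟨x, hx⟩]
  exact hc.image _ continuous_subtype_val.continuousOn

lemma exists_hasLogOn_punctured_nhdsWithin
    (hA : Nonempty (ChartedSpace (EuclideanSpace ℝ (Fin 2)) A)) {x : E} (hx : x ∈ A) {N : Set E}
    (hN : N ∈ 𝓝[A] x) {g₁ g₂ : E → ℂ}
    (h₁ : ContinuousOn g₁ (N \ {x})) (h₂ : ContinuousOn g₂ (N \ {x}))
    (h₁' : ∀ y ∈ N \ {x}, g₁ y ≠ 0) (h₂' : ∀ y ∈ N \ {x}, g₂ y ≠ 0) :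
    ∃ W ∈ 𝓝[A] x, ∃ n₁ n₂ : ℤ, (n₁ ≠ 0 ∨ n₂ ≠ 0) ∧
      HasLogOn (fun y => g₁ y ^ n₁ * g₂ y ^ n₂) (W \ {x}) := by
  obtain ⟨hA⟩ := hA
  have hm : Set.MapsTo (Subtype.val : A → E) (Subtype.val ⁻¹' N \ {⟨x, hx⟩}) (N \ {x}) := by
    rw [preimage_val_sdiff]; exact fun y hy => hy
  obtain ⟨W, hW, -, n₁, n₂, hn, hl⟩ :=
    exists_hasLogOn_punctured_nhd (⟨x, hx⟩ : A) (preimage_coe_mem_nhds_subtype.2 hN)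
      (h₁.comp continuous_subtype_val.continuousOn hm)
      (h₂.comp continuous_subtype_val.continuousOn hm)
      (fun y hy => h₁' _ (hm hy)) (fun y hy => h₂' _ (hm hy))
  refine ⟨Subtype.val '' W, image_val_mem_nhdsWithin hW, n₁, n₂, hn, ?_⟩
  rw [← image_val_sdiff ⟨x, hx⟩]
  exact hasLogOn_image_val hl fun _ => rfl

lemma exists_not_hasLogOn_punctured_nhdsWithin
    (hA : Nonempty (ChartedSpace (EuclideanSpace ℝ (Fin 2)) A)) {x : E} (hx : x ∈ A) {N : Set E}
    (hN : N ∈ 𝓝[A] x) :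
    ∃ W ∈ 𝓝[A] x, W ⊆ N ∧ ∃ g : E → ℂ, ContinuousOn g (W \ {x}) ∧ (∀ y ∈ W \ {x}, g y ≠ 0) ∧
      ∀ V ∈ 𝓝[A] x, V ⊆ W → ¬ HasLogOn g (V \ {x}) := by
  classical
  obtain ⟨hA⟩ := hA
  obtain ⟨W, hW, hWN, g, hg, hg0, hV⟩ :=
    exists_not_hasLogOn_punctured_nhd (⟨x, hx⟩ : A) (preimage_coe_mem_nhds_subtype.2 hN)
  refine ⟨Subtype.val '' W, image_val_mem_nhdsWithin hW, by simpa using hWN,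
    fun y => if hy : y ∈ A then g ⟨y, hy⟩ else 0, ?_, ?_, ?_⟩
  · rw [← image_val_sdiff ⟨x, hx⟩, Topology.IsEmbedding.subtypeVal.continuousOn_image_iff]
    convert hg using 1
    ext y
    simp
  · rw [← image_val_sdiff ⟨x, hx⟩]
    rintro _ ⟨y, hy, rfl⟩
    simpa using hg0 y hy
  · intro V hVn hVW hl
    refine hV (Subtype.val ⁻¹' V) (preimage_coe_mem_nhds_subtype.2 hVn) ?_ ?_
    · intro y hy
      obtain ⟨z, hz, hzy⟩ := hVW hy
      rwa [← Subtype.ext hzy]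
    · rw [preimage_val_sdiff]
      exact (hl.comp continuous_subtype_val.continuousOn fun y hy => hy).congr fun y _ => by simp

end SubspaceLocalTopology

/-! ### Piecewise linear functions and open stars. -/

section PiecewiseLinear

variable {E : Type*} [NormedAddCommGroup E] [NormedSpace ℝ E] [DecidableEq E]
  {K : SimplicialComplex ℝ E}

namespace Geometry.SimplicialComplex

lemma vertices_finite (hK : K.faces.Finite) : K.vertices.Finite :=
  hK.preimage (f := fun x => ({x} : Finset E)) Finset.singleton_injective.injOn

/-- The piecewise linear extension of a function on vertices. -/
noncomputable def plExtend (K : SimplicialComplex ℝ E) (g : E → ℝ) (y : E) : ℝ :=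
  Finsupp.linearCombination ℝ g (K.coord y)

lemma support_coord_subset_vertices (y : E) : ((K.coord y).support : Set E) ⊆ K.vertices := by
  by_cases h : ∃ w, IsFaceWeight K.faces w ∧ weightBarycenter w = y
  · obtain ⟨w, hw, rfl⟩ := h
    rw [coord_eq hw]
    exact fun v hv => mem_vertices_of_mem_face hw.support_mem hv
  · rw [coord, dif_neg h]; simp

lemma continuousOn_plExtend (hK : K.faces.Finite) (g : E → ℝ) :
    ContinuousOn (K.plExtend g) K.space := by
  have h : K.plExtend g = fun y => ∑ v ∈ (vertices_finite hK).toFinset, K.coord y v * g v := by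
    ext y
    rw [plExtend, Finsupp.linearCombination_apply,
      Finsupp.sum_of_support_subset (s := (vertices_finite hK).toFinset)]
    · simp
    · intro v hv
      simpa using support_coord_subset_vertices y hv
    · simp
  rw [h]
  exact continuousOn_finsetSum _ fun v _ => (continuousOn_coord hK v).mul continuousOn_const

lemma coord_combo {s : Finset E} (hs : s ∈ K.faces) {y z : E} (hy : y ∈ convexHull ℝ (s : Set E))
    (hz : z ∈ convexHull ℝ (s : Set E)) {α β : ℝ} (hα : 0 ≤ α) (hβ : 0 ≤ β) (h : α + β = 1) :
    K.coord (α • y + β • z) = α • K.coord y + β • K.coord z := by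
  obtain ⟨w, hw, rfl, hws⟩ := exists_weight_of_mem_convexHull hs hy
  obtain ⟨w', hw', rfl, hws'⟩ := exists_weight_of_mem_convexHull hs hz
  rw [coord_eq hw, coord_eq hw', ← map_smul, ← map_smul, ← map_add]
  have ht : weightTotal (α • w + β • w') = 1 := by
    rw [map_add, map_smul, map_smul, hw.total, hw'.total]; simpa using h
  refine coord_eq ⟨fun x => ?_, K.down_closed hs ?_ (weight_support_nonempty ht), ht⟩
  · have := hw.nonneg x
    have := hw'.nonneg x
    simp only [Finsupp.add_apply, Finsupp.smul_apply, smul_eq_mul]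
    positivity
  · exact Finsupp.support_add.trans (Finset.union_subset (Finsupp.support_smul.trans hws)
      (Finsupp.support_smul.trans hws'))

lemma coord_triangle {a b c : E} (h : ({a, b, c} : Finset E) ∈ K.faces) {α β γ : ℝ} (hα : 0 ≤ α)
    (hβ : 0 ≤ β) (hγ : 0 ≤ γ) (hs : α + β + γ = 1) :
    K.coord (α • a + β • b + γ • c) =
      Finsupp.single a α + Finsupp.single b β + Finsupp.single c γ := by
  have hsum : weightTotal (Finsupp.single a α + Finsupp.single b β + Finsupp.single c γ) = 1 := by
    simp only [map_add, weightTotal_single, hs]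
  have hw : IsFaceWeight K.faces
      (Finsupp.single a α + Finsupp.single b β + Finsupp.single c γ) := by
    refine ⟨fun x => ?_, K.down_closed h ?_ (weight_support_nonempty hsum), hsum⟩
    · simp only [Finsupp.add_apply, Finsupp.single_apply]
      split_ifs <;> positivity
    · refine Finsupp.support_add.trans (Finset.union_subset (Finsupp.support_add.trans
        (Finset.union_subset ?_ ?_)) ?_)
      all_goals exact Finsupp.support_single_subset.trans (by simp)
  rw [← coord_eq hw]
  simp only [map_add, weightBarycenter_single]

lemma combo_mem_convexHull {a b c : E} {α β γ : ℝ}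
    (hα : 0 ≤ α) (hβ : 0 ≤ β) (hγ : 0 ≤ γ) (hs : α + β + γ = 1) :
    α • a + β • b + γ • c ∈ convexHull ℝ ((({a, b, c} : Finset E)) : Set E) := by
  have h1 := mem_convexHull_iff_weight (s := ({a, b, c} : Finset E)) (y := α • a + β • b + γ • c)
  refine h1.2 ⟨Finsupp.single a α + Finsupp.single b β + Finsupp.single c γ, fun x => ?_, ?_, ?_, ?_⟩
  · simp only [Finsupp.add_apply, Finsupp.single_apply]
    split_ifs <;> positivity
  · refine Finsupp.support_add.trans (Finset.union_subset (Finsupp.support_add.trans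
      (Finset.union_subset ?_ ?_)) ?_)
    all_goals exact Finsupp.support_single_subset.trans (by simp)
  · simp only [map_add, weightTotal_single, hs]
  · simp only [map_add, weightBarycenter_single]

lemma plExtend_triangle {a b c : E} (h : ({a, b, c} : Finset E) ∈ K.faces) {α β γ : ℝ}
    (hα : 0 ≤ α) (hβ : 0 ≤ β) (hγ : 0 ≤ γ) (hs : α + β + γ = 1) (g : E → ℝ) :
    K.plExtend g (α • a + β • b + γ • c) = α * g a + β * g b + γ * g c := by
  rw [plExtend, coord_triangle h hα hβ hγ hs]
  simp

/-- The open star of a face. -/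
def openStar (K : SimplicialComplex ℝ E) (s : Finset E) : Set E :=
  {y | y ∈ K.space ∧ ∀ v ∈ s, 0 < K.coord y v}

lemma openStar_mem_nhdsWithin (hK : K.faces.Finite) {s : Finset E} {x : E}
    (hx : x ∈ K.openStar s) : K.openStar s ∈ 𝓝[K.space] x := by
  have h1 : ∀ v ∈ s, ∀ᶠ y in 𝓝[K.space] x, 0 < K.coord y v := fun v hv =>
    (continuousOn_coord hK v x hx.1).eventually_const_lt (hx.2 v hv)
  filter_upwards [self_mem_nhdsWithin, (Finset.eventually_all s).2 h1] with y hy hy'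
  exact ⟨hy, hy'⟩

lemma support_of_mem_openStar {s : Finset E} {y : E} (hy : y ∈ K.openStar s) :
    s ⊆ (K.coord y).support := fun v hv => Finsupp.mem_support_iff.2 (hy.2 v hv).ne'

lemma mem_openStar_vertex {v : E} (hv : v ∈ K.vertices) : v ∈ K.openStar {v} := by
  refine ⟨K.subset_space hv (by simp), fun u hu => ?_⟩
  rw [Finset.mem_singleton.1 hu, coord_vertex hv]
  simp

/-- A point in the open star of an edge lies in the open edge or in a triangle at the edge. -/
lemma eq_combo_of_mem_openStar_edge (hcard : ∀ s ∈ K.faces, s.card ≤ 3) {a b : E} (hab : a ≠ b)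
    {y : E} (hy : y ∈ K.openStar {a, b}) :
    (∃ α β : ℝ, 0 < α ∧ 0 < β ∧ α + β = 1 ∧ y = α • a + β • b) ∨
      ∃ c, c ≠ a ∧ c ≠ b ∧ ({a, b, c} : Finset E) ∈ K.faces ∧ ∃ α β γ : ℝ, 0 < α ∧ 0 < β ∧ 0 < γ ∧
        α + β + γ = 1 ∧ y = α • a + β • b + γ • c := by
  obtain ⟨hw, hb⟩ := coord_spec hy.1
  have hsub := support_of_mem_openStar hy
  have hα := hy.2 a (by simp)
  have hβ := hy.2 b (by simp)
  have htot := weightTotal_eq_sum (w := K.coord y) subset_rfl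
  have hbar := weightBarycenter_eq_sum (w := K.coord y) subset_rfl
  rw [hw.total] at htot
  rw [hb] at hbar
  by_cases heq : (K.coord y).support = {a, b}
  · left
    rw [heq, Finset.sum_pair hab] at htot hbar
    exact ⟨_, _, hα, hβ, htot.symm, hbar⟩
  · right
    have hss : ({a, b} : Finset E) ⊂ (K.coord y).support :=
      Finset.ssubset_iff_subset_ne.2 ⟨hsub, Ne.symm heq⟩
    obtain ⟨c, hc, hcn⟩ := Finset.exists_of_ssubset hss
    simp only [Finset.mem_insert, Finset.mem_singleton, not_or] at hcn
    change c ≠ a ∧ c ≠ b at hcn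
    have h3 : ({a, b, c} : Finset E) = (K.coord y).support := by
      apply Finset.eq_of_subset_of_card_le
      · intro z hz
        simp only [Finset.mem_insert, Finset.mem_singleton] at hz
        rcases hz with rfl | rfl | rfl
        · exact hsub (by simp)
        · exact hsub (by simp)
        · exact hc
      · rw [Finset.card_eq_three.2 ⟨a, b, c, hab, hcn.1.symm, hcn.2.symm, rfl⟩]
        exact hcard _ hw.support_mem
    rw [← h3, Finset.sum_insert (by simp [hab, hcn.1.symm]), Finset.sum_pair hcn.2.symm] at htot hbar
    refine ⟨c, hcn.1, hcn.2, h3 ▸ hw.support_mem, _, _, _, hα, hβ, ?_, by rw [add_assoc]; exact htot.symm, ?_⟩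
    · exact (coord_nonneg y c).lt_of_ne (Finsupp.mem_support_iff.1 hc).symm
    · rw [add_assoc]; exact hbar

end Geometry.SimplicialComplex

lemma exists_mem_of_mem_nhdsWithin {A W : Set E} {x : E} (hW : W ∈ 𝓝[A] x) {σ : ℝ → E}
    (hσ : Continuous σ) (h0 : σ 0 = x) (hA : ∀ t, 0 < t → t < 1 → σ t ∈ A) :
    ∃ t, 0 < t ∧ t < 1 ∧ σ t ∈ W := by
  have h1 : Tendsto σ (𝓝[>] 0) (𝓝[A] x) := by
    refine tendsto_nhdsWithin_iff.2 ⟨?_, ?_⟩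
    · rw [← h0]; exact hσ.continuousWithinAt
    · filter_upwards [Ioo_mem_nhdsGT (zero_lt_one' ℝ)] with t ht using hA t ht.1 ht.2
  obtain ⟨t, ht, ht'⟩ := ((h1.eventually hW).and (Ioo_mem_nhdsGT (zero_lt_one' ℝ))).exists
  exact ⟨t, ht'.1, ht'.2, ht⟩

end PiecewiseLinear

/-! ### Links in surfaces: connected, with two triangles at each edge. -/

section SurfaceLinks

variable {n : ℕ} {K : EuclideanComplex n}

local notation "𝔼" => EuclideanSpace ℝ (Fin n)

lemma plExtend_edge {a b : 𝔼} (h : ({a, b} : Finset 𝔼) ∈ K.faces) {α β : ℝ} (hα : 0 ≤ α)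
    (hβ : 0 ≤ β) (hs : α + β = 1) (g : 𝔼 → ℝ) :
    K.plExtend g (α • a + β • b) = α * g a + β * g b := by
  have := SimplicialComplex.plExtend_triangle (K := K) (a := a) (b := b) (c := b) (by simpa using h)
    hα hβ le_rfl (by simpa using hs) g
  simpa using this

lemma edge_combo_mem_space {a b : 𝔼} (h : ({a, b} : Finset 𝔼) ∈ K.faces) {α β : ℝ} (hα : 0 ≤ α)
    (hβ : 0 ≤ β) (hs : α + β = 1) : α • a + β • b ∈ K.space := by
  refine SimplicialComplex.convexHull_subset_space h ?_
  rw [Finset.coe_pair, convexHull_pair]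
  exact ⟨α, β, hα, hβ, hs, rfl⟩

lemma pair_mem_of_mem_face {s : Finset 𝔼} (hs : s ∈ K.faces) {u v : 𝔼} (hu : u ∈ s) (hv : v ∈ s) :
    ({u, v} : Finset 𝔼) ∈ K.faces :=
  K.down_closed hs (by simp [Finset.insert_subset_iff, hu, hv]) (by simp)

lemma triple_mem_of_mem_face {s : Finset 𝔼} (hs : s ∈ K.faces) {u v w : 𝔼} (hu : u ∈ s)
    (hv : v ∈ s) (hw : w ∈ s) : ({u, v, w} : Finset 𝔼) ∈ K.faces :=
  K.down_closed hs (by simp [Finset.insert_subset_iff, hu, hv, hw]) (by simp)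

lemma exists_ne_of_mem_openStar_vertex {v y : 𝔼} (hy : y ∈ K.openStar {v}) (hne : y ≠ v) :
    ∃ u ∈ (K.coord y).support, u ≠ v := by
  by_contra! h
  obtain ⟨hw, hb⟩ := SimplicialComplex.coord_spec hy.1
  have hs : (K.coord y).support = {v} := by
    apply Finset.Subset.antisymm
    · intro u hu; simp [h u hu]
    · exact SimplicialComplex.support_of_mem_openStar hy
  have htot := weightTotal_eq_sum hs.subset
  have hbar := weightBarycenter_eq_sum hs.subset
  rw [hw.total, Finset.sum_singleton] at htot
  rw [hb, Finset.sum_singleton, ← htot, one_smul] at hbar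
  exact hne hbar

/-- Connected sets are nonempty, so the open star of `v` contains a point other than `v`; its
carrier has a second vertex. -/
lemma IsSimplicialSurface.exists_edge (hK : IsSimplicialSurface K) {v : 𝔼} (hv : v ∈ K.vertices) :
    ∃ u, u ≠ v ∧ ({v, u} : Finset 𝔼) ∈ K.faces := by
  have hvs := SimplicialComplex.mem_openStar_vertex hv
  obtain ⟨W, -, hWN, -, hc⟩ := exists_connected_punctured_nhdsWithin hK.locally_euclidean hvs.1
    (SimplicialComplex.openStar_mem_nhdsWithin hK.finite_faces hvs)
  obtain ⟨y, hy, hyv⟩ := hc.nonempty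
  obtain ⟨u, hu, huv⟩ := exists_ne_of_mem_openStar_vertex (hWN hy) hyv
  exact ⟨u, huv, pair_mem_of_mem_face (SimplicialComplex.coord_spec (hWN hy).1).1.support_mem
    (SimplicialComplex.support_of_mem_openStar (hWN hy) (by simp)) hu⟩

lemma IsPreconnected.not_sign_change {X : Type*} [TopologicalSpace X] {s : Set X}
    (hs : IsPreconnected s) {f : X → ℝ} (hf : ContinuousOn f s) (h0 : ∀ x ∈ s, f x ≠ 0) {x y : X}
    (hx : x ∈ s) (hy : y ∈ s) (hfx : f x < 0) (hfy : 0 < f y) : False := by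
  obtain ⟨z, hz, hz0⟩ := hs.intermediate_value hx hy hf ⟨hfx.le, hfy.le⟩
  exact h0 z hz hz0

/-- The link of a vertex of a surface is connected. -/
lemma IsSimplicialSurface.link_connected (hK : IsSimplicialSurface K) {v : 𝔼} {P : Set 𝔼}
    {u₁ : 𝔼} (hu₁ : u₁ ≠ v) (hu₁f : ({v, u₁} : Finset 𝔼) ∈ K.faces) (hu₁P : u₁ ∈ P)
    (hP : ∀ u ∈ P, ∀ u', u' ≠ v → u ≠ v → ({v, u, u'} : Finset 𝔼) ∈ K.faces → u' ∈ P) {u : 𝔼}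
    (hu : u ≠ v) (huf : ({v, u} : Finset 𝔼) ∈ K.faces) : u ∈ P := by
  classical
  by_contra huP
  have hv : v ∈ K.vertices := SimplicialComplex.mem_vertices_of_mem_face huf (by simp)
  have hvs := SimplicialComplex.mem_openStar_vertex hv
  obtain ⟨W, hW, hWN, hWA, hc⟩ := exists_connected_punctured_nhdsWithin hK.locally_euclidean hvs.1
    (SimplicialComplex.openStar_mem_nhdsWithin hK.finite_faces hvs)
  -- No face at `v` has link vertices both inside and outside `P`. Hence the piecewise linear
  -- extension of `ε` has no zero on the punctured star, yet it takes both signs if `u ∉ P`, against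
  -- connectedness.
  let ε : 𝔼 → ℝ := fun z => if z = v then 0 else if z ∈ P then 1 else -1
  have hseg : ∀ u', u' ≠ v → ({v, u'} : Finset 𝔼) ∈ K.faces → ∃ t : ℝ, 0 < t ∧
      (1 - t) • v + t • u' ∈ W \ {v} ∧ K.plExtend ε ((1 - t) • v + t • u') = t * ε u' := by
    intro u' hu' hf
    obtain ⟨t, ht0, ht1, htW⟩ := exists_mem_of_mem_nhdsWithin hW
      (σ := fun t => (1 - t) • v + t • u') (by fun_prop) (by simp)
      (fun t h0 h1 => edge_combo_mem_space hf (by linarith) h0.le (by ring))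
    refine ⟨t, ht0, ⟨htW, fun h => ?_⟩, ?_⟩
    · have h1 : t • (u' - v) = 0 := by
        have : (1 - t) • v + t • u' = v + t • (u' - v) := by module
        rw [Set.mem_singleton_iff, this] at h
        simpa using h
      rcases smul_eq_zero.1 h1 with h2 | h2
      · linarith
      · exact hu' (sub_eq_zero.1 h2)
    · rw [plExtend_edge hf (by linarith) ht0.le (by ring)]
      simp [ε]
  obtain ⟨t₁, h1, h2, h3⟩ := hseg u₁ hu₁ hu₁f
  obtain ⟨t, h1', h2', h3'⟩ := hseg u hu huf
  refine hc.isPreconnected.not_sign_change (f := K.plExtend ε)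
    ((SimplicialComplex.continuousOn_plExtend hK.finite_faces ε).mono
      (Set.sdiff_subset.trans hWA)) ?_ h2' h2 ?_ ?_
  · intro y hy h0
    have hys := hWN hy.1
    obtain ⟨w, hw, hwv⟩ := exists_ne_of_mem_openStar_vertex hys hy.2
    have hvsup := SimplicialComplex.support_of_mem_openStar hys (Finset.mem_singleton_self v)
    have hface := (SimplicialComplex.coord_spec hys.1).1.support_mem
    have hcw : 0 < K.coord y w :=
      (SimplicialComplex.coord_nonneg y w).lt_of_ne (Finsupp.mem_support_iff.1 hw).symm
    rw [SimplicialComplex.plExtend, Finsupp.linearCombination_apply, Finsupp.sum] at h0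
    by_cases hwP : w ∈ P
    · have : 0 < ∑ z ∈ (K.coord y).support, K.coord y z • ε z := by
        refine Finset.sum_pos' (fun z hz => ?_) ⟨w, hw, ?_⟩
        · by_cases hzv : z = v
          · simp [ε, hzv]
          · have := hP w hwP z hzv hwv (triple_mem_of_mem_face hface hvsup hw hz)
            simp [ε, hzv, this, SimplicialComplex.coord_nonneg]
        · simpa [ε, hwv, hwP] using hcw
      linarith
    · have : ∑ z ∈ (K.coord y).support, K.coord y z • ε z < 0 := by
        refine Finset.sum_neg' (fun z hz => ?_) ⟨w, hw, ?_⟩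
        · by_cases hzv : z = v
          · simp [ε, hzv]
          · have : z ∉ P := fun h =>
              hwP (hP z h w hwv hzv (triple_mem_of_mem_face hface hvsup hz hw))
            simp [ε, hzv, this, SimplicialComplex.coord_nonneg]
        · simpa [ε, hwv, hwP] using hcw
      linarith
  · rw [h3']; simpa [ε, hu, huP] using h1'
  · rw [h3]; simpa [ε, hu₁, hu₁P] using h1

/-- The difference of the barycentric coordinates of `a` and `b`, on vertices. -/
noncomputable def vertexDifference (a b : 𝔼) (z : 𝔼) : ℝ :=
  if z = a then 1 else if z = b then -1 else 0

lemma midpoint_mem_openStar {a b : 𝔼} (hab : a ≠ b) (h : ({a, b} : Finset 𝔼) ∈ K.faces) :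
    (1 / 2 : ℝ) • a + (1 / 2 : ℝ) • b ∈ K.openStar {a, b} := by
  refine ⟨edge_combo_mem_space h (by norm_num) (by norm_num) (by norm_num), fun v hv => ?_⟩
  have := SimplicialComplex.coord_triangle (K := K) (a := a) (b := b) (c := b) (by simpa using h)
    (α := 1 / 2) (β := 1 / 2) (γ := 0) (by norm_num) (by norm_num) le_rfl (by norm_num)
  simp only [zero_smul, add_zero] at this
  rw [this]
  simp only [Finset.mem_insert, Finset.mem_singleton] at hv
  rcases hv with rfl | rfl <;> simp [hab, hab.symm]

/-- Near the midpoint of an edge without triangles the space is an open segment, which a point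
disconnects; the difference of the coordinates at `a` and `b` detects the two sides. -/
lemma IsSimplicialSurface.exists_triangle_of_edge (hK : IsSimplicialSurface K) {a b : 𝔼}
    (hab : a ≠ b) (h : ({a, b} : Finset 𝔼) ∈ K.faces) :
    ∃ c, c ≠ a ∧ c ≠ b ∧ ({a, b, c} : Finset 𝔼) ∈ K.faces := by
  by_contra! hno
  have hx := midpoint_mem_openStar hab h
  set x : 𝔼 := (1 / 2 : ℝ) • a + (1 / 2 : ℝ) • b with hxdef
  obtain ⟨W, hW, hWN, hWA, hc⟩ := exists_connected_punctured_nhdsWithin hK.locally_euclidean hx.1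
    (SimplicialComplex.openStar_mem_nhdsWithin hK.finite_faces hx)
  have hform : ∀ y ∈ K.openStar {a, b}, ∃ α β : ℝ, 0 < α ∧ 0 < β ∧ α + β = 1 ∧
      y = α • a + β • b := by
    intro y hy
    rcases SimplicialComplex.eq_combo_of_mem_openStar_edge hK.card_le_three hab hy with h1 | h1
    · exact h1
    · obtain ⟨c, hca, hcb, hf, -⟩ := h1
      exact absurd hf (hno c hca hcb)
  have hpl : ∀ α β : ℝ, 0 < α → 0 < β → α + β = 1 →
      K.plExtend (vertexDifference a b) (α • a + β • b) = α - β := by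
    intro α β hα hβ hs
    rw [plExtend_edge h hα.le hβ.le hs]
    simp [vertexDifference, hab.symm]; ring
  have hseg : ∀ δ : ℝ, δ = 1 ∨ δ = -1 → ∃ t : ℝ, 0 < t ∧
      ∃ y ∈ W \ {x}, K.plExtend (vertexDifference a b) y = δ * t := by
    intro δ hδ
    obtain ⟨t, ht0, ht1, htW⟩ := exists_mem_of_mem_nhdsWithin hW
      (σ := fun t => ((1 + δ * t) / 2) • a + ((1 - δ * t) / 2) • b) (by fun_prop)
      (by simp [hxdef]) (fun t h0 h1 => edge_combo_mem_space h
        (by rcases hδ with rfl | rfl <;> linarith) (by rcases hδ with rfl | rfl <;> linarith)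
        (by ring))
    have hval := hpl ((1 + δ * t) / 2) ((1 - δ * t) / 2)
      (by rcases hδ with rfl | rfl <;> linarith) (by rcases hδ with rfl | rfl <;> linarith) (by ring)
    refine ⟨t, ht0, _, ⟨htW, fun hx' => ?_⟩, by rw [hval]; ring⟩
    have h0 := hpl (1 / 2) (1 / 2) (by norm_num) (by norm_num) (by norm_num)
    rw [Set.mem_singleton_iff.1 hx', hxdef, h0] at hval
    rcases hδ with rfl | rfl <;> linarith
  obtain ⟨t, ht, y, hy, hyv⟩ := hseg 1 (Or.inl rfl)
  obtain ⟨t', ht', y', hy', hyv'⟩ := hseg (-1) (Or.inr rfl)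
  refine hc.isPreconnected.not_sign_change (f := K.plExtend (vertexDifference a b))
    ((SimplicialComplex.continuousOn_plExtend hK.finite_faces _).mono
      (Set.sdiff_subset.trans hWA)) ?_ hy' hy (by rw [hyv']; linarith) (by rw [hyv]; linarith)
  intro z hz hz0
  obtain ⟨α, β, hα, hβ, hs, rfl⟩ := hform z (hWN hz.1)
  rw [hpl α β hα hβ hs] at hz0
  have h1 : α = 1 / 2 := by linarith
  have h2 : β = 1 / 2 := by linarith
  exact hz.2 (by rw [h1, h2]; rfl)

/-- An edge of a surface does not lie in exactly one triangle. -/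
lemma IsSimplicialSurface.exists_second_triangle (hK : IsSimplicialSurface K) {a b c : 𝔼}
    (hab : a ≠ b) (hca : c ≠ a) (hcb : c ≠ b) (h : ({a, b, c} : Finset 𝔼) ∈ K.faces) :
    ∃ d, d ≠ a ∧ d ≠ b ∧ d ≠ c ∧ ({a, b, d} : Finset 𝔼) ∈ K.faces := by
  by_contra! hno
  have hedge := pair_mem_of_mem_face h (u := a) (v := b) (by simp) (by simp)
  have hx := midpoint_mem_openStar hab hedge
  set x : 𝔼 := (1 / 2 : ℝ) • a + (1 / 2 : ℝ) • b with hxdef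
  -- If `{a, b, c}` were the only triangle at the edge, a small punctured neighbourhood of `x` would
  -- be star-shaped and `g` would have a logarithm there.
  obtain ⟨W, hW, hWN, g, hg, hg0, hV⟩ :=
    exists_not_hasLogOn_punctured_nhdsWithin hK.locally_euclidean hx.1
      (SimplicialComplex.openStar_mem_nhdsWithin hK.finite_faces hx)
  set T : Set 𝔼 := convexHull ℝ ((({a, b, c} : Finset 𝔼)) : Set 𝔼) with hT
  have hNT : ∀ y ∈ K.openStar {a, b}, y ∈ T := by
    intro y hy
    rcases SimplicialComplex.eq_combo_of_mem_openStar_edge hK.card_le_three hab hy with h1 | h1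
    · obtain ⟨α, β, hα, hβ, hs, rfl⟩ := h1
      have := SimplicialComplex.combo_mem_convexHull (a := a) (b := b) (c := c) hα.le hβ.le le_rfl
        (by rw [hs, add_zero])
      simpa [hT] using this
    · obtain ⟨d, hda, hdb, hf, α, β, γ, hα, hβ, hγ, hs, rfl⟩ := h1
      by_cases hdc : d = c
      · rw [hdc]
        exact SimplicialComplex.combo_mem_convexHull hα.le hβ.le hγ.le hs
      · exact absurd hf (hno d hda hdb hdc)
  obtain ⟨r, hr, hrW⟩ := Metric.mem_nhdsWithin_iff.1 hW
  have hTs : T ⊆ K.space := SimplicialComplex.convexHull_subset_space h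
  have hxT : x ∈ T := hNT x hx
  have hcT : c ∈ T := subset_convexHull ℝ _ (by simp)
  have hcx : K.coord x c = 0 := by
    have := SimplicialComplex.coord_triangle h (α := 1 / 2) (β := 1 / 2) (γ := 0) (by norm_num)
      (by norm_num) le_rfl (by norm_num)
    simp only [zero_smul, add_zero] at this
    rw [hxdef, this]
    simp [hca, hcb]
  have hcc : K.coord c c = 1 := by
    rw [SimplicialComplex.coord_vertex (SimplicialComplex.mem_vertices_of_mem_face h (by simp))]
    simp
  -- The star centre is taken off the edge, with coordinate `t > 0` at `c`. Since `x` has coordinate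
  -- `0` at `c`, a segment from this centre can reach `x` only at its other end.
  obtain ⟨t, ht0, ht1, htW⟩ := exists_mem_of_mem_nhdsWithin
    (inter_mem_nhdsWithin T (Metric.ball_mem_nhds x hr)) (σ := fun t => (1 - t) • x + t • c)
    (by fun_prop) (by simp)
    (fun t h0 h1 => convex_convexHull ℝ _ hxT hcT (by linarith) h0.le (by ring))
  refine hV (K.space ∩ Metric.ball x r) (inter_mem_nhdsWithin _ (Metric.ball_mem_nhds x hr))
    (fun y hy => hrW ⟨hy.2, hy.1⟩) ?_
  have heq : (K.space ∩ Metric.ball x r) \ {x} = (T ∩ Metric.ball x r) \ {x} := by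
    ext y
    constructor
    · rintro ⟨⟨h1, h2⟩, h3⟩
      exact ⟨⟨hNT y (hWN (hrW ⟨h2, h1⟩)), h2⟩, h3⟩
    · rintro ⟨⟨h1, h2⟩, h3⟩
      exact ⟨⟨hTs h1, h2⟩, h3⟩
  have hsubW : (K.space ∩ Metric.ball x r) \ {x} ⊆ W \ {x} :=
    Set.sdiff_subset_sdiff_left fun y hy => hrW ⟨hy.2, hy.1⟩
  rw [heq] at hsubW ⊢
  refine hasLogOn_of_starConvex (x := (1 - t) • x + t • c) ?_ (hg.mono hsubW)
    (fun y hy => hg0 y (hsubW hy))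
  have hcoordc : K.coord ((1 - t) • x + t • c) c = t := by
    rw [SimplicialComplex.coord_combo h hxT hcT (by linarith) ht0.le (by ring)]
    simp [hcx, hcc]
  intro y hy p q hp hq hpq
  refine ⟨((convex_convexHull ℝ _).inter (convex_ball x r)) htW hy.1 hp hq hpq, fun heqx => ?_⟩
  rw [Set.mem_singleton_iff] at heqx
  have h1 : K.coord (p • ((1 - t) • x + t • c) + q • y) c = p * t + q * K.coord y c := by
    rw [SimplicialComplex.coord_combo h htW.1 hy.1.1 hp hq hpq]
    simp [hcoordc]
  rw [heqx, hcx] at h1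
  have h2 := mul_nonneg hq (SimplicialComplex.coord_nonneg (K := K) y c)
  have h3 := mul_nonneg hp ht0.le
  have h4 : p = 0 := by
    rcases mul_eq_zero.1 (show p * t = 0 by linarith) with h | h
    · exact h
    · linarith
  rw [h4, zero_smul, zero_add, show q = 1 by linarith, one_smul] at heqx
  exact hy.2 heqx

/-- Multiplication by `-I` moves the closed half-plane without `0` into the slit plane; `log I`
undoes the rotation. -/
lemma hasLogOn_im_nonneg : HasLogOn (fun w : ℂ => w) {w | 0 ≤ w.im ∧ w ≠ 0} := by
  have hm : ∀ w : ℂ, 0 ≤ w.im ∧ w ≠ 0 → -Complex.I * w ∈ Complex.slitPlane := by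
    rintro w ⟨h1, h2⟩
    rw [Complex.mem_slitPlane_iff]
    by_contra! h
    simp only [Complex.mul_re, Complex.mul_im, Complex.neg_re, Complex.neg_im, Complex.I_re,
      Complex.I_im] at h
    exact h2 (Complex.ext (by simp; linarith [h.2]) (by simp; linarith [h.1]))
  refine ⟨fun w => Complex.log (-Complex.I * w) + Complex.log Complex.I, ?_, ?_⟩
  · exact (ContinuousOn.clog (by fun_prop) hm).add continuousOn_const
  · rintro w hw
    have h1 : -Complex.I * w ≠ 0 := Complex.slitPlane_ne_zero (hm w hw)
    rw [Complex.exp_add, Complex.exp_log h1, Complex.exp_log Complex.I_ne_zero]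
    linear_combination (-w) * Complex.I_mul_I

lemma hasLogOn_im_nonpos : HasLogOn (fun w : ℂ => w) {w | w.im ≤ 0 ∧ w ≠ 0} := by
  have h1 := hasLogOn_im_nonneg.comp (k := fun w : ℂ => -w) (t := {w | w.im ≤ 0 ∧ w ≠ 0})
    (by fun_prop) (fun w hw => ⟨by simpa using hw.1, neg_ne_zero.2 hw.2⟩)
  have h2 : HasLogOn (fun _ : ℂ => (-1 : ℂ)) {w : ℂ | w.im ≤ 0 ∧ w ≠ 0} :=
    ⟨fun _ => Real.pi * Complex.I, continuousOn_const, fun _ _ => Complex.exp_pi_mul_I⟩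
  exact (h1.mul h2).congr fun w _ => by ring

/-- The coordinate across an edge `{a, b}`, where `ε` tells the side of each triangle. -/
noncomputable def transverseCoord (K : EuclideanComplex n) (a b : 𝔼) (ε : 𝔼 → ℝ) (y : 𝔼) : ℂ :=
  ⟨K.plExtend (vertexDifference a b) y, K.plExtend ε y⟩

lemma continuousOn_transverseCoord (hK : K.faces.Finite) (a b : 𝔼) (ε : 𝔼 → ℝ) :
    ContinuousOn (transverseCoord K a b ε) K.space := by
  have : transverseCoord K a b ε = fun y =>
      (K.plExtend (vertexDifference a b) y : ℂ) + (K.plExtend ε y : ℂ) * Complex.I := by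
    ext y; rw [transverseCoord, Complex.mk_eq_add_mul_I]
  rw [this]
  exact ((Complex.continuous_ofReal.comp_continuousOn
    (SimplicialComplex.continuousOn_plExtend hK _)).add
    ((Complex.continuous_ofReal.comp_continuousOn
    (SimplicialComplex.continuousOn_plExtend hK _)).mul continuousOn_const))

/-- The map of a disc onto the union of the triangles `{a, b, c}` and `{a, b, d}`
near the midpoint of `{a, b}`. -/
noncomputable def twoPages (a b c d : 𝔼) (z : ℂ) : 𝔼 :=
  ((1 + z.re - |z.im|) / 2) • a + ((1 - z.re - |z.im|) / 2) • b + (max z.im 0) • c +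
    (max (-z.im) 0) • d

lemma continuous_twoPages (a b c d : 𝔼) : Continuous (twoPages a b c d) := by
  unfold twoPages
  have h1 := Complex.continuous_re
  have h2 := Complex.continuous_im
  fun_prop

lemma twoPages_eq {a b c d : 𝔼} {z : ℂ} :
    twoPages a b c d z = ((1 + z.re - |z.im|) / 2) • a + ((1 - z.re - |z.im|) / 2) • b +
      |z.im| • (if 0 ≤ z.im then c else d) := by
  unfold twoPages
  split_ifs with h
  · rw [abs_of_nonneg h, max_eq_left h, max_eq_right (by linarith)]; simp
  · push Not at h
    rw [abs_of_neg h, max_eq_right h.le, max_eq_left (by linarith)]; simp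

lemma twoPages_mem_space {a b c d : 𝔼} (hc : ({a, b, c} : Finset 𝔼) ∈ K.faces)
    (hd : ({a, b, d} : Finset 𝔼) ∈ K.faces) {z : ℂ} (hz : ‖z‖ ≤ 1 / 2) :
    twoPages a b c d z ∈ K.space := by
  rw [twoPages_eq]
  have h1 := abs_le.1 ((Complex.abs_re_le_norm z).trans hz)
  have h2 := (Complex.abs_im_le_norm z).trans hz
  have h3 := abs_nonneg z.im
  split_ifs
  · exact SimplicialComplex.convexHull_subset_space hc (SimplicialComplex.combo_mem_convexHull
      (by linarith) (by linarith) h3 (by ring))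
  · exact SimplicialComplex.convexHull_subset_space hd (SimplicialComplex.combo_mem_convexHull
      (by linarith) (by linarith) h3 (by ring))

lemma transverseCoord_twoPages {a b c d : 𝔼} (hab : a ≠ b) (hca : c ≠ a) (hcb : c ≠ b)
    (hda : d ≠ a) (hdb : d ≠ b) (hc : ({a, b, c} : Finset 𝔼) ∈ K.faces)
    (hd : ({a, b, d} : Finset 𝔼) ∈ K.faces) {ε : 𝔼 → ℝ} (ha : ε a = 0) (hb : ε b = 0) {z : ℂ}
    (hz : ‖z‖ ≤ 1 / 2) :
    transverseCoord K a b ε (twoPages a b c d z) =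
      ⟨z.re, |z.im| * ε (if 0 ≤ z.im then c else d)⟩ := by
  have h1 := abs_le.1 ((Complex.abs_re_le_norm z).trans hz)
  have h2 := (Complex.abs_im_le_norm z).trans hz
  have h3 := abs_nonneg z.im
  have hf : ∀ e, e ≠ a → e ≠ b → ({a, b, e} : Finset 𝔼) ∈ K.faces →
      transverseCoord K a b ε (((1 + z.re - |z.im|) / 2) • a + ((1 - z.re - |z.im|) / 2) • b +
      |z.im| • e) = ⟨z.re, |z.im| * ε e⟩ := by
    intro e hea heb he
    rw [transverseCoord, SimplicialComplex.plExtend_triangle he (by linarith) (by linarith) h3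
      (by ring), SimplicialComplex.plExtend_triangle he (by linarith) (by linarith) h3 (by ring),
      ha, hb]
    apply Complex.ext
    · simp [vertexDifference, hab.symm, hea, heb]; ring
    · simp
  rw [twoPages_eq]
  split_ifs
  · exact hf c hca hcb hc
  · exact hf d hda hdb hd

/-- The sides of the triangles at an edge `{a, b}`: positive for the vertices in `s`. -/
noncomputable def sideSign (a b : 𝔼) (s : Finset 𝔼) (z : 𝔼) : ℝ :=
  if z = a ∨ z = b then 0 else if z ∈ s then 1 else -1

/-- The imaginary part is, up to sign, the weight of the third vertex. If it vanishes the point lies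
on the edge, and a vanishing real part then gives equal weights to `a` and `b`. -/
lemma transverseCoord_ne_zero (hcard : ∀ s ∈ K.faces, s.card ≤ 3) {a b : 𝔼} (hab : a ≠ b)
    (h : ({a, b} : Finset 𝔼) ∈ K.faces) (s : Finset 𝔼) {y : 𝔼} (hy : y ∈ K.openStar {a, b})
    (hne : y ≠ (1 / 2 : ℝ) • a + (1 / 2 : ℝ) • b) :
    transverseCoord K a b (sideSign a b s) y ≠ 0 := by
  intro h0
  have hre := congrArg Complex.re h0
  have him := congrArg Complex.im h0
  simp only [transverseCoord, Complex.zero_re, Complex.zero_im] at hre him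
  rcases SimplicialComplex.eq_combo_of_mem_openStar_edge hcard hab hy with h1 | h1
  · obtain ⟨α, β, hα, hβ, hs, rfl⟩ := h1
    rw [plExtend_edge h hα.le hβ.le hs] at hre
    simp only [vertexDifference, hab.symm, if_true, if_false] at hre
    exact hne (by rw [show α = 1 / 2 by linarith, show β = 1 / 2 by linarith])
  · obtain ⟨c, hca, hcb, hf, α, β, γ, hα, hβ, hγ, hs, rfl⟩ := h1
    rw [SimplicialComplex.plExtend_triangle hf hα.le hβ.le hγ.le hs] at him
    simp only [sideSign, hca, hcb, true_or, or_true, or_self, if_true, if_false, mul_zero,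
      zero_add] at him
    split_ifs at him <;> linarith

/-- A circle folded along the real axis stays in a closed half-plane without `0`. -/
lemma hasLogOn_fold {r : ℝ} (hr : 0 < r) {u : ℂ → ℂ}
    (hu : (∀ z ∈ Metric.sphere (0 : ℂ) r, u z = ⟨z.re, |z.im|⟩) ∨
      (∀ z ∈ Metric.sphere (0 : ℂ) r, u z = ⟨z.re, -|z.im|⟩)) :
    HasLogOn u (Metric.sphere 0 r) := by
  have h1 := Complex.continuous_re
  have h2 := Complex.continuous_im
  have hz0 : ∀ z ∈ Metric.sphere (0 : ℂ) r, ∀ w : ℂ, w.re = z.re → |w.im| = |z.im| → w ≠ 0 := by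
    rintro z hz w h3 h4 rfl
    have : z = 0 := Complex.ext h3.symm (by simpa using h4.symm)
    rw [mem_sphere_zero_iff_norm, this, norm_zero] at hz
    exact hr.ne hz
  rcases hu with hu | hu
  · refine (hasLogOn_im_nonneg.comp (k := fun z => (z.re : ℂ) + (|z.im| : ℝ) * Complex.I)
      (t := Metric.sphere 0 r) (by fun_prop) (fun z hz => ⟨by simp, hz0 z hz _ (by simp) (by simp)⟩)).congr
      (fun z hz => ?_)
    rw [hu z hz, Complex.mk_eq_add_mul_I]
  · refine (hasLogOn_im_nonpos.comp (k := fun z => (z.re : ℂ) + (-|z.im| : ℝ) * Complex.I)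
      (t := Metric.sphere 0 r) (by fun_prop) (fun z hz => ⟨by simp, hz0 z hz _ (by simp) (by simp)⟩)).congr
      (fun z hz => ?_)
    rw [hu z hz, Complex.mk_eq_add_mul_I]

/-- Multiplying by `u ^ (-q)` removes the second factor and leaves a logarithm of `z ^ p` on a
circle. -/
lemma eq_zero_of_hasLogOn_zpow_mul {r : ℝ} (hr : 0 < r) {u : ℂ → ℂ} {p q : ℤ}
    (hu : HasLogOn u (Metric.sphere 0 r))
    (hpq : HasLogOn (fun z => z ^ p * u z ^ q) (Metric.sphere 0 r)) : p = 0 := by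
  by_contra hp
  refine not_hasLogOn_zpow_sphere hr hp ((hpq.mul (hu.zpow (-q))).congr fun z hz => ?_)
  obtain ⟨f, -, hf⟩ := hu
  have : u z ≠ 0 := by rw [← hf z hz]; exact Complex.exp_ne_zero _
  rw [mul_assoc, ← zpow_add₀ this, add_neg_cancel, zpow_zero, mul_one]

lemma transverseCoord_twoPages_of_mem_notMem {a b c d : 𝔼} (hab : a ≠ b) (hca : c ≠ a)
    (hcb : c ≠ b) (hda : d ≠ a) (hdb : d ≠ b) (hc : ({a, b, c} : Finset 𝔼) ∈ K.faces)
    (hd : ({a, b, d} : Finset 𝔼) ∈ K.faces) {s : Finset 𝔼} (hcs : c ∈ s) (hds : d ∉ s) {z : ℂ}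
    (hz : ‖z‖ ≤ 1 / 2) :
    transverseCoord K a b (sideSign a b s) (twoPages a b c d z) = z := by
  rw [transverseCoord_twoPages hab hca hcb hda hdb hc hd (by simp [sideSign]) (by simp [sideSign]) hz]
  apply Complex.ext
  · rfl
  · by_cases h : 0 ≤ z.im
    · simp [h, sideSign, hca, hcb, hcs, abs_of_nonneg h]
    · simp only [h, sideSign, hda, hdb, hds, abs_of_neg (not_le.1 h), if_false, or_self]
      ring

lemma transverseCoord_twoPages_of_mem_mem {a b c d : 𝔼} (hab : a ≠ b) (hca : c ≠ a)
    (hcb : c ≠ b) (hda : d ≠ a) (hdb : d ≠ b) (hc : ({a, b, c} : Finset 𝔼) ∈ K.faces)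
    (hd : ({a, b, d} : Finset 𝔼) ∈ K.faces) {s : Finset 𝔼} (hcs : c ∈ s) (hds : d ∈ s) {z : ℂ}
    (hz : ‖z‖ ≤ 1 / 2) :
    transverseCoord K a b (sideSign a b s) (twoPages a b c d z) = ⟨z.re, |z.im|⟩ := by
  rw [transverseCoord_twoPages hab hca hcb hda hdb hc hd (by simp [sideSign]) (by simp [sideSign]) hz]
  congr 1
  split_ifs <;> simp [sideSign, hca, hcb, hda, hdb, hcs, hds]

lemma transverseCoord_twoPages_of_notMem_notMem {a b c d : 𝔼} (hab : a ≠ b) (hca : c ≠ a)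
    (hcb : c ≠ b) (hda : d ≠ a) (hdb : d ≠ b) (hc : ({a, b, c} : Finset 𝔼) ∈ K.faces)
    (hd : ({a, b, d} : Finset 𝔼) ∈ K.faces) {s : Finset 𝔼} (hcs : c ∉ s) (hds : d ∉ s) {z : ℂ}
    (hz : ‖z‖ ≤ 1 / 2) :
    transverseCoord K a b (sideSign a b s) (twoPages a b c d z) = ⟨z.re, -|z.im|⟩ := by
  rw [transverseCoord_twoPages hab hca hcb hda hdb hc hd (by simp [sideSign]) (by simp [sideSign]) hz]
  congr 1
  split_ifs <;> simp [sideSign, hca, hcb, hda, hdb, hcs, hds]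

/-- An edge of a surface does not lie in three triangles. -/
lemma IsSimplicialSurface.not_three_triangles (hK : IsSimplicialSurface K) {a b : 𝔼}
    (hab : a ≠ b) {c : Fin 3 → 𝔼} (hc : Function.Injective c) (hca : ∀ i, c i ≠ a)
    (hcb : ∀ i, c i ≠ b) (h : ∀ i, ({a, b, c i} : Finset 𝔼) ∈ K.faces) : False := by
  have hedge := pair_mem_of_mem_face (h 0) (u := a) (v := b) (by simp) (by simp)
  have hx := midpoint_mem_openStar hab hedge
  set x : 𝔼 := (1 / 2 : ℝ) • a + (1 / 2 : ℝ) • b with hxdef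
  have hN := SimplicialComplex.openStar_mem_nhdsWithin hK.finite_faces hx
  have hcont : ∀ ε, ContinuousOn (transverseCoord K a b ε) (K.openStar {a, b} \ {x}) := fun ε =>
    (continuousOn_transverseCoord hK.finite_faces a b ε).mono fun y hy => hy.1.1
  have hnz : ∀ s, ∀ y ∈ K.openStar {a, b} \ {x},
      transverseCoord K a b (sideSign a b s) y ≠ 0 := fun s y hy =>
    transverseCoord_ne_zero hK.card_le_three hab hedge s hy.1 hy.2
  -- Three pages at an edge would give two independent winding numbers. The two test functions
  -- separate page `0` from the others and pages `0`, `1` from the others; in a surface they satisfy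
  -- a nontrivial relation.
  obtain ⟨W, hW, n₁, n₂, hn, hl⟩ := exists_hasLogOn_punctured_nhdsWithin hK.locally_euclidean hx.1 hN
    (hcont (sideSign a b {c 0})) (hcont (sideSign a b {c 0, c 1})) (hnz _) (hnz _)
  have hpage : ∀ i j, ∃ r : ℝ, 0 < r ∧ r ≤ 1 / 2 ∧
      HasLogOn (fun z => transverseCoord K a b (sideSign a b {c 0}) (twoPages a b (c i) (c j) z) ^ n₁ *
        transverseCoord K a b (sideSign a b {c 0, c 1}) (twoPages a b (c i) (c j) z) ^ n₂)
        (Metric.sphere 0 r) := by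
    intro i j
    obtain ⟨ρ, hρ, hρW⟩ := Metric.mem_nhdsWithin_iff.1 hW
    have h0 : twoPages a b (c i) (c j) 0 = x := by simp [twoPages, hxdef]
    have hev : ∀ᶠ z in 𝓝 (0 : ℂ), twoPages a b (c i) (c j) z ∈ Metric.ball x ρ :=
      (continuous_twoPages a b (c i) (c j)).continuousAt.eventually_mem
        (by rw [h0]; exact Metric.ball_mem_nhds x hρ)
    obtain ⟨r, hr, hrb⟩ := Metric.eventually_nhds_iff_ball.1 hev
    -- The radius stays at most `1 / 2` so that the weights in `twoPages` are nonnegative.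
    have hmin : 0 < min (r / 2) (1 / 2) := by positivity
    refine ⟨min (r / 2) (1 / 2), hmin, min_le_right _ _,
      hl.comp (continuous_twoPages _ _ _ _).continuousOn fun z hz => ?_⟩
    rw [mem_sphere_zero_iff_norm] at hz
    have hz2 : ‖z‖ ≤ 1 / 2 := hz ▸ min_le_right _ _
    have hzr : z ∈ Metric.ball (0 : ℂ) r := by
      rw [mem_ball_zero_iff, hz]
      exact (min_le_left _ _).trans_lt (by linarith)
    refine ⟨hρW ⟨hrb z hzr, twoPages_mem_space (h i) (h j) hz2⟩, fun hzx => ?_⟩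
    -- With the empty set of positive vertices both pages have sign `-1`, so the coordinate is
    -- `(z.re, -|z.im|)`. This determines whether `z = 0`, also when `i = j`.
    have e1 := transverseCoord_twoPages hab (hca i) (hcb i) (hca j) (hcb j) (h i) (h j)
      (ε := sideSign a b ∅) (by simp [sideSign]) (by simp [sideSign]) hz2
    have e2 := transverseCoord_twoPages hab (hca i) (hcb i) (hca j) (hcb j) (h i) (h j)
      (ε := sideSign a b ∅) (by simp [sideSign]) (by simp [sideSign]) (z := 0) (by simp)
    rw [Set.mem_singleton_iff.1 hzx, ← h0, e2] at e1
    have hre := congrArg Complex.re e1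
    have him := congrArg Complex.im e1
    have hne : sideSign a b ∅ (if 0 ≤ z.im then c i else c j) = -1 := by
      split_ifs <;> simp [sideSign, hca, hcb]
    simp only [Complex.zero_re, Complex.zero_im, abs_zero, zero_mul, hne] at hre him
    have hz0 : z = 0 := Complex.ext hre.symm (by
      have : |z.im| = 0 := by linarith
      simpa using abs_eq_zero.1 this)
    rw [hz0, norm_zero] at hz
    exact hmin.ne hz
  have h01 : c 0 ≠ c 1 := hc.ne (by decide)
  have h02 : c 0 ≠ c 2 := hc.ne (by decide)
  have h12 : c 1 ≠ c 2 := hc.ne (by decide)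
  have hle : ∀ {r : ℝ} {z : ℂ}, r ≤ 1 / 2 → z ∈ Metric.sphere (0 : ℂ) r → ‖z‖ ≤ 1 / 2 := by
    intro r z hr hz
    rw [mem_sphere_zero_iff_norm] at hz
    rwa [hz]
  -- On pages `0` and `1` the first function is the identity of the disc and the second is a fold.
  have hn₁ : n₁ = 0 := by
    obtain ⟨r, hr, hr2, hlog⟩ := hpage 0 1
    refine eq_zero_of_hasLogOn_zpow_mul (q := n₂) hr (hasLogOn_fold (u := fun z => transverseCoord K a b
      (sideSign a b {c 0, c 1}) (twoPages a b (c 0) (c 1) z)) hr (Or.inl fun z hz => ?_))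
      (hlog.congr fun z hz => ?_)
    · exact transverseCoord_twoPages_of_mem_mem hab (hca 0) (hcb 0) (hca 1) (hcb 1) (h 0) (h 1)
        (by simp) (by simp) (hle hr2 hz)
    · rw [transverseCoord_twoPages_of_mem_notMem hab (hca 0) (hcb 0) (hca 1) (hcb 1) (h 0) (h 1)
        (s := {c 0}) (by simp) (by simp [h01.symm]) (hle hr2 hz)]
  -- On pages `1` and `2` the roles are exchanged: the first function is a fold and the second the
  -- identity.
  have hn₂ : n₂ = 0 := by
    obtain ⟨r, hr, hr2, hlog⟩ := hpage 1 2
    refine eq_zero_of_hasLogOn_zpow_mul (q := n₁) hr (hasLogOn_fold (u := fun z => transverseCoord K a b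
      (sideSign a b {c 0}) (twoPages a b (c 1) (c 2) z)) hr (Or.inr fun z hz => ?_))
      (hlog.congr fun z hz => ?_)
    · exact transverseCoord_twoPages_of_notMem_notMem hab (hca 1) (hcb 1) (hca 2) (hcb 2) (h 1) (h 2)
        (by simp [h01.symm]) (by simp [h02.symm]) (hle hr2 hz)
    · rw [transverseCoord_twoPages_of_mem_notMem hab (hca 1) (hcb 1) (hca 2) (hcb 2) (h 1) (h 2)
        (s := {c 0, c 1}) (by simp) (by simp [h02.symm, h12.symm]) (hle hr2 hz), mul_comm]
  exact hn.elim (fun h => h hn₁) (fun h => h hn₂)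

/-- Each edge of a surface lies in exactly two triangles. -/
lemma IsSimplicialSurface.exists_two_triangles (hK : IsSimplicialSurface K) {a b : 𝔼}
    (hab : a ≠ b) (h : ({a, b} : Finset 𝔼) ∈ K.faces) :
    ∃ c d, c ≠ d ∧ ∀ z, (z ≠ a ∧ z ≠ b ∧ ({a, b, z} : Finset 𝔼) ∈ K.faces) ↔ z = c ∨ z = d := by
  obtain ⟨c, hca, hcb, hc⟩ := hK.exists_triangle_of_edge hab h
  obtain ⟨d, hda, hdb, hdc, hd⟩ := hK.exists_second_triangle hab hca hcb hc
  refine ⟨c, d, hdc.symm, fun z => ⟨?_, ?_⟩⟩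
  · rintro ⟨hza, hzb, hz⟩
    by_contra! hcon
    refine hK.not_three_triangles hab (c := ![c, d, z]) ?_ ?_ ?_ ?_
    · intro i j hij
      fin_cases i <;> fin_cases j <;> simp_all
    all_goals
      intro i
      fin_cases i <;> assumption
  · rintro (rfl | rfl)
    · exact ⟨hca, hcb, hc⟩
    · exact ⟨hda, hdb, hd⟩

end SurfaceLinks

/-! ### Vertex stars as wheels. -/

section Wheels

variable {n : ℕ} {K : EuclideanComplex n}

local notation "𝔼" => EuclideanSpace ℝ (Fin n)

/-- The triangles of `K` at `v` are `{v, u i, u (i + 1)}` for a sequence `u` of period `m`. -/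
structure IsWheel (K : EuclideanComplex n) (v : 𝔼) (m : ℕ) (u : ℕ → 𝔼) : Prop where
  three_le : 3 ≤ m
  periodic : ∀ i, u (i + m) = u i
  injOn : ∀ i j, i < m → j < m → u i = u j → i = j
  ne : ∀ i, u i ≠ v
  mem_iff : ∀ s, s ∈ K.faces ∧ v ∈ s ∧ s.card = 3 ↔ ∃ i, s = {v, u i, u (i + 1)}

/-- The graph whose edges are the edges of the link of `v`. -/
def linkGraph (K : EuclideanComplex n) (v : 𝔼) :
    SimpleGraph {u : 𝔼 // u ≠ v ∧ ({v, u} : Finset 𝔼) ∈ K.faces} where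
  Adj x y := x ≠ y ∧ ({v, x.1, y.1} : Finset 𝔼) ∈ K.faces
  symm := ⟨fun x y h => ⟨h.1.symm, by rw [Finset.pair_comm]; exact h.2⟩⟩
  loopless := ⟨fun x h => h.1 rfl⟩

variable {v : EuclideanSpace ℝ (Fin n)}

lemma linkGraph_neighborSet_ncard (hK : IsSimplicialSurface K)
    (x : {u : 𝔼 // u ≠ v ∧ ({v, u} : Finset 𝔼) ∈ K.faces}) :
    ((linkGraph K v).neighborSet x).ncard = 2 := by
  obtain ⟨c, d, hcd, h⟩ := hK.exists_two_triangles x.2.1.symm x.2.2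
  obtain ⟨hc1, hc2, hc3⟩ := (h c).2 (Or.inl rfl)
  obtain ⟨hd1, hd2, hd3⟩ := (h d).2 (Or.inr rfl)
  rw [Set.ncard_eq_two]
  refine ⟨⟨c, hc1, pair_mem_of_mem_face hc3 (by simp) (by simp)⟩,
    ⟨d, hd1, pair_mem_of_mem_face hd3 (by simp) (by simp)⟩, fun he => hcd (congrArg Subtype.val he), ?_⟩
  ext y
  simp only [SimpleGraph.mem_neighborSet, Set.mem_insert_iff, Set.mem_singleton_iff, Subtype.ext_iff]
  rw [← h y.1]
  constructor
  · intro hy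
    exact ⟨y.2.1, fun he => hy.1 (Subtype.ext he.symm), hy.2⟩
  · rintro ⟨-, h2, h3⟩
    exact ⟨fun he => h2 (by rw [he]), h3⟩

/-- The vertices of one component are closed under adjacency in the link, so by `link_connected`
they are all link vertices. -/
lemma linkGraph_supp (hK : IsSimplicialSurface K)
    (x y : {u : 𝔼 // u ≠ v ∧ ({v, u} : Finset 𝔼) ∈ K.faces}) :
    y ∈ ((linkGraph K v).connectedComponentMk x).supp := by
  let P : Set 𝔼 := {u | ∃ h : u ≠ v ∧ ({v, u} : Finset 𝔼) ∈ K.faces,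
    (⟨u, h⟩ : {u : 𝔼 // u ≠ v ∧ ({v, u} : Finset 𝔼) ∈ K.faces}) ∈
      ((linkGraph K v).connectedComponentMk x).supp}
  have hP : ∀ u ∈ P, ∀ w, w ≠ v → u ≠ v → ({v, u, w} : Finset 𝔼) ∈ K.faces → w ∈ P := by
    rintro u ⟨hu, hu'⟩ w hwv huv hf
    have hw : w ≠ v ∧ ({v, w} : Finset 𝔼) ∈ K.faces :=
      ⟨hwv, pair_mem_of_mem_face hf (by simp) (by simp)⟩
    refine ⟨hw, ?_⟩
    by_cases huw : u = w
    · subst huw; exact hu'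
    · rw [SimpleGraph.ConnectedComponent.mem_supp_iff] at hu' ⊢
      rw [← hu', SimpleGraph.ConnectedComponent.eq]
      have : (linkGraph K v).Adj ⟨w, hw⟩ ⟨u, hu⟩ :=
        ⟨fun he => huw (congrArg Subtype.val he).symm, by
          rw [show ({v, w, u} : Finset 𝔼) = {v, u, w} by rw [Finset.pair_comm]]; exact hf⟩
      exact this.reachable
  exact (hK.link_connected (P := P) x.2.1 x.2.2 ⟨x.2, by simp⟩ hP y.2.1 y.2.2).2

/-- The link graph is finite, connected and has two neighbours at every vertex, so it is a single
cycle. The rim is this cycle, run through periodically. -/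
lemma IsSimplicialSurface.exists_wheel (hK : IsSimplicialSurface K) (hv : v ∈ K.vertices) :
    ∃ m u, IsWheel K v m u := by
  obtain ⟨x₀, hx₀, hx₀f⟩ := hK.exists_edge hv
  let x : {u : 𝔼 // u ≠ v ∧ ({v, u} : Finset 𝔼) ∈ K.faces} := ⟨x₀, hx₀, hx₀f⟩
  have hfin : Finite {u : 𝔼 // u ≠ v ∧ ({v, u} : Finset 𝔼) ∈ K.faces} := by
    refine ((SimplicialComplex.vertices_finite hK.finite_faces).subset ?_).to_subtype
    rintro u ⟨-, hu⟩
    exact SimplicialComplex.mem_vertices_of_mem_face hu (by simp)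
  have hcyc : (linkGraph K v).IsCycles := fun y _ => linkGraph_neighborSet_ncard hK y
  obtain ⟨p, hp, hps⟩ := hcyc.exists_cycle_toSubgraph_verts_eq_connectedComponentSupp
    (v := x) (c := (linkGraph K v).connectedComponentMk x) (by simp)
    (Set.nonempty_of_ncard_ne_zero (by rw [linkGraph_neighborSet_ncard hK x]; norm_num))
  set m := p.length with hm
  have hm3 : 3 ≤ m := hp.three_le_length
  have hm0 : 0 < m := by omega
  have hinj : ∀ i j, i < m → j < m → p.getVert i = p.getVert j → i = j := fun i j hi hj h =>
    hp.getVert_injOn' (by rw [Set.mem_ofPred_eq]; omega) (by rw [Set.mem_ofPred_eq]; omega) h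
  let w : ℕ → {u : 𝔼 // u ≠ v ∧ ({v, u} : Finset 𝔼) ∈ K.faces} := fun i => p.getVert (i % m)
  have hwper : ∀ i, w (i + m) = w i := fun i => by simp [w]
  have hadj : ∀ i, (linkGraph K v).Adj (w i) (w (i + 1)) := by
    intro i
    have hlt := Nat.mod_lt i hm0
    have h1 := p.adj_getVert_succ hlt
    simp only [w]
    rw [Nat.add_mod, Nat.mod_eq_of_lt (show 1 < m by omega)]
    by_cases h : i % m + 1 = m
    · rw [h, Nat.mod_self]
      rw [h] at h1
      rw [SimpleGraph.Walk.getVert_zero]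
      rwa [hm, SimpleGraph.Walk.getVert_length] at h1
    · rwa [Nat.mod_eq_of_lt (show i % m + 1 < m by omega)]
  have hwinj : ∀ i j, i < m → j < m → w i = w j → i = j := by
    intro i j hi hj h
    simp only [w, Nat.mod_eq_of_lt hi, Nat.mod_eq_of_lt hj] at h
    exact hinj i j hi hj h
  have hne2 : ∀ i, w i ≠ w (i + 2) := by
    intro i h
    simp only [w] at h
    have h2 := hinj _ _ (Nat.mod_lt _ hm0) (Nat.mod_lt _ hm0) h
    have h3 : (m : ℤ) ∣ ((i + 2 : ℕ) : ℤ) - (i : ℕ) := (Nat.modEq_iff_dvd).1 h2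
    have h4 : (m : ℤ) ∣ 2 := by simpa using h3
    have := Int.le_of_dvd (by norm_num) h4
    omega
  have hsurj : ∀ y, ∃ i, i < m ∧ w i = y := by
    intro y
    have hy : y ∈ p.toSubgraph.verts := hps ▸ linkGraph_supp hK x y
    rw [SimpleGraph.Walk.mem_verts_toSubgraph, SimpleGraph.Walk.mem_support_iff_exists_getVert] at hy
    obtain ⟨i, hi, him⟩ := hy
    rcases him.lt_or_eq with h | h
    · exact ⟨i, h, by simp only [w]; rw [Nat.mod_eq_of_lt (show i < m from h)]; exact hi⟩
    · refine ⟨0, hm0, ?_⟩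
      rw [h, SimpleGraph.Walk.getVert_length] at hi
      simpa [w] using hi
  have hnbr : ∀ i y, (linkGraph K v).Adj (w (i + 1)) y → y = w i ∨ y = w (i + 2) := by
    intro i y hy
    obtain ⟨c, d, hcd, hs⟩ := Set.ncard_eq_two.1 (linkGraph_neighborSet_ncard hK (w (i + 1)))
    have h1 : w i ∈ (linkGraph K v).neighborSet (w (i + 1)) := (hadj i).symm
    have h2 : w (i + 2) ∈ (linkGraph K v).neighborSet (w (i + 1)) := hadj (i + 1)
    have h3 : y ∈ (linkGraph K v).neighborSet (w (i + 1)) := hy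
    have h4 := hne2 i
    rw [hs] at h1 h2 h3
    simp only [Set.mem_insert_iff, Set.mem_singleton_iff] at h1 h2 h3
    grind
  refine ⟨m, fun i => (w i).1, hm3, fun i => by rw [hwper], fun i j hi hj h =>
    hwinj i j hi hj (Subtype.ext h), fun i => (w i).2.1, fun s => ⟨?_, ?_⟩⟩
  · rintro ⟨hs, hvs, hcard⟩
    obtain ⟨a, b, hab, hsab⟩ : ∃ a b, a ≠ b ∧ s.erase v = {a, b} := by
      rw [← Finset.card_eq_two, Finset.card_erase_of_mem hvs, hcard]
    have hs' : s = {v, a, b} := by rw [← hsab, Finset.insert_erase hvs]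
    have ha : a ∈ s.erase v := by rw [hsab]; simp
    have hb : b ∈ s.erase v := by rw [hsab]; simp
    rw [Finset.mem_erase] at ha hb
    let a' : {u : 𝔼 // u ≠ v ∧ ({v, u} : Finset 𝔼) ∈ K.faces} :=
      ⟨a, ha.1, pair_mem_of_mem_face hs hvs ha.2⟩
    let b' : {u : 𝔼 // u ≠ v ∧ ({v, u} : Finset 𝔼) ∈ K.faces} :=
      ⟨b, hb.1, pair_mem_of_mem_face hs hvs hb.2⟩
    have hadj' : (linkGraph K v).Adj a' b' :=
      ⟨fun h => hab (congrArg Subtype.val h), hs' ▸ hs⟩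
    obtain ⟨i, hi, hia⟩ := hsurj a'
    -- `i + m - 1` stands for the predecessor of `i`, so that `i = 0` causes no truncated
    -- subtraction.
    have hia' : w (i + m - 1 + 1) = a' := by
      rw [show i + m - 1 + 1 = i + m by omega, hwper, hia]
    rcases hnbr (i + m - 1) b' (by rw [hia']; exact hadj') with h | h
    · refine ⟨i + m - 1, ?_⟩
      rw [hia', ← h, hs', Finset.pair_comm]
    · refine ⟨i + m - 1 + 1, ?_⟩
      rw [hia', show i + m - 1 + 1 + 1 = i + m - 1 + 2 by omega, ← h, hs']
  · rintro ⟨i, rfl⟩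
    refine ⟨(hadj i).2, by simp, ?_⟩
    rw [Finset.card_eq_three]
    exact ⟨_, _, _, (w i).2.1.symm, (w (i + 1)).2.1.symm, fun h => (hadj i).1 (Subtype.ext h), rfl⟩

end Wheels

/-! ### Angle sums, the angle defect and its total. -/

section AngleSums

variable {n : ℕ} {K : EuclideanComplex n}

local notation "𝔼" => EuclideanSpace ℝ (Fin n)

/-- The triangles of a family of simplices at the vertex `v`. -/
def trianglesAt {E : Type*} (A : Set (Finset E)) (v : E) : Set (Finset E) :=
  {t | t ∈ A ∧ v ∈ t ∧ t.card = 3}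

/-- The angle of a triangle `t` at its vertex `v`. -/
noncomputable def triangleAngle (v : 𝔼) (t : Finset 𝔼) : ℝ :=
  -- Summing over ordered pairs avoids ordering the two other vertices: for a triangle at `v` the
  -- diagonal terms are zero and the angle occurs twice.
  (1 / 2) * ∑ a ∈ t.erase v, ∑ b ∈ t.erase v, EuclideanGeometry.angle a v b

/-- The sum of the angles of the triangles of `K` at `v`. -/
noncomputable def angleSum (K : EuclideanComplex n) (v : 𝔼) : ℝ :=
  ∑ᶠ t ∈ trianglesAt K.faces v, triangleAngle v t

/-- The angle defect, normalised so that its total is the Euler characteristic. -/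
noncomputable def angleDefect : VertexFunction := fun _ K v => 1 - angleSum K v / (2 * Real.pi)

lemma triangleAngle_eq {D : DecidableEq 𝔼} {v a b : 𝔼} (hav : a ≠ v) (hbv : b ≠ v) (hab : a ≠ b) :
    triangleAngle v {v, a, b} = EuclideanGeometry.angle a v b := by
  obtain rfl : D = (by clear D; infer_instance) := Subsingleton.elim _ _
  have h : ({v, a, b} : Finset 𝔼).erase v = {a, b} := by
    ext x
    simp only [Finset.mem_erase, Finset.mem_insert, Finset.mem_singleton]
    constructor
    · tauto
    · rintro (rfl | rfl) <;> tauto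
  rw [triangleAngle, h, Finset.sum_pair hab, Finset.sum_pair hab, Finset.sum_pair hab,
    EuclideanGeometry.angle_self_of_ne hav, EuclideanGeometry.angle_self_of_ne hbv,
    EuclideanGeometry.angle_comm b v a]
  ring

lemma exists_of_mem_trianglesAt {E : Type*} [DecidableEq E] {A : Set (Finset E)} {v : E}
    {t : Finset E} (ht : t ∈ trianglesAt A v) :
    ∃ a b, a ≠ v ∧ b ≠ v ∧ a ≠ b ∧ t = {v, a, b} := by
  obtain ⟨-, hv, hc⟩ := ht
  obtain ⟨a, b, hab, h⟩ : ∃ a b, a ≠ b ∧ t.erase v = {a, b} := by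
    rw [← Finset.card_eq_two, Finset.card_erase_of_mem hv, hc]
  have ha : a ∈ t.erase v := by rw [h]; simp
  have hb : b ∈ t.erase v := by rw [h]; simp
  exact ⟨a, b, Finset.ne_of_mem_erase ha, Finset.ne_of_mem_erase hb, hab, by
    rw [← h, Finset.insert_erase hv]⟩

lemma trianglesAt_finite (hK : K.faces.Finite) (v : 𝔼) : (trianglesAt K.faces v).Finite :=
  hK.subset fun _ h => h.1

open Classical in
lemma IsSimplicialIso.bijOn_trianglesAt {E F : Type*} {A : Set (Finset E)} {B : Set (Finset F)}
    {f : E → F} (h : IsSimplicialIso A B f) {v : E} (hv : ∃ s ∈ A, v ∈ s) :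
    Set.BijOn (fun t : Finset E => t.image f) (trianglesAt A v) (trianglesAt B (f v)) := by
  have hinj : ∀ s ∈ A, Set.InjOn f s := fun s hs x hx y hy => h.1 ⟨s, hs, hx⟩ ⟨s, hs, hy⟩
  refine ⟨?_, ?_, ?_⟩
  · rintro t ⟨ht, hvt, hc⟩
    change t.image f ∈ trianglesAt B (f v)
    refine ⟨h.2.subset (Set.mem_image_of_mem _ ht), Finset.mem_image_of_mem f hvt, ?_⟩
    rw [Finset.card_image_of_injOn (hinj t ht), hc]
  · intro s hs t ht hst
    have hsub : ∀ s ∈ trianglesAt A v, ∀ t ∈ trianglesAt A v, s.image f = t.image f → s ⊆ t := by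
      intro s hs t ht hst x hx
      have h1 : f x ∈ t.image f := hst ▸ Finset.mem_image_of_mem f hx
      obtain ⟨y, hy, hyx⟩ := Finset.mem_image.1 h1
      rwa [← h.1 ⟨t, ht.1, hy⟩ ⟨s, hs.1, hx⟩ hyx]
    exact Finset.Subset.antisymm (hsub s hs t ht hst) (hsub t ht s hs hst.symm)
  · rintro t ⟨ht, hvt, hc⟩
    rw [← h.2] at ht
    obtain ⟨s, hs, rfl⟩ := ht
    refine ⟨s, ⟨hs, ?_, ?_⟩, rfl⟩
    · simp only at hvt
      obtain ⟨y, hy, hyx⟩ := Finset.mem_image.1 hvt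
      rwa [← h.1 ⟨s, hs, hy⟩ hv hyx]
    · simp only at hc
      rwa [Finset.card_image_of_injOn (hinj s hs)] at hc

open Classical in
lemma triangleAngle_image {m : ℕ} {f : 𝔼 → EuclideanSpace ℝ (Fin m)} {v a b : 𝔼} (hav : a ≠ v)
    (hbv : b ≠ v) (hab : a ≠ b) (hf : Set.InjOn f (({v, a, b} : Finset 𝔼) : Set 𝔼)) :
    triangleAngle (f v) (({v, a, b} : Finset 𝔼).image f) =
      EuclideanGeometry.angle (f a) (f v) (f b) := by
  rw [Finset.image_insert, Finset.image_insert, Finset.image_singleton]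
  exact triangleAngle_eq (fun h => hav (hf (by simp) (by simp) h))
    (fun h => hbv (hf (by simp) (by simp) h)) (fun h => hab (hf (by simp) (by simp) h))

open Classical in
lemma angleSum_image {L : EuclideanComplex n} {f : 𝔼 → 𝔼} {v : 𝔼}
    (hfin : (trianglesAt K.faces v).Finite) (hf : IsSimplicialIso K.faces L.faces f)
    (hv : v ∈ K.vertices) :
    angleSum L (f v) = ∑ t ∈ hfin.toFinset, triangleAngle (f v) (t.image f) := by
  have hb := hf.bijOn_trianglesAt (v := v) ⟨{v}, hv, Finset.mem_singleton_self v⟩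
  rw [angleSum, ← finsum_mem_eq_finite_toFinset_sum _ hfin]
  exact (finsum_mem_eq_of_bijOn (f := fun t : Finset 𝔼 => triangleAngle (f v) (t.image f))
    (g := triangleAngle (f v)) _ hb fun t _ => by congr!).symm

lemma angle_eq_of_dist_eq {m : ℕ} {a v b : 𝔼} {a' v' b' : EuclideanSpace ℝ (Fin m)}
    (h1 : dist a v = dist a' v') (h2 : dist b v = dist b' v') (h3 : dist a b = dist a' b') :
    EuclideanGeometry.angle a v b = EuclideanGeometry.angle a' v' b' := by
  simp only [EuclideanGeometry.angle, InnerProductGeometry.angle, vsub_eq_sub]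
  rw [real_inner_eq_norm_mul_self_add_norm_mul_self_sub_norm_sub_mul_self_div_two,
    real_inner_eq_norm_mul_self_add_norm_mul_self_sub_norm_sub_mul_self_div_two]
  simp only [sub_sub_sub_cancel_right, ← dist_eq_norm, h1, h2, h3]

lemma trianglesAt_starFaces (v : 𝔼) : trianglesAt (starFaces K v) v = trianglesAt K.faces v := by
  ext t
  constructor
  · rintro ⟨h1, h2, h3⟩
    exact ⟨h1.1, h2, h3⟩
  · rintro ⟨h1, h2, h3⟩
    exact ⟨⟨h1, t, h1, h2, subset_rfl⟩, h2, h3⟩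

/-- The isomorphism matches the triangles at `v` with those at `w`, and an angle of a triangle is
determined by its side lengths. -/
lemma angleDefect_starIsometry {m : ℕ} {L : EuclideanComplex m} {v : 𝔼}
    {w : EuclideanSpace ℝ (Fin m)} (hv : v ∈ K.vertices) (h : StarsIsometric K v L w) :
    angleDefect n K v = angleDefect m L w := by
  classical
  obtain ⟨f, hf, rfl, hd⟩ := h
  have hsv : ∃ s ∈ starFaces K v, v ∈ s := ⟨{v}, ⟨hv, {v}, hv, by simp, subset_rfl⟩, by simp⟩
  have hb := hf.bijOn_trianglesAt (v := v) hsv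
  rw [trianglesAt_starFaces, trianglesAt_starFaces] at hb
  rw [angleDefect, angleDefect, angleSum, angleSum]
  congr 2
  refine finsum_mem_eq_of_bijOn _ hb fun t ht => ?_
  obtain ⟨a, b, hav, hbv, hab, rfl⟩ := exists_of_mem_trianglesAt ht
  have hst : ∀ s ⊆ ({v, a, b} : Finset 𝔼), s.Nonempty → s ∈ starFaces K v := fun s hs hne =>
    ⟨K.down_closed ht.1 hs hne, _, ht.1, by simp, hs⟩
  have hfull : ({v, a, b} : Finset 𝔼) ∈ starFaces K v := hst _ subset_rfl (by simp)
  have himg := triangleAngle_image hav hbv hab (f := f)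
    fun x hx y hy h => hf.1 ⟨_, hfull, hx⟩ ⟨_, hfull, hy⟩ h
  rw [triangleAngle_eq hav hbv hab]
  refine Eq.trans ?_ (himg.symm.trans (by congr!))
  have hdist : ∀ x y, x ∈ ({v, a, b} : Finset 𝔼) → y ∈ ({v, a, b} : Finset 𝔼) →
      dist x y = dist (f x) (f y) := fun x y hx hy =>
    (hd x y (hst _ (by simp only [Finset.insert_subset_iff, Finset.singleton_subset_iff]; exact ⟨hx, hy⟩)
      (by simp))).symm
  exact angle_eq_of_dist_eq (hdist _ _ (by simp) (by simp)) (hdist _ _ (by simp) (by simp))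
    (hdist _ _ (by simp) (by simp))

/-- The combinatorics is fixed along the sequence, so the sums run over one finite set of triangles,
and each angle is continuous where its sides do not degenerate. -/
lemma angleSum_tendsto {Kseq : ℕ → EuclideanComplex n} {f : ℕ → 𝔼 → 𝔼} (hK : K.faces.Finite)
    (hf : ∀ k, IsSimplicialIso K.faces (Kseq k).faces (f k))
    (ht : ∀ v ∈ K.vertices, Tendsto (fun k => f k v) atTop (𝓝 v)) {v : 𝔼} (hv : v ∈ K.vertices) :
    Tendsto (fun k => angleSum (Kseq k) (f k v)) atTop (𝓝 (angleSum K v)) := by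
  have hfin := trianglesAt_finite hK v
  rw [funext fun k => angleSum_image hfin (hf k) hv, angleSum,
    finsum_mem_eq_finite_toFinset_sum _ hfin]
  refine tendsto_finsetSum _ fun t htm => ?_
  rw [Set.Finite.mem_toFinset] at htm
  obtain ⟨a, b, hav, hbv, hab, rfl⟩ := exists_of_mem_trianglesAt htm
  rw [triangleAngle_eq hav hbv hab]
  have hvert : ∀ x ∈ ({v, a, b} : Finset 𝔼), Tendsto (fun k => f k x) atTop (𝓝 x) := fun x hx =>
    ht x (SimplicialComplex.mem_vertices_of_mem_face htm.1 hx)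
  have hc := EuclideanGeometry.continuousAt_angle (x := (a, v, b)) hav hbv
  refine (hc.tendsto.comp ((hvert a (by simp)).prodMk_nhds
    ((hvert v (by simp)).prodMk_nhds (hvert b (by simp))))).congr fun k => ?_
  have h := triangleAngle_image hav hbv hab (f := f k)
    fun x hx y hy h => (hf k).1 ⟨_, htm.1, hx⟩ ⟨_, htm.1, hy⟩ h
  refine h.symm.trans ?_
  congr!

lemma angleDefect_tendsto {Kseq : ℕ → EuclideanComplex n} {f : ℕ → 𝔼 → 𝔼} (hK : K.faces.Finite)
    (hf : ∀ k, IsSimplicialIso K.faces (Kseq k).faces (f k))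
    (ht : ∀ v ∈ K.vertices, Tendsto (fun k => f k v) atTop (𝓝 v)) {v : 𝔼} (hv : v ∈ K.vertices) :
    Tendsto (fun k => angleDefect n (Kseq k) (f k v)) atTop (𝓝 (angleDefect n K v)) :=
  tendsto_const_nhds.sub ((angleSum_tendsto hK hf ht hv).div_const _)

lemma sum_triangleAngle {t : Finset 𝔼} (ht : t.card = 3) :
    ∑ v ∈ t, triangleAngle v t = Real.pi := by
  obtain ⟨a, b, c, hab, hac, hbc, rfl⟩ := Finset.card_eq_three.1 ht
  rw [Finset.sum_insert (by simp [hab, hac]), Finset.sum_pair hbc,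
    triangleAngle_eq hab.symm hac.symm hbc]
  rw [show ({a, b, c} : Finset 𝔼) = {b, a, c} by rw [Finset.insert_comm],
    triangleAngle_eq hab hbc.symm hac,
    show ({b, a, c} : Finset 𝔼) = {c, a, b} by
      ext; simp only [Finset.mem_insert, Finset.mem_singleton]; tauto,
    triangleAngle_eq hac hbc hab]
  have := EuclideanGeometry.angle_add_angle_add_angle_eq_pi c (p₁ := a) (p₂ := b) hab.symm
  rw [EuclideanGeometry.angle_comm b a c, EuclideanGeometry.angle_comm a c b] 
  linarith

lemma ncard_vertices (K : EuclideanComplex n) : K.vertices.ncard = simplexCount K 0 := by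
  rw [simplexCount, ← Set.ncard_image_of_injective K.vertices Finset.singleton_injective]
  congr 1
  ext s
  simp only [Set.mem_image, SimplicialComplex.mem_vertices, Set.mem_ofPred_eq, zero_add]
  constructor
  · rintro ⟨x, hx, rfl⟩; simpa using hx
  · rintro ⟨h1, h2⟩
    obtain ⟨x, rfl⟩ := Finset.card_eq_one.1 h2
    exact ⟨x, h1, rfl⟩

/-- After exchanging the summations, each triangle contributes its angle sum `π`. No surface
hypothesis is needed here. -/
lemma finsum_angleDefect (hK : K.faces.Finite) :
    ∑ᶠ v ∈ K.vertices, angleDefect n K v = simplexCount K 0 - (simplexCount K 2 : ℝ) / 2 := by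
  have hV := SimplicialComplex.vertices_finite hK
  have hT : {t | t ∈ K.faces ∧ t.card = 3}.Finite := hK.subset fun _ h => h.1
  have hsum : ∑ v ∈ hV.toFinset, angleSum K v = Real.pi * simplexCount K 2 := by
    have h1 : ∀ v, angleSum K v =
        ∑ t ∈ hT.toFinset, if v ∈ t then triangleAngle v t else 0 := by
      intro v
      rw [angleSum, finsum_mem_eq_finite_toFinset_sum _ (trianglesAt_finite hK v),
        ← Finset.sum_filter]
      refine Finset.sum_congr ?_ fun _ _ => rfl
      ext t
      simp only [Set.Finite.mem_toFinset, Finset.mem_filter, trianglesAt, Set.mem_ofPred_eq]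
      tauto
    simp only [h1]
    rw [Finset.sum_comm]
    have h2 : ∀ t ∈ hT.toFinset,
        (∑ v ∈ hV.toFinset, if v ∈ t then triangleAngle v t else 0) = Real.pi := by
      intro t ht
      rw [Set.Finite.mem_toFinset] at ht
      rw [← Finset.sum_filter, ← sum_triangleAngle ht.2]
      refine Finset.sum_congr ?_ fun _ _ => rfl
      ext v
      simp only [Finset.mem_filter, Set.Finite.mem_toFinset, and_iff_right_iff_imp]
      exact fun hv => SimplicialComplex.mem_vertices_of_mem_face ht.1 hv
    rw [Finset.sum_congr rfl h2, Finset.sum_const, nsmul_eq_mul, mul_comm, simplexCount,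
      ← Set.ncard_eq_toFinset_card _ hT]
  rw [finsum_mem_eq_finite_toFinset_sum _ hV]
  simp only [angleDefect]
  rw [Finset.sum_sub_distrib, ← Finset.sum_div, hsum, Finset.sum_const, ← ncard_vertices,
    Set.ncard_eq_toFinset_card _ hV]
  have := Real.pi_ne_zero
  simp only [nsmul_eq_mul, mul_one]
  field_simp

/-- Double counting of incidences: a triangle has three edges, and an edge lies in two triangles. -/
lemma IsSimplicialSurface.three_mul_simplexCount (hK : IsSimplicialSurface K) :
    3 * simplexCount K 2 = 2 * simplexCount K 1 := by
  have hE : {t | t ∈ K.faces ∧ t.card = 2}.Finite := hK.finite_faces.subset fun _ h => h.1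
  have hT : {t | t ∈ K.faces ∧ t.card = 3}.Finite := hK.finite_faces.subset fun _ h => h.1
  have h := Finset.card_mul_eq_card_mul (s := hT.toFinset) (t := hE.toFinset)
    (fun t e => e ⊆ t) (m := 3) (n := 2) ?_ ?_
  · rw [simplexCount, simplexCount, Set.ncard_eq_toFinset_card _ hT, Set.ncard_eq_toFinset_card _ hE]
    linarith
  · intro t ht
    rw [Set.Finite.mem_toFinset] at ht
    have : Finset.bipartiteAbove (fun t e => e ⊆ t) hE.toFinset t = t.powersetCard 2 := by
      ext e
      simp only [Finset.bipartiteAbove, Finset.mem_filter, Set.Finite.mem_toFinset,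
        Finset.mem_powersetCard, Set.mem_ofPred_eq]
      constructor
      · rintro ⟨⟨-, h1⟩, h2⟩; exact ⟨h2, h1⟩
      · rintro ⟨h1, h2⟩
        exact ⟨⟨K.down_closed ht.1 h1 (Finset.card_pos.1 (by omega)), h2⟩, h1⟩
    rw [this, Finset.card_powersetCard, ht.2]; rfl
  · intro e he
    rw [Set.Finite.mem_toFinset] at he
    obtain ⟨a, b, hab, rfl⟩ := Finset.card_eq_two.1 he.2
    obtain ⟨c, d, hcd, h⟩ := hK.exists_two_triangles hab he.1
    obtain ⟨hca, hcb, hc⟩ := (h c).2 (Or.inl rfl)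
    obtain ⟨hda, hdb, hd⟩ := (h d).2 (Or.inr rfl)
    have : Finset.bipartiteBelow (fun t e => e ⊆ t) hT.toFinset ({a, b} : Finset 𝔼) =
        {{a, b, c}, {a, b, d}} := by
      ext t
      simp only [Finset.bipartiteBelow, Finset.mem_filter, Set.Finite.mem_toFinset,
        Set.mem_ofPred_eq, Finset.mem_insert, Finset.mem_singleton]
      constructor
      · rintro ⟨⟨h1, h2⟩, h3⟩
        obtain ⟨z, hz⟩ : ∃ z, t \ {a, b} = {z} := by
          rw [← Finset.card_eq_one, Finset.card_sdiff_of_subset h3, h2, he.2]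
        have hzt : z ∈ t \ {a, b} := by rw [hz]; simp
        simp only [Finset.mem_sdiff, Finset.mem_insert, Finset.mem_singleton, not_or] at hzt
        have ht : t = {a, b, z} := by
          rw [← Finset.union_sdiff_of_subset h3, hz]
          ext; simp
        rcases (h z).1 ⟨hzt.2.1, hzt.2.2, ht ▸ h1⟩ with rfl | rfl
        · exact Or.inl ht
        · exact Or.inr ht
      · rintro (rfl | rfl)
        · exact ⟨⟨hc, Finset.card_eq_three.2 ⟨a, b, c, hab, hca.symm, hcb.symm, rfl⟩⟩,
            by intro x; simp; tauto⟩
        · exact ⟨⟨hd, Finset.card_eq_three.2 ⟨a, b, d, hab, hda.symm, hdb.symm, rfl⟩⟩,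
            by intro x; simp; tauto⟩
    rw [this, Finset.card_pair]
    intro heq
    have : c ∈ ({a, b, d} : Finset 𝔼) := heq ▸ (by simp)
    simp only [Finset.mem_insert, Finset.mem_singleton] at this
    tauto

lemma IsSimplicialSurface.eulerCharacteristic_eq (hK : IsSimplicialSurface K) :
    (eulerCharacteristic K : ℝ) = simplexCount K 0 - (simplexCount K 2 : ℝ) / 2 := by
  have h : (3 * simplexCount K 2 : ℝ) = 2 * simplexCount K 1 := by
    exact_mod_cast hK.three_mul_simplexCount
  rw [eulerCharacteristic]
  push_cast
  linarith

lemma IsSimplicialSurface.finsum_angleDefect (hK : IsSimplicialSurface K) :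
    ∑ᶠ v ∈ K.vertices, angleDefect n K v = eulerCharacteristic K := by
  rw [hK.eulerCharacteristic_eq, _root_.finsum_angleDefect hK.finite_faces]

end AngleSums

/-! ### Areas of circular sectors. -/

section SectorArea

open MeasureTheory

/-- The circular sector of radius `r` between the directions `0` and `θ`. -/
def planarSector (θ r : ℝ) : Set ℂ :=
  {z | 0 ≤ z.im ∧ z.im * Real.cos θ ≤ z.re * Real.sin θ ∧ ‖z‖ ≤ r}

lemma isClosed_planarSector (θ r : ℝ) : IsClosed (planarSector θ r) := by
  have h : planarSector θ r = {z | 0 ≤ z.im} ∩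
      ({z | z.im * Real.cos θ ≤ z.re * Real.sin θ} ∩ {z | ‖z‖ ≤ r}) := by
    ext z; simp [planarSector]
  rw [h]
  refine IsClosed.inter (isClosed_le continuous_const Complex.continuous_im)
    (IsClosed.inter (isClosed_le ?_ ?_) (isClosed_le continuous_norm continuous_const))
  · exact Complex.continuous_im.mul continuous_const
  · exact Complex.continuous_re.mul continuous_const

lemma polarCoord_symm_mem_planarSector {θ r : ℝ} (h0 : 0 < θ) (hpi : θ < Real.pi) {p : ℝ × ℝ}
    (hp : p ∈ polarCoord.target) :
    Complex.polarCoord.symm p ∈ planarSector θ r ↔ p.1 ≤ r ∧ p.2 ∈ Set.Icc 0 θ := by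
  obtain ⟨h1, h2⟩ : 0 < p.1 ∧ p.2 ∈ Set.Ioo (-Real.pi) Real.pi := hp
  have hre : (Complex.polarCoord.symm p).re = p.1 * Real.cos p.2 := by
    rw [Complex.polarCoord_symm_apply, Complex.re_ofReal_mul]; simp [-Complex.ofReal_cos, -Complex.ofReal_sin]
  have him : (Complex.polarCoord.symm p).im = p.1 * Real.sin p.2 := by
    rw [Complex.polarCoord_symm_apply, Complex.im_ofReal_mul]; simp [-Complex.ofReal_cos, -Complex.ofReal_sin]
  have hmem : Complex.polarCoord.symm p ∈ planarSector θ r ↔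
      0 ≤ p.1 * Real.sin p.2 ∧ p.1 * Real.sin p.2 * Real.cos θ ≤ p.1 * Real.cos p.2 * Real.sin θ ∧
        p.1 ≤ r := by
    have : ‖Complex.polarCoord.symm p‖ = p.1 := by
      rw [Complex.norm_polarCoord_symm, abs_of_pos h1]
    rw [planarSector, Set.mem_ofPred_eq, hre, him, this]
  have hsub : p.1 * Real.cos p.2 * Real.sin θ - p.1 * Real.sin p.2 * Real.cos θ =
      p.1 * Real.sin (θ - p.2) := by rw [Real.sin_sub]; ring
  rw [hmem, ← sub_nonneg (b := p.1 * Real.sin p.2 * Real.cos θ), hsub, mul_nonneg_iff_of_pos_left h1,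
    mul_nonneg_iff_of_pos_left h1]
  constructor
  · rintro ⟨h3, h4, h5⟩
    have h6 : 0 ≤ p.2 := by
      by_contra! h
      exact absurd h3 (Real.sin_neg_of_neg_of_neg_pi_lt h h2.1).not_ge
    refine ⟨h5, h6, ?_⟩
    by_contra! h
    exact absurd h4 (Real.sin_neg_of_neg_of_neg_pi_lt (by linarith) (by linarith [h2.2])).not_ge
  · rintro ⟨h3, h4, h5⟩
    exact ⟨Real.sin_nonneg_of_nonneg_of_le_pi h4 (by linarith),
      Real.sin_nonneg_of_nonneg_of_le_pi (by linarith) (by linarith), h3⟩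

/-- In polar coordinates the sector is a rectangle with density equal to the radius. -/
lemma volume_planarSector {θ r : ℝ} (h0 : 0 < θ) (hpi : θ < Real.pi) (hr : 0 < r) :
    volume (planarSector θ r) = ENNReal.ofReal (θ * (r ^ 2 / 2)) := by
  have hm := (isClosed_planarSector θ r).measurableSet
  rw [← lintegral_indicator_one hm, ← Complex.lintegral_comp_polarCoord_symm]
  have hset : MeasurableSet (Set.Ioc 0 r ×ˢ Set.Icc 0 θ : Set (ℝ × ℝ)) :=
    measurableSet_Ioc.prod measurableSet_Icc
  have h : ∀ p ∈ polarCoord.target, ENNReal.ofReal p.1 •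
      (planarSector θ r).indicator (1 : ℂ → ENNReal) (Complex.polarCoord.symm p) =
      (Set.Ioc 0 r ×ˢ Set.Icc 0 θ : Set (ℝ × ℝ)).indicator (fun p => ENNReal.ofReal p.1) p := by
    intro p hp
    have h1 : 0 < p.1 := hp.1
    by_cases hq : Complex.polarCoord.symm p ∈ planarSector θ r
    · have := (polarCoord_symm_mem_planarSector h0 hpi hp).1 hq
      have h2 : p ∈ (Set.Ioc 0 r ×ˢ Set.Icc 0 θ : Set (ℝ × ℝ)) := ⟨⟨h1, this.1⟩, this.2⟩
      rw [Set.indicator_of_mem hq, Set.indicator_of_mem h2]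
      simp
    · have := mt (polarCoord_symm_mem_planarSector (r := r) h0 hpi hp).2 hq
      rw [Set.indicator_of_notMem hq, Set.indicator_of_notMem fun h => this ⟨h.1.2, h.2⟩]
      simp
  rw [setLIntegral_congr_fun polarCoord.open_target.measurableSet h, setLIntegral_indicator hset,
    Set.inter_eq_left.2]
  · rw [Measure.volume_eq_prod, ← Measure.prod_restrict]
    have := lintegral_prod_mul (μ := volume.restrict (Set.Ioc 0 r))
      (ν := volume.restrict (Set.Icc 0 θ)) (f := fun x => ENNReal.ofReal x) (g := 1)
      (by fun_prop) (by fun_prop)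
    simp only [Pi.one_apply, mul_one] at this
    rw [this, lintegral_one, Measure.restrict_apply_univ, Real.volume_Icc,
      ← ofReal_integral_eq_lintegral_ofReal, ← intervalIntegral.integral_of_le hr.le, integral_id,
      ← ENNReal.ofReal_mul (by norm_num; positivity)]
    · congr 1; ring
    · exact (continuous_id.integrableOn_Icc (a := 0) (b := r)).mono_set Set.Ioc_subset_Icc_self
    · exact (ae_restrict_mem measurableSet_Ioc).mono fun x hx => hx.1.le
  · rintro p ⟨h1, h2⟩
    exact ⟨h1.1, by constructor <;> [linarith [h2.1, Real.pi_pos]; linarith [h2.2]]⟩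

variable {V : Type*} [NormedAddCommGroup V] [InnerProductSpace ℝ V]

open InnerProductGeometry in
/-- Orthonormal coordinates in the plane of two vectors. -/
lemma exists_isometry_complex {u w : V} (hu : u ≠ 0) (hw : w ≠ 0) (h0 : 0 < angle u w)
    (hpi : angle u w < Real.pi) : ∃ f : ℂ →ₗᵢ[ℝ] V, f (‖u‖ : ℂ) = u ∧
      f (‖w‖ * (Real.cos (angle u w) + Real.sin (angle u w) * Complex.I)) = w := by
  have hs := Real.sin_pos_of_pos_of_lt_pi h0 hpi
  have hsc := Real.sin_sq_add_cos_sq (angle u w)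
  have hc := (cos_angle u w).symm
  set s := Real.sin (angle u w)
  set c := Real.cos (angle u w)
  have hun : ‖u‖ ≠ 0 := norm_ne_zero_iff.2 hu
  have hwn : ‖w‖ ≠ 0 := norm_ne_zero_iff.2 hw
  obtain ⟨e₁, he₁⟩ : ∃ e : V, e = ‖u‖⁻¹ • u := ⟨_, rfl⟩
  obtain ⟨w₁, hw₁⟩ : ∃ e : V, e = ‖w‖⁻¹ • w := ⟨_, rfl⟩
  obtain ⟨e₂, he₂⟩ : ∃ e : V, e = s⁻¹ • (w₁ - c • e₁) := ⟨_, rfl⟩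
  have h11 : inner ℝ e₁ e₁ = 1 := by
    simp only [he₁, inner_smul_left, inner_smul_right, real_inner_self_eq_norm_sq]
    simp; field_simp
  have h1w : inner ℝ e₁ w₁ = c := by
    rw [← hc]
    simp only [he₁, hw₁, inner_smul_left, inner_smul_right]
    simp; field_simp
  have hww : inner ℝ w₁ w₁ = 1 := by
    simp only [hw₁, inner_smul_left, inner_smul_right, real_inner_self_eq_norm_sq]
    simp; field_simp
  have h12 : inner ℝ e₁ e₂ = 0 := by
    rw [he₂, inner_smul_right, inner_sub_right, h1w, inner_smul_right, h11]; ring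
  have h22 : inner ℝ e₂ e₂ = 1 := by
    rw [he₂, inner_smul_right, inner_smul_left, inner_sub_left, inner_sub_right, inner_sub_right,
      hww, inner_smul_left, h1w, inner_smul_left, inner_smul_right, inner_smul_right, h11,
      real_inner_comm e₁ w₁, h1w]
    simp only [conj_trivial]
    field_simp
    linarith
  let g : ℂ →ₗ[ℝ] V := Complex.reLm.smulRight e₁ + Complex.imLm.smulRight e₂
  have hg : ∀ z : ℂ, g z = z.re • e₁ + z.im • e₂ := fun z => rfl
  have hnorm : ∀ z : ℂ, ‖g z‖ = ‖z‖ := by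
    intro z
    rw [← sq_eq_sq₀ (norm_nonneg _) (norm_nonneg _), ← real_inner_self_eq_norm_sq, hg,
      inner_add_left, inner_add_right, inner_add_right, inner_smul_left, inner_smul_left,
      inner_smul_left, inner_smul_left, inner_smul_right, inner_smul_right, inner_smul_right,
      inner_smul_right, h11, h22, h12, real_inner_comm e₁ e₂, h12, ← Complex.normSq_eq_norm_sq,
      Complex.normSq_apply]
    simp only [conj_trivial]
    ring
  refine ⟨⟨g, hnorm⟩, ?_, ?_⟩
  · change g _ = _
    rw [hg, he₁]
    simp [smul_smul, hun]
  · change g _ = _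
    rw [hg]
    have h1 : ((‖w‖ : ℂ) * ((c : ℂ) + (s : ℂ) * Complex.I)).re = ‖w‖ * c := by simp
    have h2 : ((‖w‖ : ℂ) * ((c : ℂ) + (s : ℂ) * Complex.I)).im = ‖w‖ * s := by simp
    have h3 : (‖w‖ * s) • e₂ = w - (‖w‖ * c) • e₁ := by
      rw [he₂, smul_smul, mul_assoc, mul_inv_cancel₀ hs.ne', mul_one, smul_sub, smul_smul, hw₁,
        smul_smul, mul_inv_cancel₀ hwn, one_smul]
    rw [h1, h2, h3]
    abel

open InnerProductGeometry in
lemma image_planarSector {u w : V} (hu : u ≠ 0) (hw : w ≠ 0) (h0 : 0 < angle u w)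
    (hpi : angle u w < Real.pi) {f : ℂ →ₗᵢ[ℝ] V} (hfu : f (‖u‖ : ℂ) = u)
    (hfw : f (‖w‖ * (Real.cos (angle u w) + Real.sin (angle u w) * Complex.I)) = w) (r : ℝ) :
    f '' planarSector (angle u w) r =
      {x | ‖x‖ ≤ r ∧ ∃ α β : ℝ, 0 ≤ α ∧ 0 ≤ β ∧ x = α • u + β • w} := by
  have hs := Real.sin_pos_of_pos_of_lt_pi h0 hpi
  set s := Real.sin (angle u w) with hsdef
  set c := Real.cos (angle u w) with hcdef
  have hun : 0 < ‖u‖ := norm_pos_iff.2 hu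
  have hwn : 0 < ‖w‖ := norm_pos_iff.2 hw
  have key : ∀ α β : ℝ, α • u + β • w = f ⟨α * ‖u‖ + β * ‖w‖ * c, β * ‖w‖ * s⟩ := by
    intro α β
    have : (⟨α * ‖u‖ + β * ‖w‖ * c, β * ‖w‖ * s⟩ : ℂ) =
        α • (‖u‖ : ℂ) + β • (‖w‖ * (c + s * Complex.I)) := by
      apply Complex.ext <;> simp <;> ring
    rw [this, map_add, map_smul, map_smul, hfu, hfw]
  ext x
  constructor
  · rintro ⟨z, ⟨h1, h2, h3⟩, rfl⟩
    refine ⟨by rwa [f.norm_map], (z.re - z.im * c / s) / ‖u‖, z.im / s / ‖w‖, ?_, by positivity, ?_⟩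
    · refine div_nonneg ?_ hun.le
      rw [sub_nonneg, div_le_iff₀ hs]
      exact h2
    · rw [key]
      congr 1
      apply Complex.ext
      · simp only; field_simp; ring
      · simp only; field_simp
  · rintro ⟨h1, α, β, hα, hβ, rfl⟩
    rw [key] at h1 ⊢
    refine ⟨_, ⟨?_, ?_, ?_⟩, rfl⟩
    · simp only; positivity
    · simp only; rw [← hsdef, ← hcdef]
      have : 0 ≤ α * ‖u‖ * s := by positivity
      linarith
    · rwa [f.norm_map] at h1

variable [MeasurableSpace V] [BorelSpace V]

open InnerProductGeometry in
-- Hausdorff measure is preserved by the isometric embedding of `ℂ` as the plane of `u` and `w`, so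
-- the planar area formula holds in any ambient space.
lemma measure_sector {u w : V} (hu : u ≠ 0) (hw : w ≠ 0) (h0 : 0 < angle u w)
    (hpi : angle u w < Real.pi) {r : ℝ} (hr : 0 < r) :
    μHE[2] {x : V | ‖x‖ ≤ r ∧ ∃ α β : ℝ, 0 ≤ α ∧ 0 ≤ β ∧ x = α • u + β • w} =
      ENNReal.ofReal (angle u w * (r ^ 2 / 2)) := by
  obtain ⟨f, hfu, hfw⟩ := exists_isometry_complex hu hw h0 hpi
  rw [← image_planarSector hu hw h0 hpi hfu hfw, f.isometry.euclideanHausdorffMeasure_image,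
    ← volume_planarSector h0 hpi hr, ← InnerProductSpace.euclideanHausdorffMeasure_eq_volume,
    Complex.finrank_real_complex]

/-- A set of finite one-dimensional measure has two-dimensional measure zero. -/
lemma measure_segment (x y : V) : μHE[2] (segment ℝ x y) = 0 := by
  have h : μHE[1] (segment ℝ x y) ≠ ⊤ := by
    have h1 : μH[((1 : ℕ) : ℝ)] (segment ℝ x y) = edist x y := by
      rw [Nat.cast_one, hausdorffMeasure_segment]
    rw [Measure.euclideanHausdorffMeasure_def, Measure.smul_apply, h1]
    exact ENNReal.mul_ne_top (by simp) (edist_ne_top _ _)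
  exact (Measure.euclideanHausdorffMeasure_zero_or_top (by norm_num : 1 < 2) _).resolve_right h

lemma measure_convexHull_of_card_le_two {s : Finset V} (hs : s.card ≤ 2) :
    μHE[2] (convexHull ℝ (s : Set V)) = 0 := by
  classical
  obtain h | h | h : s.card = 0 ∨ s.card = 1 ∨ s.card = 2 := by omega
  · simp [Finset.card_eq_zero.1 h]
  · obtain ⟨a, rfl⟩ := Finset.card_eq_one.1 h
    simpa using measure_segment a a
  · obtain ⟨a, b, -, rfl⟩ := Finset.card_eq_two.1 h
    rw [Finset.coe_pair, convexHull_pair]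
    exact measure_segment a b

end SectorArea

/-! ### Angle sums as local areas; invariance under subdivision. -/

section LocalArea

open MeasureTheory

variable {n : ℕ} {K : EuclideanComplex n}

local notation "𝔼" => EuclideanSpace ℝ (Fin n)

lemma not_collinear_of_mem_faces {v a b : EuclideanSpace ℝ (Fin n)} (h : ({v, a, b} : Finset 𝔼) ∈ K.faces)
    (hav : a ≠ v) (hbv : b ≠ v) (hab : a ≠ b) : ¬ Collinear ℝ {a, v, b} := by
  have hc : Fintype.card ({v, a, b} : Finset 𝔼) = 2 + 1 := by
    rw [Fintype.card_coe]
    exact Finset.card_eq_three.2 ⟨v, a, b, hav.symm, hbv.symm, hab, rfl⟩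
  have h1 := (K.indep h).finrank_vectorSpan hc
  rw [collinear_iff_finrank_le_one]
  have h2 : Set.range (Subtype.val : ({v, a, b} : Finset 𝔼) → 𝔼) = {a, v, b} := by
    rw [Subtype.range_coe_subtype]
    ext x
    simp only [Finset.mem_insert, Finset.mem_singleton, Set.mem_ofPred_eq, Set.mem_insert_iff,
      Set.mem_singleton_iff]
    tauto
  rw [h2] at h1
  omega

lemma angle_pos_of_mem_faces {v a b : EuclideanSpace ℝ (Fin n)} (h : ({v, a, b} : Finset 𝔼) ∈ K.faces)
    (hav : a ≠ v) (hbv : b ≠ v) (hab : a ≠ b) : 0 < EuclideanGeometry.angle a v b := by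
  refine lt_of_le_of_ne (EuclideanGeometry.angle_nonneg _ _ _) fun h0 => ?_
  refine not_collinear_of_mem_faces h hav hbv hab ?_
  rw [EuclideanGeometry.collinear_iff_eq_or_eq_or_angle_eq_zero_or_angle_eq_pi]
  tauto

lemma angle_lt_pi_of_mem_faces {v a b : EuclideanSpace ℝ (Fin n)} (h : ({v, a, b} : Finset 𝔼) ∈ K.faces)
    (hav : a ≠ v) (hbv : b ≠ v) (hab : a ≠ b) : EuclideanGeometry.angle a v b < Real.pi := by
  refine lt_of_le_of_ne (EuclideanGeometry.angle_le_pi _ _ _) fun h0 => ?_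
  refine not_collinear_of_mem_faces h hav hbv hab ?_
  rw [EuclideanGeometry.collinear_iff_eq_or_eq_or_angle_eq_zero_or_angle_eq_pi]
  tauto

lemma mem_convexHull_triple {v a b y : EuclideanSpace ℝ (Fin n)} :
    y ∈ convexHull ℝ (({v, a, b} : Finset 𝔼) : Set 𝔼) ↔
      ∃ α β : ℝ, 0 ≤ α ∧ 0 ≤ β ∧ α + β ≤ 1 ∧ y = v + (α • (a - v) + β • (b - v)) := by
  constructor
  · intro h
    rw [Finset.coe_insert, Finset.coe_pair, convexHull_insert (by simp), convexHull_pair,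
      convexJoin_singleton_left, Set.mem_iUnion₂] at h
    obtain ⟨z, hz, hy⟩ := h
    rw [segment_eq_image'] at hz hy
    obtain ⟨τ, hτ, rfl⟩ := hz
    obtain ⟨t, ht, rfl⟩ := hy
    refine ⟨t * (1 - τ), t * τ, mul_nonneg ht.1 (by linarith [hτ.2]), mul_nonneg ht.1 hτ.1,
      by nlinarith [ht.2], ?_⟩
    simp only
    module
  · rintro ⟨α, β, hα, hβ, hs, rfl⟩
    have h := SimplicialComplex.combo_mem_convexHull (a := v) (b := a) (c := b) (sub_nonneg.2 hs) hα hβ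
      (by ring)
    convert h using 1
    module

lemma isClosed_convexHull_finset (s : Finset 𝔼) : IsClosed (convexHull ℝ (s : Set 𝔼)) :=
  (Set.Finite.isCompact_convexHull (𝕜 := ℝ) s.finite_toSet).isClosed

lemma notMem_convexHull_pair {v a b : EuclideanSpace ℝ (Fin n)}
    (h : ({v, a, b} : Finset 𝔼) ∈ K.faces) (hav : a ≠ v) (hbv : b ≠ v) :
    v ∉ convexHull ℝ (({a, b} : Finset 𝔼) : Set 𝔼) := by
  intro hv
  have h1 : ({a, b} : Finset 𝔼) ∈ K.faces :=
    K.down_closed h (Finset.subset_insert _ _) (Finset.insert_nonempty _ _)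
  have h2 : v ∈ ({a, b} : Finset 𝔼) := SimplicialComplex.vertex_mem_of_mem_convexHull h1
    (SimplicialComplex.mem_vertices_of_mem_face h (Finset.mem_insert_self _ _)) hv
  rcases Finset.mem_insert.1 h2 with h2 | h2
  · exact hav h2.symm
  · exact hbv (Finset.mem_singleton.1 h2).symm

/-- A vector of the cone with `α + β > 1` is a multiple, with factor above `1`, of a vector from `v`
to the opposite side, so it is longer than the distance from `v` to that side. Thus small balls cut
the same set from the triangle as from the cone. -/
lemma add_le_one_of_norm_le {v a b : EuclideanSpace ℝ (Fin n)} {r α β : ℝ}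
    (hr : r < Metric.infDist v (convexHull ℝ (({a, b} : Finset 𝔼) : Set 𝔼)))
    (hα : 0 ≤ α) (hβ : 0 ≤ β) (hx : ‖α • (a - v) + β • (b - v)‖ ≤ r) : α + β ≤ 1 := by
  by_contra! hs
  have hs0 : 0 < α + β := by linarith
  obtain ⟨z, hz⟩ : ∃ z : 𝔼, z = (α / (α + β)) • a + (β / (α + β)) • b := ⟨_, rfl⟩
  have hzmem : z ∈ convexHull ℝ (({a, b} : Finset 𝔼) : Set 𝔼) := by
    rw [Finset.coe_pair, convexHull_pair]
    exact ⟨_, _, by positivity, by positivity, by field_simp, hz.symm⟩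
  have h1 := Metric.infDist_le_dist_of_mem (x := v) hzmem
  have h2 : α • (a - v) + β • (b - v) = (α + β) • (z - v) := by
    have h3 : (α + β) • z = α • a + β • b := by
      rw [hz, smul_add, smul_smul, smul_smul, mul_div_cancel₀ _ hs0.ne', mul_div_cancel₀ _ hs0.ne']
    rw [smul_sub (α + β), h3]
    module
  rw [h2, norm_smul, ← dist_eq_norm, dist_comm, Real.norm_eq_abs, abs_of_pos hs0] at hx
  have h3 : 0 ≤ dist v z := dist_nonneg
  nlinarith

lemma convexHull_triple_inter_closedBall {v a b : EuclideanSpace ℝ (Fin n)} {r : ℝ}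
    (hr : r < Metric.infDist v (convexHull ℝ (({a, b} : Finset 𝔼) : Set 𝔼))) :
    convexHull ℝ ((({v, a, b} : Finset 𝔼)) : Set 𝔼) ∩ Metric.closedBall v r =
      (fun x => v + x) '' {x : 𝔼 | ‖x‖ ≤ r ∧
        ∃ α β : ℝ, 0 ≤ α ∧ 0 ≤ β ∧ x = α • (a - v) + β • (b - v)} := by
  ext y
  constructor
  · rintro ⟨hy, hyr⟩
    obtain ⟨α, β, hα, hβ, hs, rfl⟩ := mem_convexHull_triple.1 hy
    refine ⟨_, ⟨?_, α, β, hα, hβ, rfl⟩, rfl⟩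
    rw [Metric.mem_closedBall, dist_eq_norm] at hyr
    rwa [add_sub_cancel_left] at hyr
  · rintro ⟨x, ⟨hx, α, β, hα, hβ, rfl⟩, rfl⟩
    refine ⟨?_, ?_⟩
    · exact mem_convexHull_triple.2 ⟨α, β, hα, hβ, add_le_one_of_norm_le hr hα hβ hx, rfl⟩
    · rw [Metric.mem_closedBall, dist_eq_norm]
      simpa only [add_sub_cancel_left] using hx

lemma measure_triangle_inter_closedBall {v : EuclideanSpace ℝ (Fin n)} {t : Finset 𝔼}
    (ht : t ∈ trianglesAt K.faces v) :
    ∀ᶠ r in 𝓝[>] (0 : ℝ), μHE[2] (convexHull ℝ (t : Set 𝔼) ∩ Metric.closedBall v r) =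
      ENNReal.ofReal (triangleAngle v t * (r ^ 2 / 2)) := by
  obtain ⟨a, b, hav, hbv, hab, rfl⟩ := exists_of_mem_trianglesAt ht
  have htK := ht.1
  have hpos := angle_pos_of_mem_faces htK hav hbv hab
  have hlt := angle_lt_pi_of_mem_faces htK hav hbv hab
  rw [triangleAngle_eq hav hbv hab]
  have hd := ((isClosed_convexHull_finset {a, b}).notMem_iff_infDist_pos
    ⟨a, subset_convexHull ℝ _ (Finset.mem_coe.2 (Finset.mem_insert_self _ _))⟩).1
    (notMem_convexHull_pair htK hav hbv)
  filter_upwards [Ioo_mem_nhdsGT hd] with r hr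
  have hiso : Isometry fun x : 𝔼 => v + x := isometry_add_left v
  rw [convexHull_triple_inter_closedBall hr.2, hiso.euclideanHausdorffMeasure_image]
  exact measure_sector (sub_ne_zero.2 hav) (sub_ne_zero.2 hbv) hpos hlt hr.1

/-- Near a vertex, the area of the underlying space is proportional to the angle sum. -/
lemma measure_space_inter_closedBall (hK : K.faces.Finite) (hcard : ∀ s ∈ K.faces, s.card ≤ 3)
    {v : EuclideanSpace ℝ (Fin n)} (hv : v ∈ K.vertices) :
    ∀ᶠ r in 𝓝[>] (0 : ℝ), μHE[2] (K.space ∩ Metric.closedBall v r) =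
      ENNReal.ofReal (angleSum K v * (r ^ 2 / 2)) := by
  have hfin := trianglesAt_finite hK v
  have h1 : ∀ᶠ r in 𝓝[>] (0 : ℝ), ∀ t ∈ hfin.toFinset,
      μHE[2] (convexHull ℝ (t : Set 𝔼) ∩ Metric.closedBall v r) =
        ENNReal.ofReal (triangleAngle v t * (r ^ 2 / 2)) :=
    (Finset.eventually_all _).2 fun t ht => measure_triangle_inter_closedBall (hfin.mem_toFinset.1 ht)
  have h2 : ∀ᶠ r in 𝓝[>] (0 : ℝ), ∀ t ∈ hK.toFinset, v ∉ t →
      Disjoint (convexHull ℝ (t : Set 𝔼)) (Metric.closedBall v r) := by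
    refine (Finset.eventually_all _).2 fun t ht => ?_
    by_cases hvt : v ∈ t
    · exact Eventually.of_forall fun r h => absurd hvt h
    · have hnot : v ∉ convexHull ℝ (t : Set 𝔼) := fun h =>
        hvt (SimplicialComplex.vertex_mem_of_mem_convexHull (hK.mem_toFinset.1 ht) hv h)
      have hne : (convexHull ℝ (t : Set 𝔼)).Nonempty :=
        convexHull_nonempty_iff.2 (K.nonempty_of_mem_faces (hK.mem_toFinset.1 ht))
      have hd := ((isClosed_convexHull_finset t).notMem_iff_infDist_pos hne).1 hnot
      filter_upwards [Ioo_mem_nhdsGT hd] with r hr _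
      rw [Set.disjoint_left]
      intro y hy hyr
      have := Metric.infDist_le_dist_of_mem (x := v) hy
      rw [Metric.mem_closedBall, dist_comm] at hyr
      linarith [hr.2]
  filter_upwards [h1, h2, self_mem_nhdsWithin] with r h1 h2 hr
  -- The union of the vertices and edges is null, so only the triangles at `v` contribute to the
  -- area in a small ball.
  set L : Set 𝔼 := ⋃ s ∈ {s | s ∈ K.faces ∧ s.card ≤ 2}, convexHull ℝ (s : Set 𝔼) with hL
  have hL0 : μHE[2] L = 0 := by
    rw [hL, measure_biUnion_null_iff (hK.subset fun s hs => hs.1).countable]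
    exact fun s hs => measure_convexHull_of_card_le_two hs.2
  have hcover : K.space ∩ Metric.closedBall v r ⊆
      (⋃ t ∈ hfin.toFinset, convexHull ℝ (t : Set 𝔼) ∩ Metric.closedBall v r) ∪ L := by
    rintro y ⟨hy, hyr⟩
    obtain ⟨s, hs, hys⟩ := SimplicialComplex.mem_space_iff.1 hy
    by_cases hc : s.card ≤ 2
    · exact Or.inr (Set.mem_biUnion (show s ∈ {s | s ∈ K.faces ∧ s.card ≤ 2} from ⟨hs, hc⟩) hys)
    · have hvs : v ∈ s := by
        by_contra hvs
        exact Set.disjoint_left.1 (h2 s (hK.mem_toFinset.2 hs) hvs) hys hyr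
      have : s ∈ hfin.toFinset :=
        hfin.mem_toFinset.2 ⟨hs, hvs, by have := hcard s hs; omega⟩
      exact Or.inl (Set.mem_biUnion this ⟨hys, hyr⟩)
  have hsub : (⋃ t ∈ hfin.toFinset, convexHull ℝ (t : Set 𝔼) ∩ Metric.closedBall v r) ⊆
      K.space ∩ Metric.closedBall v r := by
    refine Set.iUnion₂_subset fun t ht y hy => ⟨?_, hy.2⟩
    exact SimplicialComplex.mem_space_iff.2 ⟨t, (hfin.mem_toFinset.1 ht).1, hy.1⟩
  have heq : μHE[2] (K.space ∩ Metric.closedBall v r) =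
      μHE[2] (⋃ t ∈ hfin.toFinset, convexHull ℝ (t : Set 𝔼) ∩ Metric.closedBall v r) := by
    refine le_antisymm ((measure_mono hcover).trans ((measure_union_le _ _).trans ?_))
      (measure_mono hsub)
    rw [hL0, add_zero]
  -- Distinct triangles meet in the hull of at most two vertices, so they are disjoint up to null
  -- sets and their areas add.
  rw [heq, measure_biUnion_finset₀]
  · rw [Finset.sum_congr rfl h1, ← ENNReal.ofReal_sum_of_nonneg, ← Finset.sum_mul, angleSum,
      finsum_mem_eq_finite_toFinset_sum _ hfin]
    intro t ht
    obtain ⟨a, b, hav, hbv, hab, rfl⟩ := exists_of_mem_trianglesAt (hfin.mem_toFinset.1 ht)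
    rw [triangleAngle_eq hav hbv hab]
    have := EuclideanGeometry.angle_nonneg a v b
    positivity
  · intro t ht t' ht' hne
    have ht := hfin.mem_toFinset.1 ht
    have ht' := hfin.mem_toFinset.1 ht'
    have hc : (t ∩ t').card ≤ 2 := by
      by_contra! hc
      have e1 : t ∩ t' = t := Finset.eq_of_subset_of_card_le Finset.inter_subset_left
        (by rw [ht.2.2]; omega)
      have e2 : t ∩ t' = t' := Finset.eq_of_subset_of_card_le Finset.inter_subset_right
        (by rw [ht'.2.2]; omega)
      exact hne (e1.symm.trans e2)
    refine measure_mono_null ?_ (measure_convexHull_of_card_le_two hc)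
    rw [Finset.coe_inter]
    exact fun y hy => K.inter_subset_convexHull ht.1 ht'.1 ⟨hy.1.1, hy.2.1⟩
  · intro t _
    exact ((isClosed_convexHull_finset t).inter
      Metric.isClosed_closedBall).measurableSet.nullMeasurableSet

/-- A vertex of `K` is an extreme point of each simplex that contains it: the points of the simplex
with coordinate below `1` at `v` form a convex set. A simplex of `J` through `v` must therefore have
`v` as a vertex. -/
lemma IsSubdivision.vertices_subset {J : EuclideanComplex n} (h : IsSubdivision J K) :
    K.vertices ⊆ J.vertices := by
  intro v hv
  have hvs : v ∈ J.space := by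
    rw [h.space_eq]
    exact K.subset_space hv (by simp)
  obtain ⟨s, hs, hvs⟩ := SimplicialComplex.mem_space_iff.1 hvs
  obtain ⟨t, ht, hst⟩ := h.refines s hs
  suffices v ∈ s from SimplicialComplex.mem_vertices_of_mem_face hs this
  by_contra hnot
  have hconv : Convex ℝ {y | y ∈ convexHull ℝ (t : Set 𝔼) ∧ K.coord y v < 1} := by
    rintro x ⟨hx, hx'⟩ y ⟨hy, hy'⟩ α β hα hβ hαβ
    refine ⟨convex_convexHull ℝ _ hx hy hα hβ hαβ, ?_⟩
    rw [SimplicialComplex.coord_combo ht hx hy hα hβ hαβ]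
    simp only [Finsupp.add_apply, Finsupp.smul_apply, smul_eq_mul]
    rcases hα.eq_or_lt with rfl | hα
    · obtain rfl : β = 1 := by linarith
      linarith
    · nlinarith
  have hsub : (s : Set 𝔼) ⊆ {y | y ∈ convexHull ℝ (t : Set 𝔼) ∧ K.coord y v < 1} := by
    intro y hy
    have hyt : y ∈ convexHull ℝ (t : Set 𝔼) := hst (subset_convexHull ℝ _ hy)
    refine ⟨hyt, ?_⟩
    by_contra! h1
    obtain ⟨w, hw, hwy, -⟩ := SimplicialComplex.exists_weight_of_mem_convexHull ht hyt
    have hcw : K.coord y = w := by rw [← hwy]; exact SimplicialComplex.coord_eq hw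
    rw [hcw] at h1
    have hsupp : w.support ⊆ insert v w.support := Finset.subset_insert _ _
    have htot := hw.total
    rw [weightTotal_eq_sum hsupp, ← Finset.add_sum_erase _ _ (Finset.mem_insert_self v _)] at htot
    have hz : ∑ x ∈ (insert v w.support).erase v, w x = 0 :=
      le_antisymm (by linarith) (Finset.sum_nonneg fun x _ => hw.nonneg x)
    have hw1 : w = Finsupp.single v 1 := by
      ext x
      by_cases hx : x = v
      · subst hx; rw [Finsupp.single_eq_same]; linarith
      · rw [Finsupp.single_eq_of_ne hx]
        by_contra hne
        exact hne ((Finset.sum_eq_zero_iff_of_nonneg fun x _ => hw.nonneg x).1 hz x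
          (by simp [hx, hne]))
    rw [hw1, weightBarycenter_single, one_smul] at hwy
    exact hnot (hwy ▸ hy)
  have := (convexHull_min hsub hconv hvs).2
  rw [SimplicialComplex.coord_vertex hv] at this
  simp at this

/-- Both angle sums are read off from the area of the same set, since a subdivision does not change
the underlying space. -/
lemma angleSum_eq_of_isSubdivision {J : EuclideanComplex n} (hK : IsSimplicialSurface K)
    (hJ : IsSimplicialSurface J) (h : IsSubdivision J K) {v : EuclideanSpace ℝ (Fin n)}
    (hv : v ∈ K.vertices) : angleSum K v = angleSum J v := by
  have h1 := measure_space_inter_closedBall hK.finite_faces hK.card_le_three hv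
  have h2 := measure_space_inter_closedBall hJ.finite_faces hJ.card_le_three (h.vertices_subset hv)
  obtain ⟨r, h1, h2, hr⟩ := (h1.and (h2.and (self_mem_nhdsWithin))).exists
  have hr0 : 0 < r ^ 2 / 2 := by have : 0 < r := hr; positivity
  have hnn : ∀ L : EuclideanComplex n, 0 ≤ angleSum L v := by
    intro L
    refine finsum_nonneg fun t => finsum_nonneg fun ht => ?_
    obtain ⟨a, b, hav, hbv, hab, rfl⟩ := exists_of_mem_trianglesAt ht
    rw [triangleAngle_eq hav hbv hab]
    exact EuclideanGeometry.angle_nonneg a v b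
  rw [h.space_eq, h1, ENNReal.ofReal_eq_ofReal_iff (mul_nonneg (hnn _) hr0.le)
    (mul_nonneg (hnn _) hr0.le)] at h2
  exact mul_right_cancel₀ hr0.ne' h2

end LocalArea

/-! ### Adjacency in links and its behaviour under edge splitting. -/

section LinkAdjacency

variable {n : ℕ} {K : EuclideanComplex n}

local notation "𝔼" => EuclideanSpace ℝ (Fin n)

/-- The points `y` and `z` are adjacent in the link of `v`. -/
def LinkAdj (K : EuclideanComplex n) (v y z : 𝔼) : Prop :=
  y ≠ v ∧ z ≠ v ∧ y ≠ z ∧ ({v, y, z} : Finset 𝔼) ∈ K.faces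

lemma LinkAdj.symm {v y z : EuclideanSpace ℝ (Fin n)} (h : LinkAdj K v y z) : LinkAdj K v z y :=
  ⟨h.2.1, h.1, h.2.2.1.symm, by rw [Finset.pair_comm]; exact h.2.2.2⟩

lemma pair_eq_pair_of_triple_eq {E : Type*} [DecidableEq E] {v a b c d : E} (ha : a ≠ v)
    (hb : b ≠ v) (hc : c ≠ v) (hd : d ≠ v) (h : ({v, a, b} : Finset E) = {v, c, d}) :
    (a = c ∧ b = d) ∨ (a = d ∧ b = c) := by
  have h1 : ∀ x, x ∈ ({v, a, b} : Finset E) ↔ x ∈ ({v, c, d} : Finset E) := fun x => by rw [h]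
  simp only [Finset.mem_insert, Finset.mem_singleton] at h1
  have ha' := h1 a
  have hb' := h1 b
  have hc' := h1 c
  have hd' := h1 d
  grind

lemma IsWheel.linkAdj_iff {v : EuclideanSpace ℝ (Fin n)} {m : ℕ} {u : ℕ → 𝔼}
    (h : IsWheel K v m u) (y z : 𝔼) :
    LinkAdj K v y z ↔ ∃ i, (y = u i ∧ z = u (i + 1)) ∨ (y = u (i + 1) ∧ z = u i) := by
  constructor
  · rintro ⟨h1, h2, h3, h4⟩
    obtain ⟨i, hi⟩ := (h.mem_iff _).1 ⟨h4, Finset.mem_insert_self _ _,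
      Finset.card_eq_three.2 ⟨v, y, z, h1.symm, h2.symm, h3, rfl⟩⟩
    exact ⟨i, pair_eq_pair_of_triple_eq h1 h2 (h.ne _) (h.ne _) hi⟩
  · have key : ∀ i, LinkAdj K v (u i) (u (i + 1)) := by
      intro i
      obtain ⟨h1, -, h3⟩ := (h.mem_iff _).2 ⟨i, rfl⟩
      refine ⟨h.ne _, h.ne _, fun he => ?_, h1⟩
      rw [he, Finset.pair_eq_singleton] at h3
      have := Finset.card_le_two (a := v) (b := u (i + 1))
      omega
    rintro ⟨i, ⟨rfl, rfl⟩ | ⟨rfl, rfl⟩⟩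
    · exact key i
    · exact (key i).symm

lemma IsWheel.linkAdj {v : EuclideanSpace ℝ (Fin n)} {m : ℕ} {u : ℕ → 𝔼}
    (h : IsWheel K v m u) (i : ℕ) : LinkAdj K v (u i) (u (i + 1)) :=
  (h.linkAdj_iff _ _).2 ⟨i, Or.inl ⟨rfl, rfl⟩⟩

lemma isWheel_of_linkAdj_iff {v : EuclideanSpace ℝ (Fin n)} {m : ℕ} {u : ℕ → 𝔼} (h3 : 3 ≤ m)
    (hp : ∀ i, u (i + m) = u i) (hinj : ∀ i j, i < m → j < m → u i = u j → i = j)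
    (hadj : ∀ y z, LinkAdj K v y z ↔
      ∃ i, (y = u i ∧ z = u (i + 1)) ∨ (y = u (i + 1) ∧ z = u i)) : IsWheel K v m u := by
  have hu : ∀ i, LinkAdj K v (u i) (u (i + 1)) := fun i => (hadj _ _).2 ⟨i, Or.inl ⟨rfl, rfl⟩⟩
  refine ⟨h3, hp, hinj, fun i => (hu i).1, fun s => ⟨?_, ?_⟩⟩
  · rintro hs
    obtain ⟨a, b, hav, hbv, hab, rfl⟩ := exists_of_mem_trianglesAt hs
    obtain ⟨i, ⟨rfl, rfl⟩ | ⟨rfl, rfl⟩⟩ := (hadj a b).1 ⟨hav, hbv, hab, hs.1⟩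
    · exact ⟨i, rfl⟩
    · exact ⟨i, by rw [Finset.pair_comm]⟩
  · rintro ⟨i, rfl⟩
    obtain ⟨h1, h2, h3, h4⟩ := hu i
    exact ⟨h4, Finset.mem_insert_self _ _,
      Finset.card_eq_three.2 ⟨_, _, _, h1.symm, h2.symm, h3, rfl⟩⟩

lemma IsWheel.eq_iff {v : EuclideanSpace ℝ (Fin n)} {m : ℕ} {u : ℕ → 𝔼}
    (h : IsWheel K v m u) (i j : ℕ) : u i = u j ↔ i % m = j % m := by
  have hm : 0 < m := by have := h.three_le; omega
  have hp : Function.Periodic u m := h.periodic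
  rw [← hp.map_mod_nat i, ← hp.map_mod_nat j]
  refine ⟨fun he => h.injOn _ _ (Nat.mod_lt _ hm) (Nat.mod_lt _ hm) he, fun he => by rw [he]⟩

/-- The crossed matching of the two rim edges would give `i + 2 ≡ i` modulo `m`, which `3 ≤ m`
forbids. -/
lemma IsWheel.injOn_triangle {v : EuclideanSpace ℝ (Fin n)} {m : ℕ} {u : ℕ → 𝔼}
    (h : IsWheel K v m u) {i j : ℕ} (he : ({v, u i, u (i + 1)} : Finset 𝔼) = {v, u j, u (j + 1)}) :
    u i = u j := by
  rcases pair_eq_pair_of_triple_eq (h.ne _) (h.ne _) (h.ne _) (h.ne _) he with ⟨h1, -⟩ | ⟨h1, h2⟩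
  · exact h1
  · exfalso
    rw [h.eq_iff] at h1 h2
    have h3 : i + 2 ≡ i [MOD m] := (Nat.ModEq.add_right 1 (show i + 1 ≡ j [MOD m] from h2)).trans
      (show i ≡ j + 1 [MOD m] from h1).symm
    have h4 : m ∣ 2 := by
      have := (Nat.modEq_iff_dvd' (by omega : i ≤ i + 2)).1 h3.symm
      simpa using this
    have := Nat.le_of_dvd (by norm_num) h4
    have := h.three_le
    omega

/-- The successive angles at the centre of a wheel. -/
noncomputable def wheelAngles (v : 𝔼) (m : ℕ) (u : ℕ → 𝔼) : List ℝ :=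
  (List.range m).map fun i => EuclideanGeometry.angle (u i) v (u (i + 1))

lemma IsWheel.angleSum_eq {v : EuclideanSpace ℝ (Fin n)} {m : ℕ} {u : ℕ → 𝔼}
    (h : IsWheel K v m u) : angleSum K v = (wheelAngles v m u).sum := by
  have hm : 0 < m := by have := h.three_le; omega
  have hb : Set.BijOn (fun i => ({v, u i, u (i + 1)} : Finset 𝔼)) (Finset.range m : Set ℕ)
      (trianglesAt K.faces v) := by
    refine ⟨fun i _ => (h.mem_iff _).2 ⟨i, rfl⟩, fun i hi j hj he => ?_, fun s hs => ?_⟩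
    · exact h.injOn _ _ (by simpa using hi) (by simpa using hj) (h.injOn_triangle he)
    · obtain ⟨i, rfl⟩ := (h.mem_iff s).1 hs
      refine ⟨i % m, by simpa using Nat.mod_lt i hm, ?_⟩
      have h1 : u (i % m) = u i := (h.eq_iff _ _).2 (Nat.mod_mod _ _)
      have h2 : u (i % m + 1) = u (i + 1) := (h.eq_iff _ _).2 (by simp [Nat.add_mod])
      simp only [h1, h2]
  rw [angleSum, ← finsum_mem_eq_of_bijOn (f := fun i => EuclideanGeometry.angle (u i) v (u (i + 1)))
    _ hb, finsum_mem_coe_finset]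
  · rw [wheelAngles, Finset.sum_range, ← List.sum_ofFn, List.ofFn_eq_map, ← List.map_coe_finRange_eq_range, List.map_map]
    rfl
  · intro i _
    obtain ⟨h1, h2, h3, h4⟩ := h.linkAdj i
    exact (triangleAngle_eq h1 h2 h3).symm

lemma IsWheel.rotate {v : EuclideanSpace ℝ (Fin n)} {m : ℕ} {u : ℕ → 𝔼}
    (h : IsWheel K v m u) : IsWheel K v m fun i => u (i + 1) := by
  have hm : 0 < m := by have := h.three_le; omega
  refine isWheel_of_linkAdj_iff h.three_le (fun i => ?_) (fun i j hi hj he => ?_) fun y z => ?_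
  · rw [add_right_comm]; exact h.periodic _
  · rw [h.eq_iff] at he
    have := Nat.ModEq.add_right_cancel' 1 (show i + 1 ≡ j + 1 [MOD m] from he)
    rwa [Nat.ModEq, Nat.mod_eq_of_lt hi, Nat.mod_eq_of_lt hj] at this
  · rw [h.linkAdj_iff]
    constructor
    · rintro ⟨i, hi⟩
      refine ⟨i + m - 1, ?_⟩
      rw [show i + m - 1 + 1 = i + m by omega, show i + m + 1 = (i + 1) + m by omega,
        h.periodic, h.periodic]
      exact hi
    · rintro ⟨i, hi⟩
      exact ⟨i + 1, hi⟩

/-- Splitting a spoke at `x` merely puts `x` in the place of `b` in the link of `v`. -/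
lemma linkAdj_edgeSplit_spoke {v b x : EuclideanSpace ℝ (Fin n)} (hx : IsInOpenEdge K v b x) (y z : 𝔼) :
    LinkAdj (edgeSplit hx) v y z ↔ (y ≠ b ∧ z ≠ b ∧ LinkAdj K v y z) ∨
      (y = x ∧ LinkAdj K v b z) ∨ (z = x ∧ LinkAdj K v b y) := by
  have hxv := hx.ne_left
  have hxb := hx.ne_right
  have hnot : ∀ s : Finset 𝔼, s ∈ K.faces → x ∉ s := fun s hs => hx.ne_of_mem_face hs
  have hone : ∀ z, z ≠ v → z ≠ x → (({v, x, z} : Finset 𝔼) ∈ (edgeSplit hx).faces ↔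
      z ≠ b ∧ ({v, b, z} : Finset 𝔼) ∈ K.faces) := by
    intro z hzv hzx
    rw [mem_edgeSplit_of_mem hx (by simp)]
    have h1 : ({v, x, z} : Finset 𝔼).erase x ∪ {v, b} = {v, b, z} := by
      ext w
      simp only [Finset.mem_union, Finset.mem_erase, Finset.mem_insert, Finset.mem_singleton]
      grind
    rw [h1]
    refine and_congr_left fun _ => ?_
    simp only [Finset.insert_subset_iff, Finset.singleton_subset_iff, Finset.mem_insert,
      Finset.mem_singleton]
    have := hx.ne
    grind
  constructor
  · rintro ⟨h1, h2, h3, h4⟩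
    by_cases hyx : y = x
    · subst hyx
      obtain ⟨h5, h6⟩ := (hone z h2 h3.symm).1 h4
      exact Or.inr (Or.inl ⟨rfl, hx.ne.symm, h2, h5.symm, h6⟩)
    · by_cases hzx : z = x
      · subst hzx
        rw [Finset.pair_comm] at h4
        obtain ⟨h5, h6⟩ := (hone y h1 hyx).1 h4
        exact Or.inr (Or.inr ⟨rfl, hx.ne.symm, h1, h5.symm, h6⟩)
      · have hxs : x ∉ ({v, y, z} : Finset 𝔼) := by
          simp only [Finset.mem_insert, Finset.mem_singleton]; tauto
        obtain ⟨h5, h6⟩ := (mem_edgeSplit_of_notMem hx hxs).1 h4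
        simp only [Finset.insert_subset_iff, Finset.singleton_subset_iff, Finset.mem_insert,
          Finset.mem_singleton] at h6
        exact Or.inl ⟨by tauto, by tauto, h1, h2, h3, h5⟩
  · rintro (⟨hyb, hzb, h1, h2, h3, h4⟩ | ⟨rfl, h1, h2, h3, h4⟩ | ⟨rfl, h1, h2, h3, h4⟩)
    · refine ⟨h1, h2, h3, (mem_edgeSplit_of_notMem hx (hnot _ h4)).2 ⟨h4, ?_⟩⟩
      simp only [Finset.insert_subset_iff, Finset.singleton_subset_iff, Finset.mem_insert,
          Finset.mem_singleton]
      have := hx.ne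
      grind
    · have hzx : z ≠ y := fun he => hnot _ h4 (by simp [he])
      exact ⟨hxv, h2, hzx.symm, (hone z h2 hzx).2 ⟨h3.symm, h4⟩⟩
    · have hzx : y ≠ z := fun he => hnot _ h4 (by simp [he])
      refine ⟨h2, hxv, hzx, ?_⟩
      rw [Finset.pair_comm]
      exact (hone y h2 hzx).2 ⟨h3.symm, h4⟩

/-- Splitting a rim edge inserts `x` between its endpoints in the link of `v`. The bound on face
sizes ensures that `x` acquires no further neighbours in this link. -/
lemma linkAdj_edgeSplit_opposite (hcard : ∀ s ∈ K.faces, s.card ≤ 3)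
    {v a b x : EuclideanSpace ℝ (Fin n)} (hx : IsInOpenEdge K a b x) (hab : LinkAdj K v a b)
    (y z : 𝔼) :
    LinkAdj (edgeSplit hx) v y z ↔ (¬ (y = a ∧ z = b) ∧ ¬ (y = b ∧ z = a) ∧ LinkAdj K v y z) ∨
      (y = x ∧ (z = a ∨ z = b)) ∨ (z = x ∧ (y = a ∨ y = b)) := by
  obtain ⟨hav, hbv, hne, habK⟩ := hab
  have hxa := hx.ne_left
  have hxb := hx.ne_right
  have hnot : ∀ s : Finset 𝔼, s ∈ K.faces → x ∉ s := fun s hs => hx.ne_of_mem_face hs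
  have hxv : x ≠ v := fun he => hnot _ habK (by simp [he])
  have hone : ∀ z, z ≠ v → z ≠ x → (({v, x, z} : Finset 𝔼) ∈ (edgeSplit hx).faces ↔
      z = a ∨ z = b) := by
    intro z hzv hzx
    rw [mem_edgeSplit_of_mem hx (by simp)]
    have h1 : ({v, x, z} : Finset 𝔼).erase x ∪ {a, b} = {v, a, b, z} := by
      ext w
      simp only [Finset.mem_union, Finset.mem_erase, Finset.mem_insert, Finset.mem_singleton]
      grind
    rw [h1]
    constructor
    · rintro ⟨-, h2⟩
      by_contra! hcon
      have : ({v, a, b, z} : Finset 𝔼).card = 4 :=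
        Finset.card_eq_four.2 ⟨v, a, b, z, hav.symm, hbv.symm, hzv.symm, hne, hcon.1.symm,
          hcon.2.symm, rfl⟩
      have := hcard _ h2
      omega
    · intro h
      have h2 : ({v, a, b, z} : Finset 𝔼) = {v, a, b} := by
        ext w
        simp only [Finset.mem_insert, Finset.mem_singleton]
        grind
      refine ⟨?_, h2 ▸ habK⟩
      simp only [Finset.insert_subset_iff, Finset.singleton_subset_iff, Finset.mem_insert,
        Finset.mem_singleton]
      grind
  constructor
  · rintro ⟨h1, h2, h3, h4⟩
    by_cases hyx : y = x
    · subst hyx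
      exact Or.inr (Or.inl ⟨rfl, (hone z h2 h3.symm).1 h4⟩)
    · by_cases hzx : z = x
      · subst hzx
        rw [Finset.pair_comm] at h4
        exact Or.inr (Or.inr ⟨rfl, (hone y h1 hyx).1 h4⟩)
      · have hxs : x ∉ ({v, y, z} : Finset 𝔼) := by
          simp only [Finset.mem_insert, Finset.mem_singleton]; tauto
        obtain ⟨h5, h6⟩ := (mem_edgeSplit_of_notMem hx hxs).1 h4
        simp only [Finset.insert_subset_iff, Finset.singleton_subset_iff, Finset.mem_insert,
          Finset.mem_singleton] at h6
        refine Or.inl ⟨?_, ?_, h1, h2, h3, h5⟩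
        · rintro ⟨rfl, rfl⟩; tauto
        · rintro ⟨rfl, rfl⟩; tauto
  · rintro (⟨hyb, hzb, h1, h2, h3, h4⟩ | ⟨rfl, h1⟩ | ⟨rfl, h1⟩)
    · refine ⟨h1, h2, h3, (mem_edgeSplit_of_notMem hx (hnot _ h4)).2 ⟨h4, ?_⟩⟩
      simp only [Finset.insert_subset_iff, Finset.singleton_subset_iff, Finset.mem_insert,
          Finset.mem_singleton]
      grind
    · have hzv : z ≠ v := by rcases h1 with rfl | rfl <;> assumption
      have hzx : z ≠ y := by rcases h1 with rfl | rfl <;> [exact hxa.symm; exact hxb.symm]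
      exact ⟨hxv, hzv, hzx.symm, (hone z hzv hzx).2 h1⟩
    · have hyv : y ≠ v := by rcases h1 with rfl | rfl <;> assumption
      have hyx : y ≠ z := by rcases h1 with rfl | rfl <;> [exact hxa.symm; exact hxb.symm]
      refine ⟨hyv, hxv, hyx, ?_⟩
      rw [Finset.pair_comm]
      exact (hone y hyv hyx).2 h1

end LinkAdjacency

/-! ### Effect of edge splitting on a wheel. -/

section WheelSplitting

variable {n : ℕ} {K : EuclideanComplex n}

local notation "𝔼" => EuclideanSpace ℝ (Fin n)

lemma IsInOpenEdge.of_pair {a b x : EuclideanSpace ℝ (Fin n)} (hab : a ≠ b)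
    (h : ({a, b} : Finset 𝔼) ∈ K.faces) (hx : x ∈ openSegment ℝ a b) : IsInOpenEdge K a b x := by
  refine ⟨hab, fun s hs => ?_, hx⟩
  have : s = {a, b} := by ext y; simp [hs]
  rwa [this]

lemma IsWheel.split_spoke {v x : EuclideanSpace ℝ (Fin n)} {m : ℕ} {u : ℕ → 𝔼}
    (h : IsWheel K v m u) {j : ℕ} (hj : j < m) (hx : IsInOpenEdge K v (u j) x) :
    IsWheel (edgeSplit hx) v m fun i => if i % m = j then x else u i := by
  have hnot : ∀ i, u i ≠ x := fun i he =>
    hx.ne_of_mem_face (h.linkAdj i).2.2.2 (by simp [he])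
  have hmod : ∀ i, i % m = j ↔ u i = u j := fun i => by rw [h.eq_iff, Nat.mod_eq_of_lt hj]
  refine isWheel_of_linkAdj_iff h.three_le (fun i => ?_) (fun i i' hi hi' he => ?_) fun y z => ?_
  · simp only [Nat.add_mod_right, h.periodic]
  · simp only [Nat.mod_eq_of_lt hi, Nat.mod_eq_of_lt hi'] at he
    split_ifs at he with h1 h2 h2
    · omega
    · exact absurd he.symm (hnot _)
    · exact absurd he (hnot _)
    · exact h.injOn i i' hi hi' he
  · rw [linkAdj_edgeSplit_spoke]
    simp only [hmod]
    have hne := fun i => (h.linkAdj i).2.2.1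
    constructor
    · rintro (⟨h1, h2, h3⟩ | ⟨rfl, h3⟩ | ⟨rfl, h3⟩)
      · obtain ⟨i, hi⟩ := (h.linkAdj_iff _ _).1 h3
        refine ⟨i, ?_⟩
        grind
      · obtain ⟨i, hi⟩ := (h.linkAdj_iff _ _).1 h3
        refine ⟨i, ?_⟩
        have := hne i
        grind
      · obtain ⟨i, hi⟩ := (h.linkAdj_iff _ _).1 h3
        refine ⟨i, ?_⟩
        have := hne i
        grind
    · have hsym : ∀ i, LinkAdj K v (u (i + 1)) (u i) := fun i => (h.linkAdj i).symm
      have hadj := h.linkAdj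
      rintro ⟨i, hi⟩
      have := hne i
      have h1 := hsym i
      have h2 := hadj i
      by_cases hi0 : u i = u j
      · have hi1 : u (i + 1) ≠ u j := by rw [← hi0]; exact this.symm
        rw [if_pos hi0, if_neg hi1] at hi
        rcases hi with ⟨rfl, rfl⟩ | ⟨rfl, rfl⟩
        · exact Or.inr (Or.inl ⟨rfl, hi0 ▸ h2⟩)
        · exact Or.inr (Or.inr ⟨rfl, hi0 ▸ h2⟩)
      · rw [if_neg hi0] at hi
        by_cases hi1 : u (i + 1) = u j
        · rw [if_pos hi1] at hi
          rcases hi with ⟨rfl, rfl⟩ | ⟨rfl, rfl⟩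
          · exact Or.inr (Or.inr ⟨rfl, hi1 ▸ h1⟩)
          · exact Or.inr (Or.inl ⟨rfl, hi1 ▸ h1⟩)
        · rw [if_neg hi1] at hi
          rcases hi with ⟨rfl, rfl⟩ | ⟨rfl, rfl⟩
          · exact Or.inl ⟨hi0, hi1, h2⟩
          · exact Or.inl ⟨hi1, hi0, h1⟩

/-- The rim obtained by inserting `x` between the first two points of the rim `u`. -/
def splitRim {E : Type*} (u : ℕ → E) (x : E) (m i : ℕ) : E :=
  if i % (m + 1) = 0 then u 0 else if i % (m + 1) = 1 then x else u (i % (m + 1) - 1)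

lemma IsWheel.split_opposite (hcard : ∀ s ∈ K.faces, s.card ≤ 3) {v x : EuclideanSpace ℝ (Fin n)}
    {m : ℕ} {u : ℕ → 𝔼} (h : IsWheel K v m u) (hx : IsInOpenEdge K (u 0) (u 1) x) :
    IsWheel (edgeSplit hx) v (m + 1) (splitRim u x m) := by
  have hm := h.three_le
  have hnot : ∀ i, u i ≠ x := fun i he =>
    hx.ne_of_mem_face (h.linkAdj i).2.2.2 (by simp [he])
  refine isWheel_of_linkAdj_iff (by omega) (fun i => ?_) (fun i i' hi hi' he => ?_) fun y z => ?_
  · simp only [splitRim, Nat.add_mod_right]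
  · simp only [splitRim, Nat.mod_eq_of_lt hi, Nat.mod_eq_of_lt hi'] at he
    have hinj : ∀ i j, i < m → j < m → u i = u j → i = j := h.injOn
    split_ifs at he with h1 h2 h3 h4 h5 h6 h7
    · omega
    · exact absurd he (hnot _)
    · have := hinj _ _ (by omega) (by omega) he; omega
    · exact absurd he.symm (hnot _)
    · omega
    · exact absurd he.symm (hnot _)
    · have := hinj _ _ (by omega) (by omega) he; omega
    · exact absurd he (hnot _)
    · have := hinj _ _ (by omega) (by omega) he; omega
  · rw [linkAdj_edgeSplit_opposite hcard hx (h.linkAdj 0)]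
    obtain ⟨w, hw⟩ : ∃ w, w = splitRim u x m := ⟨_, rfl⟩
    rw [← hw]
    have hw0 : w 0 = u 0 := by simp [hw, splitRim]
    have hw1 : w 1 = x := by
      simp only [hw, splitRim, Nat.mod_eq_of_lt (show 1 < m + 1 by omega)]; simp
    have hwi : ∀ i, 1 ≤ i → i ≤ m → w (i + 1) = u i := by
      intro i h1 h2
      rcases h2.lt_or_eq with h2 | rfl
      · simp only [hw, splitRim, Nat.mod_eq_of_lt (show i + 1 < m + 1 by omega)]
        rw [if_neg (by omega), if_neg (by omega), Nat.add_sub_cancel]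
      · have : u i = u 0 := by have := h.periodic 0; rwa [zero_add] at this
        simp only [hw, splitRim, Nat.mod_self, if_true, this]
    have hmod : ∀ i, w (i % (m + 1)) = w i := fun i => by simp only [hw, splitRim, Nat.mod_mod]
    have hcases : ∀ i, (w i = u 0 ∧ w (i + 1) = x) ∨ (w i = x ∧ w (i + 1) = u 1) ∨
        ∃ j, 1 ≤ j ∧ j < m ∧ w i = u j ∧ w (i + 1) = u (j + 1) := by
      intro i
      have hr : i % (m + 1) < m + 1 := Nat.mod_lt _ (by omega)
      have hs : w (i + 1) = w (i % (m + 1) + 1) := by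
        rw [← hmod (i + 1), ← hmod (i % (m + 1) + 1)]; simp [Nat.add_mod]
      rw [← hmod i, hs]
      obtain h0 | h1 | h2 : i % (m + 1) = 0 ∨ i % (m + 1) = 1 ∨ 2 ≤ i % (m + 1) := by omega
      · rw [h0]; exact Or.inl ⟨hw0, hw1⟩
      · rw [h1]; exact Or.inr (Or.inl ⟨hw1, hwi 1 le_rfl (by omega)⟩)
      · refine Or.inr (Or.inr ⟨i % (m + 1) - 1, by omega, by omega, ?_, ?_⟩)
        · rw [← hwi _ (by omega) (by omega)]; congr 1; omega
        · rw [hwi _ (by omega) (by omega)]; congr 1; omega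
    have h01 : u 0 ≠ u 1 := hx.ne
    constructor
    · rintro (⟨h1, h2, h3⟩ | ⟨rfl, h3⟩ | ⟨rfl, h3⟩)
      · obtain ⟨i, hi⟩ := (h.linkAdj_iff _ _).1 h3
        have e1 : u (i % m) = u i := (h.eq_iff _ _).2 (Nat.mod_mod _ _)
        have e2 : u (i % m + 1) = u (i + 1) := (h.eq_iff _ _).2 (by simp [Nat.add_mod])
        have hlt : i % m < m := Nat.mod_lt _ (by omega)
        have hi0 : i % m ≠ 0 := by
          intro h0
          rw [h0] at e1 e2
          rcases hi with ⟨rfl, rfl⟩ | ⟨rfl, rfl⟩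
          · exact h1 ⟨e1.symm, e2.symm⟩
          · exact h2 ⟨e2.symm, e1.symm⟩
        refine ⟨i % m + 1, ?_⟩
        rw [hwi _ (by omega) (by omega), hwi _ (by omega) (by omega), e1, e2]
        exact hi
      · rcases h3 with rfl | rfl
        · exact ⟨0, Or.inr ⟨hw1.symm, hw0.symm⟩⟩
        · exact ⟨1, Or.inl ⟨hw1.symm, (hwi 1 le_rfl (by omega)).symm⟩⟩
      · rcases h3 with rfl | rfl
        · exact ⟨0, Or.inl ⟨hw0.symm, hw1.symm⟩⟩
        · exact ⟨1, Or.inr ⟨(hwi 1 le_rfl (by omega)).symm, hw1.symm⟩⟩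
    · rintro ⟨i, hi⟩
      rcases hcases i with ⟨h1, h2⟩ | ⟨h1, h2⟩ | ⟨j, hj1, hjm, h1, h2⟩
      · rw [h1, h2] at hi
        rcases hi with ⟨rfl, rfl⟩ | ⟨rfl, rfl⟩
        · exact Or.inr (Or.inr ⟨rfl, Or.inl rfl⟩)
        · exact Or.inr (Or.inl ⟨rfl, Or.inl rfl⟩)
      · rw [h1, h2] at hi
        rcases hi with ⟨rfl, rfl⟩ | ⟨rfl, rfl⟩
        · exact Or.inr (Or.inl ⟨rfl, Or.inr rfl⟩)
        · exact Or.inr (Or.inr ⟨rfl, Or.inr rfl⟩)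
      · rw [h1, h2] at hi
        have hj0 : u j ≠ u 0 := fun he => by have := h.injOn _ _ hjm (by omega) he; omega
        have hj01 : ¬ (u j = u 1 ∧ u (j + 1) = u 0) := by
          rintro ⟨he, he'⟩
          have := h.injOn _ _ hjm (by omega) he
          subst this
          have := h.injOn _ _ (by omega) (by omega) he'
          omega
        refine Or.inl ⟨?_, ?_, (h.linkAdj_iff _ _).2 ⟨j, hi⟩⟩
        · rcases hi with ⟨rfl, rfl⟩ | ⟨rfl, rfl⟩
          · exact fun h => hj0 h.1
          · exact fun h => hj01 ⟨h.2, h.1⟩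
        · rcases hi with ⟨rfl, rfl⟩ | ⟨rfl, rfl⟩
          · exact hj01
          · exact fun h => hj0 h.2

lemma wheelAngles_split {v x : EuclideanSpace ℝ (Fin n)} {m : ℕ} {u : ℕ → 𝔼} (hm : 3 ≤ m)
    (hu : u m = u 0) :
    wheelAngles v (m + 1) (splitRim u x m) =
    EuclideanGeometry.angle (u 0) v x :: EuclideanGeometry.angle x v (u 1) ::
      (wheelAngles v m u).tail := by
  obtain ⟨k, rfl⟩ : ∃ k, m = k + 1 := ⟨m - 1, by omega⟩
  rw [wheelAngles, wheelAngles, List.range_succ_eq_map, List.range_succ_eq_map]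
  simp only [splitRim, List.map_cons, List.map_map, List.tail_cons]
  congr 1
  congr 1
  · simp [Nat.mod_eq_of_lt (show 1 < k + 1 + 1 by omega),
      Nat.mod_eq_of_lt (show 2 < k + 1 + 1 by omega)]
  · refine List.map_congr_left fun i hi => ?_
    rw [List.mem_range] at hi
    simp only [Function.comp_apply, Nat.succ_eq_add_one]
    rw [Nat.mod_eq_of_lt (show i + 1 + 1 < k + 1 + 1 by omega)]
    rcases (show i + 1 + 1 ≤ k + 1 by omega).lt_or_eq with h | h
    · rw [Nat.mod_eq_of_lt (show i + 1 + 1 + 1 < k + 1 + 1 by omega)]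
      simp
    · rw [h, Nat.mod_self, show i + 1 = k by omega, hu]
      simp [show k ≠ 0 by omega]

/-- Directions inside an angle are realised on the opposite side of a triangle. -/
lemma exists_mem_openSegment_angle {v a b : EuclideanSpace ℝ (Fin n)} (h : LinkAdj K v a b)
    {θ : ℝ} (h0 : 0 < θ) (h1 : θ < EuclideanGeometry.angle a v b) :
    ∃ x ∈ openSegment ℝ a b, EuclideanGeometry.angle a v x = θ ∧
      EuclideanGeometry.angle x v b = EuclideanGeometry.angle a v b - θ := by
  obtain ⟨hav, hbv, hab, hK⟩ := h
  have hseg : ∀ τ : ℝ, τ ∈ Set.Icc (0 : ℝ) 1 → AffineMap.lineMap a b τ ≠ v := by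
    intro τ hτ he
    apply notMem_convexHull_pair hK hav hbv
    rw [Finset.coe_pair, convexHull_pair, segment_eq_image_lineMap]
    exact ⟨τ, hτ, he⟩
  -- The angle seen from `v` grows continuously from `0` to the full angle along the side, so `θ` is
  -- attained; additivity of angles at an intermediate point gives the rest.
  have hcont : ContinuousOn (fun τ : ℝ => EuclideanGeometry.angle a v (AffineMap.lineMap a b τ))
      (Set.Icc 0 1) := by
    intro τ hτ
    have hc := EuclideanGeometry.continuousAt_angle (x := (a, v, AffineMap.lineMap a b τ)) hav (hseg τ hτ)
    have hc2 : ContinuousAt (fun τ : ℝ => ((a, v, AffineMap.lineMap a b τ) : 𝔼 × 𝔼 × 𝔼)) τ := by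
      have : Continuous (fun τ : ℝ => (AffineMap.lineMap a b τ : 𝔼)) := AffineMap.lineMap_continuous
      fun_prop
    exact (ContinuousAt.comp (f := fun τ : ℝ => ((a, v, AffineMap.lineMap a b τ) : 𝔼 × 𝔼 × 𝔼))
      hc hc2).continuousWithinAt
  obtain ⟨τ, hτ, hτθ⟩ := intermediate_value_Icc zero_le_one hcont
    (show θ ∈ Set.Icc _ _ by
      simp only [AffineMap.lineMap_apply_zero, AffineMap.lineMap_apply_one,
        EuclideanGeometry.angle_self_of_ne hav]
      exact ⟨h0.le, h1.le⟩)
  simp only at hτθ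
  have hτ0 : τ ≠ 0 := by
    rintro rfl
    rw [AffineMap.lineMap_apply_zero, EuclideanGeometry.angle_self_of_ne hav] at hτθ
    exact h0.ne hτθ
  have hτ1 : τ ≠ 1 := by
    rintro rfl
    rw [AffineMap.lineMap_apply_one] at hτθ
    exact h1.ne hτθ.symm
  have hS : Sbtw ℝ a (AffineMap.lineMap a b τ) b := by
    rw [sbtw_iff_mem_image_Ioo_and_ne]
    exact ⟨⟨τ, ⟨lt_of_le_of_ne hτ.1 hτ0.symm, lt_of_le_of_ne hτ.2 hτ1⟩, rfl⟩, hab⟩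
  refine ⟨AffineMap.lineMap a b τ, ?_, hτθ, ?_⟩
  · rw [openSegment_eq_image_lineMap]
    exact ⟨τ, ⟨lt_of_le_of_ne hτ.1 hτ0.symm, lt_of_le_of_ne hτ.2 hτ1⟩, rfl⟩
  · rw [← hτθ, ← EuclideanGeometry.angle_add_angle_eq_of_sbtw (p := v) hS]
    ring

end WheelSplitting

/-! ### An invariant vertex function depends only on the angle sum. -/

section WheelValues

variable {n : ℕ} {K : EuclideanComplex n}

local notation "𝔼" => EuclideanSpace ℝ (Fin n)

/-- A surface is pure: every face at `v` extends to a triangle at `v`. The rim of the wheel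
therefore describes the whole star. -/
lemma IsSimplicialSurface.exists_linkAdj (hK : IsSimplicialSurface K) {v : EuclideanSpace ℝ (Fin n)}
    {t : Finset 𝔼} (ht : t ∈ K.faces) (hv : v ∈ t) : ∃ y z, LinkAdj K v y z ∧ t ⊆ {v, y, z} := by
  have hvert : v ∈ K.vertices := SimplicialComplex.mem_vertices_of_mem_face ht hv
  have hedge : ∀ a, a ≠ v → ({v, a} : Finset 𝔼) ∈ K.faces → ∃ z, LinkAdj K v a z := by
    intro a ha h
    obtain ⟨c, hc1, hc2, hc3⟩ := hK.exists_triangle_of_edge ha.symm h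
    exact ⟨c, ha, hc1, hc2.symm, hc3⟩
  have hcard := hK.card_le_three t ht
  have hpos := Finset.card_pos.2 ⟨v, hv⟩
  obtain h | h | h : t.card = 1 ∨ t.card = 2 ∨ t.card = 3 := by omega
  · obtain ⟨x, rfl⟩ := Finset.card_eq_one.1 h
    obtain rfl := Finset.mem_singleton.1 hv
    obtain ⟨a, ha, haK⟩ := hK.exists_edge hvert
    obtain ⟨z, hz⟩ := hedge a ha haK
    exact ⟨a, z, hz, Finset.singleton_subset_iff.2 (Finset.mem_insert_self _ _)⟩
  · obtain ⟨a, ha⟩ := Finset.card_eq_one.1 (show (t.erase v).card = 1 by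
      rw [Finset.card_erase_of_mem hv, h])
    have hav : a ∈ t.erase v := by rw [ha]; exact Finset.mem_singleton_self a
    have ht' : t = {v, a} := by rw [← ha, Finset.insert_erase hv]
    obtain ⟨z, hz⟩ := hedge a (Finset.ne_of_mem_erase hav) (ht' ▸ ht)
    refine ⟨a, z, hz, ?_⟩
    rw [ht']
    exact Finset.insert_subset_insert _ (Finset.singleton_subset_iff.2 (Finset.mem_insert_self _ _))
  · obtain ⟨a, b, hav, hbv, hab, rfl⟩ := exists_of_mem_trianglesAt (A := K.faces) ⟨ht, hv, h⟩
    exact ⟨a, b, ⟨hav, hbv, hab, ht⟩, subset_rfl⟩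

lemma IsWheel.mem_vertices {v : EuclideanSpace ℝ (Fin n)} {m : ℕ} {u : ℕ → 𝔼}
    (h : IsWheel K v m u) : v ∈ K.vertices :=
  SimplicialComplex.mem_vertices_of_mem_face (h.linkAdj 0).2.2.2 (Finset.mem_insert_self _ _)

lemma IsWheel.mem_starFaces_iff (hK : IsSimplicialSurface K) {v : EuclideanSpace ℝ (Fin n)} {m : ℕ}
    {u : ℕ → 𝔼} (h : IsWheel K v m u) (s : Finset 𝔼) :
    s ∈ starFaces K v ↔ s.Nonempty ∧ ∃ i, s ⊆ {v, u i, u (i + 1)} := by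
  constructor
  · rintro ⟨hs, t, ht, hvt, hst⟩
    refine ⟨SimplicialComplex.nonempty_of_mem_faces hs, ?_⟩
    obtain ⟨y, z, hyz, hsub⟩ := hK.exists_linkAdj ht hvt
    obtain ⟨i, ⟨rfl, rfl⟩ | ⟨rfl, rfl⟩⟩ := (h.linkAdj_iff _ _).1 hyz
    · exact ⟨i, hst.trans hsub⟩
    · exact ⟨i, by rw [Finset.pair_comm]; exact hst.trans hsub⟩
  · rintro ⟨hne, i, hi⟩
    have ht := (h.linkAdj i).2.2.2
    exact ⟨K.down_closed ht hi hne, _, ht, Finset.mem_insert_self _ _, hi⟩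

lemma dist_eq_of_angle_eq {k : ℕ} {a v b : EuclideanSpace ℝ (Fin n)}
    {a' v' b' : EuclideanSpace ℝ (Fin k)} (h1 : dist a v = dist a' v') (h2 : dist b v = dist b' v')
    (h3 : EuclideanGeometry.angle a v b = EuclideanGeometry.angle a' v' b') :
    dist a b = dist a' b' := by
  have e1 := EuclideanGeometry.law_cos a v b
  have e2 := EuclideanGeometry.law_cos a' v' b'
  rw [h1, h2, h3, ← e2] at e1
  exact (mul_self_inj dist_nonneg dist_nonneg).1 e1

/-- Matching the rims index by index is well defined, as both have period exactly `m`. Spokes have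
equal lengths by assumption, and rim edges by the law of cosines. -/
lemma IsWheel.starsIsometric {k : ℕ} {L : EuclideanComplex k} (hK : IsSimplicialSurface K)
    (hL : IsSimplicialSurface L) {v : EuclideanSpace ℝ (Fin n)} {w : EuclideanSpace ℝ (Fin k)}
    {m : ℕ} {u : ℕ → 𝔼} {u' : ℕ → EuclideanSpace ℝ (Fin k)} (h : IsWheel K v m u)
    (h' : IsWheel L w m u') (hd : ∀ i, dist (u i) v = dist (u' i) w)
    (ha : ∀ i, EuclideanGeometry.angle (u i) v (u (i + 1)) =
      EuclideanGeometry.angle (u' i) w (u' (i + 1))) : StarsIsometric K v L w := by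
  classical
  obtain ⟨f, hfv, hfu⟩ : ∃ f : 𝔼 → EuclideanSpace ℝ (Fin k), f v = w ∧ ∀ i, f (u i) = u' i := by
    refine ⟨fun x => if hx : ∃ i, x = u i then u' hx.choose else w, ?_, fun i => ?_⟩
    · have : ¬ ∃ i, v = u i := by rintro ⟨i, hi⟩; exact h.ne i hi.symm
      simp only [dif_neg this]
    · have hx : ∃ j, u i = u j := ⟨i, rfl⟩
      simp only [dif_pos hx]
      rw [h'.eq_iff, ← h.eq_iff]
      exact hx.choose_spec.symm
  have himg : ∀ i, ({v, u i, u (i + 1)} : Finset 𝔼).image f = {w, u' i, u' (i + 1)} := by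
    intro i
    rw [Finset.image_insert, Finset.image_insert, Finset.image_singleton, hfv, hfu, hfu]
  refine ⟨f, ⟨?_, ?_⟩, hfv, ?_⟩
  · have hmem : ∀ x, (∃ s ∈ starFaces K v, x ∈ s) → x = v ∨ ∃ i, x = u i := by
      rintro x ⟨s, hs, hx⟩
      obtain ⟨-, i, hi⟩ := (h.mem_starFaces_iff hK s).1 hs
      have := hi hx
      simp only [Finset.mem_insert, Finset.mem_singleton] at this
      rcases this with h1 | h1 | h1
      · exact Or.inl h1
      · exact Or.inr ⟨i, h1⟩
      · exact Or.inr ⟨i + 1, h1⟩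
    intro x hx y hy hxy
    rcases hmem x hx with rfl | ⟨i, rfl⟩ <;> rcases hmem y hy with rfl | ⟨j, rfl⟩
    · rfl
    · rw [hfv, hfu] at hxy; exact absurd hxy.symm (h'.ne j)
    · rw [hfv, hfu] at hxy; exact absurd hxy (h'.ne i)
    · rw [hfu, hfu, h'.eq_iff] at hxy
      exact (h.eq_iff _ _).2 hxy
  · ext s
    rw [h'.mem_starFaces_iff hL]
    constructor
    · rintro ⟨t, ht, rfl⟩
      obtain ⟨hne, i, hi⟩ := (h.mem_starFaces_iff hK t).1 ht
      have hsub := Finset.image_subset_image (f := f) hi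
      rw [himg] at hsub
      have himgne := hne.image f
      exact ⟨by convert himgne, i, by convert hsub⟩
    · rintro ⟨hne, i, hi⟩
      have hs : (({v, u i, u (i + 1)} : Finset 𝔼).filter fun x => f x ∈ s).image f = s := by
        ext y
        simp only [Finset.mem_image, Finset.mem_filter]
        constructor
        · rintro ⟨x, ⟨-, hx⟩, rfl⟩; exact hx
        · intro hy
          have h1 := hi hy
          rw [← himg, Finset.mem_image] at h1
          obtain ⟨x, hx, rfl⟩ := h1
          exact ⟨x, ⟨hx, hy⟩, rfl⟩
      refine ⟨_, (h.mem_starFaces_iff hK _).2 ⟨?_, i, Finset.filter_subset _ _⟩, by convert hs⟩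
      rw [← Finset.image_nonempty (f := f), hs]
      exact hne
  · intro x y hxy
    obtain ⟨-, i, hi⟩ := (h.mem_starFaces_iff hK _).1 (by convert hxy)
    have hx := hi (Finset.mem_insert_self x _)
    have hy := hi (Finset.mem_insert_of_mem (Finset.mem_singleton_self y))
    have hdist := dist_eq_of_angle_eq (hd i) (hd (i + 1)) (ha i)
    simp only [Finset.mem_insert, Finset.mem_singleton] at hx hy
    rcases hx with rfl | rfl | rfl <;> rcases hy with rfl | rfl | rfl <;>
      simp only [hfv, hfu, dist_self, hd, hdist, dist_comm _ (u _), dist_comm w]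
    rw [dist_comm (u' _), ← hdist, dist_comm]

variable {S : Set EmbeddedComplex} {φ : VertexFunction}

/-- The points of the rim of a wheel, moved along the spokes to distance `ε` from the centre. -/
noncomputable def pullRim (v : 𝔼) (u : ℕ → 𝔼) (ε : ℝ) (i : ℕ) : 𝔼 :=
  v + (ε / dist (u i) v) • (u i - v)

lemma pullRim_mem_openSegment {v : EuclideanSpace ℝ (Fin n)} {u : ℕ → 𝔼} {ε : ℝ} (hε : 0 < ε)
    {i : ℕ} (hi : ε < dist (u i) v) : pullRim v u ε i ∈ openSegment ℝ v (u i) := by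
  rw [openSegment_eq_image_lineMap]
  have : 0 < dist (u i) v := hε.trans hi
  refine ⟨ε / dist (u i) v, ⟨by positivity, (div_lt_one this).2 hi⟩, ?_⟩
  rw [AffineMap.lineMap_apply, pullRim, vsub_eq_sub, vadd_eq_add, add_comm]

lemma dist_pullRim {v : EuclideanSpace ℝ (Fin n)} {u : ℕ → 𝔼} {ε : ℝ} (hε : 0 < ε) {i : ℕ}
    (hi : u i ≠ v) : dist (pullRim v u ε i) v = ε := by
  have h : 0 < dist (u i) v := dist_pos.2 hi
  rw [pullRim, dist_eq_norm, add_sub_cancel_left, norm_smul, ← dist_eq_norm, Real.norm_eq_abs,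
    abs_of_pos (div_pos hε h), div_mul_cancel₀ _ h.ne']

lemma angle_pullRim {v : EuclideanSpace ℝ (Fin n)} {u : ℕ → 𝔼} {ε : ℝ} (hε : 0 < ε) {i j : ℕ}
    (hi : u i ≠ v) (hj : u j ≠ v) : EuclideanGeometry.angle (pullRim v u ε i) v (pullRim v u ε j) =
      EuclideanGeometry.angle (u i) v (u j) := by
  have h : 0 < dist (u i) v := dist_pos.2 hi
  have h' : 0 < dist (u j) v := dist_pos.2 hj
  simp only [EuclideanGeometry.angle, pullRim, vsub_eq_sub, add_sub_cancel_left]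
  rw [InnerProductGeometry.angle_smul_left_of_pos _ _ (div_pos hε h),
    InnerProductGeometry.angle_smul_right_of_pos _ _ (div_pos hε h')]

/-- The spokes of a wheel can be shortened by subdivision. -/
lemma IsWheel.exists_pull (hsurface : ∀ K ∈ S, IsSimplicialSurface K.2)
    (hsub : ClosedUnderSubdivision S) (hinv : InvariantUnderSubdivision S φ)
    {v : EuclideanSpace ℝ (Fin n)} {m : ℕ} {u : ℕ → 𝔼} (hK : (⟨n, K⟩ : EmbeddedComplex) ∈ S)
    (h : IsWheel K v m u) {ε : ℝ} (hε : 0 < ε) (hlt : ∀ i, ε < dist (u i) v) :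
    ∃ J : EuclideanComplex n, (⟨n, J⟩ : EmbeddedComplex) ∈ S ∧ IsWheel J v m (pullRim v u ε) ∧
      φ n J v = φ n K v := by
  have hm : 0 < m := by have := h.three_le; omega
  -- The spokes are split one at a time. Each split is a subdivision inside `S` that keeps `v`, so
  -- the value of `φ` does not change.
  have key : ∀ k ≤ m, ∃ J : EuclideanComplex n, (⟨n, J⟩ : EmbeddedComplex) ∈ S ∧
      IsWheel J v m (fun i => if i % m < k then pullRim v u ε i else u i) ∧
      φ n J v = φ n K v := by
    intro k
    induction k with
    | zero => exact fun _ => ⟨K, hK, by simpa using h, rfl⟩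
    | succ k ih =>
      intro hk
      obtain ⟨J, hJ, hw, hφ⟩ := ih (by omega)
      have hmod : k % m = k := Nat.mod_eq_of_lt (by omega)
      have hadj := hw.linkAdj k
      have hkk : (if k % m < k then pullRim v u ε k else u k) = u k := by rw [hmod, if_neg (lt_irrefl k)]
      have hx : IsInOpenEdge J v (if k % m < k then pullRim v u ε k else u k) (pullRim v u ε k) :=
        IsInOpenEdge.of_pair hadj.1.symm
          (pair_mem_of_mem_face hadj.2.2.2 (Finset.mem_insert_self _ _)
            (Finset.mem_insert_of_mem (Finset.mem_insert_self _ _)))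
          (by rw [hkk]; exact pullRim_mem_openSegment hε (hlt k))
      have hsd := edgeSplit_isSubdivision hx (hsurface _ hJ).finite_faces
      have hJ' := hsub n J _ hJ hsd
      refine ⟨_, hJ', ?_, (hinv n J _ hJ hJ' hsd v hw.mem_vertices).symm.trans hφ⟩
      have hsplit := hw.split_spoke (show k < m by omega) hx
      convert hsplit using 1
      funext i
      by_cases hi : i % m = k
      · have hui : u i = u k := (h.eq_iff _ _).2 (by rw [hi, hmod])
        rw [if_pos hi, if_pos (by omega), pullRim, pullRim, hui]
      · rw [if_neg hi]
        by_cases hi' : i % m < k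
        · rw [if_pos hi', if_pos (by omega)]
        · rw [if_neg hi', if_neg (by omega)]
  obtain ⟨J, hJ, hw, hφ⟩ := key m le_rfl
  refine ⟨J, hJ, ?_, hφ⟩
  convert hw using 1
  funext i
  rw [if_pos (Nat.mod_lt i hm)]

lemma IsWheel.exists_lt_dist {v : EuclideanSpace ℝ (Fin n)} {m : ℕ} {u : ℕ → 𝔼}
    (h : IsWheel K v m u) : ∀ᶠ ε in 𝓝[>] (0 : ℝ), ∀ i, ε < dist (u i) v := by
  have hm : 0 < m := by have := h.three_le; omega
  have h1 : ∀ᶠ ε in 𝓝[>] (0 : ℝ), ∀ i ∈ Finset.range m, ε < dist (u i) v :=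
    (Finset.eventually_all _).2 fun i _ => by
      filter_upwards [Ioo_mem_nhdsGT (dist_pos.2 (h.ne i))] with ε hε using hε.2
  filter_upwards [h1] with ε hε i
  rw [← (h.eq_iff _ _).2 (Nat.mod_mod i m)]
  exact hε _ (Finset.mem_range.2 (Nat.mod_lt i hm))

/-- The vertex function takes the value `c` at some vertex with angles `l` in cyclic order. -/
def HasWheelValue (S : Set EmbeddedComplex) (φ : VertexFunction) (l : List ℝ) (c : ℝ) : Prop :=
  ∃ (n : ℕ) (K : EuclideanComplex n) (v : EuclideanSpace ℝ (Fin n)) (m : ℕ)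
    (u : ℕ → EuclideanSpace ℝ (Fin n)), (⟨n, K⟩ : EmbeddedComplex) ∈ S ∧ IsWheel K v m u ∧
      wheelAngles v m u = l ∧ φ n K v = c

/-- Both rims are pulled in to a common distance `ε` from the centre. With equal angles the two
stars become isometric. -/
lemma HasWheelValue.unique (hsurface : ∀ K ∈ S, IsSimplicialSurface K.2)
    (hsub : ClosedUnderSubdivision S) (hinv : InvariantUnderSubdivision S φ)
    (hiso : InvariantUnderStarIsometry S φ) {l : List ℝ} {c c' : ℝ} (h : HasWheelValue S φ l c)
    (h' : HasWheelValue S φ l c') : c = c' := by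
  obtain ⟨n, K, v, m, u, hK, hw, rfl, rfl⟩ := h
  obtain ⟨k, L, w, m', u', hL, hw', hl, rfl⟩ := h'
  obtain rfl : m' = m := by
    have := congrArg List.length hl
    simpa [wheelAngles] using this
  have hm : 0 < m' := by have := hw.three_le; omega
  obtain ⟨ε, h1, h2, hε⟩ := (hw.exists_lt_dist.and (hw'.exists_lt_dist.and self_mem_nhdsWithin)).exists
  obtain ⟨J, hJ, hJw, hJφ⟩ := hw.exists_pull hsurface hsub hinv hK hε h1
  obtain ⟨M, hM, hMw, hMφ⟩ := hw'.exists_pull hsurface hsub hinv hL hε h2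
  rw [← hJφ, ← hMφ]
  refine hiso _ _ J M hJ hM v hJw.mem_vertices w hMw.mem_vertices
    (hJw.starsIsometric (hsurface _ hJ) (hsurface _ hM) hMw (fun i => ?_) fun i => ?_)
  · rw [dist_pullRim hε (hw.ne i), dist_pullRim hε (hw'.ne i)]
  · rw [angle_pullRim hε (hw.ne _) (hw.ne _), angle_pullRim hε (hw'.ne _) (hw'.ne _)]
    have e1 : u (i % m') = u i := (hw.eq_iff _ _).2 (Nat.mod_mod _ _)
    have e2 : u (i % m' + 1) = u (i + 1) := (hw.eq_iff _ _).2 (by simp [Nat.add_mod])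
    have e3 : u' (i % m') = u' i := (hw'.eq_iff _ _).2 (Nat.mod_mod _ _)
    have e4 : u' (i % m' + 1) = u' (i + 1) := (hw'.eq_iff _ _).2 (by simp [Nat.add_mod])
    have h3 := List.map_inj_left.1 hl (i % m') (List.mem_range.2 (Nat.mod_lt i hm))
    rw [e1, e2, e3, e4] at h3
    exact h3.symm

/-- The rim of a wheel has no distinguished starting point. -/
lemma HasWheelValue.rotate {a : ℝ} {l : List ℝ} {c : ℝ} (h : HasWheelValue S φ (a :: l) c) :
    HasWheelValue S φ (l ++ [a]) c := by
  obtain ⟨n, K, v, m, u, hK, hw, hl, hc⟩ := h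
  refine ⟨n, K, v, m, _, hK, hw.rotate, ?_, hc⟩
  obtain ⟨k, rfl⟩ : ∃ k, m = k + 1 := ⟨m - 1, by have := hw.three_le; omega⟩
  rw [wheelAngles, List.range_succ_eq_map, List.map_cons, List.map_map, List.cons.injEq] at hl
  rw [wheelAngles, List.range_succ, List.map_append, List.map_singleton, ← hl.2, ← hl.1]
  have h1 := hw.periodic 0
  have h2 := hw.periodic 1
  rw [zero_add] at h1
  rw [show 1 + (k + 1) = k + 1 + 1 by ring] at h2
  simp only [h1, h2, zero_add]
  rfl

lemma HasWheelValue.append_comm {l₁ : List ℝ} {c : ℝ} : ∀ {l₂ : List ℝ},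
    HasWheelValue S φ (l₁ ++ l₂) c → HasWheelValue S φ (l₂ ++ l₁) c := by
  induction l₁ with
  | nil => intro l₂ h; simpa using h
  | cons a l ih =>
    intro l₂ h
    have h1 := HasWheelValue.rotate (a := a) (l := l ++ l₂) h
    rw [List.append_assoc] at h1
    have h2 := ih h1
    simpa using h2

/-- After rotating `a` to the front, the rim edge opposite the centre is split in the direction at
angle `b`; invariance under subdivision keeps the value. -/
lemma HasWheelValue.refine (hsurface : ∀ K ∈ S, IsSimplicialSurface K.2)
    (hsub : ClosedUnderSubdivision S) (hinv : InvariantUnderSubdivision S φ) {l₁ l₂ : List ℝ}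
    {a b c : ℝ} (hb : 0 < b) (hba : b < a) (h : HasWheelValue S φ (l₁ ++ a :: l₂) c) :
    HasWheelValue S φ (l₁ ++ b :: (a - b) :: l₂) c := by
  suffices H : HasWheelValue S φ (b :: (a - b) :: (l₂ ++ l₁)) c by
    have := HasWheelValue.append_comm (l₁ := b :: (a - b) :: l₂) (l₂ := l₁) (by simpa using H)
    simpa using this
  obtain ⟨n, K, v, m, u, hK, hw, hl, rfl⟩ := h.append_comm
  have hm := hw.three_le
  have hlen : wheelAngles v m u =
      EuclideanGeometry.angle (u 0) v (u 1) :: (wheelAngles v m u).tail := by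
    obtain ⟨k, rfl⟩ : ∃ k, m = k + 1 := ⟨m - 1, by omega⟩
    rw [wheelAngles, List.range_succ_eq_map, List.map_cons, List.tail_cons]
  rw [hlen, List.cons_append, List.cons.injEq] at hl
  obtain ⟨hl1, hl2⟩ := hl
  obtain ⟨x, hx, hx1, hx2⟩ := exists_mem_openSegment_angle (hw.linkAdj 0) hb (hl1 ▸ hba)
  have hadj := hw.linkAdj 0
  have hx' : IsInOpenEdge K (u 0) (u 1) x := IsInOpenEdge.of_pair hadj.2.2.1
    (K.down_closed hadj.2.2.2 (Finset.subset_insert _ _) (Finset.insert_nonempty _ _)) hx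
  have hsd := edgeSplit_isSubdivision hx' (hsurface _ hK).finite_faces
  have hJ := hsub n K _ hK hsd
  refine ⟨n, _, v, m + 1, _, hJ, hw.split_opposite (hsurface _ hK).card_le_three hx', ?_,
    (hinv n K _ hK hJ hsd v hw.mem_vertices).symm⟩
  rw [wheelAngles_split hm (by have := hw.periodic 0; rwa [zero_add] at this), hx1]
  congr 1
  rw [show (EuclideanGeometry.angle x v (u 1)) = a - b by rw [← hl1]; exact hx2, hl2]

/-- Common refinement of two lists of positive angles with equal sums. The larger of the two leading
angles is cut so that its first piece matches the smaller one, the match joins the common prefix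
`p`, and the remaining total length drops. -/
lemma HasWheelValue.eq_of_sum_eq (hsurface : ∀ K ∈ S, IsSimplicialSurface K.2)
    (hsub : ClosedUnderSubdivision S) (hinv : InvariantUnderSubdivision S φ)
    (hiso : InvariantUnderStarIsometry S φ) {c c' : ℝ} (N : ℕ) : ∀ {p l l' : List ℝ},
    l.length + l'.length ≤ N → (∀ x ∈ l, 0 < x) → (∀ x ∈ l', 0 < x) → l.sum = l'.sum →
    HasWheelValue S φ (p ++ l) c → HasWheelValue S φ (p ++ l') c' → c = c' := by
  induction N with
  | zero =>
    intro p l l' hlen _ _ _ h h'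
    obtain rfl : l = [] := List.length_eq_zero_iff.1 (by omega)
    obtain rfl : l' = [] := List.length_eq_zero_iff.1 (by omega)
    exact h.unique hsurface hsub hinv hiso h'
  | succ N ih =>
    intro p l l' hlen hl hl' hsum h h'
    have hnn : ∀ l : List ℝ, (∀ x ∈ l, 0 < x) → 0 ≤ l.sum := fun l hl =>
      List.sum_nonneg fun x hx => (hl x hx).le
    rcases l with _ | ⟨a, t⟩ <;> rcases l' with _ | ⟨a', t'⟩
    · exact h.unique hsurface hsub hinv hiso h'
    · have := hl' a' (by simp)
      have := hnn t' fun x hx => hl' x (by simp [hx])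
      simp only [List.sum_nil, List.sum_cons] at hsum
      linarith
    · have := hl a (by simp)
      have := hnn t fun x hx => hl x (by simp [hx])
      simp only [List.sum_nil, List.sum_cons] at hsum
      linarith
    · simp only [List.length_cons] at hlen
      simp only [List.sum_cons] at hsum
      simp only [List.mem_cons, forall_eq_or_imp] at hl hl'
      rcases lt_trichotomy a a' with hlt | rfl | hlt
      · have h2 := h'.refine hsurface hsub hinv hl.1 hlt
        refine ih (p := p ++ [a]) (l := t) (l' := (a' - a) :: t') (by simp; omega) hl.2 ?_ ?_
          (by simpa using h) (by simpa using h2)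
        · simp only [List.mem_cons, forall_eq_or_imp]
          exact ⟨by linarith, hl'.2⟩
        · simp only [List.sum_cons]; linarith
      · exact ih (p := p ++ [a]) (l := t) (l' := t') (by omega) hl.2 hl'.2 (by linarith)
          (by simpa using h) (by simpa using h')
      · have h2 := h.refine hsurface hsub hinv hl'.1 hlt
        refine ih (p := p ++ [a']) (l := (a - a') :: t) (l' := t') (by simp; omega) ?_ hl'.2 ?_
          (by simpa using h2) (by simpa using h')
        · simp only [List.mem_cons, forall_eq_or_imp]
          exact ⟨by linarith, hl.2⟩
        · simp only [List.sum_cons]; linarith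

lemma IsWheel.wheelAngles_pos {v : EuclideanSpace ℝ (Fin n)} {m : ℕ} {u : ℕ → 𝔼}
    (h : IsWheel K v m u) : ∀ x ∈ wheelAngles v m u, 0 < x := by
  intro x hx
  obtain ⟨i, -, rfl⟩ := List.mem_map.1 hx
  obtain ⟨h1, h2, h3, h4⟩ := h.linkAdj i
  exact angle_pos_of_mem_faces h4 h1 h2 h3

/-- An invariant vertex function depends only on the sum of the angles at the vertex. -/
lemma eq_of_angleSum_eq (hsurface : ∀ K ∈ S, IsSimplicialSurface K.2)
    (hsub : ClosedUnderSubdivision S) (hinv : InvariantUnderSubdivision S φ)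
    (hiso : InvariantUnderStarIsometry S φ) {k : ℕ} {L : EuclideanComplex k}
    (hK : (⟨n, K⟩ : EmbeddedComplex) ∈ S) (hL : (⟨k, L⟩ : EmbeddedComplex) ∈ S)
    {v : EuclideanSpace ℝ (Fin n)} {w : EuclideanSpace ℝ (Fin k)} (hv : v ∈ K.vertices)
    (hw : w ∈ L.vertices) (h : angleSum K v = angleSum L w) : φ n K v = φ k L w := by
  obtain ⟨m, u, hu⟩ := (hsurface _ hK).exists_wheel hv
  obtain ⟨m', u', hu'⟩ := (hsurface _ hL).exists_wheel hw
  rw [hu.angleSum_eq, hu'.angleSum_eq] at h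
  exact HasWheelValue.eq_of_sum_eq hsurface hsub hinv hiso _ (p := []) le_rfl hu.wheelAngles_pos
    hu'.wheelAngles_pos h ⟨n, K, v, m, u, hK, hu, rfl, rfl⟩ ⟨k, L, w, m', u', hL, hu', rfl, rfl⟩

lemma angleSum_pos (hK : IsSimplicialSurface K) {v : EuclideanSpace ℝ (Fin n)}
    (hv : v ∈ K.vertices) : 0 < angleSum K v := by
  obtain ⟨m, u, hu⟩ := hK.exists_wheel hv
  rw [hu.angleSum_eq]
  refine List.sum_pos _ hu.wheelAngles_pos ?_
  have := hu.three_le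
  intro h
  have := congrArg List.length h
  simp only [wheelAngles, List.length_map, List.length_range, List.length_nil] at this
  omega

end WheelValues

/-! ### Hat functions on the fan of directions spaced by `π / m`. -/

section Tents

/-- A piecewise linear function on the plane that vanishes outside the directions at angle less than
`τ` from `θ`. -/
noncomputable def tent (τ θ x y : ℝ) : ℝ :=
  max 0 (Real.sin τ * (x * Real.cos θ + y * Real.sin θ) -
    Real.cos τ * |y * Real.cos θ - x * Real.sin θ|)

/-- The tent at direction `0` lives on the sectors `j = 0` and `j = 2m - 1`, where it picks out the
coefficient of that direction; on all other sectors it vanishes. -/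
lemma tent_of_directions {m : ℕ} (hm : 2 ≤ m) (j : ℕ) (hj : j < 2 * m) {a b : ℝ} (ha : 0 ≤ a)
    (hb : 0 ≤ b) : tent (Real.pi / m) 0
      (a * Real.cos (j * (Real.pi / m)) + b * Real.cos ((j + 1) * (Real.pi / m)))
      (a * Real.sin (j * (Real.pi / m)) + b * Real.sin ((j + 1) * (Real.pi / m))) =
    Real.sin (Real.pi / m) * ((if j = 0 then a else 0) + if j + 1 = 2 * m then b else 0) := by
  have hm0 : (0 : ℝ) < m := by exact_mod_cast (by omega : 0 < m)
  have hm2 : (2 : ℝ) ≤ m := by exact_mod_cast hm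
  obtain ⟨τ, hτ⟩ : ∃ τ, τ = Real.pi / m := ⟨_, rfl⟩
  have hmτ : m * τ = Real.pi := by rw [hτ]; field_simp
  rw [← hτ]
  have hτ0 : 0 < τ := by rw [hτ]; positivity
  have hτ2 : τ ≤ Real.pi / 2 := by nlinarith
  have hs : 0 < Real.sin τ := Real.sin_pos_of_pos_of_lt_pi hτ0 (by linarith [Real.pi_pos])
  have hc : 0 ≤ Real.cos τ := Real.cos_nonneg_of_neg_pi_div_two_le_of_le (by linarith) hτ2
  simp only [tent, Real.cos_zero, Real.sin_zero, mul_one, mul_zero, add_zero, sub_zero]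
  by_cases h0 : j = 0
  · subst h0
    have h1 : ¬ (0 + 1 = 2 * m) := by omega
    rw [if_pos rfl, if_neg h1]
    simp only [Nat.cast_zero, zero_mul, Real.cos_zero, Real.sin_zero, zero_add, one_mul, mul_one,
      mul_zero, add_zero]
    rw [abs_of_nonneg (by positivity), max_eq_right]
    · ring
    · have : 0 ≤ Real.sin τ * a := by positivity
      linarith
  rw [if_neg h0]
  by_cases h1 : j + 1 = 2 * m
  · rw [if_pos h1]
    have hj' : (j : ℝ) + 1 = 2 * m := by exact_mod_cast h1
    have e1 : ((j : ℝ) + 1) * τ = 2 * Real.pi := by rw [hj', mul_assoc, hmτ]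
    have e2 : (j : ℝ) * τ = 2 * Real.pi - τ := by linarith
    rw [e1, e2, Real.cos_two_pi, Real.sin_two_pi, Real.cos_two_pi_sub, Real.sin_two_pi_sub]
    rw [show a * -Real.sin τ + b * 0 = -(a * Real.sin τ) by ring, abs_neg,
      abs_of_nonneg (by positivity), max_eq_right]
    · ring
    · have : 0 ≤ Real.sin τ * b := by positivity
      linarith
  rw [if_neg h1, add_zero, mul_zero, max_eq_left_iff]
  have hj1 : (1 : ℝ) ≤ j := by exact_mod_cast Nat.one_le_iff_ne_zero.2 h0
  have hj2 : (j : ℝ) + 2 ≤ 2 * m := by exact_mod_cast (by omega : j + 2 ≤ 2 * m)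
  have key1 : Real.sin τ * (a * Real.cos (j * τ) + b * Real.cos ((j + 1) * τ)) -
      Real.cos τ * (a * Real.sin (j * τ) + b * Real.sin ((j + 1) * τ)) =
      -(a * Real.sin (j * τ - τ) + b * Real.sin ((j + 1) * τ - τ)) := by
    rw [Real.sin_sub, Real.sin_sub]; ring
  have key2 : Real.sin τ * (a * Real.cos (j * τ) + b * Real.cos ((j + 1) * τ)) +
      Real.cos τ * (a * Real.sin (j * τ) + b * Real.sin ((j + 1) * τ)) =
      -(a * Real.sin (j * τ + τ - Real.pi) + b * Real.sin ((j + 1) * τ + τ - Real.pi)) := by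
    rw [Real.sin_sub_pi, Real.sin_sub_pi, Real.sin_add, Real.sin_add]; ring
  have ha1 := mul_le_mul_of_nonneg_left
    (le_abs_self (a * Real.sin (j * τ) + b * Real.sin ((j + 1) * τ))) hc
  have ha2 := mul_le_mul_of_nonneg_left
    (neg_le_abs (a * Real.sin (j * τ) + b * Real.sin ((j + 1) * τ))) hc
  -- For `j ≤ m` it suffices to compare `|y|` with `y`, through `key1`; for `m ≤ j` with `-y`,
  -- through `key2`.
  rcases le_total j m with h | h
  · have hj3 : (j : ℝ) ≤ m := by exact_mod_cast h
    have s1 : 0 ≤ Real.sin (j * τ - τ) :=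
      Real.sin_nonneg_of_nonneg_of_le_pi (by nlinarith) (by nlinarith)
    have s2 : 0 ≤ Real.sin ((j + 1) * τ - τ) :=
      Real.sin_nonneg_of_nonneg_of_le_pi (by nlinarith) (by nlinarith)
    have := mul_nonneg ha s1
    have := mul_nonneg hb s2
    linarith
  · have hj3 : (m : ℝ) ≤ j := by exact_mod_cast h
    have s1 : 0 ≤ Real.sin (j * τ + τ - Real.pi) :=
      Real.sin_nonneg_of_nonneg_of_le_pi (by nlinarith) (by nlinarith)
    have s2 : 0 ≤ Real.sin ((j + 1) * τ + τ - Real.pi) :=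
      Real.sin_nonneg_of_nonneg_of_le_pi (by nlinarith) (by nlinarith)
    have := mul_nonneg ha s1
    have := mul_nonneg hb s2
    linarith

lemma tent_rotate (τ θ x y : ℝ) : tent τ θ x y =
    tent τ 0 (x * Real.cos θ + y * Real.sin θ) (y * Real.cos θ - x * Real.sin θ) := by
  simp [tent]

/-- Rotation by the angle of direction `k` reduces to direction `0`, with sector index `i - k` taken
modulo `2m`. -/
lemma tent_cone {m : ℕ} (hm : 2 ≤ m) (i k : ℕ) {a b : ℝ} (ha : 0 ≤ a) (hb : 0 ≤ b) :
    tent (Real.pi / m) (k * (Real.pi / m))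
      (a * Real.cos (i * (Real.pi / m)) + b * Real.cos ((i + 1) * (Real.pi / m)))
      (a * Real.sin (i * (Real.pi / m)) + b * Real.sin ((i + 1) * (Real.pi / m))) =
    Real.sin (Real.pi / m) *
      ((if i % (2 * m) = k % (2 * m) then a else 0) +
        if (i + 1) % (2 * m) = k % (2 * m) then b else 0) := by
  have hm0 : (m : ℝ) ≠ 0 := by exact_mod_cast (by omega : m ≠ 0)
  obtain ⟨τ, hτ⟩ : ∃ τ, τ = Real.pi / m := ⟨_, rfl⟩
  have hmτ : m * τ = Real.pi := by rw [hτ]; field_simp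
  rw [← hτ]
  set N := 2 * m with hN
  have hNpos : 0 < N := by omega
  obtain ⟨q, j, hj, hq⟩ : ∃ (q : ℤ) (j : ℕ), j < N ∧ (i : ℤ) - k = N * q + j := by
    have h1 := Int.emod_nonneg ((i : ℤ) - k) (show (N : ℤ) ≠ 0 by omega)
    have h2 := Int.emod_lt_of_pos ((i : ℤ) - k) (show (0 : ℤ) < N by omega)
    refine ⟨((i : ℤ) - k) / N, (((i : ℤ) - k) % N).toNat, by omega, ?_⟩
    rw [Int.toNat_of_nonneg h1, Int.mul_ediv_add_emod]
  have hqR : (i : ℝ) - k = N * q + j := by exact_mod_cast hq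
  have hang : (i : ℝ) * τ - k * τ = j * τ + q * (2 * Real.pi) := by
    rw [← sub_mul, hqR, hN]; push_cast; linear_combination (2 * (q : ℝ)) * hmτ
  have hang' : ((i : ℝ) + 1) * τ - k * τ = (j + 1) * τ + q * (2 * Real.pi) := by
    linear_combination hang
  have c1 : Real.cos (i * τ) * Real.cos (k * τ) + Real.sin (i * τ) * Real.sin (k * τ) =
      Real.cos (j * τ) := by
    rw [← Real.cos_sub, hang, Real.cos_add_int_mul_two_pi]
  have c2 : Real.cos ((i + 1) * τ) * Real.cos (k * τ) + Real.sin ((i + 1) * τ) * Real.sin (k * τ) =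
      Real.cos ((j + 1) * τ) := by
    rw [← Real.cos_sub, hang', Real.cos_add_int_mul_two_pi]
  have s1 : Real.sin (i * τ) * Real.cos (k * τ) - Real.cos (i * τ) * Real.sin (k * τ) =
      Real.sin (j * τ) := by
    rw [← Real.sin_sub, hang, Real.sin_add_int_mul_two_pi]
  have s2 : Real.sin ((i + 1) * τ) * Real.cos (k * τ) - Real.cos ((i + 1) * τ) * Real.sin (k * τ) =
      Real.sin ((j + 1) * τ) := by
    rw [← Real.sin_sub, hang', Real.sin_add_int_mul_two_pi]
  have h := tent_of_directions hm j hj ha hb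
  rw [← hτ] at h
  rw [tent_rotate, show (a * Real.cos (i * τ) + b * Real.cos ((i + 1) * τ)) * Real.cos (k * τ) +
      (a * Real.sin (i * τ) + b * Real.sin ((i + 1) * τ)) * Real.sin (k * τ) =
      a * Real.cos (j * τ) + b * Real.cos ((j + 1) * τ) by linear_combination a * c1 + b * c2,
    show (a * Real.sin (i * τ) + b * Real.sin ((i + 1) * τ)) * Real.cos (k * τ) -
      (a * Real.cos (i * τ) + b * Real.cos ((i + 1) * τ)) * Real.sin (k * τ) =
      a * Real.sin (j * τ) + b * Real.sin ((j + 1) * τ) by linear_combination a * s1 + b * s2, h]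
  have hdvd : ∀ x : ℕ, x ≤ N → 0 ≤ x → ((N : ℤ) ∣ x ↔ x = 0 ∨ x = N) := by
    intro x hx _
    constructor
    · rintro ⟨c, hc⟩
      rcases Nat.eq_zero_or_pos x with h0 | h0
      · exact Or.inl h0
      · right
        have := Int.le_of_dvd (by omega) ⟨c, hc⟩
        omega
    · rintro (rfl | rfl) <;> simp
  have e1 : i % N = k % N ↔ j = 0 := by
    have h1 : i % N = k % N ↔ (N : ℤ) ∣ (j : ℤ) := by
      rw [eq_comm, ← Nat.ModEq, Nat.modEq_iff_dvd, hq]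
      exact Int.dvd_add_right (dvd_mul_right _ _)
    rw [h1, hdvd j hj.le (Nat.zero_le _)]
    omega
  have e2 : (i + 1) % N = k % N ↔ j + 1 = N := by
    have h1 : (i + 1) % N = k % N ↔ (N : ℤ) ∣ ((j + 1 : ℕ) : ℤ) := by
      rw [eq_comm, ← Nat.ModEq, Nat.modEq_iff_dvd,
        show ((i + 1 : ℕ) : ℤ) - k = N * q + (j + 1 : ℕ) by push_cast; linarith]
      exact Int.dvd_add_right (dvd_mul_right _ _)
    rw [h1, hdvd (j + 1) hj (Nat.zero_le _)]
    omega
  simp only [e1, e2]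
  rfl

end Tents

/-! ### Bipyramids over star-shaped polygons as simplicial complexes. -/

section Bipyramids

local notation "𝔼³" => EuclideanSpace ℝ (Fin 3)

/-- The vertices of a star-shaped `2m`-gon with two alternating radii. -/
noncomputable def starPoint (m : ℕ) (r₀ r₁ : ℝ) (k : ℕ) : EuclideanSpace ℝ (Fin 2) :=
  !₂[(if Even k then r₀ else r₁) * Real.cos (k * (Real.pi / m)),
    (if Even k then r₀ else r₁) * Real.sin (k * (Real.pi / m))]

/-- The polygon as the equator of a bipyramid. -/
noncomputable def equator (m : ℕ) (r₀ r₁ : ℝ) (k : ℕ) : 𝔼³ := planeInSpace (starPoint m r₀ r₁ k)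

/-- The point at height `h` on the axis. -/
noncomputable def axisPoint (h : ℝ) : 𝔼³ := !₂[0, 0, h]

/-- The simplices of the bipyramid with apexes at heights `h` and `-h`. -/
def bipyramidFaces (m : ℕ) (r₀ r₁ h : ℝ) : Set (Finset 𝔼³) :=
  {s | s.Nonempty ∧ ∃ i, ∃ a ∈ ({axisPoint h, axisPoint (-h)} : Set 𝔼³),
    s ⊆ {a, equator m r₀ r₁ i, equator m r₀ r₁ (i + 1)}}

variable {m : ℕ} {r₀ r₁ h : ℝ}

lemma equator_zero (k : ℕ) : equator m r₀ r₁ k 0 =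
    (if Even k then r₀ else r₁) * Real.cos (k * (Real.pi / m)) := rfl

lemma equator_one (k : ℕ) : equator m r₀ r₁ k 1 =
    (if Even k then r₀ else r₁) * Real.sin (k * (Real.pi / m)) := rfl

lemma equator_two (k : ℕ) : equator m r₀ r₁ k 2 = 0 := rfl

lemma radius_pos (h₀ : 0 < r₀) (h₁ : 0 < r₁) (k : ℕ) : 0 < if Even k then r₀ else r₁ := by
  split_ifs <;> assumption

lemma starPoint_periodic (hm : 2 ≤ m) (k : ℕ) :
    starPoint m r₀ r₁ (k + 2 * m) = starPoint m r₀ r₁ k := by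
  have hm0 : (m : ℝ) ≠ 0 := by exact_mod_cast (by omega : m ≠ 0)
  have h1 : ((k + 2 * m : ℕ) : ℝ) * (Real.pi / m) = k * (Real.pi / m) + 2 * Real.pi := by
    push_cast; field_simp
  have h2 : Even (k + 2 * m) ↔ Even k := by simp [Nat.even_add]
  simp only [starPoint, h1, h2, Real.cos_add_two_pi, Real.sin_add_two_pi]

lemma equator_periodic (hm : 2 ≤ m) (k : ℕ) :
    equator m r₀ r₁ (k + 2 * m) = equator m r₀ r₁ k := by
  rw [equator, starPoint_periodic hm, equator]

lemma sin_pi_div_pos (hm : 2 ≤ m) : 0 < Real.sin (Real.pi / m) := by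
  have hm2 : (2 : ℝ) ≤ m := by exact_mod_cast hm
  refine Real.sin_pos_of_pos_of_lt_pi (by positivity) ?_
  rw [div_lt_iff₀ (by linarith)]
  nlinarith [Real.pi_pos]

/-- The tent functions recover the coefficients of a point of a cone over an edge. -/
lemma tent_equator (hm : 2 ≤ m) (h₀ : 0 < r₀) (h₁ : 0 < r₁) (i k : ℕ) {a b : ℝ} (ha : 0 ≤ a)
    (hb : 0 ≤ b) {x y : ℝ}
    (hx : x = a * equator m r₀ r₁ i 0 + b * equator m r₀ r₁ (i + 1) 0)
    (hy : y = a * equator m r₀ r₁ i 1 + b * equator m r₀ r₁ (i + 1) 1) :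
    tent (Real.pi / m) (k * (Real.pi / m)) x y =
    Real.sin (Real.pi / m) * (if Even k then r₀ else r₁) *
      ((if i % (2 * m) = k % (2 * m) then a else 0) +
        if (i + 1) % (2 * m) = k % (2 * m) then b else 0) := by
  have hi := radius_pos h₀ h₁ i
  have hi' := radius_pos h₀ h₁ (i + 1)
  have := tent_cone hm i k (mul_nonneg ha hi.le) (mul_nonneg hb hi'.le)
  rw [hx, hy, equator_zero, equator_zero, equator_one, equator_one]
  simp only [← mul_assoc] at this ⊢
  push_cast at this ⊢
  rw [this, mul_assoc]
  congr 1
  have hpar : ∀ i : ℕ, i % (2 * m) = k % (2 * m) → (Even i ↔ Even k) := by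
    intro i hik
    have : i % 2 = k % 2 := by
      rw [← Nat.mod_mul_right_mod i 2 m, ← Nat.mod_mul_right_mod k 2 m, hik]
    rw [Nat.even_iff, Nat.even_iff, this]
  rw [mul_add]
  congr 1
  · by_cases e : i % (2 * m) = k % (2 * m)
    · simp only [if_pos e, hpar _ e]; ring
    · simp only [if_neg e, mul_zero]
  · by_cases e : (i + 1) % (2 * m) = k % (2 * m)
    · simp only [if_pos e, hpar _ e]; ring
    · simp only [if_neg e, mul_zero]

lemma equator_eq_iff (hm : 2 ≤ m) (h₀ : 0 < r₀) (h₁ : 0 < r₁) (i j : ℕ) :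
    equator m r₀ r₁ i = equator m r₀ r₁ j ↔ i % (2 * m) = j % (2 * m) := by
  have hs := sin_pi_div_pos hm
  constructor
  · intro he
    have e1 := tent_equator hm h₀ h₁ i j zero_le_one le_rfl (x := equator m r₀ r₁ i 0)
      (y := equator m r₀ r₁ i 1) (by ring) (by ring)
    have e2 := tent_equator hm h₀ h₁ j j zero_le_one le_rfl (x := equator m r₀ r₁ i 0)
      (y := equator m r₀ r₁ i 1) (by rw [he]; ring) (by rw [he]; ring)
    by_contra hne
    rw [e1, if_neg hne, if_pos rfl] at e2
    have := radius_pos h₀ h₁ j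
    have h3 : 0 < Real.sin (Real.pi / m) * (if Even j then r₀ else r₁) := by positivity
    simp only [ite_self, add_zero, mul_zero, mul_one] at e2
    linarith
  · intro he
    have hp : Function.Periodic (equator m r₀ r₁) (2 * m) := equator_periodic hm
    rw [← hp.map_mod_nat i, he, hp.map_mod_nat]

lemma axisPoint_ne_equator (h : ℝ) (h0 : h ≠ 0) (k : ℕ) : axisPoint h ≠ equator m r₀ r₁ k := by
  intro he
  have := congrArg (fun x : 𝔼³ => x 2) he
  exact h0 this

lemma axisPoint_ne_neg (h0 : 0 < h) : axisPoint h ≠ axisPoint (-h) := by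
  intro he
  have : h = -h := congrArg (fun x : 𝔼³ => x 2) he
  linarith

lemma equator_ne_succ (hm : 2 ≤ m) (h₀ : 0 < r₀) (h₁ : 0 < r₁) (i : ℕ) :
    equator m r₀ r₁ i ≠ equator m r₀ r₁ (i + 1) := by
  rw [Ne, equator_eq_iff hm h₀ h₁]
  intro he
  have := (Nat.modEq_iff_dvd' (by omega : i ≤ i + 1)).1 he
  simp at this

/-- The weights of a point in a face of the bipyramid, in terms of its coordinates. -/
lemma weight_of_bipyramidFaces (hm : 2 ≤ m) (h₀ : 0 < r₀) (h₁ : 0 < r₁) (hh : 0 < h)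
    {w : 𝔼³ →₀ ℝ} (hw : IsFaceWeight (bipyramidFaces m r₀ r₁ h) w) :
    (∀ k : ℕ, tent (Real.pi / m) (k * (Real.pi / m)) (weightBarycenter w 0) (weightBarycenter w 1) =
      Real.sin (Real.pi / m) * (if Even k then r₀ else r₁) * w (equator m r₀ r₁ k)) ∧
    max 0 (weightBarycenter w 2) = h * w (axisPoint h) ∧
    max 0 (-(weightBarycenter w 2)) = h * w (axisPoint (-h)) ∧
    ∀ x, w x ≠ 0 → x = axisPoint h ∨ x = axisPoint (-h) ∨ ∃ k, x = equator m r₀ r₁ k := by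
  obtain ⟨-, i, a, ha, hsub⟩ := hw.support_mem
  have hane : ∀ k, a ≠ equator m r₀ r₁ k := by
    rcases ha with rfl | rfl
    · exact axisPoint_ne_equator _ hh.ne'
    · exact axisPoint_ne_equator _ (neg_ne_zero.2 hh.ne')
  have hii := equator_ne_succ hm h₀ h₁ i
  have hbar : weightBarycenter w = w a • a + (w (equator m r₀ r₁ i) • equator m r₀ r₁ i +
      w (equator m r₀ r₁ (i + 1)) • equator m r₀ r₁ (i + 1)) := by
    rw [weightBarycenter_eq_sum hsub, Finset.sum_insert, Finset.sum_pair hii]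
    simp [hane]
  have ha0 : a 0 = 0 := by rcases ha with rfl | rfl <;> rfl
  have ha1 : a 1 = 0 := by rcases ha with rfl | rfl <;> rfl
  have hz : weightBarycenter w 2 = w a * a 2 := by
    rw [hbar]; simp [equator_two]
  have hsupp : ∀ x, w x ≠ 0 → x = a ∨ x = equator m r₀ r₁ i ∨ x = equator m r₀ r₁ (i + 1) := by
    intro x hx
    simpa using hsub (Finsupp.mem_support_iff.2 hx)
  have hpq := axisPoint_ne_neg hh
  have hp2 : axisPoint h 2 = h := rfl
  have hq2 : axisPoint (-h) 2 = -h := rfl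
  have hother : ∀ z, z ∈ ({axisPoint h, axisPoint (-h)} : Set 𝔼³) → z ≠ a → w z = 0 := by
    intro z hz hza
    by_contra hne
    have hze : ∀ k, z ≠ equator m r₀ r₁ k := by
      rcases hz with rfl | rfl
      · exact axisPoint_ne_equator _ hh.ne'
      · exact axisPoint_ne_equator _ (neg_ne_zero.2 hh.ne')
    rcases hsupp z hne with h1 | h1 | h1
    · exact hza h1
    · exact hze _ h1
    · exact hze _ h1
  have hwa := hw.nonneg a
  refine ⟨fun k => ?_, ?_, ?_, fun x hx => ?_⟩
  · rw [tent_equator hm h₀ h₁ i k (hw.nonneg (equator m r₀ r₁ i)) (hw.nonneg (equator m r₀ r₁ (i + 1)))]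
    · congr 1
      simp only [← equator_eq_iff hm h₀ h₁]
      by_cases e1 : equator m r₀ r₁ i = equator m r₀ r₁ k
      · have e2 : equator m r₀ r₁ (i + 1) ≠ equator m r₀ r₁ k := fun e => hii (e1.trans e.symm)
        rw [if_pos e1, if_neg e2, add_zero, e1]
      · rw [if_neg e1]
        by_cases e2 : equator m r₀ r₁ (i + 1) = equator m r₀ r₁ k
        · rw [if_pos e2, zero_add, e2]
        · rw [if_neg e2, add_zero]
          by_contra hne
          rcases hsupp _ (Ne.symm hne) with h1 | h1 | h1
          · exact hane k h1.symm
          · exact e1 h1.symm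
          · exact e2 h1.symm
    · rw [hbar]; simp [ha0]
    · rw [hbar]; simp [ha1]
  · rw [hz]
    rcases ha with rfl | rfl
    · rw [hp2, max_eq_right (by positivity), mul_comm]
    · rw [hq2, hother (axisPoint h) (Or.inl rfl) hpq, mul_zero, max_eq_left]
      nlinarith
  · rw [hz]
    rcases ha with rfl | rfl
    · rw [hp2, hother (axisPoint (-h)) (Or.inr rfl) hpq.symm, mul_zero, max_eq_left]
      nlinarith
    · rw [hq2, max_eq_right (by nlinarith)]; ring
  · rcases hsupp x hx with rfl | rfl | rfl
    · rcases ha with rfl | rfl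
      · exact Or.inl rfl
      · exact Or.inr (Or.inl rfl)
    · exact Or.inr (Or.inr ⟨_, rfl⟩)
    · exact Or.inr (Or.inr ⟨_, rfl⟩)

/-- Each weight is a function of the point alone, whichever face carries it: tents recover the
weights on the equator, and the positive and negative parts of the height recover those of the
apices. -/
lemma uniqueFaceWeights_bipyramidFaces (hm : 2 ≤ m) (h₀ : 0 < r₀) (h₁ : 0 < r₁) (hh : 0 < h) :
    UniqueFaceWeights (bipyramidFaces m r₀ r₁ h) := by
  intro w w' hw hw' hb
  obtain ⟨e1, e2, e3, e4⟩ := weight_of_bipyramidFaces hm h₀ h₁ hh hw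
  obtain ⟨e1', e2', e3', e4'⟩ := weight_of_bipyramidFaces hm h₀ h₁ hh hw'
  rw [← hb] at e2' e3'
  have hs := sin_pi_div_pos hm
  have key : ∀ x, (x = axisPoint h ∨ x = axisPoint (-h) ∨ ∃ k, x = equator m r₀ r₁ k) →
      w x = w' x := by
    rintro x (rfl | rfl | ⟨k, rfl⟩)
    · exact mul_left_cancel₀ hh.ne' (e2.symm.trans e2')
    · exact mul_left_cancel₀ hh.ne' (e3.symm.trans e3')
    · have h1 := e1 k
      have h2 := e1' k
      rw [← hb] at h2
      have := radius_pos h₀ h₁ k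
      exact mul_left_cancel₀ (by positivity) (h1.symm.trans h2)
  ext x
  by_cases hx : w x = 0
  · by_cases hx' : w' x = 0
    · rw [hx, hx']
    · exact key x (e4' x hx')
  · exact key x (e4 x hx)

/-- The bipyramid over a star-shaped polygon. -/
def starBipyramid (hm : 2 ≤ m) (h₀ : 0 < r₀) (h₁ : 0 < r₁) (hh : 0 < h) : EuclideanComplex 3 :=
  complexOfUniqueFaceWeights (bipyramidFaces m r₀ r₁ h) (fun _ hs => hs.1)
    (fun _ hs _ hts ht => ⟨ht, by
      obtain ⟨i, a, ha, hsub⟩ := hs.2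
      exact ⟨i, a, ha, hts.trans hsub⟩⟩) (uniqueFaceWeights_bipyramidFaces hm h₀ h₁ hh)

end Bipyramids

/-! ### The star polygon and the links of the bipyramid over it. -/

section StarBipyramids

local notation "𝔼³" => EuclideanSpace ℝ (Fin 3)

variable {m : ℕ} {r₀ r₁ h : ℝ}

lemma starPoint_mod (hm : 2 ≤ m) {i j : ℕ} (h : i % (2 * m) = j % (2 * m)) :
    starPoint m r₀ r₁ i = starPoint m r₀ r₁ j := by
  have hp : Function.Periodic (starPoint m r₀ r₁) (2 * m) := starPoint_periodic hm
  rw [← hp.map_mod_nat i, h, hp.map_mod_nat]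

lemma starPoint_eq_iff (hm : 2 ≤ m) (h₀ : 0 < r₀) (h₁ : 0 < r₁) (i j : ℕ) :
    starPoint m r₀ r₁ i = starPoint m r₀ r₁ j ↔ i % (2 * m) = j % (2 * m) := by
  refine ⟨fun he => (equator_eq_iff hm h₀ h₁ i j).1 ?_, starPoint_mod hm⟩
  rw [equator, he, equator]

/-- The star-shaped polygon. -/
noncomputable def starPolygon (m : ℕ) (r₀ r₁ : ℝ) : Polygon (EuclideanSpace ℝ (Fin 2)) (2 * m) :=
  ⟨fun i => starPoint m r₀ r₁ i⟩

lemma starPolygon_succ (hm : 2 ≤ m) [NeZero (2 * m)] (i : Fin (2 * m)) :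
    (starPolygon m r₀ r₁).vertices (i + 1) = starPoint m r₀ r₁ (i + 1 : ℕ) := by
  refine starPoint_mod hm ?_
  rw [Fin.val_add, Nat.mod_mod, Fin.val_one', Nat.mod_eq_of_lt (show 1 < 2 * m by omega)]

/-- The tents evaluate the coefficient at every polygon vertex, so a point on two edges has the same
coefficients along both. -/
lemma coefficients_eq (hm : 2 ≤ m) (h₀ : 0 < r₀) (h₁ : 0 < r₁) {i j : ℕ} {t t' : ℝ}
    (ht : t ∈ Set.Icc (0 : ℝ) 1) (ht' : t' ∈ Set.Icc (0 : ℝ) 1)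
    (he : AffineMap.lineMap (starPoint m r₀ r₁ i) (starPoint m r₀ r₁ (i + 1)) t =
      AffineMap.lineMap (starPoint m r₀ r₁ j) (starPoint m r₀ r₁ (j + 1)) t') (k : ℕ) :
    ((if i % (2 * m) = k % (2 * m) then 1 - t else 0) +
        if (i + 1) % (2 * m) = k % (2 * m) then t else 0) =
      (if j % (2 * m) = k % (2 * m) then 1 - t' else 0) +
        if (j + 1) % (2 * m) = k % (2 * m) then t' else 0 := by
  have hc : ∀ (i : ℕ) (t : ℝ) (l : Fin 2),
      AffineMap.lineMap (starPoint m r₀ r₁ i) (starPoint m r₀ r₁ (i + 1)) t l =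
      (1 - t) * starPoint m r₀ r₁ i l + t * starPoint m r₀ r₁ (i + 1) l := by
    intro i t l
    rw [AffineMap.lineMap_apply_module]; simp
  have e1 := tent_equator hm h₀ h₁ i k (sub_nonneg.2 ht.2) ht.1 (hc i t 0) (hc i t 1)
  have e2 := tent_equator hm h₀ h₁ j k (sub_nonneg.2 ht'.2) ht'.1 (hc j t' 0) (hc j t' 1)
  rw [← he, e1] at e2
  have h1 := sin_pi_div_pos hm
  have h2 := radius_pos h₀ h₁ k
  exact mul_left_cancel₀ (by positivity) e2

lemma isSimpleClosedPolygon_starPolygon (hm : 2 ≤ m) [NeZero (2 * m)] (h₀ : 0 < r₀) (h₁ : 0 < r₁) :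
    IsSimpleClosedPolygon (starPolygon m r₀ r₁) := by
  refine ⟨by omega, fun i j hij => ?_, fun i j hij x hx => ?_⟩
  · have := (starPoint_eq_iff hm h₀ h₁ _ _).1 hij
    rw [Nat.mod_eq_of_lt i.2, Nat.mod_eq_of_lt j.2] at this
    exact Fin.ext this
  · have hrot : ∀ i : Fin (2 * m), (starPolygon m r₀ r₁) (finRotate _ i) =
        starPoint m r₀ r₁ (i + 1 : ℕ) := by
      intro i
      rw [← starPolygon_succ hm]
      rw [finRotate_apply]
    obtain ⟨⟨t, ht, hxt⟩, ⟨t', ht', hxt'⟩⟩ := hx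
    simp only [hrot] at hxt hxt'
    rw [starPolygon_succ hm, starPolygon_succ hm]
    change x ∈ ({starPoint m r₀ r₁ i, _} : Set _) ∩ {starPoint m r₀ r₁ j, _}
    have hne : (i : ℕ) % (2 * m) ≠ (j : ℕ) % (2 * m) := by
      rw [Nat.mod_eq_of_lt i.2, Nat.mod_eq_of_lt j.2]
      exact fun h => hij (Fin.ext h)
    have hne' : ((i : ℕ) + 1) % (2 * m) ≠ ((j : ℕ) + 1) % (2 * m) := fun h =>
      hne (Nat.ModEq.add_right_cancel' 1 h)
    have hs : ∀ i : ℕ, (i + 1) % (2 * m) ≠ i % (2 * m) := fun i h => by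
      have := (Nat.modEq_iff_dvd' (by omega : i ≤ i + 1)).1 (show i ≡ i + 1 [MOD 2 * m] from h.symm)
      simp at this
    have hc := coefficients_eq hm h₀ h₁ ht ht' (hxt.trans hxt'.symm)
    -- Compare coefficients at the endpoints of edge `i`. If `t < 1` then edge `j` ends at `i`, and
    -- if `0 < t` then it starts at `i + 1`; both together would make `2 * m` divide `2`.
    have hci := hc i
    have hci' := hc (i + 1)
    rw [if_pos rfl, if_neg (hs i), if_neg hne.symm] at hci
    rw [if_neg (hs i).symm, if_pos rfl, if_neg hne'.symm] at hci'
    rcases ht.1.eq_or_lt with h0 | h0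
    · subst h0
      rw [AffineMap.lineMap_apply_zero] at hxt
      have h1 : ((j : ℕ) + 1) % (2 * m) = (i : ℕ) % (2 * m) := by
        by_contra h1
        rw [if_neg h1] at hci
        norm_num at hci
      have h2 := starPoint_mod (r₀ := r₀) (r₁ := r₁) hm h1
      exact ⟨Or.inl hxt.symm, Or.inr (hxt.symm.trans h2.symm)⟩
    · have h1 : (j : ℕ) % (2 * m) = ((i : ℕ) + 1) % (2 * m) := by
        by_contra h1
        rw [if_neg h1] at hci'
        linarith
      have h2 := starPoint_mod (r₀ := r₀) (r₁ := r₁) hm h1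
      rcases ht.2.eq_or_lt with h3 | h3
      · subst h3
        rw [AffineMap.lineMap_apply_one] at hxt
        exact ⟨Or.inr hxt.symm, Or.inl (hxt.symm.trans h2.symm)⟩
      · exfalso
        have h4 : ((j : ℕ) + 1) % (2 * m) = (i : ℕ) % (2 * m) := by
          by_contra h1
          rw [if_neg h1] at hci
          linarith
        have h5 : (i : ℕ) + 2 ≡ i [MOD 2 * m] :=
          (Nat.ModEq.add_right 1 (show (i : ℕ) + 1 ≡ j [MOD 2 * m] from h1.symm)).trans h4
        have h6 := (Nat.modEq_iff_dvd' (by omega : (i : ℕ) ≤ i + 2)).1 h5.symm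
        have := Nat.le_of_dvd (by omega) h6
        omega

lemma starBipyramid_isBipyramid (hm : 2 ≤ m) (h₀ : 0 < r₀) (h₁ : 0 < r₁) (hh : 0 < h) :
    IsBipyramid (starBipyramid hm h₀ h₁ hh) := by
  have : NeZero (2 * m) := ⟨by omega⟩
  refine ⟨2 * m, this, starPolygon m r₀ r₁, axisPoint h, axisPoint (-h),
    isSimpleClosedPolygon_starPolygon hm h₀ h₁, hh, neg_neg_of_pos hh, ?_⟩
  ext s
  constructor
  · rintro ⟨hne, i, a, ha, hsub⟩
    refine ⟨hne, ⟨i % (2 * m), Nat.mod_lt _ (by omega)⟩, a, ha, ?_⟩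
    rw [starPolygon_succ hm]
    have e1 : equator m r₀ r₁ i = planeInSpace (starPoint m r₀ r₁ (i % (2 * m))) := by
      rw [equator, starPoint_mod hm (Nat.mod_mod i (2 * m)).symm]
    have e2 : equator m r₀ r₁ (i + 1) = planeInSpace (starPoint m r₀ r₁ (i % (2 * m) + 1)) := by
      rw [equator, starPoint_mod hm (show (i + 1) % (2 * m) = (i % (2 * m) + 1) % (2 * m) by
        simp [Nat.add_mod])]
    rw [e1, e2] at hsub
    convert hsub
    rfl
  · rintro ⟨hne, i, a, ha, hsub⟩
    rw [starPolygon_succ hm] at hsub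
    exact ⟨hne, i, a, ha, by convert hsub <;> rfl⟩

lemma mem_vertices_starBipyramid (hm : 2 ≤ m) (h₀ : 0 < r₀) (h₁ : 0 < r₁) (hh : 0 < h) (x : 𝔼³) :
    x ∈ (starBipyramid hm h₀ h₁ hh).vertices ↔
      x = axisPoint h ∨ x = axisPoint (-h) ∨ ∃ k, x = equator m r₀ r₁ k := by
  constructor
  · rintro ⟨-, i, a, ha, hsub⟩
    have := hsub (Finset.mem_singleton_self x)
    simp only [Finset.mem_insert, Finset.mem_singleton] at this
    rcases this with rfl | rfl | rfl
    · rcases ha with rfl | rfl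
      · exact Or.inl rfl
      · exact Or.inr (Or.inl rfl)
    · exact Or.inr (Or.inr ⟨_, rfl⟩)
    · exact Or.inr (Or.inr ⟨_, rfl⟩)
  · rintro (rfl | rfl | ⟨k, rfl⟩)
    · exact ⟨Finset.singleton_nonempty _, 0, _, Or.inl rfl, by simp⟩
    · exact ⟨Finset.singleton_nonempty _, 0, _, Or.inr rfl, by simp⟩
    · exact ⟨Finset.singleton_nonempty _, k, _, Or.inl rfl, by simp⟩

lemma triangle_mem_starBipyramid (hm : 2 ≤ m) (h₀ : 0 < r₀) (h₁ : 0 < r₁) (hh : 0 < h) {a : 𝔼³}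
    (ha : a ∈ ({axisPoint h, axisPoint (-h)} : Set 𝔼³)) (i : ℕ) :
    ({a, equator m r₀ r₁ i, equator m r₀ r₁ (i + 1)} : Finset 𝔼³) ∈
      (starBipyramid hm h₀ h₁ hh).faces :=
  ⟨Finset.insert_nonempty _ _, i, a, ha, subset_rfl⟩

lemma apex_ne_equator (hh : 0 < h) {a : 𝔼³} (ha : a ∈ ({axisPoint h, axisPoint (-h)} : Set 𝔼³))
    (i : ℕ) : a ≠ equator m r₀ r₁ i := by
  rcases ha with rfl | rfl
  · exact axisPoint_ne_equator _ hh.ne' i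
  · exact axisPoint_ne_equator _ (neg_ne_zero.2 hh.ne') i

lemma isWheel_apex (hm : 2 ≤ m) (h₀ : 0 < r₀) (h₁ : 0 < r₁) (hh : 0 < h) {p : 𝔼³}
    (hp : p ∈ ({axisPoint h, axisPoint (-h)} : Set 𝔼³)) :
    IsWheel (starBipyramid hm h₀ h₁ hh) p (2 * m) (equator m r₀ r₁) := by
  refine isWheel_of_linkAdj_iff (by omega) (equator_periodic hm) (fun i j hi hj he => ?_)
    fun y z => ⟨?_, ?_⟩
  · rw [equator_eq_iff hm h₀ h₁, Nat.mod_eq_of_lt hi, Nat.mod_eq_of_lt hj] at he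
    exact he
  · rintro ⟨h1, h2, h3, -, i, a, ha, hsub⟩
    simp only [Finset.insert_subset_iff, Finset.singleton_subset_iff, Finset.mem_insert,
      Finset.mem_singleton] at hsub
    obtain ⟨e1, e2, e3⟩ := hsub
    have := apex_ne_equator (m := m) (r₀ := r₀) (r₁ := r₁) hh hp i
    have := apex_ne_equator (m := m) (r₀ := r₀) (r₁ := r₁) hh hp (i + 1)
    exact ⟨i, by grind⟩
  · have key : ∀ i, LinkAdj (starBipyramid hm h₀ h₁ hh) p (equator m r₀ r₁ i)
        (equator m r₀ r₁ (i + 1)) := fun i =>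
      ⟨(apex_ne_equator hh hp i).symm, (apex_ne_equator hh hp _).symm, equator_ne_succ hm h₀ h₁ i,
        triangle_mem_starBipyramid hm h₀ h₁ hh hp i⟩
    rintro ⟨i, ⟨rfl, rfl⟩ | ⟨rfl, rfl⟩⟩
    · exact key i
    · exact (key i).symm

/-- The link of a vertex on the equator of a bipyramid. -/
noncomputable def equatorLink (m : ℕ) (r₀ r₁ h : ℝ) (k i : ℕ) : 𝔼³ :=
  if i % 4 = 0 then axisPoint h else if i % 4 = 1 then equator m r₀ r₁ (k + 1)
  else if i % 4 = 2 then axisPoint (-h) else equator m r₀ r₁ (k + (2 * m - 1))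

/-- The predecessor of `k` on the equator is written `k + (2 * m - 1)`, which stays within the
natural numbers. -/
lemma equator_pred_succ (hm : 2 ≤ m) (k : ℕ) :
    equator m r₀ r₁ (k + (2 * m - 1) + 1) = equator m r₀ r₁ k := by
  rw [show k + (2 * m - 1) + 1 = k + 2 * m by omega, equator_periodic hm]

lemma equatorLink_cases (i : ℕ) (k : ℕ) :
    (equatorLink m r₀ r₁ h k i = axisPoint h ∧
      equatorLink m r₀ r₁ h k (i + 1) = equator m r₀ r₁ (k + 1)) ∨
    (equatorLink m r₀ r₁ h k i = equator m r₀ r₁ (k + 1) ∧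
      equatorLink m r₀ r₁ h k (i + 1) = axisPoint (-h)) ∨
    (equatorLink m r₀ r₁ h k i = axisPoint (-h) ∧
      equatorLink m r₀ r₁ h k (i + 1) = equator m r₀ r₁ (k + (2 * m - 1))) ∨
    (equatorLink m r₀ r₁ h k i = equator m r₀ r₁ (k + (2 * m - 1)) ∧
      equatorLink m r₀ r₁ h k (i + 1) = axisPoint h) := by
  simp only [equatorLink]
  obtain h4 | h4 | h4 | h4 : i % 4 = 0 ∨ i % 4 = 1 ∨ i % 4 = 2 ∨ i % 4 = 3 := by omega
  · have : (i + 1) % 4 = 1 := by omega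
    simp [h4, this]
  · have : (i + 1) % 4 = 2 := by omega
    simp [h4, this]
  · have : (i + 1) % 4 = 3 := by omega
    simp [h4, this]
  · have : (i + 1) % 4 = 0 := by omega
    simp [h4, this]

lemma isWheel_equator (hm : 2 ≤ m) (h₀ : 0 < r₀) (h₁ : 0 < r₁) (hh : 0 < h) (k : ℕ) :
    IsWheel (starBipyramid hm h₀ h₁ hh) (equator m r₀ r₁ k) 4 (equatorLink m r₀ r₁ h k) := by
  have hp : axisPoint h ∈ ({axisPoint h, axisPoint (-h)} : Set 𝔼³) := Or.inl rfl
  have hq : axisPoint (-h) ∈ ({axisPoint h, axisPoint (-h)} : Set 𝔼³) := Or.inr rfl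
  have hpq := axisPoint_ne_neg hh
  have hpe := fun i => apex_ne_equator (m := m) (r₀ := r₀) (r₁ := r₁) hh hp i
  have hqe := fun i => apex_ne_equator (m := m) (r₀ := r₀) (r₁ := r₁) hh hq i
  have hks := equator_ne_succ hm h₀ h₁ k
  have hpk := equator_ne_succ hm h₀ h₁ (k + (2 * m - 1))
  rw [equator_pred_succ hm] at hpk
  have hps : equator m r₀ r₁ (k + 1) ≠ equator m r₀ r₁ (k + (2 * m - 1)) := by
    rw [Ne, equator_eq_iff hm h₀ h₁]
    intro he
    have := (Nat.modEq_iff_dvd' (by omega : k + 1 ≤ k + (2 * m - 1))).1 he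
    have := Nat.le_of_dvd (by omega) this
    omega
  refine isWheel_of_linkAdj_iff (by omega) (fun i => ?_) (fun i j hi hj he => ?_)
    fun y z => ⟨?_, ?_⟩
  · simp only [equatorLink, Nat.add_mod_right]
  · simp only [equatorLink, Nat.mod_eq_of_lt hi, Nat.mod_eq_of_lt hj] at he
    interval_cases i <;> interval_cases j <;> first
      | rfl
      | exact absurd he hpq
      | exact absurd he hpq.symm
      | exact absurd he hps
      | exact absurd he hps.symm
      | exact absurd he (hpe _)
      | exact absurd he (Ne.symm (hpe _))
      | exact absurd he (hqe _)
      | exact absurd he (Ne.symm (hqe _))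
  · rintro ⟨h1, h2, h3, -, i, a, ha, hsub⟩
    simp only [Finset.insert_subset_iff, Finset.singleton_subset_iff, Finset.mem_insert,
      Finset.mem_singleton] at hsub
    obtain ⟨e1, e2, e3⟩ := hsub
    have hak := apex_ne_equator (m := m) (r₀ := r₀) (r₁ := r₁) hh ha k
    have hyz : (y = a ∧ z = equator m r₀ r₁ (k + 1)) ∨ (z = a ∧ y = equator m r₀ r₁ (k + 1)) ∨
        (y = a ∧ z = equator m r₀ r₁ (k + (2 * m - 1))) ∨
        (z = a ∧ y = equator m r₀ r₁ (k + (2 * m - 1))) := by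
      rcases e1 with e1 | e1 | e1
      · exact absurd e1.symm hak
      · have hi1 : equator m r₀ r₁ (i + 1) = equator m r₀ r₁ (k + 1) := by
          rw [equator_eq_iff hm h₀ h₁] at e1 ⊢
          exact (Nat.ModEq.add_right 1 e1).symm
        rw [hi1, ← e1] at e2 e3
        grind
      · have hi1 : equator m r₀ r₁ i = equator m r₀ r₁ (k + (2 * m - 1)) := by
          rw [equator_eq_iff hm h₀ h₁] at e1 ⊢
          have h5 : k + (2 * m - 1) + 1 ≡ i + 1 [MOD 2 * m] := by
            rw [show k + (2 * m - 1) + 1 = k + 2 * m by omega]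
            exact (Nat.add_mod_right k (2 * m)).trans e1
          exact (Nat.ModEq.add_right_cancel' 1 h5).symm
        rw [hi1, ← e1] at e2 e3
        grind
    have l0 : equatorLink m r₀ r₁ h k 0 = axisPoint h := rfl
    have l1 : equatorLink m r₀ r₁ h k 1 = equator m r₀ r₁ (k + 1) := rfl
    have l2 : equatorLink m r₀ r₁ h k 2 = axisPoint (-h) := rfl
    have l3 : equatorLink m r₀ r₁ h k 3 = equator m r₀ r₁ (k + (2 * m - 1)) := rfl
    have l4 : equatorLink m r₀ r₁ h k 4 = axisPoint h := rfl
    rcases ha with rfl | rfl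
    · rcases hyz with ⟨rfl, rfl⟩ | ⟨rfl, rfl⟩ | ⟨rfl, rfl⟩ | ⟨rfl, rfl⟩
      · exact ⟨0, Or.inl ⟨l0.symm, l1.symm⟩⟩
      · exact ⟨0, Or.inr ⟨l1.symm, l0.symm⟩⟩
      · exact ⟨3, Or.inr ⟨l4.symm, l3.symm⟩⟩
      · exact ⟨3, Or.inl ⟨l3.symm, l4.symm⟩⟩
    · rcases hyz with ⟨rfl, rfl⟩ | ⟨rfl, rfl⟩ | ⟨rfl, rfl⟩ | ⟨rfl, rfl⟩
      · exact ⟨1, Or.inr ⟨l2.symm, l1.symm⟩⟩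
      · exact ⟨1, Or.inl ⟨l1.symm, l2.symm⟩⟩
      · exact ⟨2, Or.inl ⟨l2.symm, l3.symm⟩⟩
      · exact ⟨2, Or.inr ⟨l3.symm, l2.symm⟩⟩
  · have k1 : ∀ a, a ∈ ({axisPoint h, axisPoint (-h)} : Set 𝔼³) →
        LinkAdj (starBipyramid hm h₀ h₁ hh) (equator m r₀ r₁ k) a (equator m r₀ r₁ (k + 1)) := by
      intro a ha
      have := triangle_mem_starBipyramid hm h₀ h₁ hh ha k
      rw [Finset.insert_comm] at this
      exact ⟨apex_ne_equator hh ha k, hks.symm, apex_ne_equator hh ha _, this⟩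
    have k2 : ∀ a, a ∈ ({axisPoint h, axisPoint (-h)} : Set 𝔼³) →
        LinkAdj (starBipyramid hm h₀ h₁ hh) (equator m r₀ r₁ k) a
          (equator m r₀ r₁ (k + (2 * m - 1))) := by
      intro a ha
      have := triangle_mem_starBipyramid hm h₀ h₁ hh ha (k + (2 * m - 1))
      rw [equator_pred_succ hm, Finset.pair_comm, Finset.insert_comm] at this
      exact ⟨apex_ne_equator hh ha k, hpk, apex_ne_equator hh ha _, this⟩
    have key : ∀ i, LinkAdj (starBipyramid hm h₀ h₁ hh) (equator m r₀ r₁ k)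
        (equatorLink m r₀ r₁ h k i) (equatorLink m r₀ r₁ h k (i + 1)) := by
      intro i
      rcases equatorLink_cases (m := m) (r₀ := r₀) (r₁ := r₁) (h := h) i k with
        ⟨e1, e2⟩ | ⟨e1, e2⟩ | ⟨e1, e2⟩ | ⟨e1, e2⟩ <;> rw [e1, e2]
      · exact k1 _ hp
      · exact (k1 _ hq).symm
      · exact k2 _ hq
      · exact (k2 _ hp).symm
    rintro ⟨i, ⟨rfl, rfl⟩ | ⟨rfl, rfl⟩⟩
    · exact key i
    · exact (key i).symm

end StarBipyramids

/-! ### Angle sums of star-shaped bipyramids. -/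

section BipyramidAngles

local notation "𝔼³" => EuclideanSpace ℝ (Fin 3)

lemma angle_eq_of_sides {n : ℕ} {a v b : EuclideanSpace ℝ (Fin n)} {x y z θ : ℝ} (hx : 0 < x)
    (hy : 0 < y) (h1 : dist a v = x) (h2 : dist b v = y) (h3 : dist a b = z)
    (hθ : θ ∈ Set.Icc 0 Real.pi) (h : x ^ 2 + y ^ 2 - z ^ 2 = 2 * x * y * Real.cos θ) :
    EuclideanGeometry.angle a v b = θ := by
  have h4 := EuclideanGeometry.law_cos a v b
  rw [h1, h2, h3] at h4
  refine Real.injOn_cos ⟨EuclideanGeometry.angle_nonneg _ _ _, EuclideanGeometry.angle_le_pi _ _ _⟩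
    hθ ?_
  have h5 : 2 * x * y * Real.cos (EuclideanGeometry.angle a v b) = 2 * x * y * Real.cos θ := by
    linarith
  exact mul_left_cancel₀ (by positivity) h5

variable {m : ℕ} {r₀ r₁ h : ℝ}

lemma dist_apex_equator {a : 𝔼³} (ha : a ∈ ({axisPoint h, axisPoint (-h)} : Set 𝔼³)) (k : ℕ) :
    dist a (equator m r₀ r₁ k) ^ 2 = h ^ 2 + (if Even k then r₀ else r₁) ^ 2 := by
  have h1 := Real.sin_sq_add_cos_sq (k * (Real.pi / m))
  rw [EuclideanSpace.dist_eq, Real.sq_sqrt (by positivity), Fin.sum_univ_three, Real.dist_eq,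
    Real.dist_eq, Real.dist_eq, sq_abs, sq_abs, sq_abs, equator_zero, equator_one, equator_two]
  rcases ha with rfl | rfl
  · change (0 - _) ^ 2 + (0 - _) ^ 2 + (h - 0) ^ 2 = _
    linear_combination (if Even k then r₀ else r₁) ^ 2 * h1
  · change (0 - _) ^ 2 + (0 - _) ^ 2 + (-h - 0) ^ 2 = _
    linear_combination (if Even k then r₀ else r₁) ^ 2 * h1

lemma dist_equator_succ (k : ℕ) : dist (equator m r₀ r₁ k) (equator m r₀ r₁ (k + 1)) ^ 2 =
    r₀ ^ 2 + r₁ ^ 2 - 2 * r₀ * r₁ * Real.cos (Real.pi / m) := by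
  have h1 := Real.sin_sq_add_cos_sq (k * (Real.pi / m))
  have h2 := Real.sin_sq_add_cos_sq ((k + 1 : ℕ) * (Real.pi / m))
  have h3 : Real.cos ((k + 1 : ℕ) * (Real.pi / m)) * Real.cos (k * (Real.pi / m)) +
      Real.sin ((k + 1 : ℕ) * (Real.pi / m)) * Real.sin (k * (Real.pi / m)) =
      Real.cos (Real.pi / m) := by
    rw [← Real.cos_sub]; congr 1; push_cast; ring
  rw [EuclideanSpace.dist_eq, Real.sq_sqrt (by positivity), Fin.sum_univ_three, Real.dist_eq,
    Real.dist_eq, Real.dist_eq, sq_abs, sq_abs, sq_abs, equator_zero, equator_one, equator_two,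
    equator_zero, equator_one, equator_two]
  by_cases hk : Even k
  · have hk' : ¬ Even (k + 1) := by rw [Nat.even_add_one]; tauto
    rw [if_pos hk, if_neg hk']
    linear_combination r₀ ^ 2 * h1 + r₁ ^ 2 * h2 - 2 * r₀ * r₁ * h3
  · have hk' : Even (k + 1) := by rw [Nat.even_add_one]; tauto
    rw [if_neg hk, if_pos hk']
    linear_combination r₁ ^ 2 * h1 + r₀ ^ 2 * h2 - 2 * r₀ * r₁ * h3

/-- The sides `X, Y, Z` and angles `α, β, γ` of the lateral triangles of a star-shaped bipyramid. -/
structure IsLateralTriangle (m : ℕ) (r₀ r₁ h X Y Z α β γ : ℝ) : Prop where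
  X_pos : 0 < X
  Y_pos : 0 < Y
  Z_pos : 0 < Z
  X_sq : X ^ 2 = h ^ 2 + r₀ ^ 2
  Y_sq : Y ^ 2 = h ^ 2 + r₁ ^ 2
  Z_sq : Z ^ 2 = r₀ ^ 2 + r₁ ^ 2 - 2 * r₀ * r₁ * Real.cos (Real.pi / m)
  α_mem : α ∈ Set.Icc 0 Real.pi
  β_mem : β ∈ Set.Icc 0 Real.pi
  γ_mem : γ ∈ Set.Icc 0 Real.pi
  cos_α : X ^ 2 + Y ^ 2 - Z ^ 2 = 2 * X * Y * Real.cos α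
  cos_β : X ^ 2 + Z ^ 2 - Y ^ 2 = 2 * X * Z * Real.cos β
  cos_γ : Y ^ 2 + Z ^ 2 - X ^ 2 = 2 * Y * Z * Real.cos γ

variable {X Y Z α β γ : ℝ}

lemma IsLateralTriangle.dist_apex (T : IsLateralTriangle m r₀ r₁ h X Y Z α β γ) {a : 𝔼³}
    (ha : a ∈ ({axisPoint h, axisPoint (-h)} : Set 𝔼³)) (k : ℕ) :
    dist a (equator m r₀ r₁ k) = if Even k then X else Y := by
  have h1 := dist_apex_equator (m := m) (r₀ := r₀) (r₁ := r₁) ha k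
  have := T.X_pos
  have := T.Y_pos
  split_ifs at h1 ⊢ with hk
  · rw [← T.X_sq] at h1
    exact (sq_eq_sq₀ dist_nonneg T.X_pos.le).1 h1
  · rw [← T.Y_sq] at h1
    exact (sq_eq_sq₀ dist_nonneg T.Y_pos.le).1 h1

lemma IsLateralTriangle.dist_succ (T : IsLateralTriangle m r₀ r₁ h X Y Z α β γ) (k : ℕ) :
    dist (equator m r₀ r₁ k) (equator m r₀ r₁ (k + 1)) = Z := by
  have h1 := dist_equator_succ (m := m) (r₀ := r₀) (r₁ := r₁) k
  rw [← T.Z_sq] at h1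
  exact (sq_eq_sq₀ dist_nonneg T.Z_pos.le).1 h1

lemma IsLateralTriangle.angleSum_apex (T : IsLateralTriangle m r₀ r₁ h X Y Z α β γ) (hm : 2 ≤ m)
    (h₀ : 0 < r₀) (h₁ : 0 < r₁) (hh : 0 < h) {p : 𝔼³}
    (hp : p ∈ ({axisPoint h, axisPoint (-h)} : Set 𝔼³)) :
    angleSum (starBipyramid hm h₀ h₁ hh) p = 2 * m * α := by
  rw [(isWheel_apex hm h₀ h₁ hh hp).angleSum_eq, wheelAngles]
  have : ∀ i ∈ List.range (2 * m),
      EuclideanGeometry.angle (equator m r₀ r₁ i) p (equator m r₀ r₁ (i + 1)) = α := by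
    intro i _
    have d1 := T.dist_apex hp i
    have d2 := T.dist_apex hp (i + 1)
    rw [dist_comm] at d1 d2
    by_cases hi : Even i
    · have hi' : ¬ Even (i + 1) := by rw [Nat.even_add_one]; tauto
      rw [if_pos hi] at d1
      rw [if_neg hi'] at d2
      exact angle_eq_of_sides T.X_pos T.Y_pos d1 d2 (T.dist_succ i) T.α_mem T.cos_α
    · have hi' : Even (i + 1) := by rw [Nat.even_add_one]; tauto
      rw [if_neg hi] at d1
      rw [if_pos hi'] at d2
      exact angle_eq_of_sides T.Y_pos T.X_pos d1 d2 (T.dist_succ i) T.α_mem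
        (by linarith [T.cos_α])
  rw [List.map_congr_left this, List.map_const', List.sum_replicate]
  simp

/-- Four congruent lateral triangles meet at each equatorial vertex, with the same angle there; the
parity of `k` decides whether it is `β` or `γ`. -/
lemma IsLateralTriangle.angleSum_equator (T : IsLateralTriangle m r₀ r₁ h X Y Z α β γ) (hm : 2 ≤ m)
    (h₀ : 0 < r₀) (h₁ : 0 < r₁) (hh : 0 < h) (k : ℕ) :
    angleSum (starBipyramid hm h₀ h₁ hh) (equator m r₀ r₁ k) = 4 * if Even k then β else γ := by
  have hp : axisPoint h ∈ ({axisPoint h, axisPoint (-h)} : Set 𝔼³) := Or.inl rfl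
  have hq : axisPoint (-h) ∈ ({axisPoint h, axisPoint (-h)} : Set 𝔼³) := Or.inr rfl
  have key : ∀ a, a ∈ ({axisPoint h, axisPoint (-h)} : Set 𝔼³) → ∀ j, (Even j ↔ ¬ Even k) →
      dist (equator m r₀ r₁ j) (equator m r₀ r₁ k) = Z →
      EuclideanGeometry.angle a (equator m r₀ r₁ k) (equator m r₀ r₁ j) =
        if Even k then β else γ := by
    intro a ha j hj hd
    have d1 := T.dist_apex ha k
    have d2 := T.dist_apex ha j
    by_cases hk : Even k
    · rw [if_pos hk] at d1 ⊢
      rw [if_neg (by tauto)] at d2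
      exact angle_eq_of_sides T.X_pos T.Z_pos d1 hd d2 T.β_mem T.cos_β
    · rw [if_neg hk] at d1 ⊢
      rw [if_pos (by tauto)] at d2
      exact angle_eq_of_sides T.Y_pos T.Z_pos d1 hd d2 T.γ_mem T.cos_γ
  have hs := fun a ha => key a ha (k + 1) Nat.even_add_one (by rw [dist_comm]; exact T.dist_succ k)
  have hpred := fun a ha => key a ha (k + (2 * m - 1))
    (by rw [Nat.even_add, Nat.even_sub (by omega)]; simp)
    (by have := T.dist_succ (k + (2 * m - 1)); rwa [equator_pred_succ hm] at this)
  rw [(isWheel_equator hm h₀ h₁ hh k).angleSum_eq, wheelAngles]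
  have hsum : ((List.range 4).map fun i => EuclideanGeometry.angle (equatorLink m r₀ r₁ h k i)
      (equator m r₀ r₁ k) (equatorLink m r₀ r₁ h k (i + 1))).sum =
      EuclideanGeometry.angle (axisPoint h) (equator m r₀ r₁ k) (equator m r₀ r₁ (k + 1)) +
      (EuclideanGeometry.angle (equator m r₀ r₁ (k + 1)) (equator m r₀ r₁ k) (axisPoint (-h)) +
      (EuclideanGeometry.angle (axisPoint (-h)) (equator m r₀ r₁ k)
        (equator m r₀ r₁ (k + (2 * m - 1))) +
      (EuclideanGeometry.angle (equator m r₀ r₁ (k + (2 * m - 1))) (equator m r₀ r₁ k)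
        (axisPoint h) + 0))) := rfl
  rw [hsum, EuclideanGeometry.angle_comm (equator m r₀ r₁ (k + 1)),
    EuclideanGeometry.angle_comm (equator m r₀ r₁ (k + (2 * m - 1))), hs _ hp, hs _ hq, hpred _ hp,
    hpred _ hq]
  ring

lemma sum_range_alternating (a b : ℝ) (m : ℕ) :
    ∑ k ∈ Finset.range (2 * m), (if Even k then a else b) = m * a + m * b := by
  induction m with
  | zero => simp
  | succ m ih =>
    rw [show 2 * (m + 1) = 2 * m + 1 + 1 by ring, Finset.sum_range_succ, Finset.sum_range_succ, ih,
      if_pos (even_two_mul m), if_neg (by rw [Nat.even_add_one]; simp)]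
    push_cast; ring

/-- Two apices, `m` equatorial vertices of radius `r₀` and `m` of radius `r₁`. This is the source of
the functional equation. -/
lemma IsLateralTriangle.finsum_eq (T : IsLateralTriangle m r₀ r₁ h X Y Z α β γ) (hm : 2 ≤ m)
    (h₀ : 0 < r₀) (h₁ : 0 < r₁) (hh : 0 < h) {φ : VertexFunction} {f : ℝ → ℝ}
    (hf : ∀ v ∈ (starBipyramid hm h₀ h₁ hh).vertices, φ 3 (starBipyramid hm h₀ h₁ hh) v =
      f (angleSum (starBipyramid hm h₀ h₁ hh) v)) :
    ∑ᶠ v ∈ (starBipyramid hm h₀ h₁ hh).vertices, φ 3 (starBipyramid hm h₀ h₁ hh) v =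
      2 * f (2 * m * α) + m * f (4 * β) + m * f (4 * γ) := by
  have hp : axisPoint h ∈ ({axisPoint h, axisPoint (-h)} : Set 𝔼³) := Or.inl rfl
  have hq : axisPoint (-h) ∈ ({axisPoint h, axisPoint (-h)} : Set 𝔼³) := Or.inr rfl
  have hV : (starBipyramid hm h₀ h₁ hh).vertices = ((insert (axisPoint h) (insert (axisPoint (-h))
      ((Finset.range (2 * m)).image (equator m r₀ r₁))) : Finset 𝔼³) : Set 𝔼³) := by
    ext x
    rw [mem_vertices_starBipyramid]
    simp only [Finset.coe_insert, Set.mem_insert_iff, Finset.mem_coe, Finset.mem_image,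
      Finset.mem_range]
    refine or_congr_right (or_congr_right ⟨?_, ?_⟩)
    · rintro ⟨k, rfl⟩
      exact ⟨k % (2 * m), Nat.mod_lt _ (by omega), (equator_eq_iff hm h₀ h₁ _ _).2 (Nat.mod_mod _ _)⟩
    · rintro ⟨k, -, rfl⟩
      exact ⟨k, rfl⟩
  rw [finsum_mem_congr rfl hf, hV, finsum_mem_coe_finset, Finset.sum_insert, Finset.sum_insert,
    Finset.sum_image]
  · rw [T.angleSum_apex hm h₀ h₁ hh hp, T.angleSum_apex hm h₀ h₁ hh hq]
    have : ∀ k ∈ Finset.range (2 * m), f (angleSum (starBipyramid hm h₀ h₁ hh)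
        (equator m r₀ r₁ k)) = if Even k then f (4 * β) else f (4 * γ) := by
      intro k _
      rw [T.angleSum_equator]
      split_ifs <;> rfl
    rw [Finset.sum_congr rfl this, sum_range_alternating]
    ring
  · intro i hi j hj he
    rw [equator_eq_iff hm h₀ h₁, Nat.mod_eq_of_lt (by simpa using hi),
      Nat.mod_eq_of_lt (by simpa using hj)] at he
    exact he
  · simp only [Finset.mem_image, not_exists, not_and]
    exact fun k _ he => apex_ne_equator hh hq k he.symm
  · simp only [Finset.mem_insert, Finset.mem_image, not_or, not_exists, not_and]
    exact ⟨axisPoint_ne_neg hh, fun k _ he => apex_ne_equator hh hp k he.symm⟩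

/-- A triangle with prescribed angles, as a lateral triangle of a bipyramid. -/
lemma isLateralTriangle_of_angles (hα : 0 < α) (hβ : 0 < β) (hγ : 0 < γ)
    (hsum : α + β + γ = Real.pi) (hr₀ : r₀ ^ 2 = Real.sin γ ^ 2 - h ^ 2)
    (hr₁ : r₁ ^ 2 = Real.sin β ^ 2 - h ^ 2)
    (heq : h ^ 2 + r₀ * r₁ * Real.cos (Real.pi / m) = Real.sin γ * Real.sin β * Real.cos α) :
    IsLateralTriangle m r₀ r₁ h (Real.sin γ) (Real.sin β) (Real.sin α) α β γ := by
  -- A triangle with circumdiameter `1` has the sines of its angles as opposite sides; this is its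
  -- law of cosines.
  have hsin : ∀ x y z : ℝ, x + y + z = Real.pi →
      Real.sin y ^ 2 + Real.sin z ^ 2 - Real.sin x ^ 2 = 2 * Real.sin y * Real.sin z * Real.cos x := by
    intro x y z h
    have hx : x = Real.pi - (y + z) := by linarith
    rw [hx, Real.sin_pi_sub, Real.cos_pi_sub, Real.sin_add, Real.cos_add]
    have h1 := Real.sin_sq_add_cos_sq y
    have h2 := Real.sin_sq_add_cos_sq z
    linear_combination (-Real.sin z ^ 2) * h1 - Real.sin y ^ 2 * h2
  have hpos : ∀ x : ℝ, 0 < x → x < Real.pi → 0 < Real.sin x := fun x h1 h2 =>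
    Real.sin_pos_of_pos_of_lt_pi h1 h2
  have e1 := hsin α β γ hsum
  refine ⟨hpos γ hγ (by linarith), hpos β hβ (by linarith), hpos α hα (by linarith),
    by linarith, by linarith, by linear_combination hr₀ + hr₁ + 2 * heq - e1 - 2 * hr₀ - 2 * hr₁,
    ⟨hα.le, by linarith⟩, ⟨hβ.le, by linarith⟩, ⟨hγ.le, by linarith⟩, ?_, ?_, ?_⟩
  · linear_combination e1
  · have := hsin β γ α (by linarith)
    linear_combination this
  · have := hsin γ β α (by linarith)
    linear_combination this

end BipyramidAngles

/-! ### Realisable angles and the functional equation. -/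

section AngleEquation

/-- Parameters of a star-shaped bipyramid whose lateral triangles have angles `α` at the apexes and
`β`, `γ` at the equator. -/
structure HasBipyramidAngles (m : ℕ) (h r₀ r₁ α β γ : ℝ) : Prop where
  h_pos : 0 < h
  r₀_pos : 0 < r₀
  r₁_pos : 0 < r₁
  α_pos : 0 < α
  β_pos : 0 < β
  γ_pos : 0 < γ
  sum_eq : α + β + γ = Real.pi
  r₀_sq : r₀ ^ 2 = Real.sin γ ^ 2 - h ^ 2
  r₁_sq : r₁ ^ 2 = Real.sin β ^ 2 - h ^ 2
  -- The inner product of two adjacent lateral edges at an apex: in coordinates on the left, from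
  -- their lengths `sin γ`, `sin β` and their angle `α` on the right.
  eq : h ^ 2 + r₀ * r₁ * Real.cos (Real.pi / m) = Real.sin γ * Real.sin β * Real.cos α

/-- The height of a regular bipyramid with apex angles `α`. -/
noncomputable def regularHeight (m : ℕ) (α : ℝ) : ℝ :=
  Real.cos (α / 2) * √((Real.cos α - Real.cos (Real.pi / m)) / (1 - Real.cos (Real.pi / m)))

/-- The radius of the equator of a regular bipyramid with apex angles `α`. -/
noncomputable def regularRadius (m : ℕ) (α : ℝ) : ℝ :=
  Real.cos (α / 2) * √((1 - Real.cos α) / (1 - Real.cos (Real.pi / m)))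

lemma cos_pi_div_lt_one {m : ℕ} (hm : 2 ≤ m) : Real.cos (Real.pi / m) < 1 := by
  have hm2 : (2 : ℝ) ≤ m := by exact_mod_cast hm
  rw [← Real.cos_zero]
  refine Real.cos_lt_cos_of_nonneg_of_le_pi le_rfl ?_ (by positivity)
  exact div_le_self Real.pi_pos.le (by linarith)

/-- With `r₀ = r₁ = r` and lateral edge `X = cos (α / 2)`, the conditions are `h² + r² = X²` and `h²
+ r² cos (π / m) = X² cos α`. Solving them gives the two defining formulas, and `α < π / m` makes
`h²` positive. -/
lemma hasBipyramidAngles_regular {m : ℕ} (hm : 2 ≤ m) {α : ℝ} (h0 : 0 < α) (h1 : α < Real.pi / m) :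
    HasBipyramidAngles m (regularHeight m α) (regularRadius m α) (regularRadius m α) α
      ((Real.pi - α) / 2) ((Real.pi - α) / 2) := by
  have hm2 : (2 : ℝ) ≤ m := by exact_mod_cast hm
  have hp : Real.pi / m ≤ Real.pi := div_le_self Real.pi_pos.le (by linarith)
  have hc := cos_pi_div_lt_one hm
  have hcα : Real.cos (Real.pi / m) < Real.cos α := Real.cos_lt_cos_of_nonneg_of_le_pi h0.le hp h1
  have hcα1 : Real.cos α < 1 := by
    rw [← Real.cos_zero]
    exact Real.cos_lt_cos_of_nonneg_of_le_pi le_rfl (by linarith) h0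
  have hX : 0 < Real.cos (α / 2) := Real.cos_pos_of_mem_Ioo ⟨by linarith, by linarith⟩
  have hs : Real.sin ((Real.pi - α) / 2) = Real.cos (α / 2) := by
    rw [← Real.sin_pi_div_two_sub]; ring_nf
  have a1 : 0 < (Real.cos α - Real.cos (Real.pi / m)) / (1 - Real.cos (Real.pi / m)) :=
    div_pos (by linarith) (by linarith)
  have a2 : 0 < (1 - Real.cos α) / (1 - Real.cos (Real.pi / m)) :=
    div_pos (by linarith) (by linarith)
  have e1 := Real.sq_sqrt a1.le
  have e2 := Real.sq_sqrt a2.le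
  have hne : 1 - Real.cos (Real.pi / m) ≠ 0 := by linarith
  refine ⟨mul_pos hX (Real.sqrt_pos.2 a1), mul_pos hX (Real.sqrt_pos.2 a2),
    mul_pos hX (Real.sqrt_pos.2 a2), h0, by linarith, by linarith, by ring, ?_, ?_, ?_⟩
  · rw [hs, regularRadius, regularHeight, mul_pow, mul_pow, e1, e2]; field_simp; ring
  · rw [hs, regularRadius, regularHeight, mul_pow, mul_pow, e1, e2]; field_simp; ring
  · rw [hs, ← sq (regularRadius m α), regularRadius, regularHeight, mul_pow, mul_pow, e1, e2]
    field_simp; ring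

/-- An equatorial vertex with angle sum `4γ = 2π`, used for the value at `2π`. The equation is
solved by `h² = 1/3`, `r₀² = 2/3`, `r₁² = 1/6`. -/
lemma hasBipyramidAngles_right : ∃ h r₀ r₁, HasBipyramidAngles 3 h r₀ r₁ (Real.pi / 4)
    (Real.pi / 4) (Real.pi / 2) := by
  have e2 : (√2 / 2 : ℝ) ^ 2 = 1 / 2 := by rw [div_pow, Real.sq_sqrt (by norm_num)]; norm_num
  have a1 : √(1 / 3 : ℝ) ^ 2 = 1 / 3 := Real.sq_sqrt (by norm_num)
  have a2 : √(2 / 3 : ℝ) ^ 2 = 2 / 3 := Real.sq_sqrt (by norm_num)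
  have a3 : √(1 / 6 : ℝ) ^ 2 = 1 / 6 := Real.sq_sqrt (by norm_num)
  have a4 : √(2 / 3 : ℝ) * √(1 / 6 : ℝ) = 1 / 3 := by
    rw [← Real.sqrt_mul (by norm_num), show (2 / 3 * (1 / 6) : ℝ) = (1 / 3) ^ 2 by norm_num,
      Real.sqrt_sq (by norm_num)]
  refine ⟨√(1 / 3), √(2 / 3), √(1 / 6), by positivity, by positivity, by positivity,
    by positivity, by positivity, by positivity, by ring, ?_, ?_, ?_⟩
  · rw [Real.sin_pi_div_two, a1, a2]; norm_num
  · rw [Real.sin_pi_div_four, e2, a1, a3]; norm_num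
  · rw [Real.sin_pi_div_two, Real.sin_pi_div_four, Real.cos_pi_div_four, a1, a4, one_mul, ← sq, e2]
    push_cast
    rw [Real.cos_pi_div_three]; norm_num

/-- Apex angle sums above `2π` need a nonconvex equator. Fixing `γ = 3π/4` pins one equatorial angle
sum at `3π`, while the other stays below `π`. -/
lemma hasBipyramidAngles_wide {m : ℕ} (hm : 2 ≤ m) {α : ℝ} (h0 : Real.pi / m < α)
    (h1 : α < Real.pi / 4) : ∃ h r₀ r₁, HasBipyramidAngles m h r₀ r₁ α
      (Real.pi / 4 - α) (3 * Real.pi / 4) := by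
  have hpi := Real.pi_pos
  have hm2 : (2 : ℝ) ≤ m := by exact_mod_cast hm
  have hτ : 0 < Real.pi / m := by positivity
  have hs2 : Real.sin (3 * Real.pi / 4) = √2 / 2 := by
    rw [show 3 * Real.pi / 4 = Real.pi - Real.pi / 4 by ring, Real.sin_pi_sub,
      Real.sin_pi_div_four]
  have hs : Real.sin (Real.pi / 4 - α) < √2 / 2 := by
    rw [← Real.sin_pi_div_four]
    exact Real.sin_lt_sin_of_lt_of_le_pi_div_two (by linarith) (by linarith) (by linarith)
  have hsp : 0 < Real.sin (Real.pi / 4 - α) := Real.sin_pos_of_pos_of_lt_pi (by linarith)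
    (by linarith)
  obtain ⟨s, hsd⟩ : ∃ s, s = Real.sin (Real.pi / 4 - α) := ⟨_, rfl⟩
  obtain ⟨q, hq⟩ : ∃ q : ℝ, q = √2 / 2 := ⟨_, rfl⟩
  have hcos : Real.cos α < Real.cos (Real.pi / m) :=
    Real.cos_lt_cos_of_nonneg_of_le_pi hτ.le (by linarith) h0
  have hss : s = q * Real.cos α - q * Real.sin α := by
    rw [hsd, Real.sin_sub, Real.sin_pi_div_four, Real.cos_pi_div_four, hq]
  have hsα : 0 < Real.sin α := Real.sin_pos_of_pos_of_lt_pi (by linarith) (by linarith)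
  rw [← hsd] at hs hsp
  rw [← hq] at hs hs2
  have hq0 : 0 < q := hsp.trans hs
  -- `g` is the defect in the apex equation as a function of the height, with `q = sin γ` and `s =
  -- sin β`. It is positive at `0` because `π / m < α`, and equals `-q s sin α` at `s`, so a height
  -- in between solves the equation.
  obtain ⟨g, hg⟩ : ∃ g : ℝ → ℝ, g = fun h => h ^ 2 + √(q ^ 2 - h ^ 2) * √(s ^ 2 - h ^ 2) *
    Real.cos (Real.pi / m) - q * s * Real.cos α := ⟨_, rfl⟩
  have hgc : ContinuousOn g (Set.Icc 0 s) := by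
    rw [hg]; fun_prop
  have hg0 : 0 < g 0 := by
    rw [hg]
    simp only [ne_eq, OfNat.ofNat_ne_zero, not_false_eq_true, zero_pow, sub_zero, zero_add,
      Real.sqrt_sq hq0.le, Real.sqrt_sq hsp.le]
    have := mul_lt_mul_of_pos_left hcos (mul_pos hq0 hsp)
    linarith
  have hgs : g s < 0 := by
    rw [hg]
    simp only [sub_self, Real.sqrt_zero, mul_zero, zero_mul, add_zero]
    nlinarith [mul_pos hsp (mul_pos hq0 hsα)]
  obtain ⟨h, ⟨hh0, hhs⟩, hgh⟩ := intermediate_value_Ioo' hsp.le hgc ⟨hgs, hg0⟩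
  have p1 : 0 < q ^ 2 - h ^ 2 := by nlinarith
  have p2 : 0 < s ^ 2 - h ^ 2 := by nlinarith
  refine ⟨h, √(q ^ 2 - h ^ 2), √(s ^ 2 - h ^ 2), hh0, Real.sqrt_pos.2 p1, Real.sqrt_pos.2 p2,
    by linarith, by linarith, by linarith, by ring, ?_, ?_, ?_⟩
  · rw [Real.sq_sqrt p1.le, hs2]
  · rw [Real.sq_sqrt p2.le, hsd]
  · rw [hs2, ← hsd]
    rw [hg] at hgh
    linarith

/-- The equation imposed by the bipyramids forces a continuous function of the angle sum to
vanish. -/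
lemma eq_zero_of_bipyramid_equation {F : ℝ → ℝ} (hF : ContinuousOn F (Set.Ioo 0 (2 * Real.pi)))
    (heq : ∀ m : ℕ, 2 ≤ m → ∀ h r₀ r₁ α β γ, HasBipyramidAngles m h r₀ r₁ α β γ →
      2 * F (2 * m * α) + m * F (4 * β) + m * F (4 * γ) = 0) {A : ℝ} (hA : 0 < A) : F A = 0 := by
  have hpi := Real.pi_gt_three
  -- The regular bipyramid with `α = t / 2` has apex angle sum `m t` and all equatorial angle sums
  -- `2π - t`.
  have hreg : ∀ m : ℕ, 2 ≤ m → ∀ t, 0 < t → m * t < 2 * Real.pi →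
      F (m * t) = -(m * F (2 * Real.pi - t)) := by
    intro m hm t h0 h1
    have hm0 : (0 : ℝ) < m := by exact_mod_cast (by omega : 0 < m)
    have := heq m hm _ _ _ _ _ _ (hasBipyramidAngles_regular hm (α := t / 2) (by positivity)
      (by rw [lt_div_iff₀ hm0]; linarith))
    rw [show 2 * (m : ℝ) * (t / 2) = m * t by ring,
      show 4 * ((Real.pi - t / 2) / 2) = 2 * Real.pi - t by ring] at this
    linarith
  -- The parameters `m = 2k` and `m = 2` at `t / 2` express both sides through the same value `F (2π
  -- - t / 2)`.
  have hmul : ∀ k : ℕ, 1 ≤ k → ∀ t, 0 < t → k * t < 2 * Real.pi → F (k * t) = k * F t := by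
    intro k hk t h0 h1
    have hk1 : (1 : ℝ) ≤ k := by exact_mod_cast hk
    have e1 := hreg (2 * k) (by omega) (t / 2) (by positivity) (by push_cast; linarith)
    have e2 := hreg 2 le_rfl (t / 2) (by positivity) (by push_cast; nlinarith)
    push_cast at e1 e2
    rw [show 2 * (k : ℝ) * (t / 2) = k * t by ring] at e1
    rw [show 2 * (t / 2) = t by ring] at e2
    rw [e1, e2]; ring
  -- Homogeneity gives the formula at rational points of the interval, and continuity extends it
  -- from this dense set.
  have hlin : Set.EqOn F (fun t => t * F 1) (Set.Ioo 0 (2 * Real.pi)) := by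
    have hd : Dense (Set.range ((↑) : ℚ → ℝ)) := Rat.denseRange_cast
    have hcl := hd.open_subset_closure_inter (isOpen_Ioo (a := 0) (b := 2 * Real.pi))
    refine Set.EqOn.of_subset_closure ?_ hF (by fun_prop) Set.inter_subset_left hcl
    rintro _ ⟨⟨h0, h1⟩, q, rfl⟩
    have hq0 : 0 < q := by exact_mod_cast h0
    have hden : 1 ≤ q.den := q.den_pos
    have hden' : (0 : ℝ) < q.den := by exact_mod_cast q.den_pos
    have hden1 : (1 : ℝ) ≤ q.den := by exact_mod_cast q.den_pos
    have hnum : (q.num.toNat : ℤ) = q.num := Int.toNat_of_nonneg (Rat.num_nonneg.2 hq0.le)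
    have hnum1 : 1 ≤ q.num.toNat := by have := Rat.num_pos.2 hq0; omega
    have hq : (q : ℝ) = q.num.toNat * (1 / q.den) := by
      rw [mul_one_div]
      have : (q.num : ℝ) = (q.num.toNat : ℝ) := by exact_mod_cast hnum.symm
      rw [← this]
      exact Rat.cast_def q
    have e1 := hmul q.den hden (1 / q.den) (by positivity) (by field_simp; linarith)
    have e2 := hmul q.num.toNat hnum1 (1 / q.den) (by positivity) (by rw [← hq]; exact h1)
    rw [mul_one_div_cancel hden'.ne'] at e1
    show F q = q * F 1
    rw [e1]
    conv_lhs => rw [hq]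
    rw [e2]
    conv_rhs => rw [hq]
    field_simp
  -- Inserting the linear form into `F 2 = -2 F (2π - 1)` gives `4π F 1 = 0`.
  have hF1 : F 1 = 0 := by
    have e1 := hreg 2 le_rfl 1 one_pos (by push_cast; linarith)
    push_cast at e1
    have e2 := hlin (x := 2 * 1) ⟨by norm_num, by linarith⟩
    have e3 := hlin (x := 2 * Real.pi - 1) ⟨by linarith, by linarith⟩
    simp only at e2 e3
    rw [e2, e3] at e1
    have : 4 * Real.pi * F 1 = 0 := by linear_combination e1
    rcases mul_eq_zero.1 this with h | h
    · linarith
    · exact h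
  have hsmall : ∀ t, 0 < t → t < 2 * Real.pi → F t = 0 := by
    intro t h0 h1
    have := hlin ⟨h0, h1⟩
    simpa [hF1] using this
  rcases lt_trichotomy A (2 * Real.pi) with h | rfl | h
  · exact hsmall A hA h
  -- The other angle sums here are `3π/2` and `π`, where `F` is already known to vanish.
  · obtain ⟨h, r₀, r₁, hb⟩ := hasBipyramidAngles_right
    have e1 := heq 3 (by norm_num) _ _ _ _ _ _ hb
    rw [hsmall _ (by positivity) (by push_cast; linarith),
      hsmall _ (by positivity) (by linarith)] at e1
    push_cast at e1
    rw [show 4 * (Real.pi / 2) = 2 * Real.pi by ring] at e1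
    linarith
  -- The apex angle `A / (2m)` realises the sum `A`; it exceeds `π / m` because `2π < A`. Two
  -- consecutive values of `m` separate `F A` from `F (3π)`.
  · have key : ∀ m : ℕ, 2 ≤ m → 2 * A < m * Real.pi → 2 * F A + m * F (3 * Real.pi) = 0 := by
      intro m hm hmA
      have hm0 : (0 : ℝ) < m := by exact_mod_cast (by omega : 0 < m)
      have hlt : A / (2 * m) < Real.pi / 4 := by
        rw [div_lt_div_iff₀ (by positivity) (by norm_num)]; linarith
      obtain ⟨y, r₀, r₁, hb⟩ := hasBipyramidAngles_wide hm (α := A / (2 * m))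
        (by rw [div_lt_div_iff₀ hm0 (by positivity)]; nlinarith) hlt
      have e1 := heq m hm _ _ _ _ _ _ hb
      have : 0 < A / (2 * m) := by positivity
      rw [hsmall (4 * _) (by linarith) (by linarith), show 2 * (m : ℝ) * (A / (2 * m)) = A by
        field_simp, show 4 * (3 * Real.pi / 4) = 3 * Real.pi by ring] at e1
      linarith
    obtain ⟨m, hm⟩ := exists_nat_gt (2 * A + 2)
    have hm2 : 2 ≤ m := by
      have : (2 : ℝ) < m := by linarith
      exact_mod_cast this.le
    have e1 := key m hm2 (by nlinarith)
    have e2 := key (m + 1) (by omega) (by push_cast; nlinarith)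
    push_cast at e2
    have : F (3 * Real.pi) = 0 := by linarith
    rw [this] at e1
    linarith

end AngleEquation

/-! ### Continuity in the angle sum, and identification with the angle defect. -/

section Rigidity

local notation "𝔼³" => EuclideanSpace ℝ (Fin 3)

/-- Scaling by `ρ` in the plane and by `η` in the vertical direction. -/
noncomputable def axialScaling (ρ η : ℝ) (x : EuclideanSpace ℝ (Fin 3)) :
    EuclideanSpace ℝ (Fin 3) := !₂[ρ * x 0, ρ * x 1, η * x 2]

lemma axialScaling_injective {ρ η : ℝ} (hρ : ρ ≠ 0) (hη : η ≠ 0) :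
    Function.Injective (axialScaling ρ η) := by
  intro x y h
  have h0 : ρ * x 0 = ρ * y 0 := congrArg (fun z : 𝔼³ => z 0) h
  have h1 : ρ * x 1 = ρ * y 1 := congrArg (fun z : 𝔼³ => z 1) h
  have h2 : η * x 2 = η * y 2 := congrArg (fun z : 𝔼³ => z 2) h
  ext i
  fin_cases i
  · exact mul_left_cancel₀ hρ h0
  · exact mul_left_cancel₀ hρ h1
  · exact mul_left_cancel₀ hη h2

lemma axialScaling_axisPoint (ρ η h : ℝ) : axialScaling ρ η (axisPoint h) = axisPoint (η * h) := by
  ext i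
  fin_cases i <;> simp [axialScaling, axisPoint]

lemma axialScaling_equator (ρ η : ℝ) (m : ℕ) (r₀ r₁ : ℝ) (k : ℕ) :
    axialScaling ρ η (equator m r₀ r₁ k) = equator m (ρ * r₀) (ρ * r₁) k := by
  ext i
  fin_cases i
  · show ρ * equator m r₀ r₁ k 0 = equator m (ρ * r₀) (ρ * r₁) k 0
    rw [equator_zero, equator_zero]; split_ifs <;> ring
  · show ρ * equator m r₀ r₁ k 1 = equator m (ρ * r₀) (ρ * r₁) k 1
    rw [equator_one, equator_one]; split_ifs <;> ring
  · show η * equator m r₀ r₁ k 2 = equator m (ρ * r₀) (ρ * r₁) k 2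
    rw [equator_two, equator_two, mul_zero]

lemma isSimplicialIso_axialScaling {m : ℕ} {r₀ r₁ h ρ η : ℝ} (hρ : ρ ≠ 0) (hη : η ≠ 0) :
    IsSimplicialIso (bipyramidFaces m r₀ r₁ h) (bipyramidFaces m (ρ * r₀) (ρ * r₁) (η * h))
      (axialScaling ρ η) := by
  have hinj := axialScaling_injective hρ hη
  refine ⟨hinj.injOn, ?_⟩
  have himg : ∀ a i, ({a, equator m r₀ r₁ i, equator m r₀ r₁ (i + 1)} : Finset 𝔼³).image
      (axialScaling ρ η) = {axialScaling ρ η a, equator m (ρ * r₀) (ρ * r₁) i,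
        equator m (ρ * r₀) (ρ * r₁) (i + 1)} := by
    intro a i
    rw [Finset.image_insert, Finset.image_insert, Finset.image_singleton, axialScaling_equator,
      axialScaling_equator]
  have hapex : ∀ a, a ∈ ({axisPoint h, axisPoint (-h)} : Set 𝔼³) →
      axialScaling ρ η a ∈ ({axisPoint (η * h), axisPoint (-(η * h))} : Set 𝔼³) := by
    rintro a (rfl | rfl)
    · exact Or.inl (axialScaling_axisPoint _ _ _)
    · exact Or.inr (by rw [axialScaling_axisPoint, mul_neg]; rfl)
  ext s
  constructor
  · rintro ⟨t, ⟨hne, i, a, ha, hsub⟩, rfl⟩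
    refine ⟨?_, i, axialScaling ρ η a, hapex a ha, ?_⟩
    · simpa using hne
    · have := Finset.image_subset_image (f := axialScaling ρ η) hsub
      rw [himg] at this
      convert this
  · rintro ⟨hne, i, a, ha, hsub⟩
    obtain ⟨b, hb, rfl⟩ : ∃ b ∈ ({axisPoint h, axisPoint (-h)} : Set 𝔼³),
        axialScaling ρ η b = a := by
      rcases ha with rfl | rfl
      · exact ⟨_, Or.inl rfl, axialScaling_axisPoint _ _ _⟩
      · exact ⟨_, Or.inr rfl, by rw [axialScaling_axisPoint, mul_neg]⟩
    have hsub' : s ⊆ ({b, equator m r₀ r₁ i, equator m r₀ r₁ (i + 1)} : Finset 𝔼³).image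
      (axialScaling ρ η) := by rw [himg]; exact hsub
    obtain ⟨t, ht, rfl⟩ := Finset.subset_image_iff.1 hsub'
    have ht' : t ∈ bipyramidFaces m r₀ r₁ h := ⟨Finset.image_nonempty.1 hne, i, b, hb, ht⟩
    refine ⟨t, ht', ?_⟩
    beta_reduce
    congr!

lemma tendsto_axialScaling {ρ η : ℕ → ℝ} (hρ : Tendsto ρ atTop (𝓝 1)) (hη : Tendsto η atTop (𝓝 1))
    (x : 𝔼³) : Tendsto (fun k => axialScaling (ρ k) (η k) x) atTop (𝓝 x) := by
  have h : Tendsto (fun k => (![ρ k * x 0, ρ k * x 1, η k * x 2] : Fin 3 → ℝ)) atTop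
      (𝓝 (WithLp.ofLp x)) := by
    rw [tendsto_pi_nhds]
    intro i
    fin_cases i
    · simpa using hρ.mul_const (x 0)
    · simpa using hρ.mul_const (x 1)
    · simpa using hη.mul_const (x 2)
  exact ((PiLp.continuous_toLp 2 (fun _ : Fin 3 => ℝ)).tendsto _).comp h

lemma HasBipyramidAngles.isLateralTriangle {m : ℕ} {h r₀ r₁ α β γ : ℝ}
    (H : HasBipyramidAngles m h r₀ r₁ α β γ) :
    IsLateralTriangle m r₀ r₁ h (Real.sin γ) (Real.sin β) (Real.sin α) α β γ :=
  isLateralTriangle_of_angles H.α_pos H.β_pos H.γ_pos H.sum_eq H.r₀_sq H.r₁_sq H.eq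

lemma continuous_regularHeight (m : ℕ) : Continuous (regularHeight m) := by
  unfold regularHeight
  fun_prop

lemma continuous_regularRadius (m : ℕ) : Continuous (regularRadius m) := by
  unfold regularRadius
  fun_prop

variable {S : Set EmbeddedComplex} {φ : VertexFunction}

/-- The values at vertices with the same angle sum coincide; angle sums that do not occur get the
value `0`. -/
lemma exists_function_of_angleSum (hsurface : ∀ K ∈ S, IsSimplicialSurface K.2)
    (hsub : ClosedUnderSubdivision S) (hinv : InvariantUnderSubdivision S φ)
    (hiso : InvariantUnderStarIsometry S φ) : ∃ f : ℝ → ℝ, ∀ (n : ℕ) (K : EuclideanComplex n),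
      (⟨n, K⟩ : EmbeddedComplex) ∈ S → ∀ v ∈ K.vertices, φ n K v = f (angleSum K v) := by
  have : ∀ θ : ℝ, ∃ y : ℝ, ∀ (n : ℕ) (K : EuclideanComplex n), (⟨n, K⟩ : EmbeddedComplex) ∈ S →
      ∀ v ∈ K.vertices, angleSum K v = θ → φ n K v = y := by
    intro θ
    by_cases h : ∃ (n : ℕ) (K : EuclideanComplex n) (v : EuclideanSpace ℝ (Fin n)),
        (⟨n, K⟩ : EmbeddedComplex) ∈ S ∧ v ∈ K.vertices ∧ angleSum K v = θ
    · obtain ⟨n, K, v, hK, hv, hθ⟩ := h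
      exact ⟨φ n K v, fun k L hL w hw hw' =>
        eq_of_angleSum_eq hsurface hsub hinv hiso hL hK hw hv (hw'.trans hθ.symm)⟩
    · exact ⟨0, fun n K hK v hv hθ => (h ⟨n, K, v, hK, hv, hθ⟩).elim⟩
  choose f hf using this
  exact ⟨f, fun n K hK v hv => hf _ n K hK v hv rfl⟩

/-- The bipyramid over a square (`m = 2`) with `α = t / 4` has apex angle sum `t`. Bipyramids for
different `t` are axial scalings of one another, with factors tending to `1`, so continuity of `φ`
at the apex becomes continuity of `f`. -/
lemma continuousOn_of_continuousVertexFunction (hcont : ContinuousVertexFunction S φ)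
    (hbip : ∀ K : EuclideanComplex 3, IsBipyramid K → (⟨3, K⟩ : EmbeddedComplex) ∈ S) {f : ℝ → ℝ}
    (hf : ∀ (n : ℕ) (K : EuclideanComplex n),
      (⟨n, K⟩ : EmbeddedComplex) ∈ S → ∀ v ∈ K.vertices, φ n K v = f (angleSum K v)) :
    ContinuousOn f (Set.Ioo 0 (2 * Real.pi)) := by
  have H : ∀ t : Set.Ioo 0 (2 * Real.pi), HasBipyramidAngles 2 (regularHeight 2 (t / 4))
      (regularRadius 2 (t / 4)) (regularRadius 2 (t / 4)) (t / 4) ((Real.pi - t / 4) / 2)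
      ((Real.pi - t / 4) / 2) := fun t => hasBipyramidAngles_regular le_rfl
        (by have := t.2.1; positivity) (by have := t.2.2; push_cast; linarith)
  have hφ : ∀ t : Set.Ioo 0 (2 * Real.pi), φ 3 (starBipyramid le_rfl (H t).r₀_pos (H t).r₁_pos
      (H t).h_pos) (axisPoint (regularHeight 2 (t / 4))) = f t := by
    intro t
    rw [hf 3 _ (hbip _ (starBipyramid_isBipyramid _ _ _ _)) _
      ((mem_vertices_starBipyramid _ _ _ _ _).2 (Or.inl rfl)),
      (H t).isLateralTriangle.angleSum_apex le_rfl (H t).r₀_pos (H t).r₁_pos (H t).h_pos (Or.inl rfl)]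
    congr 1
    push_cast; ring
  rw [continuousOn_iff_continuous_domRestrict]
  refine SeqContinuous.continuous fun t t₀ ht => ?_
  have hρ : Tendsto (fun k => regularRadius 2 (t k / 4) / regularRadius 2 (t₀ / 4)) atTop (𝓝 1) := by
    rw [← div_self (H t₀).r₀_pos.ne']
    exact ((((continuous_regularRadius 2).comp (continuous_subtype_val.div_const 4)).tendsto
      t₀).comp ht).div_const _
  have hη : Tendsto (fun k => regularHeight 2 (t k / 4) / regularHeight 2 (t₀ / 4)) atTop (𝓝 1) := by
    rw [← div_self (H t₀).h_pos.ne']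
    exact ((((continuous_regularHeight 2).comp (continuous_subtype_val.div_const 4)).tendsto
      t₀).comp ht).div_const _
  have key := hcont 3 (starBipyramid le_rfl (H t₀).r₀_pos (H t₀).r₁_pos (H t₀).h_pos)
    (fun k => starBipyramid le_rfl (H (t k)).r₀_pos (H (t k)).r₁_pos (H (t k)).h_pos)
    (fun k => axialScaling (regularRadius 2 (t k / 4) / regularRadius 2 (t₀ / 4))
      (regularHeight 2 (t k / 4) / regularHeight 2 (t₀ / 4)))
    (hbip _ (starBipyramid_isBipyramid _ _ _ _))
    (fun k => hbip _ (starBipyramid_isBipyramid _ _ _ _)) (fun k => ?_)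
    (fun v _ => tendsto_axialScaling hρ hη v) _
    ((mem_vertices_starBipyramid _ _ _ _ _).2 (Or.inl rfl))
  · simp only [axialScaling_axisPoint, div_mul_cancel₀ _ (H t₀).h_pos.ne'] at key
    simp only [hφ] at key
    exact key
  · have := isSimplicialIso_axialScaling (m := 2) (r₀ := regularRadius 2 (t₀ / 4))
      (r₁ := regularRadius 2 (t₀ / 4)) (h := regularHeight 2 (t₀ / 4))
      (div_pos (H (t k)).r₀_pos (H t₀).r₀_pos).ne' (div_pos (H (t k)).h_pos (H t₀).h_pos).ne'
    rw [div_mul_cancel₀ _ (H t₀).r₀_pos.ne', div_mul_cancel₀ _ (H t₀).h_pos.ne'] at this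
    exact this

/-- A vertex-supported function with the four properties is the normalized angle defect. -/
lemma eq_angleDefect (hsurface : ∀ K ∈ S, IsSimplicialSurface K.2)
    (hsub : ClosedUnderSubdivision S) (hinv : InvariantUnderSubdivision S φ)
    (hiso : InvariantUnderStarIsometry S φ) (hcont : ContinuousVertexFunction S φ)
    (hbip : ∀ K : EuclideanComplex 3, IsBipyramid K → (⟨3, K⟩ : EmbeddedComplex) ∈ S)
    (hsum : ∀ K : EuclideanComplex 3, IsBipyramid K → ∑ᶠ v ∈ K.vertices, φ 3 K v = 2)
    {n : ℕ} {K : EuclideanComplex n} (hK : (⟨n, K⟩ : EmbeddedComplex) ∈ S)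
    {v : EuclideanSpace ℝ (Fin n)} (hv : v ∈ K.vertices) : φ n K v = angleDefect n K v := by
  obtain ⟨f, hf⟩ := exists_function_of_angleSum hsurface hsub hinv hiso
  have hc := continuousOn_of_continuousVertexFunction hcont hbip hf
  have hpi := Real.pi_pos
  -- The equation is linear, and `1 - x / 2π` also has total `2` on each such bipyramid because `α +
  -- β + γ = π`; hence the difference satisfies the homogeneous equation.
  have h0 := eq_zero_of_bipyramid_equation (F := fun x => f x - (1 - x / (2 * Real.pi)))
    (hc.sub (by fun_prop)) (fun m hm h r₀ r₁ α β γ H => by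
      have hB := starBipyramid_isBipyramid hm H.r₀_pos H.r₁_pos H.h_pos
      have e := H.isLateralTriangle.finsum_eq (φ := φ) (f := f) hm H.r₀_pos H.r₁_pos H.h_pos
        (hf 3 _ (hbip _ hB))
      rw [hsum _ hB] at e
      have hs : γ = Real.pi - α - β := by linarith [H.sum_eq]
      simp only [hs] at e ⊢
      field_simp
      linear_combination (-(2 * Real.pi)) * e) (angleSum_pos (hsurface _ hK) hv)
  rw [hf n K hK v hv, angleDefect]
  linarith

end Rigidity

/-! ### Euler characteristic of a bipyramid. -/

section Bipyramid

local notation "𝔼³" => EuclideanSpace ℝ (Fin 3)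

lemma planeInSpace_injective : Function.Injective planeInSpace := by
  intro x y h
  ext i
  fin_cases i
  · exact congrArg (fun z : 𝔼³ => z 0) h
  · exact congrArg (fun z : 𝔼³ => z 1) h

/-- There are `n + 2` vertices and `2n` triangles; in a surface this determines the Euler
characteristic as `V - F/2`. -/
lemma eulerCharacteristic_eq_two_of_isBipyramid {K : EuclideanComplex 3}
    (hK : IsSimplicialSurface K) (hb : IsBipyramid K) : eulerCharacteristic K = 2 := by
  obtain ⟨n, hn, P, p, q, hP, hp, hq, hfaces⟩ := hb
  obtain ⟨Q, hQ⟩ : ∃ Q : Fin n → 𝔼³, ∀ i, Q i = planeInSpace (P.vertices i) := ⟨_, fun _ => rfl⟩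
  simp only [← hQ] at hfaces
  have hQinj : Function.Injective Q := by
    intro i j h
    rw [hQ, hQ] at h
    exact hP.injective (planeInSpace_injective h)
  have hQ2 : ∀ i, Q i 2 = 0 := fun i => by rw [hQ]; rfl
  have hpq : p ≠ q := by rintro rfl; linarith
  have hpQ : ∀ i, p ≠ Q i := by rintro i rfl; rw [hQ2] at hp; exact lt_irrefl _ hp
  have hqQ : ∀ i, q ≠ Q i := by rintro i rfl; rw [hQ2] at hq; exact lt_irrefl _ hq
  have hn3 := hP.three_le
  have hone : (1 : Fin n).val = 1 := by
    rw [Fin.val_one', Nat.mod_eq_of_lt (by omega)]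
  have hsucc : ∀ i : Fin n, i + 1 ≠ i := by
    intro i h
    have h1 : (1 : Fin n) = 0 := by simpa using h
    have := congrArg Fin.val h1
    rw [hone] at this
    simp at this
  -- Here `3 ≤ n` matters: a polygon edge determines its starting index, so the listed triangles are
  -- distinct.
  have hsucc2 : ∀ i : Fin n, i + 1 + 1 ≠ i := by
    intro i h
    have h1 : (1 + 1 : Fin n) = 0 := by rw [add_assoc] at h; simpa using h
    have := congrArg Fin.val h1
    rw [Fin.val_add, hone, Nat.mod_eq_of_lt (by omega)] at this
    simp at this
  have hmem : ∀ s, s ∈ K.faces ↔ s.Nonempty ∧ ∃ i, ∃ a ∈ ({p, q} : Set 𝔼³),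
      s ⊆ {a, Q i, Q (i + 1)} := fun s => by rw [hfaces]; rfl
  have hV : simplexCount K 0 = n + 2 := by
    rw [← ncard_vertices]
    have : K.vertices = ((insert p (insert q (Finset.univ.image Q)) : Finset 𝔼³) : Set 𝔼³) := by
      ext x
      rw [SimplicialComplex.mem_vertices, hmem]
      simp only [Finset.singleton_nonempty, true_and, Finset.singleton_subset_iff,
        Finset.mem_insert, Finset.mem_singleton, Finset.coe_insert, Set.mem_insert_iff,
        Finset.mem_coe, Finset.mem_image, Finset.mem_univ]
      constructor
      · rintro ⟨i, a, ha, rfl | rfl | rfl⟩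
        · rcases ha with rfl | rfl <;> simp
        · exact Or.inr (Or.inr ⟨i, rfl⟩)
        · exact Or.inr (Or.inr ⟨i + 1, rfl⟩)
      · rintro (rfl | rfl | ⟨i, rfl⟩)
        · exact ⟨0, _, Or.inl rfl, Or.inl rfl⟩
        · exact ⟨0, _, Or.inr rfl, Or.inl rfl⟩
        · exact ⟨i, _, Or.inl rfl, Or.inr (Or.inl rfl)⟩
    rw [this, Set.ncard_coe_finset, Finset.card_insert_of_notMem, Finset.card_insert_of_notMem,
      Finset.card_image_of_injective _ hQinj, Finset.card_univ, Fintype.card_fin]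
    · simp only [Finset.mem_image, Finset.mem_univ, true_and, not_exists]
      exact fun i h => hqQ i h.symm
    · simp only [Finset.mem_insert, Finset.mem_image, Finset.mem_univ, true_and, not_or, not_exists]
      exact ⟨hpq, fun i h => hpQ i h.symm⟩
  have haQ : ∀ a ∈ ({p, q} : Finset 𝔼³), ∀ i, a ≠ Q i := by
    intro a ha
    simp only [Finset.mem_insert, Finset.mem_singleton] at ha
    rcases ha with rfl | rfl
    · exact hpQ
    · exact hqQ
  have hF : simplexCount K 2 = 2 * n := by
    have : {s : Finset 𝔼³ | s ∈ K.faces ∧ s.card = 2 + 1} =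
        ((((({p, q} : Finset 𝔼³) ×ˢ (Finset.univ : Finset (Fin n))).image
          fun x => ({x.1, Q x.2, Q (x.2 + 1)} : Finset 𝔼³)) : Finset (Finset 𝔼³)) :
            Set (Finset 𝔼³)) := by
      ext s
      simp only [Finset.coe_image, Set.mem_image, Finset.mem_coe, Finset.mem_product,
        Finset.mem_univ, and_true, Prod.exists]
      show s ∈ K.faces ∧ s.card = 3 ↔ _
      rw [hmem]
      constructor
      · rintro ⟨⟨-, i, a, ha, hsub⟩, hc⟩
        refine ⟨a, i, by simpa using ha, ?_⟩
        exact (Finset.eq_of_subset_of_card_le hsub (by rw [hc]; exact Finset.card_le_three)).symm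
      · rintro ⟨a, i, ha, rfl⟩
        refine ⟨⟨Finset.insert_nonempty _ _, i, a, by simpa using ha, subset_rfl⟩, ?_⟩
        exact Finset.card_eq_three.2 ⟨_, _, _, haQ a ha i, haQ a ha _,
          fun h => hsucc i (hQinj h).symm, rfl⟩
    rw [simplexCount, this, Set.ncard_coe_finset, Finset.card_image_of_injOn, Finset.card_product,
      Finset.card_pair hpq, Finset.card_univ, Fintype.card_fin]
    rintro ⟨a, i⟩ hai ⟨b, j⟩ hbj h
    simp only [Finset.coe_product, Set.mem_prod, Finset.mem_coe, Finset.coe_univ, Set.mem_univ,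
      and_true] at hai hbj
    simp only at h
    have h1 : a = b := by
      have : a ∈ ({b, Q j, Q (j + 1)} : Finset 𝔼³) := h ▸ Finset.mem_insert_self _ _
      simpa [haQ a hai] using this
    have h2 : ∀ k, k = i ∨ k = i + 1 → k = j ∨ k = j + 1 := by
      intro k hk
      have : Q k ∈ ({b, Q j, Q (j + 1)} : Finset 𝔼³) := by
        rw [← h]; rcases hk with rfl | rfl <;> simp
      simpa [(haQ b hbj k).symm, hQinj.eq_iff] using this
    refine Prod.ext h1 ?_
    rcases h2 i (Or.inl rfl) with h3 | h3
    · exact h3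
    rcases h2 (i + 1) (Or.inr rfl) with h4 | h4
    · exact (hsucc2 j (by rw [← h3]; exact h4)).elim
    · exact add_right_cancel h4
  have := hK.eulerCharacteristic_eq
  rw [hV, hF] at this
  push_cast at this
  exact_mod_cast (by linarith : (eulerCharacteristic K : ℝ) = 2)

end Bipyramid

/-! ### Euler characteristic of a pyramid, relative to its base. -/

section Pyramid

variable {n : ℕ} {K : EuclideanComplex n}

local notation "𝔼" => EuclideanSpace ℝ (Fin n)

/-- Double counting at `v`: a triangle at `v` contains two edges at `v`, and each such edge lies in
two triangles. -/
lemma IsSimplicialSurface.ncard_edges_at (hK : IsSimplicialSurface K)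
    (v : EuclideanSpace ℝ (Fin n)) :
    {t | t ∈ K.faces ∧ v ∈ t ∧ t.card = 3}.ncard = {t | t ∈ K.faces ∧ v ∈ t ∧ t.card = 2}.ncard := by
  have hE : {t | t ∈ K.faces ∧ v ∈ t ∧ t.card = 2}.Finite := hK.finite_faces.subset fun _ h => h.1
  have hT : {t | t ∈ K.faces ∧ v ∈ t ∧ t.card = 3}.Finite := hK.finite_faces.subset fun _ h => h.1
  have h := Finset.card_mul_eq_card_mul (s := hT.toFinset) (t := hE.toFinset)
    (fun t e => e ⊆ t) (m := 2) (n := 2) ?_ ?_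
  · rw [Set.ncard_eq_toFinset_card _ hT, Set.ncard_eq_toFinset_card _ hE]
    omega
  · intro t ht
    rw [Set.Finite.mem_toFinset] at ht
    obtain ⟨htK, hvt, hc⟩ := ht
    obtain ⟨a, b, hav, hbv, hab, rfl⟩ : ∃ a b, a ≠ v ∧ b ≠ v ∧ a ≠ b ∧ t = {v, a, b} := by
      have h1 : (t.erase v).card = 2 := by rw [Finset.card_erase_of_mem hvt, hc]
      obtain ⟨a, b, hab, he⟩ := Finset.card_eq_two.1 h1
      have ha : a ∈ t.erase v := by rw [he]; simp
      have hb : b ∈ t.erase v := by rw [he]; simp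
      exact ⟨a, b, Finset.ne_of_mem_erase ha, Finset.ne_of_mem_erase hb, hab, by
        rw [← he, Finset.insert_erase hvt]⟩
    have : Finset.bipartiteAbove (fun t e => e ⊆ t) hE.toFinset ({v, a, b} : Finset 𝔼) =
        {{v, a}, {v, b}} := by
      ext e
      simp only [Finset.bipartiteAbove, Finset.mem_filter, Set.Finite.mem_toFinset,
        Set.mem_ofPred_eq, Finset.mem_insert, Finset.mem_singleton]
      constructor
      · rintro ⟨⟨-, hve, h2⟩, hsub⟩
        obtain ⟨x, hx⟩ : ∃ x, e.erase v = {x} := by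
          rw [← Finset.card_eq_one, Finset.card_erase_of_mem hve, h2]
        have he : e = {v, x} := by rw [← hx, Finset.insert_erase hve]
        have hxe : x ∈ e.erase v := by rw [hx]; simp
        have hx1 := Finset.ne_of_mem_erase hxe
        have hx2 := hsub (Finset.mem_of_mem_erase hxe)
        simp only [Finset.mem_insert, Finset.mem_singleton] at hx2
        rcases hx2 with h3 | rfl | rfl
        · exact (hx1 h3).elim
        · exact Or.inl he
        · exact Or.inr he
      · rintro (rfl | rfl)
        · exact ⟨⟨pair_mem_of_mem_face htK (by simp) (by simp), by simp,
            Finset.card_pair hav.symm⟩, by intro x; simp; tauto⟩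
        · exact ⟨⟨pair_mem_of_mem_face htK (by simp) (by simp), by simp,
            Finset.card_pair hbv.symm⟩, by intro x; simp; tauto⟩
    rw [this, Finset.card_pair]
    intro he
    have : a ∈ ({v, b} : Finset 𝔼) := by rw [← he]; simp
    simp [hav, hab] at this
  · intro e he
    rw [Set.Finite.mem_toFinset] at he
    obtain ⟨heK, hve, hc⟩ := he
    obtain ⟨b, hvb, rfl⟩ : ∃ b, v ≠ b ∧ e = {v, b} := by
      obtain ⟨b, hb⟩ : ∃ x, e.erase v = {x} := by
        rw [← Finset.card_eq_one, Finset.card_erase_of_mem hve, hc]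
      have hbe : b ∈ e.erase v := by rw [hb]; simp
      exact ⟨b, (Finset.ne_of_mem_erase hbe).symm, by rw [← hb, Finset.insert_erase hve]⟩
    obtain ⟨c, d, hcd, h⟩ := hK.exists_two_triangles hvb heK
    obtain ⟨hcv, hcb, hcK⟩ := (h c).2 (Or.inl rfl)
    obtain ⟨hdv, hdb, hdK⟩ := (h d).2 (Or.inr rfl)
    have : Finset.bipartiteBelow (fun t e => e ⊆ t) hT.toFinset ({v, b} : Finset 𝔼) =
        {{v, b, c}, {v, b, d}} := by
      ext t
      simp only [Finset.bipartiteBelow, Finset.mem_filter, Set.Finite.mem_toFinset,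
        Set.mem_ofPred_eq, Finset.mem_insert, Finset.mem_singleton]
      constructor
      · rintro ⟨⟨h1, -, h2⟩, h3⟩
        obtain ⟨z, hz⟩ : ∃ z, t \ {v, b} = {z} := by
          rw [← Finset.card_eq_one, Finset.card_sdiff_of_subset h3, h2, hc]
        have hzt : z ∈ t \ {v, b} := by rw [hz]; simp
        simp only [Finset.mem_sdiff, Finset.mem_insert, Finset.mem_singleton, not_or] at hzt
        have ht : t = {v, b, z} := by
          rw [← Finset.union_sdiff_of_subset h3, hz]
          ext; simp
        rcases (h z).1 ⟨hzt.2.1, hzt.2.2, ht ▸ h1⟩ with rfl | rfl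
        · exact Or.inl ht
        · exact Or.inr ht
      · rintro (rfl | rfl)
        · exact ⟨⟨hcK, by simp, Finset.card_eq_three.2 ⟨v, b, c, hvb, hcv.symm, hcb.symm, rfl⟩⟩,
            by intro x; simp; tauto⟩
        · exact ⟨⟨hdK, by simp, Finset.card_eq_three.2 ⟨v, b, d, hvb, hdv.symm, hdb.symm, rfl⟩⟩,
            by intro x; simp; tauto⟩
    rw [this, Finset.card_pair]
    intro he
    have : c ∈ ({v, b, d} : Finset 𝔼) := by rw [← he]; simp
    simp [hcv, hcb, hcd] at this

/-- Faces avoiding the apex form a copy of `D`. Faces at the apex contribute `1`, its edges and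
triangles being equally many in a surface; the shape of the boundary of `D` never enters. -/
lemma eulerCharacteristic_of_isPyramid {K : EuclideanComplex 3} (hK : IsSimplicialSurface K)
    (hp : IsPyramid K)
    (hdisk : ∀ D : EuclideanComplex 2, IsPlanarSimplicialDisk D → eulerCharacteristic D = 1) :
    eulerCharacteristic K = 2 := by
  obtain ⟨D, p, hD, hp0, hfaces⟩ := hp
  have hpn : ∀ x, planeInSpace x ≠ p := by rintro x rfl; exact hp0 rfl
  have hcount : ∀ i, simplexCount K i = simplexCount D i +
      {t | t ∈ K.faces ∧ p ∈ t ∧ t.card = i + 1}.ncard := by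
    intro i
    have hsplit : {s | s ∈ K.faces ∧ s.card = i + 1} =
        {s | s ∈ K.faces ∧ p ∉ s ∧ s.card = i + 1} ∪ {t | t ∈ K.faces ∧ p ∈ t ∧ t.card = i + 1} := by
      ext s
      show _ ∧ _ ↔ (_ ∧ _ ∧ _) ∨ (_ ∧ _ ∧ _)
      tauto
    have hbase : {s | s ∈ K.faces ∧ p ∉ s ∧ s.card = i + 1} =
        (fun s => s.image planeInSpace) '' {s | s ∈ D.faces ∧ s.card = i + 1} := by
      ext s
      constructor
      · rintro ⟨hs, hps, hc⟩
        rw [hfaces] at hs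
        rcases hs with (⟨t, ht, rfl⟩ | rfl) | ⟨t, ht, rfl⟩
        · refine ⟨t, ⟨ht, ?_⟩, by congr!⟩
          rw [← hc]
          exact (Finset.card_image_of_injective _ planeInSpace_injective).symm
        · exact (hps (Finset.mem_singleton_self p)).elim
        · exact (hps (Finset.mem_insert_self _ _)).elim
      · rintro ⟨t, ⟨ht, hc⟩, rfl⟩
        refine ⟨?_, ?_, ?_⟩
        · rw [hfaces]
          exact Or.inl (Or.inl ⟨t, ht, by congr!⟩)
        · simp only [Finset.mem_image, not_exists, not_and]
          exact fun x _ => hpn x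
        · rw [← hc]
          exact Finset.card_image_of_injective _ planeInSpace_injective
    rw [simplexCount, hsplit, Set.ncard_union_eq ?_ (hK.finite_faces.subset fun _ h => h.1)
      (hK.finite_faces.subset fun _ h => h.1), hbase, Set.ncard_image_of_injective, simplexCount]
    · exact Finset.image_injective planeInSpace_injective
    · rw [Set.disjoint_left]
      exact fun s h h' => h.2.1 h'.2.1
  have h1 : {t | t ∈ K.faces ∧ p ∈ t ∧ t.card = 0 + 1}.ncard = 1 := by
    rw [Set.ncard_eq_one]
    refine ⟨{p}, ?_⟩
    ext s
    constructor
    · rintro ⟨-, hps, hc⟩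
      obtain ⟨x, rfl⟩ := Finset.card_eq_one.1 hc
      rw [Finset.mem_singleton.1 hps]; rfl
    · rintro rfl
      refine ⟨?_, Finset.mem_singleton_self p, Finset.card_singleton p⟩
      rw [hfaces]
      exact Or.inl (Or.inr rfl)
  have h2 := hK.ncard_edges_at p
  have h3 := hdisk D hD
  rw [eulerCharacteristic] at h3 ⊢
  rw [hcount, hcount, hcount, h1]
  push_cast
  norm_num at h2 ⊢
  rw [h2]
  linarith

end Pyramid

/-! ### Extreme edges of planar triangles. -/

section PlanarTriangles

local notation "𝔼²" => EuclideanSpace ℝ (Fin 2)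

variable {D : EuclideanComplex 2}

/-- If `w` and `w'` lie on the same side of the line `vu`, then a point just off the midpoint of the
edge, towards `w`, belongs to both triangles and would have two different systems of coordinates. -/
lemma false_of_overlapping_triangles {v u w w' : EuclideanSpace ℝ (Fin 2)}
    (h : ({v, u, w} : Finset 𝔼²) ∈ D.faces)
    (h' : ({v, u, w'} : Finset 𝔼²) ∈ D.faces) (hv : w ≠ v) (hu : w ≠ u) (hw : w ≠ w') {c μ : ℝ}
    (hμ : 0 ≤ μ) (he : w - v = c • (u - v) + μ • (w' - v)) : False := by
  -- Small enough that all weights of the point stay nonnegative in both triangles.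
  obtain ⟨ε, hε⟩ : ∃ ε, ε = 1 / (4 * (1 + |c| + μ)) := ⟨_, rfl⟩
  have hc := abs_nonneg c
  have hε0 : 0 < ε := by rw [hε]; positivity
  have hε1 : ε * (1 + |c| + μ) = 1 / 4 := by rw [hε]; field_simp
  have h1 : ε * c ≤ ε * |c| := mul_le_mul_of_nonneg_left (le_abs_self c) hε0.le
  have h2 : ε * -c ≤ ε * |c| := mul_le_mul_of_nonneg_left (neg_le_abs c) hε0.le
  have h3 : 0 ≤ ε * μ := by positivity
  have h4 : 0 ≤ ε * |c| := by positivity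
  have e1 := SimplicialComplex.coord_triangle h (α := 1 / 2 - ε) (β := 1 / 2) (γ := ε)
    (by linarith) (by norm_num) hε0.le (by ring)
  have e2 := SimplicialComplex.coord_triangle h' (α := 1 / 2 - ε * c - ε * μ) (β := 1 / 2 + ε * c)
    (γ := ε * μ) (by linarith) (by linarith) h3 (by ring)
  have hy : (1 / 2 - ε) • v + (1 / 2 : ℝ) • u + ε • w =
      (1 / 2 - ε * c - ε * μ) • v + (1 / 2 + ε * c) • u + (ε * μ) • w' := by
    have : w = v + (c • (u - v) + μ • (w' - v)) := by rw [← he]; abel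
    rw [this]
    module
  rw [hy] at e1
  have := DFunLike.congr_fun (e1.symm.trans e2) w
  simp [hv.symm, hu.symm, hw.symm] at this
  exact hε0.ne' this

/-- The vertex `v` farthest from the origin is a corner of the union, and the edge from `v` with
extreme direction has all triangles of `T` on one side. Planarity then allows only one triangle at
it. -/
lemma exists_extreme_edge {T : Finset (Finset (EuclideanSpace ℝ (Fin 2)))} (hne : T.Nonempty)
    (hT : ∀ t ∈ T, t ∈ D.faces ∧ t.card = 3) :
    ∃ t₀ ∈ T, ∃ e ⊆ t₀, e.card = 2 ∧ ∀ t ∈ T, e ⊆ t → t = t₀ := by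
  obtain ⟨t₁, ht₁⟩ := hne
  obtain ⟨v, hvT, hvmax⟩ := (T.biUnion id).exists_max_image (fun x => x 0 ^ 2 + x 1 ^ 2) (by
    obtain ⟨x, hx⟩ := Finset.card_pos.1 (by rw [(hT t₁ ht₁).2]; norm_num : 0 < t₁.card)
    exact ⟨x, Finset.mem_biUnion.2 ⟨t₁, ht₁, hx⟩⟩)
  obtain ⟨t₂, ht₂, hvt₂⟩ := Finset.mem_biUnion.1 hvT
  rw [id] at hvt₂
  -- `a` and `b` are coordinates centred at `v`, directed towards the origin and across. By
  -- maximality of `v` all other vertices have `a > 0`, so the slope `b / a` orders the directions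
  -- at `v`.
  obtain ⟨a, ha⟩ : ∃ a : 𝔼² → ℝ, ∀ x, a x = -((x 0 - v 0) * v 0 + (x 1 - v 1) * v 1) :=
    ⟨_, fun _ => rfl⟩
  obtain ⟨b, hb⟩ : ∃ b : 𝔼² → ℝ, ∀ x, b x = v 0 * (x 1 - v 1) - v 1 * (x 0 - v 0) :=
    ⟨_, fun _ => rfl⟩
  have hapos : ∀ t ∈ T, ∀ x ∈ t, x ≠ v → 0 < a x := by
    intro t ht x hx hxv
    have h1 := hvmax x (Finset.mem_biUnion.2 ⟨t, ht, hx⟩)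
    have h2 : 0 < (x 0 - v 0) ^ 2 + (x 1 - v 1) ^ 2 := by
      by_contra hcon
      have e0 : x 0 - v 0 = 0 := by nlinarith [sq_nonneg (x 0 - v 0), sq_nonneg (x 1 - v 1)]
      have e1 : x 1 - v 1 = 0 := by nlinarith [sq_nonneg (x 0 - v 0), sq_nonneg (x 1 - v 1)]
      refine hxv ?_
      ext i
      fin_cases i
      · exact sub_eq_zero.1 e0
      · exact sub_eq_zero.1 e1
    rw [ha]
    nlinarith
  obtain ⟨u, hu, humax⟩ := ((T.filter (v ∈ ·)).biUnion id |>.erase v).exists_max_image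
    (fun x => b x / a x) (by
      obtain ⟨x, hx⟩ := Finset.card_pos.1 (by
        rw [Finset.card_erase_of_mem hvt₂, (hT t₂ ht₂).2]; norm_num : 0 < (t₂.erase v).card)
      exact ⟨x, Finset.mem_erase.2 ⟨Finset.ne_of_mem_erase hx, Finset.mem_biUnion.2
        ⟨t₂, Finset.mem_filter.2 ⟨ht₂, hvt₂⟩, Finset.mem_of_mem_erase hx⟩⟩⟩)
  obtain ⟨huv, hu⟩ := Finset.mem_erase.1 hu
  obtain ⟨t₀, ht₀, hut₀⟩ := Finset.mem_biUnion.1 hu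
  obtain ⟨ht₀, hvt₀⟩ := Finset.mem_filter.1 ht₀
  rw [id] at hut₀
  have hau := hapos t₀ ht₀ u hut₀ huv
  have hv0 : 0 < v 0 ^ 2 + v 1 ^ 2 := by
    by_contra hcon
    have e0 : v 0 = 0 := by nlinarith [sq_nonneg (v 0), sq_nonneg (v 1)]
    have e1 : v 1 = 0 := by nlinarith [sq_nonneg (v 0), sq_nonneg (v 1)]
    rw [ha, e0, e1] at hau
    simp at hau
  have hvec : ∀ z : 𝔼², z 0 * v 0 + z 1 * v 1 = 0 → v 0 * z 1 - v 1 * z 0 = 0 → z = 0 := by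
    intro z h1 h2
    have e0 : (v 0 ^ 2 + v 1 ^ 2) * z 0 = 0 := by linear_combination v 0 * h1 - v 1 * h2
    have e1 : (v 0 ^ 2 + v 1 ^ 2) * z 1 = 0 := by linear_combination v 1 * h1 + v 0 * h2
    ext i
    fin_cases i
    · exact (mul_eq_zero.1 e0).resolve_left hv0.ne'
    · exact (mul_eq_zero.1 e1).resolve_left hv0.ne'
  have hcomb : ∀ w w' : 𝔼², ∀ c μ : ℝ, a w = c * a u + μ * a w' → b w = c * b u + μ * b w' →
      w - v = c • (u - v) + μ • (w' - v) := by
    intro w w' c μ h1 h2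
    simp only [ha, hb] at h1 h2
    refine sub_eq_zero.1 (hvec _ ?_ ?_)
    · simp only [PiLp.sub_apply, PiLp.add_apply, PiLp.smul_apply, smul_eq_mul]
      linear_combination -h1
    · simp only [PiLp.sub_apply, PiLp.add_apply, PiLp.smul_apply, smul_eq_mul]
      linear_combination h2
  have hthird : ∀ t ∈ T, ({v, u} : Finset 𝔼²) ⊆ t → ∃ w, w ≠ v ∧ w ≠ u ∧ t = {v, u, w} ∧ 0 < a w ∧
      b w / a w ≤ b u / a u := by
    intro t ht hsub
    obtain ⟨w, hw⟩ : ∃ w, t \ {v, u} = {w} := by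
      rw [← Finset.card_eq_one, Finset.card_sdiff_of_subset hsub, (hT t ht).2,
        Finset.card_pair huv.symm]
    have hwt : w ∈ t \ {v, u} := by rw [hw]; simp
    simp only [Finset.mem_sdiff, Finset.mem_insert, Finset.mem_singleton, not_or] at hwt
    refine ⟨w, hwt.2.1, hwt.2.2, ?_, hapos t ht w hwt.1 hwt.2.1, humax w (Finset.mem_erase.2
      ⟨hwt.2.1, Finset.mem_biUnion.2 ⟨t, Finset.mem_filter.2 ⟨ht, hsub (by simp)⟩, hwt.1⟩⟩)⟩
    rw [← Finset.union_sdiff_of_subset hsub, hw]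
    ext; simp
  have hsub₀ : ({v, u} : Finset 𝔼²) ⊆ t₀ := by
    intro x hx
    simp only [Finset.mem_insert, Finset.mem_singleton] at hx
    rcases hx with rfl | rfl <;> assumption
  refine ⟨t₀, ht₀, {v, u}, hsub₀, Finset.card_pair huv.symm, fun t ht hsub => ?_⟩
  obtain ⟨w, hwv, hwu, rfl, haw, hsw⟩ := hthird t ht hsub
  obtain ⟨w', hwv', hwu', rfl, haw', hsw'⟩ := hthird t₀ ht₀ hsub₀
  by_contra hne
  have hww : w ≠ w' := by rintro rfl; exact hne rfl
  -- If `w'` has the extreme slope, its triangle is degenerate, which is the case `μ = 0`. Otherwise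
  -- `w` is expressed through `u` and `w'`, with the nonnegative coefficient `μ` obtained by
  -- comparing slopes.
  rcases hsw'.eq_or_lt with heq | hlt
  · refine false_of_overlapping_triangles (hT _ ht₀).1 (hT _ ht).1 hwv' hwu' hww.symm
      (c := a w' / a u) le_rfl (hcomb _ _ _ _ ?_ ?_)
    · field_simp; ring
    · rw [div_eq_div_iff haw'.ne' hau.ne'] at heq
      field_simp
      linarith
  · have hpos : 0 < b u / a u - b w' / a w' := by linarith
    refine false_of_overlapping_triangles (hT _ ht).1 (hT _ ht₀).1 hwv hwu hww
      (μ := (b u / a u - b w / a w) * a w / ((b u / a u - b w' / a w') * a w'))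
      (c := (a w - (b u / a u - b w / a w) * a w / (b u / a u - b w' / a w')) / a u)
      (by have : 0 ≤ b u / a u - b w / a w := by linarith
          positivity) (hcomb _ _ _ _ ?_ ?_)
    · field_simp
      ring
    · have e1 : b u = (b u / a u) * a u := by field_simp
      have e2 : b w = (b w / a w) * a w := by field_simp
      have e3 : b w' = (b w' / a w') * a w' := by field_simp
      generalize b u / a u = p at *
      generalize b w / a w = q at *
      generalize b w' / a w' = r at *
      rw [e1, e2, e3]
      field_simp
      ring

end PlanarTriangles

/-! ### Locally constant functions and integral cocycles through logarithms. -/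

section Cocycles

variable {n : ℕ} {K : EuclideanComplex n}

local notation "𝔼" => EuclideanSpace ℝ (Fin n)

lemma plExtend_eq_sum {s : Finset (EuclideanSpace ℝ (Fin n))} (hs : s ∈ K.faces)
    {y : EuclideanSpace ℝ (Fin n)} (hy : y ∈ convexHull ℝ (s : Set 𝔼)) (g : 𝔼 → ℝ) :
    K.plExtend g y = ∑ v ∈ s, K.coord y v * g v := by
  have hsub := (SimplicialComplex.mem_convexHull_iff_coord hs
    (SimplicialComplex.convexHull_subset_space hs hy)).1 hy
  rw [SimplicialComplex.plExtend, Finsupp.linearCombination_apply,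
    Finsupp.sum_of_support_subset _ hsub _ (by simp)]
  simp

lemma sum_coord_eq_one {s : Finset (EuclideanSpace ℝ (Fin n))} (hs : s ∈ K.faces)
    {y : EuclideanSpace ℝ (Fin n)} (hy : y ∈ convexHull ℝ (s : Set 𝔼)) :
    ∑ v ∈ s, K.coord y v = 1 := by
  have hyK := SimplicialComplex.convexHull_subset_space hs hy
  rw [← weightTotal_eq_sum ((SimplicialComplex.mem_convexHull_iff_coord hs hyK).1 hy)]
  exact (SimplicialComplex.coord_spec hyK).1.total

/-- A function on the vertices of a connected complex that is constant on edges is constant. -/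
lemma eq_of_forall_edge (hK : K.faces.Finite) (hc : IsPreconnected K.space)
    {f : EuclideanSpace ℝ (Fin n) → ℝ}
    (hf : ∀ u v, ({u, v} : Finset 𝔼) ∈ K.faces → f u = f v) {u v : EuclideanSpace ℝ (Fin n)}
    (hu : u ∈ K.vertices) (hv : v ∈ K.vertices) : f u = f v := by
  have hval : ∀ s ∈ K.faces, ∀ y ∈ convexHull ℝ (s : Set 𝔼), ∀ u ∈ s, K.plExtend f y = f u := by
    intro s hs y hy u hu
    rw [plExtend_eq_sum hs hy, ← one_mul (f u), ← sum_coord_eq_one hs hy, Finset.sum_mul]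
    exact Finset.sum_congr rfl fun w hw => by
      rw [hf w u (pair_mem_of_mem_face hs hw hu)]
  have hvert : ∀ u ∈ K.vertices, u ∈ K.space ∧ K.plExtend f u = f u := by
    intro u hu
    have h := subset_convexHull ℝ ((({u} : Finset 𝔼)) : Set 𝔼) (Finset.mem_singleton_self u)
    exact ⟨SimplicialComplex.convexHull_subset_space hu h,
      hval _ hu u h u (Finset.mem_singleton_self u)⟩
  -- The extension takes only finitely many values, so its image of the connected space is a single
  -- point.
  have hsub : K.plExtend f '' K.space ⊆ f '' K.vertices := by
    rintro _ ⟨y, hy, rfl⟩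
    obtain ⟨s, hs, hys⟩ := SimplicialComplex.mem_space_iff.1 hy
    obtain ⟨u, hu⟩ := K.nonempty_of_mem_faces hs
    exact ⟨u, SimplicialComplex.mem_vertices_of_mem_face hs hu, (hval s hs y hys u hu).symm⟩
  have hsing := (((SimplicialComplex.vertices_finite hK).image f).subset hsub).countable
    |>.isTotallyDisconnected _ subset_rfl
      (hc.image _ (SimplicialComplex.continuousOn_plExtend hK f))
  rw [← (hvert u hu).2, ← (hvert v hv).2]
  exact hsing ⟨u, (hvert u hu).1, rfl⟩ ⟨v, (hvert v hv).1, rfl⟩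

/-- An integral simplicial `1`-cocycle on a contractible complex is a coboundary. -/
lemma exists_primitive_of_contractible (hK : K.faces.Finite) [ContractibleSpace K.space]
    {c : EuclideanSpace ℝ (Fin n) → EuclideanSpace ℝ (Fin n) → ℤ}
    (hc : ∀ u v w, ({u, v, w} : Finset 𝔼) ∈ K.faces → c u v + c v w = c u w) :
    ∃ p : EuclideanSpace ℝ (Fin n) → ℤ,
      ∀ u v, ({u, v} : Finset 𝔼) ∈ K.faces → c u v = p v - p u := by
  classical
  have hself : ∀ u ∈ K.vertices, c u u = 0 := by
    intro u hu
    have h : ({u, u, u} : Finset 𝔼) ∈ K.faces := by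
      rw [Finset.insert_eq_of_mem (by simp), Finset.insert_eq_of_mem (by simp)]; exact hu
    linarith [hc u u u h]
  -- `A u` is a local logarithm on the star of `u`. On a common face, `A u` and `A u'` differ by
  -- `2πi c u u'` thanks to the cocycle condition, so their exponentials glue to one nonvanishing
  -- function `g`.
  let A : 𝔼 → 𝔼 → ℂ := fun u y => 2 * Real.pi * Complex.I * (K.plExtend (fun w => (c u w : ℝ)) y : ℂ)
  have hA : ∀ u, ContinuousOn (A u) K.space := fun u => continuousOn_const.mul
    (Complex.continuous_ofReal.comp_continuousOn (SimplicialComplex.continuousOn_plExtend hK _))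
  have hcompat : ∀ s ∈ K.faces, ∀ y ∈ convexHull ℝ (s : Set 𝔼), ∀ u ∈ s, ∀ u' ∈ s,
      Complex.exp (A u y) = Complex.exp (A u' y) := by
    intro s hs y hy u hu u' hu'
    have h1 : K.plExtend (fun w => (c u w : ℝ)) y =
        K.plExtend (fun w => (c u' w : ℝ)) y + c u u' := by
      rw [plExtend_eq_sum hs hy, plExtend_eq_sum hs hy, ← one_mul (c u u' : ℝ),
        ← sum_coord_eq_one hs hy, Finset.sum_mul, ← Finset.sum_add_distrib]
      refine Finset.sum_congr rfl fun w hw => ?_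
      rw [← hc u u' w (triple_mem_of_mem_face hs hu hu' hw)]
      push_cast; ring
    have h2 : A u y = A u' y + c u u' * (2 * Real.pi * Complex.I) := by
      simp only [A, h1]; push_cast; ring
    rw [h2, Complex.exp_add, Complex.exp_int_mul_two_pi_mul_I, mul_one]
  let g : 𝔼 → ℂ := fun y => if h : (K.coord y).support.Nonempty then Complex.exp (A h.choose y) else 1
  have hg : ∀ s ∈ K.faces, ∀ y ∈ convexHull ℝ (s : Set 𝔼), ∀ u ∈ s, g y = Complex.exp (A u y) := by
    intro s hs y hy u hu
    have hyK := SimplicialComplex.convexHull_subset_space hs hy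
    have hne : (K.coord y).support.Nonempty :=
      K.nonempty_of_mem_faces (SimplicialComplex.coord_spec hyK).1.support_mem
    simp only [g, dif_pos hne]
    exact hcompat s hs y hy _
      ((SimplicialComplex.mem_convexHull_iff_coord hs hyK).1 hy hne.choose_spec) u hu
  have hgc : ContinuousOn g K.space := by
    have : Finite K.faces := hK.to_subtype
    have hspace : K.space = ⋃ s : K.faces, convexHull ℝ ((s : Finset 𝔼) : Set 𝔼) := by
      ext y
      simp [SimplicialComplex.mem_space_iff]
    rw [hspace]
    refine (locallyFinite_of_finite _).continuousOn_iUnion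
      (fun s => isClosed_convexHull_finset _) fun s => ?_
    obtain ⟨u, hu⟩ := K.nonempty_of_mem_faces s.2
    have h1 : ContinuousOn (fun y => Complex.exp (A u y)) (convexHull ℝ ((s : Finset 𝔼) : Set 𝔼)) :=
      ((hA u).mono (SimplicialComplex.convexHull_subset_space s.2)).cexp
    exact h1.congr fun y hy => hg s.1 s.2 y hy u hu
  have hg0 : ∀ y : K.space, g y ≠ 0 := by
    intro y
    obtain ⟨s, hs, hys⟩ := SimplicialComplex.mem_space_iff.1 y.2
    obtain ⟨u, hu⟩ := K.nonempty_of_mem_faces hs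
    rw [hg s hs y hys u hu]
    exact Complex.exp_ne_zero _
  -- Since `g = 1` at every vertex, the values of this global logarithm there are integral multiples
  -- of `2πi`; these integers form the primitive `p`.
  obtain ⟨L, hL, hLe⟩ := hasLog_of_contractible
    (continuousOn_iff_continuous_domRestrict.1 hgc) hg0
  have hvs : ∀ v ∈ K.vertices, v ∈ convexHull ℝ ((({v} : Finset 𝔼)) : Set 𝔼) := fun v hv =>
    subset_convexHull ℝ _ (Finset.mem_singleton_self v)
  have hvK : ∀ v ∈ K.vertices, v ∈ K.space := fun v hv =>
    SimplicialComplex.convexHull_subset_space hv (hvs v hv)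
  have hApt : ∀ u, ∀ v ∈ K.vertices, A u v = 2 * Real.pi * Complex.I * c u v := by
    intro u v hv
    simp only [A, SimplicialComplex.plExtend, SimplicialComplex.coord_vertex hv]
    simp
  have hgv : ∀ v ∈ K.vertices, g v = 1 := by
    intro v hv
    rw [hg _ hv v (hvs v hv) v (Finset.mem_singleton_self v), hApt v v hv, hself v hv]
    simp
  have hp : ∀ v, ∃ k : ℤ, ∀ hv : v ∈ K.vertices,
      L ⟨v, hvK v hv⟩ = k * (2 * Real.pi * Complex.I) := by
    intro v
    by_cases hv : v ∈ K.vertices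
    · have := hLe ⟨v, hvK v hv⟩
      rw [show (K.space.domRestrict g) ⟨v, hvK v hv⟩ = 1 from hgv v hv] at this
      obtain ⟨k, hk⟩ := Complex.exp_eq_one_iff.1 this
      exact ⟨k, fun _ => hk⟩
    · exact ⟨0, fun h => (hv h).elim⟩
  choose p hp using hp
  refine ⟨p, fun u v huv => ?_⟩
  have hu := SimplicialComplex.mem_vertices_of_mem_face huv (v := u) (by simp)
  have hv := SimplicialComplex.mem_vertices_of_mem_face huv (v := v) (by simp)
  have hsub := SimplicialComplex.convexHull_subset_space huv
  have hmem : ∀ w ∈ ({u, v} : Finset 𝔼), w ∈ convexHull ℝ ((({u, v} : Finset 𝔼)) : Set 𝔼) :=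
    fun w hw => subset_convexHull ℝ _ hw
  have hum := hmem u (by simp)
  have hvm := hmem v (by simp)
  have : PreconnectedSpace (convexHull ℝ ((({u, v} : Finset 𝔼)) : Set 𝔼)) :=
    Subtype.preconnectedSpace (convex_convexHull ℝ _).isPreconnected
  -- Along an edge from `u`, the global logarithm `L` and the local one `A u` differ by the constant
  -- `L u`; at `v` this reads `c u v = p v - p u`.
  have key := eq_of_exp_eq (X := convexHull ℝ ((({u, v} : Finset 𝔼)) : Set 𝔼))
    (f := fun y => L ⟨y, hsub y.2⟩) (f' := fun y => A u y + L ⟨u, hvK u hu⟩)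
    (hL.comp (by fun_prop))
    ((continuousOn_iff_continuous_domRestrict.1 ((hA u).mono hsub)).add continuous_const)
    (fun y => by
      rw [Complex.exp_add, hLe, hLe, show (K.space.domRestrict g) ⟨u, hvK u hu⟩ = 1 from hgv u hu,
        mul_one]
      exact hg _ huv y y.2 u (by simp)) ⟨u, hum⟩ (by
      simp only [hApt u u hu, hself u hu]
      simp)
  have h1 := congrFun key ⟨v, hvm⟩
  simp only [hApt u v hv, hp v hv, hp u hu] at h1
  have h2 : (2 * Real.pi * Complex.I) * ((p v : ℂ) - c u v - p u) = 0 := by linear_combination h1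
  have h3 := (mul_eq_zero.1 h2).resolve_left Complex.two_pi_I_ne_zero
  have h4 : p v - c u v - p u = 0 := by exact_mod_cast h3
  linarith

end Cocycles

/-! ### Rational simplicial cochains and the Euler characteristic of a disk. -/

section Cochains

variable {n : ℕ} {K : EuclideanComplex n}

local notation "𝔼" => EuclideanSpace ℝ (Fin n)

/-- The edges of `K`. -/
abbrev EdgeOf (K : EuclideanComplex n) : Type := {e : Finset 𝔼 // e ∈ K.faces ∧ e.card = 2}

/-- The triangles of `K`. -/
abbrev TriangleOf (K : EuclideanComplex n) : Type := {t : Finset 𝔼 // t ∈ K.faces ∧ t.card = 3}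

lemma exists_endpoints (e : EdgeOf K) : ∃ x : 𝔼 × 𝔼, x.1 ≠ x.2 ∧ e.1 = {x.1, x.2} := by
  obtain ⟨a, b, hab, h⟩ := Finset.card_eq_two.1 e.2.2
  exact ⟨(a, b), hab, h⟩

lemma exists_corners (t : TriangleOf K) :
    ∃ x : 𝔼 × 𝔼 × 𝔼, x.1 ≠ x.2.1 ∧ x.1 ≠ x.2.2 ∧ x.2.1 ≠ x.2.2 ∧ t.1 = {x.1, x.2.1, x.2.2} := by
  obtain ⟨a, b, c, hab, hac, hbc, h⟩ := Finset.card_eq_three.1 t.2.2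
  exact ⟨(a, b, c), hab, hac, hbc, h⟩

/-- An arbitrary orientation of an edge. -/
noncomputable def endpoints (e : EdgeOf K) : 𝔼 × 𝔼 := (exists_endpoints e).choose

/-- An arbitrary ordering of the vertices of a triangle. -/
noncomputable def corners (t : TriangleOf K) : 𝔼 × 𝔼 × 𝔼 := (exists_corners t).choose

lemma endpoints_ne (e : EdgeOf K) : (endpoints e).1 ≠ (endpoints e).2 :=
  (exists_endpoints e).choose_spec.1

lemma edge_eq (e : EdgeOf K) : e.1 = {(endpoints e).1, (endpoints e).2} :=
  (exists_endpoints e).choose_spec.2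

lemma corners_ne (t : TriangleOf K) : (corners t).1 ≠ (corners t).2.1 ∧
    (corners t).1 ≠ (corners t).2.2 ∧ (corners t).2.1 ≠ (corners t).2.2 :=
  ⟨(exists_corners t).choose_spec.1, (exists_corners t).choose_spec.2.1,
    (exists_corners t).choose_spec.2.2.1⟩

lemma triangle_eq (t : TriangleOf K) :
    t.1 = {(corners t).1, (corners t).2.1, (corners t).2.2} :=
  (exists_corners t).choose_spec.2.2.2

variable {A B : Type*} [AddCommGroup A] [AddCommGroup B]

open Classical in
/-- A `1`-cochain as an antisymmetric function of two vertices. -/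
noncomputable def alternating (x : EdgeOf K → A) (u v : 𝔼) : A :=
  if h : ({u, v} : Finset 𝔼) ∈ K.faces ∧ ({u, v} : Finset 𝔼).card = 2 then
    if (endpoints ⟨_, h⟩).1 = u then x ⟨_, h⟩ else -x ⟨_, h⟩ else 0

lemma alternating_self (x : EdgeOf K → A) (u : 𝔼) : alternating x u u = 0 := by
  rw [alternating, dif_neg]
  simp

lemma alternating_endpoints (x : EdgeOf K → A) (e : EdgeOf K) :
    alternating x (endpoints e).1 (endpoints e).2 = x e := by
  have h : ({(endpoints e).1, (endpoints e).2} : Finset 𝔼) ∈ K.faces ∧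
      ({(endpoints e).1, (endpoints e).2} : Finset 𝔼).card = 2 := by
    rw [← edge_eq]; exact e.2
  have he : (⟨_, h⟩ : EdgeOf K) = e := Subtype.ext (edge_eq e).symm
  rw [alternating, dif_pos h, he, if_pos rfl]

lemma alternating_endpoints_swap (x : EdgeOf K → A) (e : EdgeOf K) :
    alternating x (endpoints e).2 (endpoints e).1 = -x e := by
  have h : ({(endpoints e).2, (endpoints e).1} : Finset 𝔼) ∈ K.faces ∧
      ({(endpoints e).2, (endpoints e).1} : Finset 𝔼).card = 2 := by
    rw [Finset.pair_comm, ← edge_eq]; exact e.2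
  have he : (⟨_, h⟩ : EdgeOf K) = e := Subtype.ext ((Finset.pair_comm _ _).trans (edge_eq e).symm)
  rw [alternating, dif_pos h, he, if_neg (endpoints_ne e)]

lemma eq_endpoints {u v : EuclideanSpace ℝ (Fin n)} (huv : u ≠ v)
    (h : ({u, v} : Finset 𝔼) ∈ K.faces) : ∃ e : EdgeOf K,
      e.1 = {u, v} ∧ (endpoints e = (u, v) ∨ endpoints e = (v, u)) := by
  refine ⟨⟨_, h, Finset.card_pair huv⟩, rfl, ?_⟩
  set e : EdgeOf K := ⟨_, h, Finset.card_pair huv⟩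
  have he : ({u, v} : Finset 𝔼) = {(endpoints e).1, (endpoints e).2} := edge_eq e
  have hne := endpoints_ne e
  have h1 : (endpoints e).1 ∈ ({u, v} : Finset 𝔼) := by rw [he]; simp
  have h2 : (endpoints e).2 ∈ ({u, v} : Finset 𝔼) := by rw [he]; simp
  simp only [Finset.mem_insert, Finset.mem_singleton] at h1 h2
  simp only [Prod.ext_iff]
  rcases h1 with h1 | h1 <;> rcases h2 with h2 | h2
  · exact (hne (h1.trans h2.symm)).elim
  · exact Or.inl ⟨h1, h2⟩
  · exact Or.inr ⟨h1, h2⟩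
  · exact (hne (h1.trans h2.symm)).elim

lemma alternating_swap (x : EdgeOf K → A) (u v : 𝔼) : alternating x v u = -alternating x u v := by
  by_cases huv : u = v
  · rw [huv, alternating_self, neg_zero]
  by_cases h : ({u, v} : Finset 𝔼) ∈ K.faces
  · obtain ⟨e, -, he | he⟩ := eq_endpoints huv h
    · have h1 := alternating_endpoints x e
      have h2 := alternating_endpoints_swap x e
      rw [he] at h1 h2
      rw [h1, h2]
    · have h1 := alternating_endpoints x e
      have h2 := alternating_endpoints_swap x e
      rw [he] at h1 h2
      rw [h1, h2, neg_neg]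
  · rw [alternating, dif_neg (by rw [Finset.pair_comm]; tauto), alternating, dif_neg (by tauto),
      neg_zero]

lemma alternating_map (f : A →+ B) (x : EdgeOf K → A) (u v : 𝔼) :
    alternating (fun e => f (x e)) u v = f (alternating x u v) := by
  unfold alternating
  split_ifs <;> simp

lemma alternating_add (x y : EdgeOf K → A) (u v : 𝔼) :
    alternating (x + y) u v = alternating x u v + alternating y u v := by
  unfold alternating
  split_ifs
  · rfl
  · simp only [Pi.add_apply]; abel
  · simp

lemma alternating_single (e : EdgeOf K) [DecidableEq (EdgeOf K)] {u v : 𝔼} :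
    alternating (Pi.single e (1 : ℚ)) u v ≠ 0 ↔ e.1 = {u, v} := by
  constructor
  · intro h
    rw [alternating] at h
    split_ifs at h with h1 h2
    · by_contra hne
      exact h (Pi.single_eq_of_ne (fun he => hne (congrArg Subtype.val he).symm) _)
    · by_contra hne
      exact h (by rw [Pi.single_eq_of_ne (fun he => hne (congrArg Subtype.val he).symm), neg_zero])
    · exact (h rfl).elim
  · intro h
    have h1 : ({u, v} : Finset 𝔼) ∈ K.faces ∧ ({u, v} : Finset 𝔼).card = 2 := h ▸ e.2
    have he : (⟨_, h1⟩ : EdgeOf K) = e := Subtype.ext h.symm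
    rw [alternating, dif_pos h1, he]
    split_ifs <;> simp

/-- The coboundary of a `0`-cochain. -/
noncomputable def coboundaryZero (K : EuclideanComplex n) :
    (K.vertices → ℚ) →ₗ[ℚ] (EdgeOf K → ℚ) where
  toFun p e :=
    p ⟨(endpoints e).2, SimplicialComplex.mem_vertices_of_mem_face e.2.1 (by rw [edge_eq e]; simp)⟩ -
    p ⟨(endpoints e).1, SimplicialComplex.mem_vertices_of_mem_face e.2.1 (by rw [edge_eq e]; simp)⟩
  map_add' p q := by ext e; simp only [Pi.add_apply]; ring
  map_smul' c p := by ext e; simp only [Pi.smul_apply, smul_eq_mul, RingHom.id_apply]; ring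

/-- The coboundary of a `1`-cochain. -/
noncomputable def coboundaryOne (K : EuclideanComplex n) :
    (EdgeOf K → ℚ) →ₗ[ℚ] (TriangleOf K → ℚ) where
  toFun x t := alternating x (corners t).1 (corners t).2.1 +
    alternating x (corners t).2.1 (corners t).2.2 + alternating x (corners t).2.2 (corners t).1
  map_add' x y := by ext t; simp only [Pi.add_apply, alternating_add]; ring
  map_smul' c x := by
    have h : ∀ u v, alternating (c • x) u v = c * alternating x u v := fun u v =>
      alternating_map (AddMonoidHom.mulLeft c) x u v
    ext t
    simp only [h, Pi.smul_apply, smul_eq_mul, RingHom.id_apply]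
    ring

lemma alternating_coboundaryZero (p : 𝔼 → ℚ) {u v : EuclideanSpace ℝ (Fin n)}
    (h : ({u, v} : Finset 𝔼) ∈ K.faces) :
    alternating (coboundaryZero K fun v => p v) u v = p v - p u := by
  by_cases huv : u = v
  · rw [huv, alternating_self, sub_self]
  obtain ⟨e, -, he | he⟩ := eq_endpoints huv h
  · have h1 := alternating_endpoints (coboundaryZero K fun v => p v) e
    simp only [coboundaryZero, LinearMap.coe_mk, AddHom.coe_mk] at h1 ⊢
    rw [he] at h1
    exact h1
  · have h1 := alternating_endpoints_swap (coboundaryZero K fun v => p v) e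
    simp only [coboundaryZero, LinearMap.coe_mk, AddHom.coe_mk] at h1 ⊢
    rw [he] at h1
    rw [h1]; ring

lemma alternating_cocycle {x : EdgeOf K → ℚ} (hx : coboundaryOne K x = 0)
    {u v w : EuclideanSpace ℝ (Fin n)} (h : ({u, v, w} : Finset 𝔼) ∈ K.faces) :
    alternating x u v + alternating x v w = alternating x u w := by
  by_cases huv : u = v
  · rw [huv, alternating_self, zero_add]
  by_cases hvw : v = w
  · rw [hvw, alternating_self, add_zero]
  by_cases huw : u = w
  · rw [huw, alternating_self, alternating_swap x w v, add_neg_cancel]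
  let t : TriangleOf K := ⟨_, h, Finset.card_eq_three.2 ⟨u, v, w, huv, huw, hvw, rfl⟩⟩
  have ht := congrFun hx t
  simp only [coboundaryOne, LinearMap.coe_mk, AddHom.coe_mk, Pi.zero_apply] at ht
  have he : ({u, v, w} : Finset 𝔼) = {(corners t).1, (corners t).2.1, (corners t).2.2} :=
    triangle_eq t
  obtain ⟨h1, h2, h3⟩ := corners_ne t
  generalize (corners t).1 = a at *
  generalize (corners t).2.1 = b at *
  generalize (corners t).2.2 = c at *
  have ha : a ∈ ({u, v, w} : Finset 𝔼) := by rw [he]; simp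
  have hb : b ∈ ({u, v, w} : Finset 𝔼) := by rw [he]; simp
  have hc : c ∈ ({u, v, w} : Finset 𝔼) := by rw [he]; simp
  simp only [Finset.mem_insert, Finset.mem_singleton] at ha hb hc
  have s1 := alternating_swap x u v
  have s2 := alternating_swap x v w
  have s3 := alternating_swap x u w
  rcases ha with rfl | rfl | rfl <;> rcases hb with rfl | rfl | rfl <;>
    rcases hc with rfl | rfl | rfl <;> first | contradiction | linarith

lemma coboundaryOne_comp_coboundaryZero (p : K.vertices → ℚ) :
    coboundaryOne K (coboundaryZero K p) = 0 := by
  classical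
  obtain ⟨q, hq⟩ : ∃ q : 𝔼 → ℚ, p = fun v : K.vertices => q v :=
    ⟨fun v => if h : v ∈ K.vertices then p ⟨v, h⟩ else 0, by ext v; simp⟩
  ext t
  have ht : ({(corners t).1, (corners t).2.1, (corners t).2.2} : Finset 𝔼) ∈ K.faces := by
    rw [← triangle_eq]; exact t.2.1
  rw [hq]
  simp only [coboundaryOne, LinearMap.coe_mk, AddHom.coe_mk]
  rw [alternating_coboundaryZero q (pair_mem_of_mem_face ht (by simp) (by simp)),
    alternating_coboundaryZero q (pair_mem_of_mem_face ht (by simp) (by simp)),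
    alternating_coboundaryZero q (pair_mem_of_mem_face ht (by simp) (by simp)), Pi.zero_apply]
  ring

/-- A common denominator of the finitely many values makes the cocycle integral; it is then a
coboundary by `exists_primitive_of_contractible`, and dividing gives the rational primitive. -/
lemma ker_coboundaryOne_le (hK : K.faces.Finite) [ContractibleSpace K.space] :
    LinearMap.ker (coboundaryOne K) ≤ LinearMap.range (coboundaryZero K) := by
  intro x hx
  rw [LinearMap.mem_ker] at hx
  have : Finite (EdgeOf K) := (hK.subset fun e he => he.1 :
    {e : Finset 𝔼 | e ∈ K.faces ∧ e.card = 2}.Finite).to_subtype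
  obtain ⟨b, hb⟩ := IsLocalization.exist_integer_multiples_of_finite (nonZeroDivisors ℤ) x
  choose z hz using hb
  have hb0 : ((b : ℤ) : ℚ) ≠ 0 := by exact_mod_cast nonZeroDivisors.ne_zero b.2
  have hzx : ∀ u v, ((alternating z u v : ℤ) : ℚ) = (b : ℤ) * alternating x u v := by
    intro u v
    have h1 := alternating_map (Int.castAddHom ℚ) z u v
    have h2 := alternating_map (AddMonoidHom.mulLeft ((b : ℤ) : ℚ)) x u v
    have h3 : (fun e => (Int.castAddHom ℚ) (z e)) =
        fun e => (AddMonoidHom.mulLeft ((b : ℤ) : ℚ)) (x e) := by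
      ext e
      have := hz e
      simp only [eq_intCast, zsmul_eq_mul] at this
      exact this
    rw [h3] at h1
    exact h1.symm.trans h2
  obtain ⟨p, hp⟩ := exists_primitive_of_contractible hK (c := alternating z) (fun u v w h => by
    have h1 := alternating_cocycle hx h
    have h2 : ((alternating z u v : ℤ) : ℚ) + (alternating z v w : ℤ) = (alternating z u w : ℤ) := by
      rw [hzx, hzx, hzx, ← h1]; ring
    exact_mod_cast h2)
  refine ⟨fun v => (p v : ℚ) / (b : ℤ), ?_⟩
  ext e
  have he : ({(endpoints e).1, (endpoints e).2} : Finset 𝔼) ∈ K.faces := by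
    rw [← edge_eq]; exact e.2.1
  have h1 := hzx (endpoints e).1 (endpoints e).2
  rw [hp _ _ he, alternating_endpoints] at h1
  simp only [coboundaryZero, LinearMap.coe_mk, AddHom.coe_mk]
  rw [← sub_div, div_eq_iff hb0]
  push_cast at h1
  linarith

lemma finrank_ker_coboundaryZero (hK : K.faces.Finite) (hc : IsPreconnected K.space)
    (hne : K.vertices.Nonempty) : Module.finrank ℚ (LinearMap.ker (coboundaryZero K)) = 1 := by
  classical
  obtain ⟨v₀, hv₀⟩ := hne
  have h1 : (fun _ : K.vertices => (1 : ℚ)) ∈ LinearMap.ker (coboundaryZero K) := by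
    rw [LinearMap.mem_ker]; ext e; simp [coboundaryZero]
  refine finrank_eq_one (⟨_, h1⟩ : LinearMap.ker (coboundaryZero K)) (fun h => ?_) fun w => ?_
  · have := congrFun (congrArg Subtype.val h) ⟨v₀, hv₀⟩
    simp at this
  · obtain ⟨p, hp⟩ := w
    obtain ⟨q, rfl⟩ : ∃ q : 𝔼 → ℚ, p = fun v : K.vertices => q v :=
      ⟨fun v => if h : v ∈ K.vertices then p ⟨v, h⟩ else 0, by ext v; simp⟩
    rw [LinearMap.mem_ker] at hp
    refine ⟨q v₀, Subtype.ext (funext fun v => ?_)⟩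
    have hedge : ∀ u v, ({u, v} : Finset 𝔼) ∈ K.faces → (q u : ℝ) = (q v : ℝ) := by
      intro u v huv
      have h2 := alternating_coboundaryZero q huv
      rw [hp, alternating] at h2
      have h3 : q v - q u = 0 := by
        rw [← h2]; split_ifs <;> simp
      rw [sub_eq_zero.1 h3]
    have := eq_of_forall_edge hK hc (f := fun v => (q v : ℝ)) hedge hv₀ v.2
    have h4 : q v₀ = q v := by exact_mod_cast this
    simp [h4]

/-- A proper range would be killed by a nonzero functional, that is, by coefficients `c` on
triangles. The triangles with `c ≠ 0` have an edge lying in exactly one of them, and pairing with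
the coboundary of that edge isolates a nonzero coefficient. -/
lemma range_coboundaryOne {D : EuclideanComplex 2} (hD : D.faces.Finite) :
    LinearMap.range (coboundaryOne D) = ⊤ := by
  classical
  by_contra hne
  obtain ⟨f, hf0, hf⟩ := Submodule.exists_le_ker_of_lt_top _ (lt_top_iff_ne_top.2 hne)
  have : Finite (TriangleOf D) := (hD.subset fun e he => he.1 :
    {e : Finset (EuclideanSpace ℝ (Fin 2)) | e ∈ D.faces ∧ e.card = 3}.Finite).to_subtype
  have := Fintype.ofFinite (TriangleOf D)
  obtain ⟨c, hc⟩ : ∃ c : TriangleOf D → ℚ, ∀ y, f y = ∑ t, y t * c t :=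
    ⟨_, fun y => LinearMap.pi_apply_eq_sum_univ f y⟩
  obtain ⟨t₁, ht₁⟩ : ∃ t, c t ≠ 0 := by
    by_contra! h
    exact hf0 (LinearMap.ext fun y => by rw [hc]; simp [h])
  obtain ⟨t₀, ht₀, e, he, hec, huniq⟩ := exists_extreme_edge (D := D)
    (T := (Finset.univ.filter fun t => c t ≠ 0).map ⟨Subtype.val, Subtype.val_injective⟩)
    ⟨t₁.1, Finset.mem_map_of_mem _ (by simpa using ht₁)⟩ (fun t ht => by
      obtain ⟨s, -, rfl⟩ := Finset.mem_map.1 ht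
      exact s.2)
  obtain ⟨t, ht, rfl⟩ := Finset.mem_map.1 ht₀
  replace ht : c t ≠ 0 := by simpa using ht
  simp only [Function.Embedding.coeFn_mk] at he huniq
  have heD : e ∈ D.faces := D.down_closed t.2.1 he (Finset.card_pos.1 (by omega))
  have h1 : f (coboundaryOne D (Pi.single (⟨e, heD, hec⟩ : EdgeOf D) 1)) = 0 :=
    hf (LinearMap.mem_range_self _ _)
  have hval : ∀ s : TriangleOf D, ¬ e ⊆ s.1 →
      coboundaryOne D (Pi.single (⟨e, heD, hec⟩ : EdgeOf D) 1) s = 0 := by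
    intro s hs
    rw [triangle_eq s] at hs
    simp only [coboundaryOne, LinearMap.coe_mk, AddHom.coe_mk]
    have hz : ∀ u v, ({u, v} : Finset (EuclideanSpace ℝ (Fin 2))) ⊆
        {(corners s).1, (corners s).2.1, (corners s).2.2} →
          alternating (Pi.single (⟨e, heD, hec⟩ : EdgeOf D) (1 : ℚ)) u v = 0 := by
      intro u v huv
      by_contra h
      have : e = {u, v} := (alternating_single _).1 h
      exact hs (this ▸ huv)
    rw [hz _ _ (by intro x; simp; tauto), hz _ _ (by intro x; simp; tauto),
      hz _ _ (by intro x; simp; tauto)]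
    ring
  rw [hc, Finset.sum_eq_single t] at h1
  · have h2 := (mul_eq_zero.1 h1).resolve_right ht
    simp only [coboundaryOne, LinearMap.coe_mk, AddHom.coe_mk] at h2
    rw [triangle_eq t] at he
    obtain ⟨n1, n2, n3⟩ := corners_ne t
    generalize (corners t).1 = a at *
    generalize (corners t).2.1 = b at *
    generalize (corners t).2.2 = d at *
    have key : ∀ u v w : EuclideanSpace ℝ (Fin 2), u ≠ v → w ≠ u → w ≠ v → e = {u, v} →
        alternating (Pi.single (⟨e, heD, hec⟩ : EdgeOf D) (1 : ℚ)) u v ≠ 0 ∧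
        alternating (Pi.single (⟨e, heD, hec⟩ : EdgeOf D) (1 : ℚ)) v w = 0 ∧
        alternating (Pi.single (⟨e, heD, hec⟩ : EdgeOf D) (1 : ℚ)) w u = 0 := by
      intro u v w _ hwu hwv heq
      have hw : w ∉ e := by rw [heq]; simp [hwu, hwv]
      refine ⟨(alternating_single _).2 heq, ?_, ?_⟩
      · by_contra h
        have h3 : e = {v, w} := (alternating_single _).1 h
        exact hw (by rw [h3]; simp)
      · by_contra h
        have h3 : e = {w, u} := (alternating_single _).1 h
        exact hw (by rw [h3]; simp)
    obtain ⟨x, y, hxy, hexy⟩ := Finset.card_eq_two.1 hec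
    have hx := he (show x ∈ e by rw [hexy]; simp)
    have hy := he (show y ∈ e by rw [hexy]; simp)
    simp only [Finset.mem_insert, Finset.mem_singleton] at hx hy
    have hcases : e = {a, b} ∨ e = {b, d} ∨ e = {d, a} := by
      rcases hx with rfl | rfl | rfl <;> rcases hy with rfl | rfl | rfl <;>
        first | contradiction | exact Or.inl hexy | exact Or.inr (Or.inl hexy) |
          exact Or.inr (Or.inr hexy) | (rw [Finset.pair_comm] at hexy; tauto)
    rcases hcases with h | h | h
    · obtain ⟨k1, k2, k3⟩ := key a b d n1 n2.symm n3.symm h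
      rw [k2, k3] at h2
      exact k1 (by linarith)
    · obtain ⟨k1, k2, k3⟩ := key b d a n3 n1 n2 h
      rw [k2, k3] at h2
      exact k1 (by linarith)
    · obtain ⟨k1, k2, k3⟩ := key d a b n2.symm n3 n1.symm h
      rw [k2, k3] at h2
      exact k1 (by linarith)
  · intro s _ hst
    by_cases hcs : c s = 0
    · rw [hcs, mul_zero]
    · rw [hval s, zero_mul]
      intro hes
      exact hst (Subtype.ext (huniq s.1 (Finset.mem_map_of_mem _ (by simpa using hcs)) hes))
  · simp

/-- The sequence `0 → ℚ → C⁰ → C¹ → C² → 0` is exact: the disk is connected, it is contractible, and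
it lies in the plane. Rank–nullity then gives `V - E + F = 1`. -/
lemma eulerCharacteristic_of_isPlanarSimplicialDisk {D : EuclideanComplex 2}
    (hD : IsPlanarSimplicialDisk D) : eulerCharacteristic D = 1 := by
  obtain ⟨φ⟩ := hD.disk
  have hball : ContractibleSpace (Metric.closedBall (0 : EuclideanSpace ℝ (Fin 2)) 1) :=
    (convex_closedBall _ _).contractibleSpace ⟨0, by simp⟩
  have hcontr : ContractibleSpace D.space := φ.contractibleSpace
  have hconn : IsPreconnected D.space := isPreconnected_iff_preconnectedSpace.2 inferInstance
  have hne : D.vertices.Nonempty := by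
    obtain ⟨y⟩ : Nonempty D.space := inferInstance
    obtain ⟨s, hs, -⟩ := SimplicialComplex.mem_space_iff.1 y.2
    obtain ⟨u, hu⟩ := D.nonempty_of_mem_faces hs
    exact ⟨u, SimplicialComplex.mem_vertices_of_mem_face hs hu⟩
  have hfin := hD.finite_faces
  have : Finite (EdgeOf D) := (hfin.subset fun e he => he.1 :
    {e : Finset (EuclideanSpace ℝ (Fin 2)) | e ∈ D.faces ∧ e.card = 2}.Finite).to_subtype
  have : Finite (TriangleOf D) := (hfin.subset fun e he => he.1 :
    {e : Finset (EuclideanSpace ℝ (Fin 2)) | e ∈ D.faces ∧ e.card = 3}.Finite).to_subtype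
  have : Finite D.vertices := (SimplicialComplex.vertices_finite hfin).to_subtype
  have := Fintype.ofFinite (EdgeOf D)
  have := Fintype.ofFinite (TriangleOf D)
  have := Fintype.ofFinite D.vertices
  have hV : simplexCount D 0 = Fintype.card D.vertices := by
    rw [← ncard_vertices, ← Nat.card_coe_set_eq, Nat.card_eq_fintype_card]
  have hE : simplexCount D 1 = Fintype.card (EdgeOf D) := by
    rw [← Nat.card_eq_fintype_card]; rfl
  have hF : simplexCount D 2 = Fintype.card (TriangleOf D) := by
    rw [← Nat.card_eq_fintype_card]; rfl
  have r0 := LinearMap.finrank_range_add_finrank_ker (coboundaryZero D)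
  have r1 := LinearMap.finrank_range_add_finrank_ker (coboundaryOne D)
  have hker : LinearMap.ker (coboundaryOne D) = LinearMap.range (coboundaryZero D) := by
    refine le_antisymm (ker_coboundaryOne_le hfin) ?_
    rintro _ ⟨p, rfl⟩
    exact coboundaryOne_comp_coboundaryZero p
  rw [finrank_ker_coboundaryZero hfin hconn hne, Module.finrank_fintype_fun_eq_card] at r0
  rw [hker, range_coboundaryOne hfin, finrank_top, Module.finrank_fintype_fun_eq_card,
    Module.finrank_fintype_fun_eq_card] at r1
  rw [eulerCharacteristic, hV, hE, hF]
  omega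

end Cochains

/-! ### The characterisation of the Euler characteristic. -/

theorem corollary2p7 (S : Set EmbeddedComplex)
    (hsurface : ∀ K ∈ S, IsSimplicialSurface K.2)
    (hsubdivision : ClosedUnderSubdivision S)
    (hpyramid : ∀ K : EuclideanComplex 3, IsPyramid K ∨ IsBipyramid K →
      (⟨3, K⟩ : EmbeddedComplex) ∈ S)
    (Λ : S → ℝ) :
    (GeometricallyLocallyDetermined S Λ ∧
      ∀ (K : EuclideanComplex 3) (hK : IsPyramid K ∨ IsBipyramid K),
        Λ ⟨⟨3, K⟩, hpyramid K hK⟩ = 2) ↔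
      ∀ K : S, Λ K = (eulerCharacteristic K.1.2 : ℝ) := by
  constructor
  · rintro ⟨⟨φ, hiso, hinv, hcont, hsum⟩, htwo⟩ K
    -- Both quantities are totals over the vertices, so it suffices that `φ` is the angle defect
    -- vertex by vertex.
    rw [← hsum K, ← (hsurface K.1 K.2).finsum_angleDefect]
    refine finsum_mem_congr rfl fun v hv => ?_
    exact eq_angleDefect hsurface hsubdivision hinv hiso hcont (fun K hK => hpyramid K (Or.inr hK))
      (fun K hK => (hsum ⟨⟨3, K⟩, hpyramid K (Or.inr hK)⟩).trans (htwo K (Or.inr hK))) K.2 hv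
  · intro h
    refine ⟨⟨angleDefect, ?_, ?_, ?_, fun K => ?_⟩, fun K hK => ?_⟩
    · intro m n K L _ _ v hv w _ hvw
      exact angleDefect_starIsometry hv hvw
    · intro n K J hK hJ hsub v hv
      have hKs : IsSimplicialSurface K := hsurface _ hK
      have hJs : IsSimplicialSurface J := hsurface _ hJ
      simp only [angleDefect, angleSum_eq_of_isSubdivision hKs hJs hsub hv]
    · intro n K Kseq f hK _ hf ht v hv
      exact angleDefect_tendsto (hsurface _ hK).finite_faces hf ht hv
    · rw [h K, (hsurface K.1 K.2).finsum_angleDefect]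
    · rw [h]
      have hs : IsSimplicialSurface K := hsurface _ (hpyramid K hK)
      have : eulerCharacteristic K = 2 := hK.elim
        (fun hp => eulerCharacteristic_of_isPyramid hs hp fun D hD =>
          eulerCharacteristic_of_isPlanarSimplicialDisk hD)
        (eulerCharacteristic_eq_two_of_isBipyramid hs)
      exact_mod_cast this
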